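/- **Setting.** Let $V:\mathbb R\to\mathbb R$ be smooth and even with $V(0)=0$, $V''(0)>0$, and let $f=V'$, $d>0$, $T>0$, $\omega=2\pi/T$. For $M\ge 1$ let $X_M$ be the space of (real-valued) $T$-periodic trigonometric polynomials of degree at most $M$ with the $L^2([0,T])$ norm, $X_M^{\mathbb C}$ its complexification, $X_{M,e}\subset X_M$ the subspace of even functions of $t$, $P_M$ the $L^2([0,T])$-orthogonal projection onto $X_M$, and $g(u)=P_Mf(u)$, so that $g'(u)w=P_M(f'(u)w)$. The spatial dynamics map $$F_M(u,\tilde u)=\Bigl(2u+\tfrac1d g(u)+\tfrac1d\partial_t^2u-\tilde u,\;u\Bigr)$$ is a bijection of $X_M^2$, and $u_n$ solves $\ddot u_n=d(u_{n+1}-2u_n+u_{n-1})-g(u_n)$ if and only if $U(n)=(u_n,u_{n-1})$ satisfies $U(n+1)=F_M(U(n))$. **Hypotheses.** (i) The spectrum (set of eigenvalues) of $DF(0)=\begin{pmatrix}\frac1d\partial_t^2+\frac{f'(0)}d+2&-1\\1&0\end{pmatrix}$ on smooth $T$-periodic functions is bounded away from the unit circle. Let $r_M>1$ be the smallest modulus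 of the eigenvalues of $DF_M(0)$ outside the closed unit disc. (ii) $Q_M(n)=(q_n,q_{n-1})$ is a nontrivial homoclinic orbit of $F_M$ to $0$ in $X_{M,e}^2$, along which the stable and unstable manifolds of $0$ in $X_{M,e}^2$ intersect transversely in $X_{M,e}^2$. (iii) Along $Q_M(n)$, the intersection of (the tangent spaces of) the stable and unstable manifolds $W^s_M(0)$, $W^u_M(0)$ of $0$ in the full space $X_M^2$ is exactly one-dimensional. **Theorem 2.** The breather $q$ belongs to a family of breathers, even in $t$, parametrized by the frequency near $\omega$ and differentiable at $\omega$ in $\ell^2(\mathbb Z,X_M)$ after time is rescaled to a fixed period; let $y_n=\omega\,\partial_\omega q_n$ be $\omega$ times its derivative at fixed rescaled time, and let $$K=\sum_{n=-\infty}^{\infty}\int_0^T\bigl(\dot q_n^2+2\dot y_n\dot q_n\bigr)\,dt .$$ There are $\varepsilon>0$, $N^*\in\mathbb N$, $\delta>0$ and $C>0$ such that the following holds for all $m\ge 2$, all distances $N_1,\dots,N_{m-1}\ge N^*$ and all orientations $\sigma_1,\dots,\sigma_m\in\{1,-1\}$. Put $N_i^+=\lfloor N_i/2\rfloor$, $N_i^-=N_i-N_i^+$,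 $N_0^-=N_m^+=\infty$, $N=\frac12\min_iN_i$ and $s_i=\sum_{j<i}N_j$. There is exactly one orbit $U(n)=(u_n,u_{n-1})$ of $F_M$ in $X_{M,e}^2$ (the $m$-component multi-breather) with $\|U(s_i+n)-\sigma_iQ_M(n)\|\le\varepsilon$ for all $1\le i\le m$ and all integers $-N_{i-1}^-\le n\le N_i^+$. For it there is a matrix function $R(\lambda)\in\mathbb C^{m\times m}$, analytic in $|\lambda|<\delta$, such that for every $\lambda\in\mathbb C$ with $|\lambda|<\delta$ the Floquet eigenvalue problem $$d(w_{n+1}-2w_n+w_{n-1})-g'(u_n)w_n-\ddot w_n=2\lambda\dot w_n+\lambda^2w_n,\qquad w_n\in X_M^{\mathbb C},\ n\in\mathbb Z,$$ has a bounded nonzero solution if and only if $$\det\Bigl(A+\tfrac1dK\lambda^2I+R(\lambda)\Bigr)=0,$$ and $\|R(\lambda)c\|_\infty\le C\,(r_M^{-N}+|\lambda|)^3\|c\|_\infty$ for all $c\in\mathbb C^m$. Here $A$ is the tridiagonal $m\times m$ matrix $$A=\begin{pmatrix}-a_1&a_1\\-\tilde a_1&\tilde a_1-a_2&a_2\\&-\tilde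 a_2&\tilde a_2-a_3&a_3\\&&\ddots&\ddots&\ddots\\&&&-\tilde a_{m-1}&\tilde a_{m-1}\end{pmatrix},$$ $$a_i=\sigma_i\sigma_{i+1}\int_0^T\bigl(\dot q_{N_i^+}\dot q_{-N_i^--1}-\dot q_{N_i^+-1}\dot q_{-N_i^-}\bigr)dt,\qquad \tilde a_i=\sigma_i\sigma_{i+1}\int_0^T\bigl(\dot q_{-N_i^-}\dot q_{N_i^+-1}-\dot q_{-N_i^--1}\dot q_{N_i^+}\bigr)dt .$$ -/

import Mathlib

open scoped ContDiff Matrix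
open Filter Topology

noncomputable section

namespace DKG

/-- Real trigonometric modes of wavenumber at most `M`: `inl k` is the cosine of wavenumber `k`
(`0 ≤ k ≤ M`), and `inr k` is the sine of wavenumber `k + 1` (`1 ≤ k + 1 ≤ M`). -/
abbrev Mode (M : ℕ) : Type := Fin (M + 1) ⊕ Fin M

/-- The `L²([0,T])`-orthonormal trigonometric functions of period `T`. -/
def mode (T : ℝ) {M : ℕ} : Mode M → ℝ → ℝ
  | Sum.inl k, t =>
      if (k : ℕ) = 0 then 1 / √T else √(2 / T) * Real.cos (2 * Real.pi * (k : ℕ) / T * t)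
  | Sum.inr k, t => √(2 / T) * Real.sin (2 * Real.pi * ((k : ℕ) + 1) / T * t)

/-- The space `X_M` of `T`-periodic trigonometric polynomials of degree at most `M`, real-valued for
`𝕜 = ℝ` and complex-valued for `𝕜 = ℂ`, in coordinates with respect to the orthonormal basis `mode`.
Its Euclidean norm is the `L²([0,T])` norm. -/
abbrev X (𝕜 : Type) [RCLike 𝕜] (M : ℕ) : Type := EuclideanSpace 𝕜 (Mode M)

section Basic

variable {𝕜 : Type} [RCLike 𝕜] {M : ℕ}

/-- The function of time represented by an element of `X_M`. -/
def ev (T : ℝ) (u : X 𝕜 M) (t : ℝ) : 𝕜 := ∑ k, u k * (mode T k t : 𝕜)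

/-- The orthogonal projection `P_M` of `L²([0,T])` onto `X_M`. -/
def proj (T : ℝ) (φ : ℝ → 𝕜) : X 𝕜 M :=
  WithLp.toLp 2 fun k => ∫ t in (0 : ℝ)..T, φ t * (mode T k t : 𝕜)

/-- Differentiation `∂_t` on `X_M`. -/
def dt (T : ℝ) (u : X 𝕜 M) : X 𝕜 M :=
  WithLp.toLp 2 (Sum.elim
    (fun k => Fin.cases (motive := fun _ => 𝕜) 0
      (fun j => ((2 * Real.pi * ((j : ℕ) + 1) / T : ℝ) : 𝕜) * u (Sum.inr j)) k)
    (fun j => -(((2 * Real.pi * ((j : ℕ) + 1) / T : ℝ) : 𝕜) * u (Sum.inl j.succ))))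

/-- `dt` is indeed differentiation with respect to time. -/
theorem hasDerivAt_ev (T : ℝ) (u : X 𝕜 M) (t : ℝ) :
    HasDerivAt (ev T u) (ev T (dt T u) t) t := by
  have hlin : ∀ c : ℝ, HasDerivAt (fun s : ℝ => c * s) c t := fun c => by
    simpa using (hasDerivAt_id t).const_mul c
  have hof : ∀ {φ : ℝ → ℝ} {φ' : ℝ}, HasDerivAt φ φ' t →
      HasDerivAt (fun s => ((φ s : ℝ) : 𝕜)) ((φ' : ℝ) : 𝕜) t := fun h => by
    exact (RCLike.ofRealCLM (K := 𝕜)).hasFDerivAt.comp_hasDerivAt t h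
  have h : HasDerivAt (ev T u)
      (u (Sum.inl 0) * 0 +
        ∑ j : Fin M, u (Sum.inl j.succ) *
          ((√(2 / T) * (-Real.sin (2 * Real.pi * ((j : ℕ) + 1) / T * t)
            * (2 * Real.pi * ((j : ℕ) + 1) / T)) : ℝ) : 𝕜) +
        ∑ j : Fin M, u (Sum.inr j) *
          ((√(2 / T) * (Real.cos (2 * Real.pi * ((j : ℕ) + 1) / T * t)
            * (2 * Real.pi * ((j : ℕ) + 1) / T)) : ℝ) : 𝕜)) t := by
    have he : ev T u = fun s => u (Sum.inl 0) * ((1 / √T : ℝ) : 𝕜) +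
        ∑ j : Fin M, u (Sum.inl j.succ) *
          ((√(2 / T) * Real.cos (2 * Real.pi * ((j : ℕ) + 1) / T * s) : ℝ) : 𝕜) +
        ∑ j : Fin M, u (Sum.inr j) *
          ((√(2 / T) * Real.sin (2 * Real.pi * ((j : ℕ) + 1) / T * s) : ℝ) : 𝕜) := by
      funext s
      simp [ev, mode, Fintype.sum_sum_type, Fin.sum_univ_succ]
    rw [he]
    refine HasDerivAt.add (HasDerivAt.add ?_ ?_) ?_
    · simpa using hasDerivAt_const t (u (Sum.inl 0) * ((1 / √T : ℝ) : 𝕜))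
    · refine HasDerivAt.fun_sum fun j _ => HasDerivAt.const_mul _ (hof ?_)
      exact ((hlin _).cos).const_mul _
    · refine HasDerivAt.fun_sum fun j _ => HasDerivAt.const_mul _ (hof ?_)
      exact ((hlin _).sin).const_mul _
  convert h using 1
  simp only [ev, dt, mode, Fintype.sum_sum_type, Fin.sum_univ_succ, Sum.elim_inl, Sum.elim_inr,
    Fin.cases_zero, Fin.cases_succ, zero_mul, mul_zero, zero_add, Fin.val_succ, Nat.succ_ne_zero,
    if_false, ← Finset.sum_add_distrib]
  refine Finset.sum_congr rfl fun j _ => ?_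
  push_cast
  simp
  ring

end Basic

section Dynamics

variable {M : ℕ}

/-- The nonlinearity `g(u) = P_M f(u)` on (real) `X_M`, where `f = V'`. -/
def g (V : ℝ → ℝ) (T : ℝ) (u : X ℝ M) : X ℝ M := proj T fun t => deriv V (ev T u t)

/-- The derivative `g'(u) w = P_M (f'(u) w)` at a real `u`, acting on real or complex `w`. -/
def dg {𝕜 : Type} [RCLike 𝕜] (V : ℝ → ℝ) (T : ℝ) (u : X ℝ M) (w : X 𝕜 M) : X 𝕜 M :=
  proj T fun t => ((deriv (deriv V) (ev T u t) : ℝ) : 𝕜) * ev T w t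

/-- The spatial dynamics map `F_M` on `X_M²`, as a bijection. A sequence `u` solves
`ü_n = d (u_{n+1} - 2 u_n + u_{n-1}) - g(u_n)` if and only if `(u_n, u_{n-1})` is an orbit of it. -/
def F (V : ℝ → ℝ) (d T : ℝ) : (X ℝ M × X ℝ M) ≃ (X ℝ M × X ℝ M) where
  toFun P := ((2 : ℝ) • P.1 + (1 / d) • g V T P.1 + (1 / d) • dt T (dt T P.1) - P.2, P.1)
  invFun P := (P.2, (2 : ℝ) • P.2 + (1 / d) • g V T P.2 + (1 / d) • dt T (dt T P.2) - P.1)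
  left_inv P := by simp
  right_inv P := by simp

/-- The linearization `DF_M` at a real point of `X_M²` with first component `u`, acting on real or
complex vectors. -/
def DF {𝕜 : Type} [RCLike 𝕜] (V : ℝ → ℝ) (d T : ℝ) (u : X ℝ M) (P : X 𝕜 M × X 𝕜 M) :
    X 𝕜 M × X 𝕜 M :=
  ((2 : 𝕜) • P.1 + ((1 / d : ℝ) : 𝕜) • dg V T u P.1
    + ((1 / d : ℝ) : 𝕜) • dt T (dt T P.1) - P.2, P.1)

/-- The sequence `(q_n, q_{n-1})` in `X_M²`. -/
def pair {𝕜 : Type} [RCLike 𝕜] (q : ℤ → X 𝕜 M) (n : ℤ) : X 𝕜 M × X 𝕜 M := (q n, q (n - 1))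

/-- The subspace `X_{M,e}²` of pairs of even functions of time. -/
def evenPairs (M : ℕ) (T : ℝ) : Set (X ℝ M × X ℝ M) :=
  {P | (∀ t, ev T P.1 (-t) = ev T P.1 t) ∧ ∀ t, ev T P.2 (-t) = ev T P.2 t}

/-- `μ` is an eigenvalue of the linearization at zero of the full (unprojected) spatial dynamics,
`DF(0) = ((1/d) ∂_t² + f'(0)/d + 2, -1; 1, 0)`, on smooth `T`-periodic functions. -/
def IsEigenvalueDFzero (V : ℝ → ℝ) (d T : ℝ) (μ : ℂ) : Prop :=
  ∃ v w : ℝ → ℂ, ContDiff ℝ ∞ v ∧ ContDiff ℝ ∞ w ∧ Function.Periodic v T ∧ Function.Periodic w T ∧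
    (v ≠ 0 ∨ w ≠ 0) ∧
    ∀ t, (1 / d : ℂ) * deriv (deriv v) t + ((deriv (deriv V) 0 : ℝ) / d + 2 : ℂ) * v t - w t
        = μ * v t ∧ v t = μ * w t

/-- The spectrum of `DF(0)` is bounded away from the unit circle. -/
def SpectrumAwayFromCircle (V : ℝ → ℝ) (d T : ℝ) : Prop :=
  ∃ ε > 0, ∀ μ : ℂ, IsEigenvalueDFzero V d T μ → ε ≤ |‖μ‖ - 1|

/-- `r_M`, the smallest modulus of an eigenvalue of `DF_M(0)` (on `X_{M,e}²`) outside the closed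
unit disc. All eigenvalues off the unit circle are real, so real eigenvectors suffice. -/
def rM (V : ℝ → ℝ) (d T : ℝ) (M : ℕ) : ℝ :=
  sInf {ρ : ℝ | 1 < ρ ∧ ∃ μ : ℝ, |μ| = ρ ∧
    ∃ P ∈ evenPairs M T, P ≠ 0 ∧ DF V d T (0 : X ℝ M) P = μ • P}

end Dynamics

section Manifolds

variable {E : Type*} [NormedAddCommGroup E] [NormedSpace ℝ E]

/-- The stable manifold of the equilibrium `0` for the restriction of `G` to an invariant subspace
`S`. The unstable manifold is the stable manifold of the inverse map. -/
def stableManifold (G : E ≃ E) (S : Set E) : Set E :=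
  {p | p ∈ S ∧ Tendsto (fun n : ℕ => G^[n] p) atTop (𝓝 0)}

/-- The tangent space at `p` of the (immersed) stable manifold of `0` in `S`: the velocities of the
curves through `p` in the manifold. The orbits of the points of the curve are required to converge
to `0` uniformly near `p`, so that the curve stays in a single sheet of the immersed manifold,
i.e. in the preimage of a local stable manifold under some iterate of `G`. -/
def stableTangent (G : E ≃ E) (S : Set E) (p : E) : Set E :=
  {v | ∃ γ : ℝ → E, γ 0 = p ∧ HasDerivAt γ v 0 ∧ ∃ η > 0,
    (∀ s ∈ Set.Ioo (-η) η, γ s ∈ stableManifold G S) ∧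
    TendstoUniformlyOn (fun (n : ℕ) s => G^[n] (γ s)) (fun _ => 0) atTop (Set.Ioo (-η) η)}

end Manifolds

section Breathers

variable {M : ℕ}

/-- `Q_M(n) = (q_n, q_{n-1})` is an orbit of `F_M` homoclinic to `0` in `X_{M,e}²`, along which
the stable and unstable manifolds of `0` in `X_{M,e}²` intersect transversely in `X_{M,e}²`. -/
structure IsPrimaryBreather (V : ℝ → ℝ) (d T : ℝ) (q : ℤ → X ℝ M) : Prop where
  nontrivial : q ≠ 0
  orbit : ∀ n, pair q (n + 1) = F V d T (pair q n)
  homoclinic : ∀ n, pair q n ∈ stableManifold (F V d T) (evenPairs M T) ∩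
    stableManifold (F V d T).symm (evenPairs M T)
  transverse : ∀ n, ∀ v ∈ evenPairs M T,
    ∃ a ∈ stableTangent (F V d T) (evenPairs M T) (pair q n),
    ∃ b ∈ stableTangent (F V d T).symm (evenPairs M T) (pair q n), a + b = v

/-- Along `Q_M(n) = (q_n, q_{n-1})`, the intersection of (the tangent spaces of) the stable and
unstable manifolds of `0` in the full space `X_M²` is exactly one-dimensional. -/
def IsNondegenerate (V : ℝ → ℝ) (d T : ℝ) (q : ℤ → X ℝ M) : Prop :=
  ∀ n, ∃ v : X ℝ M × X ℝ M, v ≠ 0 ∧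
    stableTangent (F V d T) Set.univ (pair q n) ∩ stableTangent (F V d T).symm Set.univ (pair q n)
      = {p | ∃ c : ℝ, p = c • v}

/-- `y = ω ∂_ω q`, where `ω = 2π/T`. The breather `q` is continued to a family of breathers, even in
time, of frequencies `ω'` near `ω`; after rescaling time by `ω'/ω`, so that the period is `T`
throughout, the member `p ω'` of the family satisfies
`(ω'/ω)² p̈_n = d (p_{n+1} - 2 p_n + p_{n-1}) - g(p_n)`. The family is differentiable at `ω` in
`ℓ²(ℤ, X_M)`, and the derivative is taken at fixed rescaled time. -/
def IsFrequencyDerivative (V : ℝ → ℝ) (d T : ℝ) (q y : ℤ → X ℝ M) : Prop :=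
  ∃ (p : ℝ → lp (fun _ : ℤ => X ℝ M) 2) (p' : lp (fun _ : ℤ => X ℝ M) 2),
    (∀ᶠ ω' in 𝓝 (2 * Real.pi / T), ∀ n : ℤ,
      (∀ t, ev T (p ω' n) (-t) = ev T (p ω' n) t) ∧
      (ω' / (2 * Real.pi / T)) ^ 2 • dt T (dt T (p ω' n))
        = d • (p ω' (n + 1) - (2 : ℝ) • p ω' n + p ω' (n - 1)) - g V T (p ω' n)) ∧
    (∀ n, p (2 * Real.pi / T) n = q n) ∧
    HasDerivAt p p' (2 * Real.pi / T) ∧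
    ∀ n, y n = (2 * Real.pi / T) • p' n

/-- `K = ∑_n ∫ (q̇_n² + 2 ẏ_n q̇_n) dt`. -/
def K (T : ℝ) (q y : ℤ → X ℝ M) : ℝ :=
  ∑' n : ℤ, ∫ t in (0 : ℝ)..T,
    (ev T (dt T (q n)) t ^ 2 + 2 * ev T (dt T (y n)) t * ev T (dt T (q n)) t)

/-- `N⁺ = ⌊N/2⌋`. -/
def half (N : ℕ) : ℤ := ((N / 2 : ℕ) : ℤ)

/-- `N⁻ = N - N⁺`. -/
def coHalf (N : ℕ) : ℤ := (N : ℤ) - half N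

/-- The position of the `i`-th copy, the sum of the preceding distances. -/
def center {k : ℕ} (N : Fin k → ℕ) (i : Fin (k + 1)) : ℤ :=
  ∑ j : Fin k, if j.castSucc < i then (N j : ℤ) else 0

/-- `(u_n, u_{n-1})` is a multi-breather with `m = k + 1` components, distances `N_i` (`N i` is the
distance between the copies `i` and `i + 1`, counted from zero) and orientations `σ_i`, up to
remainders of size at most `ε`: an orbit of `F_M` in `X_{M,e}²` with
`U(center_i + n) = σ_i Q_M(n) + Ũ_i(n)`, `‖Ũ_i(n)‖ ≤ ε`, for `-N_{i-1}⁻ ≤ n ≤ N_i⁺` (with no lower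
bound on `n` for the first copy, and no upper bound for the last copy). -/
structure IsMultiBreather (V : ℝ → ℝ) (d T : ℝ) (q : ℤ → X ℝ M) {k : ℕ} (N : Fin k → ℕ)
    (σ : Fin (k + 1) → ℝ) (ε : ℝ) (u : ℤ → X ℝ M) : Prop where
  orbit : ∀ n, pair u (n + 1) = F V d T (pair u n)
  even : ∀ n, pair u n ∈ evenPairs M T
  close : ∀ (i : Fin (k + 1)) (n : ℤ), (∀ j : Fin k, j.succ = i → -coHalf (N j) ≤ n) →
    (∀ j : Fin k, j.castSucc = i → n ≤ half (N j)) →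
    ‖pair u (center N i + n) - σ i • pair q n‖ ≤ ε

/-- `a_i`. -/
def a (T : ℝ) (q : ℤ → X ℝ M) {k : ℕ} (N : Fin k → ℕ) (σ : Fin (k + 1) → ℝ) (i : Fin k) : ℝ :=
  σ i.castSucc * σ i.succ * ∫ t in (0 : ℝ)..T,
    (ev T (dt T (q (half (N i)))) t * ev T (dt T (q (-coHalf (N i) - 1))) t
      - ev T (dt T (q (half (N i) - 1))) t * ev T (dt T (q (-coHalf (N i)))) t)

/-- `ã_i`. -/
def aTilde (T : ℝ) (q : ℤ → X ℝ M) {k : ℕ} (N : Fin k → ℕ) (σ : Fin (k + 1) → ℝ) (i : Fin k) : ℝ :=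
  σ i.castSucc * σ i.succ * ∫ t in (0 : ℝ)..T,
    (ev T (dt T (q (-coHalf (N i)))) t * ev T (dt T (q (half (N i) - 1))) t
      - ev T (dt T (q (-coHalf (N i) - 1))) t * ev T (dt T (q (half (N i)))) t)

/-- The tridiagonal matrix with rows `(…, -α̃_{i-1}, α̃_{i-1} - α_i, α_i, …)`, where the terms with
`α̃_{i-1}` are absent from the first row and those with `α_i` are absent from the last row. -/
def tridiag {k : ℕ} (α αt : Fin k → ℝ) : Matrix (Fin (k + 1)) (Fin (k + 1)) ℝ :=
  Matrix.of fun i j =>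
    (∑ l : Fin k, if i = l.castSucc then
      (if j = l.succ then α l else if j = l.castSucc then -α l else 0) else 0) +
    ∑ l : Fin k, if i = l.succ then
      (if j = l.castSucc then -αt l else if j = l.succ then αt l else 0) else 0

/-- `W` is a bounded nonzero solution of the Floquet eigenvalue problem about `u`,
`W(n+1) = [DF_M(U(n)) + (1/d) (2 λ ∂_t + λ²) B] W(n)`, where `B` is the projection onto the first
component. With `W(n) = (w_n, w_{n-1})` this is
`d (w_{n+1} - 2 w_n + w_{n-1}) - g'(u_n) w_n - ẅ_n = 2 λ ẇ_n + λ² w_n`. -/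
def IsFloquetEigenfunction (V : ℝ → ℝ) (d T : ℝ) (u : ℤ → X ℝ M) (l : ℂ)
    (W : ℤ → X ℂ M × X ℂ M) : Prop :=
  W ≠ 0 ∧ (∃ b : ℝ, ∀ n, ‖W n‖ ≤ b) ∧
  ∀ n, W (n + 1) = DF V d T (u n) (W n)
    + ((1 / d : ℂ) • ((2 * l) • dt T (W n).1 + l ^ 2 • (W n).1), 0)

/-- The characteristic distance `N = (1/2) min_i N_i`. -/
def charDist {k : ℕ} (N : Fin k → ℕ) : ℝ := (1 / 2) * ⨅ i, (N i : ℝ)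

end Breathers

end DKG

end

/-!
The equation for stationary states on the lattice, `d (u_{n+1} + u_{n-1}) = H(u_n)`, is treated as an
equation for bounded sequences `u : ℤ → X_M`, with linearization `L_u`. All decay estimates come from
maximum principles for scalar recursions. The spectrum at zero stays away from the unit circle, so
that the diagonal part of `L_0` dominates the off-diagonal part: `θ + θ⁻¹ ≤ |c_j|` for the traces `c_j`
on the modes, where `θ = 1 / r_M` (`Chain.exists_rate`).

The hypotheses on the stable and unstable manifolds enter through one fact: the bounded solutions of
`L_q w = 0` are the multiples of `q̇` (`HypChain.isPulse`). It follows from the identification of the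
tangent spaces of the stable manifold with the initial data of bounded solutions of the linearization
on a half-line (`HypChain.exists_forward_of_mem_stableTangent`,
`HypChain.mem_stableTangent_of_forward`). Hence `L_q`, bordered by `q̇` and by the functional that pairs
with `q̇`, is invertible. About a superposition of separated pulses, the operator
`(w, b) ↦ (L_u w - ∑ b_j e_j, ⟨e_i, w⟩)`, bordered by the copies `e_i` of `q̇`, is invertible with a
bound that does not depend on the number of pulses: near each center, cutoffs reduce the estimate to
that for one pulse, and far from all centers the diagonal part dominates
(`HypChain.IsPulse.exists_bordered_bound`, `HypChain.IsPulse.exists_bord_inverse`).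

This yields the family in the frequency, by the implicit function theorem for bordered equations in
weighted spaces, with `L_q y = 2 q̈` (`HypChain.IsPulse.exists_frequencyDerivative`), and the
multi-breather, by Newton's method with a residual `O(θ ^ L)`, `L` being the smallest distance of two
neighbouring centers (`HypChain.IsPulse.exists_multiBreather`). In both cases the multipliers `b`
vanish, because the bordering vectors are odd in time while the equation is time reversible.

The Floquet problem is `T_λ w = 0` with `T_λ = L_u - 2 λ ∂_t - λ²`. The bordered version of `T_λ` is
invertible for small `λ`; let `β(λ)` be the block of its inverse that maps the prescribed values of the
functionals to the multipliers (`multiplier`), and `G` the Gram matrix of the `e_i`. Then `β` is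
holomorphic, a bounded nonzero solution exists exactly if `det β(λ) = 0`, and `R(λ)` is defined by
`-(1 / d) G β(λ) G = A + (K / d) λ² + R(λ)`. To estimate it, let `b = β(λ) G c`. The solution of the
bordered problem with the values `G c` of the functionals is `∑ c_j (e_j + λ y_j)`, with the copies
`y_j` of `y`, up to an error of second order in `ρ ^ L + |λ|`, where `ρ = θ ^ (1 / 2)`
(`HypChain.IsPulse.exists_ansatz_bound`). Pairing with `e_i`, on which `T_λ` is of first order by
symmetry, determines `G b` up to third order. The terms of odd order in `λ` vanish by parity in time,
the coefficient of `-λ²` is `K` up to small overlaps, and that of `λ⁰` is the matrix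
`⟨e_i, L_u e_j⟩` (`HypChain.IsPulse.exists_floquet_bound`).

The last matrix equals `-d A` up to `O(ρ ^ (3 L))` (`HypChain.IsPulse.exists_interaction_bound`). For
neighbours, summation by parts on the two sides of the midpoint leaves the symplectic form of the two
copies at the midpoint, which is the entry of `A` (`HypChain.IsPulse.exists_adjacent_bound`). The
entries two or more off the diagonal are negligible. The row sums are small since the time derivative
of the multi-breather is an exact solution of `L_u w = 0` that is close to `∑ e_j`
(`HypChain.IsPulse.exists_rowSum_bound`), and those of `A` vanish because `aTilde = -a`
(`aTilde_eq_neg`); this settles the diagonal.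
-/

namespace DKG

/-! ### Trigonometric polynomials -/

section TrigonometricPolynomials

variable {𝕜 : Type} [RCLike 𝕜] {M : ℕ}

/-- The inclusion of the real trigonometric polynomials into those with values in `𝕜`. -/
noncomputable def lift (𝕜 : Type) [RCLike 𝕜] {M : ℕ} : X ℝ M →L[ℝ] X 𝕜 M :=
  LinearMap.toContinuousLinearMap
    { toFun := fun u => WithLp.toLp 2 fun k => (u k : 𝕜)
      map_add' := fun u v => by ext k; simp
      map_smul' := fun c u => by ext k; simp [RCLike.real_smul_eq_coe_mul] }

@[simp] theorem lift_apply (u : X ℝ M) (k : Mode M) : lift 𝕜 u k = (u k : 𝕜) := rfl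

@[simp] theorem norm_lift (u : X ℝ M) : ‖lift 𝕜 u‖ = ‖u‖ := by
  simp [EuclideanSpace.norm_eq]

theorem lift_real (u : X ℝ M) : lift ℝ u = u := by ext k; simp

/-- Differentiation in time, as a continuous linear map. -/
noncomputable def dtL (𝕜 : Type) [RCLike 𝕜] {M : ℕ} (T : ℝ) : X 𝕜 M →L[𝕜] X 𝕜 M :=
  LinearMap.toContinuousLinearMap
    { toFun := dt T
      map_add' := fun u v => by
        ext k
        rcases k with k | k
        · refine Fin.cases ?_ (fun j => ?_) k <;> simp [dt, mul_add]
        · simp [dt, mul_add]; ring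
      map_smul' := fun c u => by
        ext k
        rcases k with k | k
        · refine Fin.cases ?_ (fun j => ?_) k <;> simp [dt]
          ring
        · simp [dt]; ring }

@[simp] theorem dtL_apply (T : ℝ) (u : X 𝕜 M) : dtL 𝕜 T u = dt T u := rfl

/-- The time reflection `t ↦ -t`. -/
noncomputable def refl (𝕜 : Type) [RCLike 𝕜] {M : ℕ} : X 𝕜 M →L[𝕜] X 𝕜 M :=
  LinearMap.toContinuousLinearMap
    { toFun := fun u => WithLp.toLp 2 (Sum.elim (fun k => u (Sum.inl k)) fun k => -u (Sum.inr k))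
      map_add' := fun u v => by
        ext k
        rcases k with k | k <;> simp
        ring
      map_smul' := fun c u => by ext k; rcases k with k | k <;> simp }

@[simp] theorem refl_inl (u : X 𝕜 M) (k : Fin (M + 1)) :
    refl 𝕜 u (Sum.inl k) = u (Sum.inl k) := rfl

@[simp] theorem refl_inr (u : X 𝕜 M) (k : Fin M) : refl 𝕜 u (Sum.inr k) = -u (Sum.inr k) := rfl

@[simp] theorem refl_refl (u : X 𝕜 M) : refl 𝕜 (refl 𝕜 u) = u := by
  ext k; rcases k with k | k <;> simp

@[simp] theorem norm_refl (u : X 𝕜 M) : ‖refl 𝕜 u‖ = ‖u‖ := by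
  simp [EuclideanSpace.norm_eq, Fintype.sum_sum_type]

theorem dt_refl (T : ℝ) (u : X 𝕜 M) : dt T (refl 𝕜 u) = -refl 𝕜 (dt T u) := by
  ext k
  rcases k with k | k
  · refine Fin.cases ?_ (fun j => ?_) k <;> simp [dt]
  · simp [dt]

theorem refl_lift (u : X ℝ M) : refl 𝕜 (lift 𝕜 u) = lift 𝕜 (refl ℝ u) := by
  ext k; rcases k with k | k <;> simp

theorem dt_lift (T : ℝ) (u : X ℝ M) : dt T (lift 𝕜 u) = lift 𝕜 (dt T u) := by
  ext k
  rcases k with k | k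
  · refine Fin.cases ?_ (fun j => ?_) k <;> simp [dt]
  · simp [dt]

/-- The bilinear `L²([0,T])` pairing of a real with a `𝕜`-valued trigonometric polynomial. -/
noncomputable def dotp (a : X ℝ M) (w : X 𝕜 M) : 𝕜 := inner 𝕜 (lift 𝕜 a) w

theorem dotp_eq_sum (a : X ℝ M) (w : X 𝕜 M) : dotp a w = ∑ k, (a k : 𝕜) * w k := by
  simp [dotp, PiLp.inner_apply, mul_comm]

theorem norm_dotp_le (a : X ℝ M) (w : X 𝕜 M) : ‖dotp a w‖ ≤ ‖a‖ * ‖w‖ := by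
  simpa [dotp] using norm_inner_le_norm (𝕜 := 𝕜) (lift 𝕜 a) w

theorem dotp_add_right (a : X ℝ M) (v w : X 𝕜 M) : dotp a (v + w) = dotp a v + dotp a w :=
  inner_add_right _ _ _

theorem dotp_sub_right (a : X ℝ M) (v w : X 𝕜 M) : dotp a (v - w) = dotp a v - dotp a w :=
  inner_sub_right _ _ _

theorem dotp_neg_right (a : X ℝ M) (w : X 𝕜 M) : dotp a (-w) = -dotp a w := inner_neg_right _ _

theorem dotp_smul_right (a : X ℝ M) (c : 𝕜) (w : X 𝕜 M) : dotp a (c • w) = c * dotp a w :=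
  inner_smul_right _ _ _

theorem dotp_zero_right (a : X ℝ M) : dotp a (0 : X 𝕜 M) = 0 := inner_zero_right _

theorem dotp_add_left (a b : X ℝ M) (w : X 𝕜 M) : dotp (a + b) w = dotp a w + dotp b w := by
  simp [dotp, inner_add_left]

theorem dotp_sub_left (a b : X ℝ M) (w : X 𝕜 M) : dotp (a - b) w = dotp a w - dotp b w := by
  simp [dotp, inner_sub_left]

theorem dotp_neg_left (a : X ℝ M) (w : X 𝕜 M) : dotp (-a) w = -dotp a w := by
  simp [dotp, inner_neg_left]

theorem dotp_smul_left (c : ℝ) (a : X ℝ M) (w : X 𝕜 M) : dotp (c • a) w = (c : 𝕜) * dotp a w := by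
  simp only [dotp_eq_sum, Finset.mul_sum]
  exact Finset.sum_congr rfl fun k _ => by simp [mul_assoc]

theorem dotp_zero_left (w : X 𝕜 M) : dotp (0 : X ℝ M) w = 0 := by simp [dotp]

theorem dotp_comm (a b : X ℝ M) : dotp a b = dotp b a := by
  simp [dotp_eq_sum, mul_comm]

theorem dotp_lift (a b : X ℝ M) : dotp a (lift 𝕜 b) = ((dotp a b : ℝ) : 𝕜) := by
  simp [dotp_eq_sum]

theorem dotp_self (a : X ℝ M) : dotp a a = ‖a‖ ^ 2 := by
  simp [dotp, lift_real]

theorem dotp_single (k : Mode M) (w : X 𝕜 M) :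
    dotp (EuclideanSpace.single k (1 : ℝ)) w = w k := by
  rw [dotp_eq_sum, Finset.sum_eq_single k] <;> simp +contextual

theorem eq_of_forall_dotp_eq {v w : X 𝕜 M} (h : ∀ a : X ℝ M, dotp a v = dotp a w) : v = w := by
  ext k; simpa [dotp_single] using h (EuclideanSpace.single k 1)

theorem dotp_dt_left (T : ℝ) (a : X ℝ M) (w : X 𝕜 M) : dotp (dt T a) w = -dotp a (dt T w) := by
  simp only [dotp_eq_sum, Fintype.sum_sum_type, Fin.sum_univ_succ, dt, Sum.elim_inl, Sum.elim_inr,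
    Fin.cases_zero, Fin.cases_succ, map_zero, zero_mul, mul_zero, zero_add, neg_add,
    ← Finset.sum_neg_distrib]
  rw [add_comm]
  congr 1 <;> refine Finset.sum_congr rfl fun j _ => ?_ <;> push_cast <;>
    simp only [RCLike.ofReal_real_eq_id, id] <;> ring

theorem dotp_refl_left (a : X ℝ M) (w : X 𝕜 M) : dotp (refl ℝ a) w = dotp a (refl 𝕜 w) := by
  simp [dotp_eq_sum, Fintype.sum_sum_type]

/-- An odd and an even trigonometric polynomial are orthogonal. -/
theorem dotp_eq_zero_of_parity {a : X ℝ M} {w : X 𝕜 M} (ha : refl ℝ a = -a)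
    (hw : refl 𝕜 w = w) : dotp a w = 0 := by
  have h := dotp_refl_left a w
  rw [ha, hw, dotp_neg_left] at h
  exact self_eq_neg.mp h.symm

theorem continuous_mode (T : ℝ) (k : Mode M) : Continuous (mode T k) := by
  rcases k with k | k
  · change Continuous fun t => mode T (Sum.inl k) t
    by_cases h : (k : ℕ) = 0 <;> simp only [mode, h, if_true, if_false] <;> fun_prop
  · change Continuous fun t => mode T (Sum.inr k) t
    simp only [mode]; fun_prop

theorem continuous_ev (T : ℝ) (u : X 𝕜 M) : Continuous (ev T u) :=
  continuous_finsetSum _ fun k _ =>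
    continuous_const.mul (RCLike.continuous_ofReal.comp (continuous_mode T k))

theorem integral_cos_int {T : ℝ} (hT : 0 < T) (n : ℤ) (hn : n ≠ 0) :
    ∫ t in (0 : ℝ)..T, Real.cos (2 * Real.pi * n / T * t) = 0 := by
  have h0 : 2 * Real.pi * n / T ≠ 0 := by
    have : (n : ℝ) ≠ 0 := by exact_mod_cast hn
    positivity
  rw [intervalIntegral.integral_comp_mul_left (fun t => Real.cos t) h0, integral_cos,
    div_mul_cancel₀ _ hT.ne']
  have : Real.sin (2 * Real.pi * n) = 0 := by
    rw [Real.sin_eq_zero_iff]; exact ⟨2 * n, by push_cast; ring⟩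
  simp [this]

theorem integral_sin_int {T : ℝ} (hT : 0 < T) (n : ℤ) :
    ∫ t in (0 : ℝ)..T, Real.sin (2 * Real.pi * n / T * t) = 0 := by
  by_cases hn : n = 0
  · simp [hn]
  have h0 : 2 * Real.pi * n / T ≠ 0 := by
    have : (n : ℝ) ≠ 0 := by exact_mod_cast hn
    positivity
  rw [intervalIntegral.integral_comp_mul_left (fun t => Real.sin t) h0, integral_sin,
    div_mul_cancel₀ _ hT.ne']
  have : Real.cos (2 * Real.pi * n) = 1 := by
    rw [Real.cos_eq_one_iff]; exact ⟨n, by ring⟩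
  simp [this]

theorem integral_cos_mul_cos {T : ℝ} (hT : 0 < T) (m n : ℕ) (h : m + n ≠ 0) :
    ∫ t in (0 : ℝ)..T, Real.cos (2 * Real.pi * m / T * t) * Real.cos (2 * Real.pi * n / T * t)
      = if m = n then T / 2 else 0 := by
  have e : ∀ t : ℝ, Real.cos (2 * Real.pi * m / T * t) * Real.cos (2 * Real.pi * n / T * t) =
      1 / 2 * (Real.cos (2 * Real.pi * ((m - n : ℤ) : ℝ) / T * t)
        + Real.cos (2 * Real.pi * ((m + n : ℤ) : ℝ) / T * t)) := by
    intro t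
    have := Real.cos_add_cos (2 * Real.pi * ((m - n : ℤ) : ℝ) / T * t)
      (2 * Real.pi * ((m + n : ℤ) : ℝ) / T * t)
    rw [this, show (2 * Real.pi * ((m - n : ℤ) : ℝ) / T * t
      + 2 * Real.pi * ((m + n : ℤ) : ℝ) / T * t) / 2 = 2 * Real.pi * m / T * t by push_cast; ring,
      show (2 * Real.pi * ((m - n : ℤ) : ℝ) / T * t
      - 2 * Real.pi * ((m + n : ℤ) : ℝ) / T * t) / 2 = -(2 * Real.pi * n / T * t) by
        push_cast; ring, Real.cos_neg]
    ring
  simp only [e]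
  rw [intervalIntegral.integral_const_mul, intervalIntegral.integral_add
    (by apply Continuous.intervalIntegrable; fun_prop)
    (by apply Continuous.intervalIntegrable; fun_prop),
    integral_cos_int hT (m + n : ℤ) (by omega)]
  split_ifs with hmn
  · simp [hmn]; ring
  · rw [integral_cos_int hT _ (by omega)]; simp

theorem integral_sin_mul_sin {T : ℝ} (hT : 0 < T) (m n : ℕ) (h : m + n ≠ 0) :
    ∫ t in (0 : ℝ)..T, Real.sin (2 * Real.pi * m / T * t) * Real.sin (2 * Real.pi * n / T * t)
      = if m = n then T / 2 else 0 := by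
  have e : ∀ t : ℝ, Real.sin (2 * Real.pi * m / T * t) * Real.sin (2 * Real.pi * n / T * t) =
      Real.cos (2 * Real.pi * ((m - n : ℤ) : ℝ) / T * t) -
      Real.cos (2 * Real.pi * m / T * t) * Real.cos (2 * Real.pi * n / T * t) := by
    intro t
    rw [show 2 * Real.pi * ((m - n : ℤ) : ℝ) / T * t
      = 2 * Real.pi * m / T * t - 2 * Real.pi * n / T * t by push_cast; ring, Real.cos_sub]
    ring
  simp only [e]
  rw [intervalIntegral.integral_sub (by apply Continuous.intervalIntegrable; fun_prop)
    (by apply Continuous.intervalIntegrable; fun_prop), integral_cos_mul_cos hT m n h]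
  split_ifs with hmn
  · simp [hmn]; ring
  · rw [integral_cos_int hT _ (by omega)]; simp

theorem integral_sin_mul_cos {T : ℝ} (hT : 0 < T) (m n : ℕ) :
    ∫ t in (0 : ℝ)..T, Real.sin (2 * Real.pi * m / T * t) * Real.cos (2 * Real.pi * n / T * t)
      = 0 := by
  have e : ∀ t : ℝ, Real.sin (2 * Real.pi * m / T * t) * Real.cos (2 * Real.pi * n / T * t) =
      1 / 2 * (Real.sin (2 * Real.pi * ((m - n : ℤ) : ℝ) / T * t)
        + Real.sin (2 * Real.pi * ((m + n : ℤ) : ℝ) / T * t)) := by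
    intro t
    rw [show 2 * Real.pi * ((m - n : ℤ) : ℝ) / T * t
      = 2 * Real.pi * m / T * t - 2 * Real.pi * n / T * t by push_cast; ring,
      show 2 * Real.pi * ((m + n : ℤ) : ℝ) / T * t
      = 2 * Real.pi * m / T * t + 2 * Real.pi * n / T * t by push_cast; ring,
      Real.sin_sub, Real.sin_add]
    ring
  simp only [e]
  rw [intervalIntegral.integral_const_mul, intervalIntegral.integral_add
    (by apply Continuous.intervalIntegrable; fun_prop)
    (by apply Continuous.intervalIntegrable; fun_prop), integral_sin_int hT, integral_sin_int hT]
  simp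

theorem integral_mode_mul_mode {T : ℝ} (hT : 0 < T) (j k : Mode M) :
    ∫ t in (0 : ℝ)..T, mode T j t * mode T k t = if j = k then 1 else 0 := by
  have hs : √(2 / T) * √(2 / T) = 2 / T := Real.mul_self_sqrt (by positivity)
  have hs' : √T * √T = T := Real.mul_self_sqrt hT.le
  have hs0 : √T ≠ 0 := (Real.sqrt_pos.mpr hT).ne'
  have hpull : ∀ (a b : ℝ) (φ ψ : ℝ → ℝ),
      ∫ t in (0 : ℝ)..T, (a * φ t) * (b * ψ t) = a * b * ∫ t in (0 : ℝ)..T, φ t * ψ t := by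
    intro a b φ ψ
    rw [← intervalIntegral.integral_const_mul]
    congr 1; funext t; ring
  -- the constant mode is a multiple of the cosine of wavenumber zero
  have hcos : ∀ k : Fin (M + 1), ∃ a : ℝ, (∀ t, mode T (Sum.inl k : Mode M) t
      = a * Real.cos (2 * Real.pi * (k : ℕ) / T * t)) ∧
      a * a = if (k : ℕ) = 0 then 1 / T else 2 / T := by
    intro k
    by_cases h : (k : ℕ) = 0
    · refine ⟨1 / √T, fun t => by simp [mode, h], ?_⟩
      rw [if_pos h, div_mul_div_comm, hs', one_mul]
    · exact ⟨√(2 / T), fun t => by simp [mode, h], by rw [if_neg h, hs]⟩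
  have hsin : ∀ k : Fin M, ∀ t, mode T (Sum.inr k : Mode M) t
      = √(2 / T) * Real.sin (2 * Real.pi * ((k : ℕ) + 1 : ℕ) / T * t) := by
    intro k t; simp [mode]
  rcases j with j | j <;> rcases k with k | k
  · obtain ⟨a, ha, ha'⟩ := hcos j
    obtain ⟨b, hb, hb'⟩ := hcos k
    simp only [ha, hb, hpull, Sum.inl.injEq, Fin.ext_iff]
    by_cases h : (j : ℕ) + k = 0
    · have hj : (j : ℕ) = 0 := by omega
      have hk : (k : ℕ) = 0 := by omega
      have : j = k := Fin.ext (by omega)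
      subst this
      have hab : a * b = 1 / T := by
        have h0 := ha 0; rw [hb 0] at h0
        simp at h0; rw [h0, ha', if_pos hj]
      simp [hj, hab, hT.ne']
    · rw [integral_cos_mul_cos hT _ _ h]
      split_ifs with hjk
      · have : j = k := Fin.ext hjk
        subst this
        have hab : a * b = 2 / T := by
          have h0 := ha 0; rw [hb 0] at h0
          simp at h0; rw [h0, ha', if_neg (by omega)]
        rw [hab]; field_simp
      · simp
  · obtain ⟨a, ha, -⟩ := hcos j
    simp only [ha, hsin, hpull]
    simp only [mul_comm (Real.cos _)]
    rw [integral_sin_mul_cos hT]; simp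
  · obtain ⟨a, ha, -⟩ := hcos k
    simp only [ha, hsin, hpull]
    rw [integral_sin_mul_cos hT]; simp
  · simp only [hsin, hpull, Sum.inr.injEq, Fin.ext_iff]
    rw [integral_sin_mul_sin hT _ _ (by omega)]
    split_ifs with h h' h'
    · rw [hs]; field_simp
    · omega
    · omega
    · simp

theorem continuous_ofReal_mode (T : ℝ) (k : Mode M) :
    Continuous fun t => ((mode T k t : ℝ) : 𝕜) :=
  RCLike.continuous_ofReal.comp (continuous_mode T k)

theorem integral_coe_real (T : ℝ) (φ : ℝ → ℝ) :
    ∫ t in (0 : ℝ)..T, (φ t : 𝕜) = ((∫ t in (0 : ℝ)..T, φ t : ℝ) : 𝕜) := by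
  simp only [intervalIntegral.intervalIntegral_eq_integral_uIoc, integral_ofReal]
  split_ifs <;> simp

theorem proj_ev {T : ℝ} (hT : 0 < T) (u : X 𝕜 M) : proj T (ev T u) = u := by
  ext k
  simp only [proj, ev, Finset.sum_mul]
  rw [intervalIntegral.integral_finsetSum fun j _ => by
    apply Continuous.intervalIntegrable
    exact (continuous_const.mul (continuous_ofReal_mode T j)).mul (continuous_ofReal_mode T k)]
  have : ∀ j : Mode M, ∫ t in (0 : ℝ)..T, u j * ((mode T j t : ℝ) : 𝕜) * ((mode T k t : ℝ) : 𝕜)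
      = u j * if j = k then 1 else 0 := by
    intro j
    simp only [mul_assoc, ← RCLike.ofReal_mul]
    rw [intervalIntegral.integral_const_mul, integral_coe_real,
      integral_mode_mul_mode hT]
    split_ifs <;> simp
  simp [this]

theorem ev_injective {T : ℝ} (hT : 0 < T) {u v : X 𝕜 M} (h : ∀ t, ev T u t = ev T v t) :
    u = v := by
  rw [← proj_ev hT u, ← proj_ev hT v, funext h]

theorem ev_neg (T : ℝ) (u : X 𝕜 M) (t : ℝ) : ev T u (-t) = ev T (refl 𝕜 u) t := by
  simp only [ev, Fintype.sum_sum_type, refl_inl, refl_inr]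
  congr 1 <;> refine Finset.sum_congr rfl fun k _ => ?_ <;> simp [mode]

theorem even_iff {T : ℝ} (hT : 0 < T) (u : X 𝕜 M) :
    (∀ t, ev T u (-t) = ev T u t) ↔ refl 𝕜 u = u := by
  simp only [ev_neg]
  exact ⟨fun h => ev_injective hT h, fun h t => by rw [h]⟩

theorem ev_periodic {T : ℝ} (hT : 0 < T) (u : X 𝕜 M) : Function.Periodic (ev T u) T := by
  intro t
  refine Finset.sum_congr rfl fun k _ => ?_
  congr 2
  rcases k with k | k
  · simp only [mode]
    rw [show 2 * Real.pi * (k : ℕ) / T * (t + T)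
      = 2 * Real.pi * (k : ℕ) / T * t + (k : ℕ) * (2 * Real.pi) by field_simp,
      Real.cos_add_nat_mul_two_pi]
  · simp only [mode]
    rw [show 2 * Real.pi * ((k : ℕ) + 1) / T * (t + T)
      = 2 * Real.pi * ((k : ℕ) + 1) / T * t + ((k + 1 : ℕ) : ℝ) * (2 * Real.pi) by
        push_cast; field_simp, Real.sin_add_nat_mul_two_pi]

/-- Testing a projection against a trigonometric polynomial is integrating. -/
theorem dotp_proj {T : ℝ} {φ : ℝ → 𝕜} (hφ : Continuous φ) (a : X ℝ M) :
    dotp a (proj T φ) = ∫ t in (0 : ℝ)..T, φ t * ((ev T a t : ℝ) : 𝕜) := by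
  simp only [dotp_eq_sum, proj, ev, ← intervalIntegral.integral_const_mul]
  rw [← intervalIntegral.integral_finsetSum fun k _ => by
    apply Continuous.intervalIntegrable
    exact continuous_const.mul (hφ.mul (continuous_ofReal_mode T k))]
  congr 1; funext t
  push_cast
  rw [Finset.mul_sum]
  exact Finset.sum_congr rfl fun k _ => by simp; ring

theorem proj_dotp {T : ℝ} {φ : ℝ → ℝ} (hφ : Continuous φ) (w : X 𝕜 M) :
    dotp (proj T φ) w = ∫ t in (0 : ℝ)..T, (φ t : 𝕜) * ev T w t := by
  simp only [dotp_eq_sum, proj, ev, RCLike.ofReal_real_eq_id, id]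
  simp only [← integral_coe_real, ← intervalIntegral.integral_mul_const]
  rw [← intervalIntegral.integral_finsetSum fun k _ => by
    apply Continuous.intervalIntegrable
    exact (RCLike.continuous_ofReal.comp
      (hφ.mul (continuous_mode T k))).mul continuous_const]
  congr 1; funext t
  rw [Finset.mul_sum]
  exact Finset.sum_congr rfl fun k _ => by push_cast; ring

theorem integral_ev_mul_ev {T : ℝ} (hT : 0 < T) (u v : X ℝ M) :
    ∫ t in (0 : ℝ)..T, ev T u t * ev T v t = dotp u v := by
  have := dotp_proj (T := T) (continuous_ev T u) v
  rw [proj_ev hT] at this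
  rw [dotp_comm, this]; rfl

theorem ev_lift (T : ℝ) (u : X ℝ M) (t : ℝ) : ev T (lift 𝕜 u) t = ((ev T u t : ℝ) : 𝕜) := by
  simp [ev]

theorem proj_ofReal (T : ℝ) (φ : ℝ → ℝ) :
    proj T (fun t => (φ t : 𝕜)) = lift 𝕜 (proj T φ : X ℝ M) := by
  ext k
  simp only [proj, lift_apply]
  rw [← integral_coe_real]
  simp

theorem exists_norm_ev_le (𝕜 : Type) [RCLike 𝕜] (M : ℕ) (T : ℝ) :
    ∃ C, 0 < C ∧ ∀ (u : X 𝕜 M) (t : ℝ), ‖ev T u t‖ ≤ C * ‖u‖ := by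
  have hm : ∀ (k : Mode M) t, |mode T k t| ≤ 1 / √T + √(2 / T) := by
    intro k t
    have h1 : 0 ≤ 1 / √T := by positivity
    have h2 : 0 ≤ √(2 / T) := by positivity
    rcases k with k | k
    · by_cases h : (k : ℕ) = 0
      · simp only [mode, h, if_true]; rw [abs_of_nonneg h1]; linarith
      · simp only [mode, h, if_false, abs_mul, abs_of_nonneg h2]
        nlinarith [Real.abs_cos_le_one (2 * Real.pi * (k : ℕ) / T * t)]
    · simp only [mode, abs_mul, abs_of_nonneg h2]
      nlinarith [Real.abs_sin_le_one (2 * Real.pi * ((k : ℕ) + 1) / T * t)]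
  set B := 1 / √T + √(2 / T)
  have hB : 0 ≤ B := by positivity
  refine ⟨Fintype.card (Mode M) * B + 1, by positivity, fun u t => ?_⟩
  calc ‖ev T u t‖ ≤ ∑ k : Mode M, ‖u k * ((mode T k t : ℝ) : 𝕜)‖ := norm_sum_le _ _
    _ ≤ ∑ k : Mode M, ‖u‖ * B := Finset.sum_le_sum fun k _ => by
        rw [norm_mul, RCLike.norm_ofReal]
        exact mul_le_mul (PiLp.norm_apply_le u k) (hm k t) (abs_nonneg _) (norm_nonneg _)
    _ ≤ _ := by
        rw [Finset.sum_const, nsmul_eq_mul, Finset.card_univ]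
        nlinarith [norm_nonneg u]

theorem exists_norm_proj_le (𝕜 : Type) [RCLike 𝕜] (M : ℕ) {T : ℝ} (hT : 0 < T) :
    ∃ C, 0 < C ∧ ∀ (φ : ℝ → 𝕜) (b : ℝ), (∀ t, ‖φ t‖ ≤ b) → ‖(proj T φ : X 𝕜 M)‖ ≤ C * b := by
  obtain ⟨C, hC, h⟩ := exists_norm_ev_le 𝕜 M T
  refine ⟨Fintype.card (Mode M) * (C * T) + 1, by positivity, fun φ b hb => ?_⟩
  have hb0 : 0 ≤ b := (norm_nonneg _).trans (hb 0)
  have hk : ∀ k : Mode M, ‖(proj T φ : X 𝕜 M) k‖ ≤ C * T * b := by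
    intro k
    have := intervalIntegral.norm_integral_le_of_norm_le_const (a := 0) (b := T) (C := b * C)
      (f := fun t => φ t * ((mode T k t : ℝ) : 𝕜)) fun t _ => by
        rw [norm_mul]
        have h1 := h (EuclideanSpace.single k 1) t
        have h2 : ev T (EuclideanSpace.single k (1 : 𝕜)) t = ((mode T k t : ℝ) : 𝕜) := by
          simp only [ev]
          rw [Finset.sum_eq_single k] <;> simp +contextual
        rw [h2] at h1
        simp only [PiLp.norm_single, norm_one, mul_one] at h1
        exact mul_le_mul (hb t) h1 (norm_nonneg _) hb0
    calc _ ≤ b * C * |T - 0| := this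
      _ = _ := by rw [sub_zero, abs_of_pos hT]; ring
  have hsum : (proj T φ : X 𝕜 M) = ∑ k, EuclideanSpace.single k ((proj T φ : X 𝕜 M) k) := by
    ext j; simp [Finset.sum_apply, Pi.single_apply, -Fintype.sum_sum_type]
  rw [hsum]
  calc _ ≤ ∑ k : Mode M, ‖EuclideanSpace.single k ((proj T φ : X 𝕜 M) k)‖ := norm_sum_le _ _
    _ ≤ ∑ k : Mode M, C * T * b := Finset.sum_le_sum fun k _ => by
        simpa using hk k
    _ ≤ _ := by
        rw [Finset.sum_const, nsmul_eq_mul, Finset.card_univ]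
        nlinarith

theorem proj_add {T : ℝ} {φ ψ : ℝ → 𝕜} (hφ : Continuous φ) (hψ : Continuous ψ) :
    (proj T (fun t => φ t + ψ t) : X 𝕜 M) = proj T φ + proj T ψ := by
  ext k
  simp only [proj, PiLp.add_apply, add_mul]
  exact intervalIntegral.integral_add
    (Continuous.intervalIntegrable (hφ.mul (continuous_ofReal_mode T k)) _ _)
    (Continuous.intervalIntegrable (hψ.mul (continuous_ofReal_mode T k)) _ _)

theorem proj_smul (T : ℝ) (c : 𝕜) (φ : ℝ → 𝕜) :
    (proj T (fun t => c * φ t) : X 𝕜 M) = c • proj T φ := by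
  ext k
  simp only [proj, PiLp.smul_apply, smul_eq_mul, mul_assoc]
  exact intervalIntegral.integral_const_mul _ _

theorem proj_sub {T : ℝ} {φ ψ : ℝ → 𝕜} (hφ : Continuous φ) (hψ : Continuous ψ) :
    (proj T (fun t => φ t - ψ t) : X 𝕜 M) = proj T φ - proj T ψ := by
  have h1 := proj_add (M := M) (T := T) hφ (ψ := fun t => -1 * ψ t)
    (continuous_const.mul hψ)
  rw [proj_smul] at h1
  rw [show (fun t => φ t - ψ t) = fun t => φ t + -1 * ψ t by funext t; ring, h1]
  simp [sub_eq_add_neg]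

theorem ev_add (T : ℝ) (u v : X 𝕜 M) (t : ℝ) : ev T (u + v) t = ev T u t + ev T v t := by
  simp [ev, add_mul, Finset.sum_add_distrib]

theorem ev_smul (T : ℝ) (c : 𝕜) (u : X 𝕜 M) (t : ℝ) : ev T (c • u) t = c * ev T u t := by
  simp [ev, mul_assoc, Finset.mul_sum, -Fintype.sum_sum_type]

theorem ev_sub (T : ℝ) (u v : X 𝕜 M) (t : ℝ) : ev T (u - v) t = ev T u t - ev T v t := by
  simp [ev, sub_mul, Finset.sum_sub_distrib]

theorem ev_zero (T : ℝ) (t : ℝ) : ev T (0 : X 𝕜 M) t = 0 := by simp [ev]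

end TrigonometricPolynomials

/-! ### The nonlinearity and the stationary equation -/

section ScalarNonlinearity

theorem contDiff_deriv {V : ℝ → ℝ} (hV : ContDiff ℝ ∞ V) : ContDiff ℝ ∞ (deriv V) :=
  (contDiff_infty_iff_deriv.mp hV).2

theorem exists_lipschitz_of_contDiff {φ : ℝ → ℝ} (hφ : ContDiff ℝ ∞ φ) (R : ℝ) :
    ∃ C, 0 < C ∧ ∀ x y : ℝ, |x| ≤ R → |y| ≤ R → |φ x - φ y| ≤ C * |x - y| := by
  obtain ⟨C, hC⟩ := (isCompact_Icc (a := -R) (b := R)).exists_bound_of_continuousOn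
    (contDiff_deriv hφ).continuous.continuousOn
  refine ⟨max C 1, by positivity, fun x y hx hy => ?_⟩
  have := (convex_Icc (-R) R).norm_image_sub_le_of_norm_deriv_le (f := φ) (C := max C 1)
    (fun z _ => (hφ.differentiable (by simp)) z) (fun z hz => (hC z hz).trans (le_max_left _ _))
    (abs_le.mp hy) (abs_le.mp hx)
  simpa using this

theorem exists_taylor_of_contDiff {φ : ℝ → ℝ} (hφ : ContDiff ℝ ∞ φ) (R : ℝ) :
    ∃ C, 0 < C ∧ ∀ x y z : ℝ, |x| ≤ R → |y| ≤ R → |z| ≤ R →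
      |φ x - φ y - deriv φ z * (x - y)| ≤ C * (|x - z| + |y - z|) * |x - y| := by
  obtain ⟨C, hC0, hC⟩ := exists_lipschitz_of_contDiff (contDiff_deriv hφ) R
  refine ⟨C, hC0, fun x y z hx hy hz => ?_⟩
  have hd : ∀ s, HasDerivAt (fun s => φ s - deriv φ z * s) (deriv φ s - deriv φ z) s := by
    intro s
    have h1 := ((hφ.differentiable (by simp)) s).hasDerivAt
    simpa using h1.fun_sub ((hasDerivAt_id s).const_mul (deriv φ z))
  have hmem : ∀ s ∈ Set.uIcc y x, |s - z| ≤ |x - z| + |y - z| ∧ |s| ≤ R := by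
    intro s hs
    rw [Set.mem_uIcc] at hs
    constructor
    · rcases hs with ⟨h1, h2⟩ | ⟨h1, h2⟩ <;>
      · have hx0 := abs_nonneg (x - z)
        have hy0 := abs_nonneg (y - z)
        rw [abs_le]
        constructor <;> linarith [neg_abs_le (x - z), neg_abs_le (y - z), le_abs_self (x - z),
          le_abs_self (y - z)]
    · rw [abs_le] at *
      rcases hs with ⟨h1, h2⟩ | ⟨h1, h2⟩ <;> constructor <;> linarith [hx.1, hx.2, hy.1, hy.2]
  have := (convex_uIcc y x).norm_image_sub_le_of_norm_hasDerivWithin_le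
    (f := fun s => φ s - deriv φ z * s) (C := C * (|x - z| + |y - z|))
    (fun s _ => (hd s).hasDerivWithinAt) (fun s hs => by
      rw [Real.norm_eq_abs]
      refine (hC s z (hmem s hs).2 hz).trans ?_
      exact mul_le_mul_of_nonneg_left (hmem s hs).1 hC0.le)
    Set.left_mem_uIcc Set.right_mem_uIcc
  rw [Real.norm_eq_abs, Real.norm_eq_abs] at this
  convert this using 2
  ring

end ScalarNonlinearity

/-- The data of the lattice: an even smooth on-site potential `V`, the coupling `d`, and the temporal
period `T`. -/
structure Chain where
  V : ℝ → ℝ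
  d : ℝ
  T : ℝ
  smooth : ContDiff ℝ ∞ V
  even_V : ∀ x, V (-x) = V x
  d_pos : 0 < d
  T_pos : 0 < T

namespace Chain

variable (P : Chain) {𝕜 : Type} [RCLike 𝕜] {M : ℕ}

theorem continuous_f : Continuous (deriv P.V) := (contDiff_deriv P.smooth).continuous

theorem continuous_f' : Continuous (deriv (deriv P.V)) :=
  (contDiff_deriv (contDiff_deriv P.smooth)).continuous

theorem f_neg (x : ℝ) : deriv P.V (-x) = -deriv P.V x := by
  have h : P.V = fun y => P.V (-y) := funext fun y => (P.even_V y).symm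
  have h2 : deriv P.V x = -deriv P.V (-x) := by
    conv_lhs => rw [h]
    exact deriv_comp_neg P.V x
  rw [h2, neg_neg]

theorem f'_neg (x : ℝ) : deriv (deriv P.V) (-x) = deriv (deriv P.V) x := by
  have h : deriv P.V = fun y => -deriv P.V (-y) := funext fun y => by rw [P.f_neg, neg_neg]
  have h2 : deriv (deriv P.V) x = deriv (deriv P.V) (-x) := by
    conv_lhs => rw [h]
    rw [deriv.fun_neg, deriv_comp_neg, neg_neg]
  exact h2.symm

theorem continuous_f_ev (u : X ℝ M) : Continuous fun t => deriv P.V (ev P.T u t) :=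
  P.continuous_f.comp (continuous_ev P.T u)

theorem continuous_f'_ev (u : X ℝ M) (w : X 𝕜 M) :
    Continuous fun t => ((deriv (deriv P.V) (ev P.T u t) : ℝ) : 𝕜) * ev P.T w t :=
  (RCLike.continuous_ofReal.comp (P.continuous_f'.comp (continuous_ev P.T u))).mul
    (continuous_ev P.T w)

/-- `g'(u)` as a continuous linear map. -/
noncomputable def dgL (𝕜 : Type) [RCLike 𝕜] (u : X ℝ M) : X 𝕜 M →L[𝕜] X 𝕜 M :=
  LinearMap.toContinuousLinearMap
    { toFun := dg P.V P.T u
      map_add' := fun v w => by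
        simp only [dg, ev_add, mul_add]
        exact proj_add (P.continuous_f'_ev u v) (P.continuous_f'_ev u w)
      map_smul' := fun c w => by
        simp only [dg, ev_smul, RingHom.id_apply, mul_left_comm _ c]
        exact proj_smul _ _ _ }

@[simp] theorem dgL_apply (u : X ℝ M) (w : X 𝕜 M) : P.dgL 𝕜 u w = dg P.V P.T u w := rfl

theorem dotp_dg (u a : X ℝ M) (w : X 𝕜 M) :
    dotp (dg P.V P.T u a) w = dotp a (dg P.V P.T u w) := by
  have h1 := proj_dotp (T := P.T) (P.continuous_f'_ev u a) w
  have h2 := dotp_proj (T := P.T) (P.continuous_f'_ev u w) a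
  simp only [dg]
  rw [h1, h2]
  congr 1; funext t
  simp only [RCLike.ofReal_real_eq_id, id]
  push_cast; ring

theorem dg_refl (u : X ℝ M) (w : X 𝕜 M) :
    dg P.V P.T (refl ℝ u) (refl 𝕜 w) = refl 𝕜 (dg P.V P.T u w) := by
  refine eq_of_forall_dotp_eq fun a => ?_
  rw [← dotp_refl_left]
  simp only [dg]
  rw [dotp_proj (P.continuous_f'_ev _ _), dotp_proj (P.continuous_f'_ev _ _)]
  simp only [← ev_neg]
  set φ : ℝ → 𝕜 := fun t => ((deriv (deriv P.V) (ev P.T u t) : ℝ) : 𝕜) * ev P.T w t *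
    ((ev P.T a (-t) : ℝ) : 𝕜) with hφ
  have h1 : (fun t => ((deriv (deriv P.V) (ev P.T u (-t)) : ℝ) : 𝕜) * ev P.T w (-t) *
    ((ev P.T a t : ℝ) : 𝕜)) = fun t => φ (-t) := by funext t; simp [hφ]
  have hper : Function.Periodic φ P.T := by
    intro t
    simp only [hφ, ev_neg, ev_periodic P.T_pos u t, ev_periodic P.T_pos w t,
      ev_periodic P.T_pos _ t]
  rw [h1, intervalIntegral.integral_comp_neg (f := φ)]
  have := hper.intervalIntegral_add_eq (-P.T) 0
  simpa using this

theorem g_refl (u : X ℝ M) : g P.V P.T (refl ℝ u) = refl ℝ (g P.V P.T u) := by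
  refine eq_of_forall_dotp_eq fun a => ?_
  rw [← dotp_refl_left]
  simp only [g]
  rw [dotp_proj (P.continuous_f_ev _), dotp_proj (P.continuous_f_ev _)]
  simp only [← ev_neg]
  set φ : ℝ → ℝ := fun t => deriv P.V (ev P.T u t) * ev P.T a (-t) with hφ
  have h1 : (fun t => deriv P.V (ev P.T u (-t)) * ev P.T a t) = fun t => φ (-t) := by
    funext t; simp [hφ]
  have hper : Function.Periodic φ P.T := by
    intro t
    simp only [hφ, ev_neg, ev_periodic P.T_pos u t, ev_periodic P.T_pos _ t]
  simp only [RCLike.ofReal_real_eq_id, id]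
  rw [h1, intervalIntegral.integral_comp_neg (f := φ)]
  have := hper.intervalIntegral_add_eq (-P.T) 0
  simpa using this

/-- Invariance of the nonlinearity under time translations, in infinitesimal form. -/
theorem dg_dt (u : X ℝ M) : dg P.V P.T u (dt P.T u) = dt P.T (g P.V P.T u) := by
  refine eq_of_forall_dotp_eq fun a => ?_
  rw [← neg_neg (dotp a (dt P.T _)), ← dotp_dt_left]
  simp only [dg, g]
  rw [dotp_proj (P.continuous_f'_ev _ _), dotp_proj (P.continuous_f_ev _)]
  simp only [RCLike.ofReal_real_eq_id, id]
  have hf : ∀ t, HasDerivAt (fun t => deriv P.V (ev P.T u t))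
      (deriv (deriv P.V) (ev P.T u t) * ev P.T (dt P.T u) t) t := fun t =>
    (((contDiff_deriv P.smooth).differentiable (by simp)) _).hasDerivAt.comp t
      (hasDerivAt_ev P.T u t)
  have := intervalIntegral.integral_mul_deriv_eq_deriv_mul (a := 0) (b := P.T)
    (fun t _ => hf t) (fun t _ => hasDerivAt_ev P.T a t)
    ((P.continuous_f'_ev u (dt P.T u)).intervalIntegrable _ _)
    ((continuous_ev P.T (dt P.T a)).intervalIntegrable _ _)
  have hu : ev P.T u P.T = ev P.T u 0 := by simpa using ev_periodic P.T_pos u 0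
  have ha : ev P.T a P.T = ev P.T a 0 := by simpa using ev_periodic P.T_pos a 0
  rw [hu, ha, sub_self, zero_sub] at this
  rw [this, neg_neg]

theorem g_neg (u : X ℝ M) : g P.V P.T (-u) = -g P.V P.T u := by
  have := proj_smul (M := M) P.T (-1 : ℝ) fun t => deriv P.V (ev P.T u t)
  have h2 : ∀ t, ev P.T (-u) t = -ev P.T u t := fun t => by
    have := ev_smul P.T (-1 : ℝ) u t
    simpa using this
  simp only [g, h2, f_neg]
  simpa using this

theorem dg_neg (u : X ℝ M) (w : X 𝕜 M) : dg P.V P.T (-u) w = dg P.V P.T u w := by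
  have h2 : ∀ t, ev P.T (-u) t = -ev P.T u t := fun t => by
    have := ev_smul P.T (-1 : ℝ) u t
    simpa using this
  simp only [dg, h2, f'_neg]

theorem dg_zero (w : X 𝕜 M) :
    dg P.V P.T (0 : X ℝ M) w = ((deriv (deriv P.V) 0 : ℝ) : 𝕜) • w := by
  simp only [dg, ev_zero]
  rw [proj_smul, proj_ev P.T_pos]

theorem dg_lift (u w : X ℝ M) : dg P.V P.T u (lift 𝕜 w) = lift 𝕜 (dg P.V P.T u w) := by
  simp only [dg, ev_lift, ← proj_ofReal]
  simp

theorem exists_dg_lipschitz (𝕜 : Type) [RCLike 𝕜] (M : ℕ) (R : ℝ) :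
    ∃ C, 0 < C ∧ ∀ u u' : X ℝ M, ‖u‖ ≤ R → ‖u'‖ ≤ R → ∀ w : X 𝕜 M,
      ‖dg P.V P.T u w - dg P.V P.T u' w‖ ≤ C * ‖u - u'‖ * ‖w‖ := by
  obtain ⟨A, hA0, hA⟩ := exists_norm_ev_le ℝ M P.T
  obtain ⟨A', hA0', hA'⟩ := exists_norm_ev_le 𝕜 M P.T
  obtain ⟨D, hD0, hD⟩ := exists_norm_proj_le 𝕜 M P.T_pos
  obtain ⟨C, hC0, hC⟩ := exists_lipschitz_of_contDiff
    (contDiff_deriv (contDiff_deriv P.smooth)) (A * R)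
  refine ⟨D * (C * A * A'), by positivity, fun u u' hu hu' w => ?_⟩
  have hb : ∀ (v : X ℝ M), ‖v‖ ≤ R → ∀ t, |ev P.T v t| ≤ A * R := fun v hv t =>
    (hA v t).trans (mul_le_mul_of_nonneg_left hv hA0.le)
  simp only [dg]
  rw [← proj_sub (P.continuous_f'_ev _ _) (P.continuous_f'_ev _ _)]
  refine (hD _ (C * A * A' * ‖u - u'‖ * ‖w‖) fun t => ?_).trans (le_of_eq (by ring))
  rw [← sub_mul, norm_mul, ← RCLike.ofReal_sub, RCLike.norm_ofReal]
  calc _ ≤ (C * (A * ‖u - u'‖)) * (A' * ‖w‖) := by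
        refine mul_le_mul ?_ (hA' w t) (norm_nonneg _) (by positivity)
        refine (hC _ _ (hb u hu t) (hb u' hu' t)).trans (mul_le_mul_of_nonneg_left ?_ hC0.le)
        rw [← ev_sub]; exact hA _ t
    _ = _ := by ring

theorem exists_g_taylor (M : ℕ) (R : ℝ) :
    ∃ C, 0 < C ∧ ∀ u u' v : X ℝ M, ‖u‖ ≤ R → ‖u'‖ ≤ R → ‖v‖ ≤ R →
      ‖g P.V P.T u - g P.V P.T u' - dg P.V P.T v (u - u')‖
        ≤ C * (‖u - v‖ + ‖u' - v‖) * ‖u - u'‖ := by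
  obtain ⟨A, hA0, hA⟩ := exists_norm_ev_le ℝ M P.T
  obtain ⟨D, hD0, hD⟩ := exists_norm_proj_le ℝ M P.T_pos
  obtain ⟨C, hC0, hC⟩ := exists_taylor_of_contDiff (contDiff_deriv P.smooth) (A * R)
  refine ⟨D * (C * A * A), by positivity, fun u u' v hu hu' hv => ?_⟩
  have hb : ∀ (v : X ℝ M), ‖v‖ ≤ R → ∀ t, |ev P.T v t| ≤ A * R := fun v hv t =>
    (hA v t).trans (mul_le_mul_of_nonneg_left hv hA0.le)
  have hd : ∀ (v w : X ℝ M) t, |ev P.T v t - ev P.T w t| ≤ A * ‖v - w‖ := fun v w t => by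
    rw [← ev_sub]; exact hA _ t
  simp only [g, dg]
  have hc : Continuous fun t => deriv P.V (ev P.T u t) - deriv P.V (ev P.T u' t) :=
    (P.continuous_f_ev _).sub (P.continuous_f_ev _)
  rw [← proj_sub (P.continuous_f_ev _) (P.continuous_f_ev _),
    ← proj_sub hc (P.continuous_f'_ev _ _)]
  refine (hD _ (C * A * A * (‖u - v‖ + ‖u' - v‖) * ‖u - u'‖) fun t => ?_).trans
    (le_of_eq (by ring))
  rw [ev_sub]
  simp only [RCLike.ofReal_real_eq_id, id, Real.norm_eq_abs]
  calc _ ≤ _ := hC _ _ _ (hb u hu t) (hb u' hu' t) (hb v hv t)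
    _ ≤ C * (A * ‖u - v‖ + A * ‖u' - v‖) * (A * ‖u - u'‖) := by
        gcongr
        · exact hd _ _ t
        · exact hd _ _ t
        · exact hd _ _ t
    _ = _ := by ring

theorem dg_dt_of_dt_eq_zero {u : X ℝ M} (hu : dt P.T u = 0) (w : X 𝕜 M) :
    dg P.V P.T u (dt P.T w) = dt P.T (dg P.V P.T u w) := by
  have hc : ∀ t, ev P.T u t = ev P.T u 0 := by
    intro t
    refine is_const_of_deriv_eq_zero (fun s => (hasDerivAt_ev P.T u s).differentiableAt)
      (fun s => ?_) t 0
    rw [(hasDerivAt_ev P.T u s).deriv, hu, ev_zero]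
  have h : ∀ v : X 𝕜 M, dg P.V P.T u v = ((deriv (deriv P.V) (ev P.T u 0) : ℝ) : 𝕜) • v := by
    intro v
    simp only [dg, hc]
    rw [proj_smul, proj_ev P.T_pos]
  rw [h, h, ← dtL_apply, ← dtL_apply, map_smul]

/-- The on-site part `H(u) = 2 d u + ü + g(u)` of the stationary lattice equation
`d (u_{n+1} + u_{n-1}) = H(u_n)`. -/
noncomputable def H (u : X ℝ M) : X ℝ M := (2 * P.d) • u + dt P.T (dt P.T u) + g P.V P.T u

/-- The derivative of the on-site part `H`, acting on real or complex vectors. -/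
noncomputable def B (𝕜 : Type) [RCLike 𝕜] (u : X ℝ M) : X 𝕜 M →L[𝕜] X 𝕜 M :=
  ((2 * P.d : ℝ) : 𝕜) • ContinuousLinearMap.id 𝕜 _ + (dtL 𝕜 P.T).comp (dtL 𝕜 P.T) + P.dgL 𝕜 u

theorem B_apply (u : X ℝ M) (w : X 𝕜 M) :
    P.B 𝕜 u w = ((2 * P.d : ℝ) : 𝕜) • w + dt P.T (dt P.T w) + dg P.V P.T u w := rfl

theorem B_sub_apply (u u' : X ℝ M) (w : X 𝕜 M) :
    (P.B 𝕜 u - P.B 𝕜 u') w = dg P.V P.T u w - dg P.V P.T u' w := by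
  rw [sub_apply, B_apply, B_apply]; abel

theorem dotp_B (u a : X ℝ M) (w : X 𝕜 M) : dotp (P.B ℝ u a) w = dotp a (P.B 𝕜 u w) := by
  simp only [B_apply, dotp_add_left, dotp_add_right, dotp_dg, dotp_dt_left, neg_neg,
    dotp_smul_right]
  rw [RCLike.ofReal_real_eq_id, id, dotp_smul_left]

theorem B_refl (u : X ℝ M) (w : X 𝕜 M) :
    P.B 𝕜 (refl ℝ u) (refl 𝕜 w) = refl 𝕜 (P.B 𝕜 u w) := by
  simp only [B_apply, dg_refl, dt_refl, map_add, map_smul]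
  rw [← dtL_apply, map_neg, dtL_apply, dt_refl, neg_neg]

theorem B_neg (u : X ℝ M) : P.B 𝕜 (-u) = P.B 𝕜 u := by
  ext1 w; simp only [B_apply, dg_neg]

theorem B_lift (u w : X ℝ M) : P.B 𝕜 u (lift 𝕜 w) = lift 𝕜 (P.B ℝ u w) := by
  simp only [B_apply, dg_lift, dt_lift, map_add]
  congr 2
  ext k; simp

theorem H_refl (u : X ℝ M) : P.H (refl ℝ u) = refl ℝ (P.H u) := by
  simp only [H, g_refl, dt_refl, map_add, map_smul]
  rw [← dtL_apply, map_neg, dtL_apply, dt_refl, neg_neg]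

theorem H_neg (u : X ℝ M) : P.H (-u) = -P.H u := by
  simp only [H, g_neg, ← dtL_apply, map_neg, smul_neg]; abel

theorem H_zero : P.H (0 : X ℝ M) = 0 := by
  have := P.H_neg (0 : X ℝ M)
  rw [neg_zero, eq_neg_iff_add_eq_zero, ← two_smul ℝ] at this
  simpa using this

theorem B_dt (u : X ℝ M) : P.B ℝ u (dt P.T u) = dt P.T (P.H u) := by
  simp only [B_apply, H, dg_dt]
  simp only [← dtL_apply, map_add, map_smul]
  rfl

theorem B_dt_of_dt_eq_zero {u : X ℝ M} (hu : dt P.T u = 0) (w : X 𝕜 M) :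
    P.B 𝕜 u (dt P.T w) = dt P.T (P.B 𝕜 u w) := by
  simp only [B_apply, P.dg_dt_of_dt_eq_zero hu]
  simp only [← dtL_apply, map_add, map_smul]

theorem exists_B_lipschitz (𝕜 : Type) [RCLike 𝕜] (M : ℕ) (R : ℝ) :
    ∃ C, 0 < C ∧ ∀ u u' : X ℝ M, ‖u‖ ≤ R → ‖u'‖ ≤ R → ‖P.B 𝕜 u - P.B 𝕜 u'‖ ≤ C * ‖u - u'‖ := by
  obtain ⟨C, hC0, hC⟩ := P.exists_dg_lipschitz 𝕜 M R
  refine ⟨C, hC0, fun u u' hu hu' => ContinuousLinearMap.opNorm_le_bound _ (by positivity)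
    fun w => ?_⟩
  rw [B_sub_apply]
  exact hC u u' hu hu' w

theorem exists_H_taylor (M : ℕ) (R : ℝ) :
    ∃ C, 0 < C ∧ ∀ u u' v : X ℝ M, ‖u‖ ≤ R → ‖u'‖ ≤ R → ‖v‖ ≤ R →
      ‖P.H u - P.H u' - P.B ℝ v (u - u')‖ ≤ C * (‖u - v‖ + ‖u' - v‖) * ‖u - u'‖ := by
  obtain ⟨C, hC0, hC⟩ := P.exists_g_taylor M R
  refine ⟨C, hC0, fun u u' v hu hu' hv => ?_⟩
  convert hC u u' v hu hu' hv using 2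
  simp only [H, B_apply, ← dtL_apply, ← dgL_apply, map_sub, RCLike.ofReal_real_eq_id, id]
  abel

theorem hasFDerivAt_H (u : X ℝ M) : HasFDerivAt P.H (P.B ℝ u) u := by
  obtain ⟨C, hC0, hC⟩ := P.exists_H_taylor M (‖u‖ + 1)
  refine .of_isLittleO ?_
  have h1 : (fun x => P.H x - P.H u - P.B ℝ u (x - u)) =O[𝓝 u] fun x => ‖x - u‖ ^ 2 := by
    refine Asymptotics.IsBigO.of_bound C ?_
    filter_upwards [Metric.ball_mem_nhds u one_pos] with x hx
    have hx' : ‖x‖ ≤ ‖u‖ + 1 := by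
      have := norm_le_norm_add_norm_sub' x u
      rw [Metric.mem_ball, dist_eq_norm] at hx
      linarith
    refine (hC x u u hx' (by linarith) (by linarith)).trans (le_of_eq ?_)
    simp; ring
  refine h1.trans_isLittleO ?_
  simp only [pow_two]
  have h2 : (fun x : X ℝ M => ‖x - u‖) =o[𝓝 u] fun _ => (1 : ℝ) := by
    rw [Asymptotics.isLittleO_one_iff]
    have : Continuous fun x : X ℝ M => ‖x - u‖ := by fun_prop
    simpa using this.tendsto u
  have h3 := h2.mul_isBigO (Asymptotics.isBigO_refl (fun x : X ℝ M => ‖x - u‖) (𝓝 u))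
  simp only [one_mul] at h3
  exact h3.trans_isBigO (Asymptotics.isBigO_norm_left.mpr (Asymptotics.isBigO_refl _ _))

/-- The stationary lattice equation `d (u_{n+1} + u_{n-1}) = H(u_n)` describes the orbits of the
spatial dynamics map. -/
theorem F_pair_iff (a b c : X ℝ M) :
    (c, b) = F P.V P.d P.T (b, a) ↔ P.d • (c + a) = P.H b := by
  have hd := P.d_pos.ne'
  have h : F P.V P.d P.T (b, a) = ((1 / P.d) • P.H b - a, b) := by
    simp only [F, H, Equiv.coe_fn_mk, smul_add, smul_smul]
    rw [show 1 / P.d * (2 * P.d) = 2 by field_simp]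
    congr 2
    abel
  rw [h, Prod.mk.injEq]
  constructor
  · rintro ⟨h, -⟩
    rw [h, sub_add_cancel, smul_smul, mul_one_div_cancel hd, one_smul]
  · intro h
    rw [← h, smul_smul, one_div_mul_cancel hd, one_smul]
    simp

theorem isOrbit_iff (u : ℤ → X ℝ M) :
    (∀ n, pair u (n + 1) = F P.V P.d P.T (pair u n)) ↔
      ∀ n, P.d • (u (n + 1) + u (n - 1)) = P.H (u n) := by
  refine forall_congr' fun n => ?_
  rw [← F_pair_iff]
  simp [pair]

end Chain

/-! ### The spectrum of the linearization at zero -/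

section Spectrum

variable {𝕜 : Type} [RCLike 𝕜] {M : ℕ}

/-- The wavenumber of a mode. -/
def wavenumber : Mode M → ℕ
  | Sum.inl k => k
  | Sum.inr k => k + 1

theorem wavenumber_le (j : Mode M) : wavenumber j ≤ M := by
  rcases j with j | j <;> simp only [wavenumber] <;> omega

theorem dt_dt_apply (T : ℝ) (u : X 𝕜 M) (j : Mode M) :
    dt T (dt T u) j = -(((2 * Real.pi * wavenumber j / T) ^ 2 : ℝ) : 𝕜) * u j := by
  rcases j with j | j
  · refine Fin.cases ?_ (fun j => ?_) j
    · simp [dt, wavenumber]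
    · simp [dt, wavenumber]; ring
  · simp [dt, wavenumber]; ring

/-- `x ↦ x + x⁻¹` is increasing on `[1, ∞)`; here in the form of a comparison of arguments. -/
theorem le_of_add_inv_le {x y : ℝ} (hx : 1 ≤ x) (hy : 1 < y) (h : x + x⁻¹ ≤ y + y⁻¹) : x ≤ y := by
  by_contra! hlt
  have h1 : 0 < y := by linarith
  have h2 : 0 < x := by linarith
  have h3 : y + y⁻¹ < x + x⁻¹ := by
    have : x + x⁻¹ - (y + y⁻¹) = (x - y) * (x * y - 1) / (x * y) := by field_simp; ring
    have h4 : 0 < (x - y) * (x * y - 1) / (x * y) :=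
      div_pos (mul_pos (by linarith) (by nlinarith)) (by positivity)
    linarith
  linarith

theorem exists_root_of_two_lt_abs {c : ℝ} (hc : 2 < |c|) :
    ∃ μ : ℝ, 1 < |μ| ∧ |μ| + |μ|⁻¹ = |c| ∧ μ ^ 2 - c * μ + 1 = 0 := by
  have key : ∀ c : ℝ, 2 < c → ∃ x : ℝ, 1 < x ∧ x + x⁻¹ = c ∧ x ^ 2 - c * x + 1 = 0 := by
    intro c hc
    have hs := Real.sq_sqrt (show 0 ≤ c ^ 2 - 4 by nlinarith)
    have hs0 := Real.sqrt_nonneg (c ^ 2 - 4)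
    have hx : (1 : ℝ) < (c + √(c ^ 2 - 4)) / 2 := by linarith
    have he : ((c + √(c ^ 2 - 4)) / 2) ^ 2 - c * ((c + √(c ^ 2 - 4)) / 2) + 1 = 0 := by
      nlinarith
    refine ⟨_, hx, ?_, he⟩
    set x := (c + √(c ^ 2 - 4)) / 2
    have : x ≠ 0 := by positivity
    field_simp
    linarith
  obtain ⟨x, hx, hxc, he⟩ := key _ hc
  rcases le_total 0 c with h | h
  · rw [abs_of_nonneg h] at hxc he
    exact ⟨x, by rwa [abs_of_pos (by linarith)],
      by rw [abs_of_pos (by linarith), abs_of_nonneg h, hxc], he⟩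
  · rw [abs_of_nonpos h] at hxc he
    exact ⟨-x, by rwa [abs_neg, abs_of_pos (by linarith)],
      by rw [abs_neg, abs_of_pos (by linarith), abs_of_nonpos h, hxc], by linarith⟩

namespace Chain

variable (P : Chain)

/-- The trace `c_j` of the spatial dynamics linearized at zero on the modes of wavenumber `j`, whose
eigenvalues are the solutions of `μ + 1/μ = c_j`. -/
noncomputable def symbol (j : ℕ) : ℝ :=
  2 + deriv (deriv P.V) 0 / P.d - (2 * Real.pi * j / P.T) ^ 2 / P.d

theorem B_zero_apply (w : X 𝕜 M) (j : Mode M) :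
    P.B 𝕜 (0 : X ℝ M) w j = ((P.d * P.symbol (wavenumber j) : ℝ) : 𝕜) * w j := by
  have hd := P.d_pos.ne'
  have : P.d * P.symbol (wavenumber j) = 2 * P.d + -((2 * Real.pi * wavenumber j / P.T) ^ 2)
      + deriv (deriv P.V) 0 := by
    rw [symbol]; field_simp; ring
  rw [this, B_apply, dg_zero]
  simp only [PiLp.add_apply, PiLp.smul_apply, dt_dt_apply, smul_eq_mul]
  push_cast; ring

theorem two_lt_abs_symbol (h : SpectrumAwayFromCircle P.V P.d P.T) (j : ℕ) :
    2 < |P.symbol j| := by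
  by_contra! hle
  obtain ⟨ε, hε, hμ⟩ := h
  have hd : (P.d : ℂ) ≠ 0 := by exact_mod_cast P.d_pos.ne'
  set c := P.symbol j with hc
  have hs : √(1 - (c / 2) ^ 2) ^ 2 = 1 - (c / 2) ^ 2 := by
    refine Real.sq_sqrt ?_
    nlinarith [sq_abs c, abs_nonneg c]
  -- If `|c| ≤ 2`, then the roots of `μ² - c μ + 1` have modulus one, and a cosine of wavenumber `j` is an
  -- eigenfunction.
  set μ : ℂ := ⟨c / 2, √(1 - (c / 2) ^ 2)⟩ with hμd
  have hμn : ‖μ‖ = 1 := by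
    have : Complex.normSq μ = 1 := by rw [Complex.normSq_mk]; nlinarith
    rw [Complex.norm_def, this, Real.sqrt_one]
  have hμ0 : μ ≠ 0 := by intro h0; rw [h0] at hμn; simp at hμn
  have hroot : μ * μ + 1 = c * μ := by
    apply Complex.ext
    · simp [hμd]; nlinarith
    · simp [hμd]; ring
  set κ : ℝ := 2 * Real.pi * j / P.T with hκ
  have hlin : ∀ t : ℝ, HasDerivAt (fun t : ℝ => κ * t) κ t := fun t => by
    simpa using (hasDerivAt_id t).const_mul κ
  have hv1 : ∀ t : ℝ, HasDerivAt (fun t : ℝ => ((Real.cos (κ * t) : ℝ) : ℂ))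
      ((-(κ * Real.sin (κ * t)) : ℝ) : ℂ) t := fun t => by
    have := (hlin t).cos.ofReal_comp
    convert this using 2
    ring
  have hv2 : ∀ t : ℝ, HasDerivAt (fun t : ℝ => ((-(κ * Real.sin (κ * t)) : ℝ) : ℂ))
      ((-(κ ^ 2 * Real.cos (κ * t)) : ℝ) : ℂ) t := fun t => by
    have := (((hlin t).sin.const_mul κ).fun_neg).ofReal_comp
    convert this using 2
    ring
  have hsm : ContDiff ℝ ∞ (fun t : ℝ => ((Real.cos (κ * t) : ℝ) : ℂ)) := by
    exact Complex.ofRealCLM.contDiff.comp (Real.contDiff_cos.comp (contDiff_const.mul contDiff_id))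
  have hper : Function.Periodic (fun t : ℝ => ((Real.cos (κ * t) : ℝ) : ℂ)) P.T := by
    intro t
    have hT := P.T_pos.ne'
    simp only [hκ]
    rw [show 2 * Real.pi * j / P.T * (t + P.T)
      = 2 * Real.pi * j / P.T * t + j * (2 * Real.pi) by field_simp,
      Real.cos_add_nat_mul_two_pi]
  have heig : IsEigenvalueDFzero P.V P.d P.T μ := by
    refine ⟨fun t => ((Real.cos (κ * t) : ℝ) : ℂ), fun t => μ⁻¹ * ((Real.cos (κ * t) : ℝ) : ℂ),
      hsm, contDiff_const.mul hsm, hper, fun t => by simp only [hper t], Or.inl ?_, fun t => ⟨?_, ?_⟩⟩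
    · intro h0
      have := congrFun h0 0
      simp at this
    · rw [show deriv (fun t : ℝ => ((Real.cos (κ * t) : ℝ) : ℂ))
        = fun t : ℝ => ((-(κ * Real.sin (κ * t)) : ℝ) : ℂ) from funext fun t => (hv1 t).deriv,
        (hv2 t).deriv]
      have hcc : (c : ℂ) = 2 + (deriv (deriv P.V) 0 : ℝ) / P.d - (κ : ℂ) ^ 2 / P.d := by
        rw [hc, symbol, hκ]; push_cast; ring
      have h1 : μ⁻¹ = c - μ := by
        field_simp
        linear_combination hroot
      rw [h1, hcc]
      push_cast
      ring
    · field_simp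
  have := hμ μ heig
  rw [hμn] at this
  simp at this
  linarith

/-- The reciprocal of `r_M` is the slowest decay rate of the linearization at zero. -/
theorem exists_rate (h : SpectrumAwayFromCircle P.V P.d P.T) (M : ℕ) :
    ∃ θ : ℝ, 0 < θ ∧ θ < 1 ∧ rM P.V P.d P.T M = θ⁻¹ ∧
      ∀ j ≤ M, θ + θ⁻¹ ≤ |P.symbol j| := by
  obtain ⟨j₀, hj₀, hmin⟩ := Finset.exists_min_image (Finset.range (M + 1))
    (fun j => |P.symbol j|) ⟨0, by simp⟩
  obtain ⟨μ, hμ1, hμ2, hμ3⟩ := exists_root_of_two_lt_abs (P.two_lt_abs_symbol h j₀)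
  have hdμ := P.d_pos.ne'
  have hj₀' : j₀ < M + 1 := by simpa using hj₀
  -- On a mode of wavenumber `j`, an eigenvalue `ν` satisfies `ν + ν⁻¹ = c_j`.
  have hDF : ∀ (Q : X ℝ M × X ℝ M) (ν : ℝ), DF P.V P.d P.T (0 : X ℝ M) Q = ν • Q ↔
      Q.1 = ν • Q.2 ∧ ∀ j, (P.symbol (wavenumber j) - ν) * Q.1 j = Q.2 j := by
    intro Q ν
    have h1 : ∀ j, ((2 : ℝ) • Q.1 + ((1 / P.d : ℝ) : ℝ) • dg P.V P.T (0 : X ℝ M) Q.1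
        + ((1 / P.d : ℝ) : ℝ) • dt P.T (dt P.T Q.1) - Q.2) j
        = P.symbol (wavenumber j) * Q.1 j - Q.2 j := by
      intro j
      rw [dg_zero]
      simp only [PiLp.add_apply, PiLp.sub_apply, PiLp.smul_apply, dt_dt_apply, smul_eq_mul, symbol]
      simp only [RCLike.ofReal_real_eq_id, id]
      ring
    rw [DF, Prod.ext_iff]
    simp only [Prod.smul_fst, Prod.smul_snd]
    rw [and_comm]
    refine and_congr Iff.rfl ⟨fun h j => ?_, fun h => ?_⟩
    · have := congrArg (fun v : X ℝ M => v j) h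
      have h1j := h1 j
      simp only [RCLike.ofReal_real_eq_id, id] at this h1j
      rw [h1j] at this
      simp only [PiLp.smul_apply, smul_eq_mul] at this
      linarith
    · ext j
      have h1j := h1 j
      simp only [RCLike.ofReal_real_eq_id, id] at h1j ⊢
      rw [h1j, PiLp.smul_apply, smul_eq_mul]
      linarith [h j]
  have hleast : IsLeast {ρ : ℝ | 1 < ρ ∧ ∃ μ : ℝ, |μ| = ρ ∧
      ∃ Q ∈ evenPairs M P.T, Q ≠ 0 ∧ DF P.V P.d P.T (0 : X ℝ M) Q = μ • Q} |μ| := by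
    refine ⟨⟨hμ1, μ, rfl, ?_⟩, ?_⟩
    · set e : X ℝ M := EuclideanSpace.single (Sum.inl ⟨j₀, hj₀'⟩) 1 with he
      have hee : refl ℝ e = e := by
        ext k; rcases k with k | k <;> simp [he]
      refine ⟨(μ • e, e), ⟨?_, ?_⟩, ?_, ?_⟩
      · rw [even_iff P.T_pos, map_smul, hee]
      · rw [even_iff P.T_pos, hee]
      · intro h0
        have := congrArg (fun v : X ℝ M => v (Sum.inl ⟨j₀, hj₀'⟩)) (Prod.ext_iff.mp h0).2
        simp [he] at this
      · rw [hDF]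
        refine ⟨rfl, fun j => ?_⟩
        by_cases hj : j = Sum.inl ⟨j₀, hj₀'⟩
        · subst hj
          simp only [he, wavenumber, PiLp.smul_apply, smul_eq_mul]
          simp
          linarith
        · simp [he, hj]
    · rintro ρ ⟨hρ, ν, rfl, Q, -, hQ0, hQ⟩
      obtain ⟨h1, h2⟩ := (hDF Q ν).mp hQ
      obtain ⟨j, hj⟩ : ∃ j, Q.2 j ≠ 0 := by
        by_contra! h0
        have : Q.2 = 0 := by ext j; simpa using h0 j
        exact hQ0 (Prod.ext (by rw [h1, this]; simp) this)
      have h3 := h2 j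
      rw [h1, PiLp.smul_apply, smul_eq_mul] at h3
      have h4 : (P.symbol (wavenumber j) - ν) * ν = 1 := by
        refine mul_right_cancel₀ hj ?_
        linarith
      have hν : ν ≠ 0 := by rintro rfl; simp at hρ; linarith
      have h5 : P.symbol (wavenumber j) = ν + ν⁻¹ := by field_simp; linarith
      refine le_of_add_inv_le hμ1.le hρ ?_
      rw [hμ2]
      refine (hmin (wavenumber j) (by simpa using Nat.lt_succ_of_le (wavenumber_le j))).trans ?_
      rw [h5, ← abs_inv]
      exact abs_add_le _ _
  refine ⟨|μ|⁻¹, by positivity, inv_lt_one_of_one_lt₀ hμ1, ?_, fun j hj => ?_⟩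
  · rw [inv_inv]; exact hleast.csInf_eq
  · rw [inv_inv, add_comm, hμ2]
    exact hmin j (by simpa using Nat.lt_succ_of_le hj)

theorem norm_B_zero_ge {θ : ℝ} (hθ : ∀ j ≤ M, θ ≤ |P.symbol j|) (h0 : 0 ≤ θ) (w : X 𝕜 M) :
    θ * P.d * ‖w‖ ≤ ‖P.B 𝕜 (0 : X ℝ M) w‖ := by
  have hd := P.d_pos
  have h1 : θ * P.d * ‖w‖ = ‖(((θ * P.d : ℝ)) : 𝕜) • w‖ := by
    rw [norm_smul, RCLike.norm_ofReal, abs_of_nonneg (by positivity)]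
  rw [h1, EuclideanSpace.norm_eq, EuclideanSpace.norm_eq]
  refine Real.sqrt_le_sqrt (Finset.sum_le_sum fun j _ => ?_)
  rw [B_zero_apply, PiLp.smul_apply, smul_eq_mul, norm_mul, norm_mul, RCLike.norm_ofReal,
    RCLike.norm_ofReal]
  gcongr ?_ ^ 2
  refine mul_le_mul_of_nonneg_right ?_ (norm_nonneg _)
  rw [abs_of_nonneg (by positivity), abs_mul, abs_of_pos hd, mul_comm]
  exact mul_le_mul_of_nonneg_left (hθ _ (wavenumber_le j)) hd.le

end Chain

end Spectrum

/-! ### Comparison principles for scalar recursions -/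

section Comparison

/-- A maximum principle on the half-line: a relative subsolution of
`a (k + 2) + a k - c a (k + 1) = -f k` lies below a supersolution, if `c > 2`. -/
theorem le_of_supersolution {a b f : ℕ → ℝ} {c : ℝ} (hc : 2 < c)
    (hbdd : ∃ K, ∀ k, a k - b k ≤ K)
    (ha : ∀ k, c * a (k + 1) ≤ a (k + 2) + a k + f k)
    (hb : ∀ k, b (k + 2) + b k + f k ≤ c * b (k + 1)) (h0 : a 0 ≤ b 0) (k : ℕ) : a k ≤ b k := by
  obtain ⟨K, hK⟩ := hbdd
  have hB : BddAbove (Set.range fun k => a k - b k) := ⟨K, by rintro _ ⟨k, rfl⟩; exact hK k⟩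
  set S := ⨆ k, (a k - b k) with hS
  have hle : ∀ k, a k - b k ≤ S := fun k => le_ciSup hB k
  by_contra! hk
  have hpos : 0 < S := lt_of_lt_of_le (by linarith) (hle k)
  have h2 : ∀ k, a k - b k ≤ 2 * S / c := by
    intro k
    rw [le_div_iff₀ (by linarith)]
    rcases k with - | k
    · nlinarith
    · nlinarith [ha k, hb k, hle k, hle (k + 2)]
  have h3 : S ≤ 2 * S / c := ciSup_le h2
  rw [le_div_iff₀ (by linarith)] at h3
  nlinarith

theorem two_lt_add_inv {τ : ℝ} (h0 : 0 < τ) (h1 : τ < 1) : 2 < τ + τ⁻¹ := by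
  have : τ + τ⁻¹ - 2 = (1 - τ) ^ 2 / τ := by field_simp; ring
  have h2 : 0 < (1 - τ) ^ 2 / τ := div_pos (pow_pos (by linarith) 2) h0
  linarith

theorem add_inv_lt_add_inv {σ τ : ℝ} (h0 : 0 < σ) (h : σ < τ) (h1 : τ < 1) :
    τ + τ⁻¹ < σ + σ⁻¹ := by
  have h2 : 0 < τ := h0.trans h
  have : σ + σ⁻¹ - (τ + τ⁻¹) = (τ - σ) * (1 - σ * τ) / (σ * τ) := by field_simp; ring
  have h3 : 0 < (τ - σ) * (1 - σ * τ) / (σ * τ) :=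
    div_pos (mul_pos (by linarith) (by nlinarith)) (by positivity)
  linarith

theorem geometric_decay {a : ℕ → ℝ} {τ : ℝ} (h0 : 0 < τ) (h1 : τ < 1) (hn : ∀ k, 0 ≤ a k)
    (hbdd : ∃ K, ∀ k, a k ≤ K) (ha : ∀ k, (τ + τ⁻¹) * a (k + 1) ≤ a (k + 2) + a k) (k : ℕ) :
    a k ≤ a 0 * τ ^ k := by
  obtain ⟨K, hK⟩ := hbdd
  refine le_of_supersolution (b := fun k => a 0 * τ ^ k) (f := fun _ => 0) (two_lt_add_inv h0 h1)
    ⟨K, fun k => ?_⟩ (fun k => by simpa using ha k) (fun k => ?_) (by simp) k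
  · have := mul_nonneg (hn 0) (pow_nonneg h0.le k)
    linarith [hK k]
  · refine le_of_eq ?_
    field_simp
    ring

/-- Decay in the presence of a forcing term of a slower rate than that of the homogeneous
equation. -/
theorem geometric_decay_forced {a : ℕ → ℝ} {τ c D : ℝ} (h0 : 0 < τ) (h1 : τ < 1)
    (hc : τ + τ⁻¹ < c) (hD : 0 ≤ D) (hn : ∀ k, 0 ≤ a k) (hbdd : ∃ K, ∀ k, a k ≤ K)
    (ha : ∀ k, c * a (k + 1) ≤ a (k + 2) + a k + D * τ ^ (k + 1)) (k : ℕ) :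
    a k ≤ (a 0 + D / (c - (τ + τ⁻¹))) * τ ^ k := by
  obtain ⟨K, hK⟩ := hbdd
  have hc' : 0 < c - (τ + τ⁻¹) := by linarith
  set E := a 0 + D / (c - (τ + τ⁻¹)) with hE
  have hE0 : 0 ≤ E := add_nonneg (hn 0) (div_nonneg hD hc'.le)
  refine le_of_supersolution (b := fun k => E * τ ^ k) (f := fun k => D * τ ^ (k + 1))
    ((two_lt_add_inv h0 h1).trans hc) ⟨K, fun k => ?_⟩ ha (fun k => ?_) ?_ k
  · have := mul_nonneg hE0 (pow_nonneg h0.le k)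
    linarith [hK k]
  · have h2 : E * τ ^ (k + 2) + E * τ ^ k = (τ + τ⁻¹) * (E * τ ^ (k + 1)) := by
      field_simp; ring
    have h3 : D ≤ (c - (τ + τ⁻¹)) * E := by
      rw [hE, mul_add, mul_div_cancel₀ _ hc'.ne']
      nlinarith [hn 0]
    have h4 := mul_le_mul_of_nonneg_right h3 (pow_nonneg h0.le (k + 1))
    rw [h2]
    linarith
  · simp only [pow_zero, mul_one, hE]
    have := div_nonneg hD hc'.le
    linarith

/-- Decay at exactly the rate `θ` of the homogeneous equation, if the forcing decays faster. -/
theorem geometric_decay_exact {a : ℕ → ℝ} {θ κ D : ℝ} (h0 : 0 < κ) (h : κ < θ) (h1 : θ < 1)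
    (hD : 0 ≤ D) (hn : ∀ k, 0 ≤ a k) (hbdd : ∃ K, ∀ k, a k ≤ K)
    (ha : ∀ k, (θ + θ⁻¹) * a (k + 1) ≤ a (k + 2) + a k + D * κ ^ (k + 1)) :
    ∃ C, 0 ≤ C ∧ ∀ k, a k ≤ C * θ ^ k := by
  obtain ⟨K, hK⟩ := hbdd
  have hθ : 0 < θ := h0.trans h
  have hκ : 0 < κ + κ⁻¹ - (θ + θ⁻¹) := by linarith [add_inv_lt_add_inv h0 h h1]
  set E := D / (κ + κ⁻¹ - (θ + θ⁻¹)) with hE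
  have hE0 : 0 ≤ E := div_nonneg hD hκ.le
  refine ⟨a 0 + E, add_nonneg (hn 0) hE0, fun k => ?_⟩
  have key : a k ≤ (a 0 + E) * θ ^ k - E * κ ^ k := by
    refine le_of_supersolution (b := fun k => (a 0 + E) * θ ^ k - E * κ ^ k)
      (f := fun k => D * κ ^ (k + 1)) (two_lt_add_inv hθ h1) ⟨K, fun k => ?_⟩ ha (fun k => ?_)
      (by simp) k
    · have h2 : E * κ ^ k ≤ (a 0 + E) * θ ^ k :=
        mul_le_mul (by linarith [hn 0]) (pow_le_pow_left₀ h0.le h.le k) (pow_nonneg h0.le k)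
          (add_nonneg (hn 0) hE0)
      linarith [hK k]
    · have h2 : (a 0 + E) * θ ^ (k + 2) + (a 0 + E) * θ ^ k
          = (θ + θ⁻¹) * ((a 0 + E) * θ ^ (k + 1)) := by
        field_simp; ring
      have h3 : E * κ ^ (k + 2) + E * κ ^ k = (κ + κ⁻¹) * (E * κ ^ (k + 1)) := by
        field_simp; ring
      have h4 : E * (κ + κ⁻¹ - (θ + θ⁻¹)) = D := div_mul_cancel₀ _ hκ.ne'
      rw [← h4]
      linarith
  have := mul_nonneg hE0 (pow_nonneg h0.le k)
  linarith

end Comparison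

/-! ### Operators on bounded sequences -/

section SequenceSpaces

/-- Bounded two-sided sequences with the supremum norm. -/
abbrev Seq (E : Type*) [NormedAddCommGroup E] := BoundedContinuousFunction ℤ E

variable {𝕜 : Type} [RCLike 𝕜] {E F : Type*} [NormedAddCommGroup E] [NormedSpace 𝕜 E]
  [NormedAddCommGroup F] [NormedSpace 𝕜 F]

/-- A bounded sequence, as an element of the space of bounded sequences. -/
noncomputable def mkSeq (f : ℤ → E) (h : ∃ C, ∀ n, ‖f n‖ ≤ C) : Seq E :=
  BoundedContinuousFunction.ofNormedAddCommGroupDiscrete f h.choose h.choose_spec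

@[simp] theorem mkSeq_apply (f : ℤ → E) (h : ∃ C, ∀ n, ‖f n‖ ≤ C) (n : ℤ) : mkSeq f h n = f n :=
  rfl

theorem Seq.norm_apply_le (v : Seq E) (n : ℤ) : ‖v n‖ ≤ ‖v‖ := v.norm_coe_le_norm n

theorem Seq.norm_le {v : Seq E} {C : ℝ} (hC : 0 ≤ C) (h : ∀ n, ‖v n‖ ≤ C) : ‖v‖ ≤ C :=
  (BoundedContinuousFunction.norm_le hC).mpr h

/-- The pointwise action of a bounded sequence of operators. -/
noncomputable def mulSeq (A : Seq (E →L[𝕜] F)) : Seq E →L[𝕜] Seq F :=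
  LinearMap.mkContinuous
    { toFun := fun v => mkSeq (fun n => A n (v n)) ⟨‖A‖ * ‖v‖, fun n =>
        (A n).le_of_opNorm_le_of_le (A.norm_apply_le n) (v.norm_apply_le n)⟩
      map_add' := fun v w => by ext n; simp
      map_smul' := fun c v => by ext n; simp } ‖A‖ fun v =>
    Seq.norm_le (by positivity) fun n =>
      (A n).le_of_opNorm_le_of_le (A.norm_apply_le n) (v.norm_apply_le n)

@[simp] theorem mulSeq_apply (A : Seq (E →L[𝕜] F)) (v : Seq E) (n : ℤ) :
    mulSeq A v n = A n (v n) := rfl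

/-- The shift `v ↦ (v_{n + k})_n`. -/
noncomputable def shiftSeq (𝕜 : Type) [RCLike 𝕜] {E : Type*} [NormedAddCommGroup E]
    [NormedSpace 𝕜 E] (k : ℤ) : Seq E →L[𝕜] Seq E :=
  LinearMap.mkContinuous
    { toFun := fun v => mkSeq (fun n => v (n + k)) ⟨‖v‖, fun n => v.norm_apply_le _⟩
      map_add' := fun v w => by ext n; simp
      map_smul' := fun c v => by ext n; simp } 1 fun v =>
    Seq.norm_le (by positivity) fun n => by
      simpa using v.norm_apply_le (n + k)

@[simp] theorem shiftSeq_apply (k : ℤ) (v : Seq E) (n : ℤ) :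
    shiftSeq 𝕜 k v n = v (n + k) := rfl

/-- The second difference operator `w ↦ d (w_{n+1} + w_{n-1}) - B_n w_n`. -/
noncomputable def lapL (d : ℝ) (B : Seq (E →L[𝕜] E)) : Seq E →L[𝕜] Seq E :=
  (d : 𝕜) • (shiftSeq 𝕜 1 + shiftSeq 𝕜 (-1)) - mulSeq B

@[simp] theorem lapL_apply (d : ℝ) (B : Seq (E →L[𝕜] E)) (w : Seq E) (n : ℤ) :
    lapL d B w n = (d : 𝕜) • (w (n + 1) + w (n - 1)) - B n (w n) := rfl

theorem norm_le_of_lapL {d γ : ℝ} (hd : 0 < d) (hγ : 2 * d < γ) {B : Seq (E →L[𝕜] E)}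
    (hB : ∀ n w, γ * ‖w‖ ≤ ‖B n w‖) (w : Seq E) : ‖w‖ ≤ (γ - 2 * d)⁻¹ * ‖lapL d B w‖ := by
  have hg : 0 < γ := by linarith
  have h1 : ∀ n, ‖w n‖ ≤ γ⁻¹ * (2 * d * ‖w‖ + ‖lapL d B w‖) := by
    intro n
    rw [inv_mul_eq_div, le_div_iff₀ hg, mul_comm]
    refine (hB n (w n)).trans ?_
    have h2 : B n (w n) = (d : 𝕜) • (w (n + 1) + w (n - 1)) - lapL d B w n := by
      rw [lapL_apply]; abel
    rw [h2]
    refine (norm_sub_le _ _).trans (add_le_add ?_ (Seq.norm_apply_le _ n))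
    rw [norm_smul, RCLike.norm_ofReal, abs_of_pos hd]
    have := norm_add_le (w (n + 1)) (w (n - 1))
    nlinarith [w.norm_apply_le (n + 1), w.norm_apply_le (n - 1)]
  have h3 := Seq.norm_le (by positivity) h1
  rw [inv_mul_eq_div, le_div_iff₀ hg] at h3
  rw [inv_mul_eq_div, le_div_iff₀ (by linarith)]
  linarith

/-- If the diagonal part dominates, then the second difference operator is invertible. -/
theorem lapL_bijective [FiniteDimensional 𝕜 E] {d γ : ℝ} (hd : 0 < d)
    (hγ : 2 * d < γ) {B : Seq (E →L[𝕜] E)} (hB : ∀ n w, γ * ‖w‖ ≤ ‖B n w‖) :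
    Function.Bijective (lapL d B) := by
  have : CompleteSpace E := FiniteDimensional.complete 𝕜 E
  have hg : 0 < γ := by linarith
  constructor
  · refine (injective_iff_map_eq_zero _).mpr fun w hw => ?_
    have := norm_le_of_lapL hd hγ hB w
    rw [hw, norm_zero, mul_zero] at this
    exact norm_le_zero_iff.mp this
  · intro f
    have hinj : ∀ n, Function.Injective (B n) := fun n =>
      (injective_iff_map_eq_zero _).mpr fun w hw => by
        have := hB n w
        rw [hw, norm_zero] at this
        exact norm_le_zero_iff.mp (by nlinarith)
    have hsurj : ∀ n y, ∃ w, B n w = y := fun n =>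
      (LinearMap.injective_iff_surjective (f := (B n : E →ₗ[𝕜] E))).mp (hinj n)
    choose J hJ using hsurj
    have hJn : ∀ n y, ‖J n y‖ ≤ γ⁻¹ * ‖y‖ := fun n y => by
      rw [inv_mul_eq_div, le_div_iff₀ hg, mul_comm]
      simpa [hJ] using hB n (J n y)
    have hJs : ∀ n y z, J n y - J n z = J n (y - z) := fun n y z =>
      hinj n (by simp [hJ])
    set Φ : Seq E → Seq E := fun w => mkSeq
      (fun n => J n ((d : 𝕜) • (w (n + 1) + w (n - 1)) - f n))
      ⟨γ⁻¹ * (‖(d : 𝕜)‖ * (‖w‖ + ‖w‖) + ‖f‖), fun n => (hJn _ _).trans (by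
        refine mul_le_mul_of_nonneg_left ?_ (by positivity)
        refine (norm_sub_le _ _).trans (add_le_add ?_ (f.norm_apply_le n))
        rw [norm_smul]
        refine mul_le_mul_of_nonneg_left ((norm_add_le _ _).trans ?_) (norm_nonneg _)
        exact add_le_add (w.norm_apply_le _) (w.norm_apply_le _))⟩ with hΦ
    have hK : (0 : ℝ) ≤ 2 * d / γ := by positivity
    obtain ⟨K, hKe⟩ : ∃ K : NNReal, (K : ℝ) = 2 * d / γ := ⟨⟨_, hK⟩, rfl⟩
    have hcon : ContractingWith K Φ := by
      refine ⟨?_, LipschitzWith.of_dist_le_mul fun v w => ?_⟩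
      · rw [← NNReal.coe_lt_coe, hKe]
        simpa using (div_lt_one hg).mpr hγ
      · rw [dist_eq_norm, dist_eq_norm, hKe]
        refine Seq.norm_le (by positivity) fun n => ?_
        have h1 : (Φ v - Φ w) n = J n ((d : 𝕜) • ((v - w) (n + 1) + (v - w) (n - 1))) := by
          simp only [hΦ, BoundedContinuousFunction.coe_sub, Pi.sub_apply, mkSeq_apply, hJs]
          congr 1
          rw [sub_sub_sub_cancel_right, ← smul_sub]
          congr 1
          abel
        rw [h1]
        refine (hJn _ _).trans ?_
        rw [norm_smul, RCLike.norm_ofReal, abs_of_pos hd]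
        have := norm_add_le ((v - w) (n + 1)) ((v - w) (n - 1))
        have h2 := (v - w).norm_apply_le (n + 1)
        have h3 := (v - w).norm_apply_le (n - 1)
        rw [div_mul_eq_mul_div, inv_mul_eq_div]
        refine div_le_div_of_nonneg_right ?_ hg.le
        nlinarith
    obtain ⟨w, hw⟩ : ∃ w, Φ w = w := ⟨hcon.fixedPoint Φ, hcon.fixedPoint_isFixedPt⟩
    refine ⟨w, ?_⟩
    ext1 n
    have h1 : w n = J n ((d : 𝕜) • (w (n + 1) + w (n - 1)) - f n) := by
      conv_lhs => rw [← hw]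
      rfl
    have h2 : B n (w n) = (d : 𝕜) • (w (n + 1) + w (n - 1)) - f n := by
      conv_lhs => rw [h1, hJ]
    rw [lapL_apply, h2, sub_sub_cancel]

end SequenceSpaces

/-! ### Superposition operators -/

section Superposition

variable {E F : Type*} [NormedAddCommGroup E] [NormedSpace ℝ E] [NormedAddCommGroup F]
  [NormedSpace ℝ F]

/-- A sequence of maps `φ n`, with derivatives `φ' n`, that are uniformly differentiable to second
order on bounded sets, so that they act smoothly on bounded sequences. -/
structure Superposable (φ : ℤ → E → F) (φ' : ℤ → E → E →L[ℝ] F) : Prop where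
  taylor : ∀ R, ∃ C, 0 < C ∧ ∀ n u u' v, ‖u‖ ≤ R → ‖u'‖ ≤ R → ‖v‖ ≤ R →
    ‖φ n u - φ n u' - φ' n v (u - u')‖ ≤ C * (‖u - v‖ + ‖u' - v‖) * ‖u - u'‖
  bdd_zero : ∃ C, ∀ n, ‖φ n 0‖ ≤ C
  bdd_deriv : ∀ R, ∃ C, ∀ n v, ‖v‖ ≤ R → ‖φ' n v‖ ≤ C

variable {φ : ℤ → E → F} {φ' : ℤ → E → E →L[ℝ] F}

namespace Superposable

theorem bdd (h : Superposable φ φ') (v : Seq E) : ∃ C, ∀ n, ‖φ n (v n)‖ ≤ C := by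
  obtain ⟨C, hC0, hC⟩ := h.taylor ‖v‖
  obtain ⟨D, hD⟩ := h.bdd_zero
  obtain ⟨A, hA⟩ := h.bdd_deriv ‖v‖
  refine ⟨C * (‖v‖ + ‖v‖) * ‖v‖ + D + A * ‖v‖, fun n => ?_⟩
  have hv := v.norm_apply_le n
  have h1 := hC n (v n) 0 0 hv (by simp) (by simp)
  have h2 : φ n (v n) = (φ n (v n) - φ n 0 - φ' n 0 (v n - 0)) + φ n 0 + φ' n 0 (v n) := by
    rw [sub_zero]; abel
  rw [h2]
  refine norm_add₃_le.trans (add_le_add (add_le_add (h1.trans ?_) (hD n)) ?_)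
  · simp only [sub_zero, norm_zero]
    gcongr
    exact norm_nonneg _
  · exact (φ' n 0).le_of_opNorm_le_of_le (hA n 0 (by simp)) hv

/-- The action of the sequence of maps on bounded sequences. -/
noncomputable def map (h : Superposable φ φ') (v : Seq E) : Seq F :=
  mkSeq (fun n => φ n (v n)) (h.bdd v)

/-- The derivative of `Superposable.map`, as a bounded sequence of operators. -/
noncomputable def deriv (h : Superposable φ φ') (v : Seq E) : Seq (E →L[ℝ] F) :=
  mkSeq (fun n => φ' n (v n))
    ⟨(h.bdd_deriv ‖v‖).choose, fun n => (h.bdd_deriv ‖v‖).choose_spec n _ (v.norm_apply_le n)⟩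

@[simp] theorem map_apply (h : Superposable φ φ') (v : Seq E) (n : ℤ) : h.map v n = φ n (v n) :=
  rfl

@[simp] theorem deriv_apply (h : Superposable φ φ') (v : Seq E) (n : ℤ) :
    h.deriv v n = φ' n (v n) := rfl

theorem exists_taylor (h : Superposable φ φ') (R : ℝ) :
    ∃ C, 0 < C ∧ ∀ u u' v : Seq E, ‖u‖ ≤ R → ‖u'‖ ≤ R → ‖v‖ ≤ R →
      ‖h.map u - h.map u' - mulSeq (h.deriv v) (u - u')‖
        ≤ C * (‖u - v‖ + ‖u' - v‖) * ‖u - u'‖ := by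
  obtain ⟨C, hC0, hC⟩ := h.taylor R
  refine ⟨C, hC0, fun u u' v hu hu' hv => Seq.norm_le (by positivity) fun n => ?_⟩
  refine (hC n (u n) (u' n) (v n) ((u.norm_apply_le n).trans hu) ((u'.norm_apply_le n).trans hu')
    ((v.norm_apply_le n).trans hv)).trans ?_
  have h1 := (u - v).norm_apply_le n
  have h2 := (u' - v).norm_apply_le n
  have h3 := (u - u').norm_apply_le n
  simp only [BoundedContinuousFunction.coe_sub, Pi.sub_apply] at h1 h2 h3
  gcongr

theorem hasStrictFDerivAt (h : Superposable φ φ') (v : Seq E) :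
    HasStrictFDerivAt h.map (mulSeq (h.deriv v)) v := by
  obtain ⟨C, hC0, hC⟩ := h.exists_taylor (‖v‖ + 1)
  refine .of_isLittleO ?_
  rw [Asymptotics.isLittleO_iff]
  intro ε hε
  have hU : Metric.ball v (min 1 (ε / (2 * C))) ∈ 𝓝 v := Metric.ball_mem_nhds v (by positivity)
  filter_upwards [prod_mem_nhds hU hU] with p ⟨h1, h2⟩
  rw [Metric.mem_ball, dist_eq_norm, lt_min_iff] at h1 h2
  have hb : ∀ u : Seq E, ‖u - v‖ < 1 → ‖u‖ ≤ ‖v‖ + 1 := fun u hu => by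
    have := norm_le_norm_add_norm_sub' u v
    linarith
  refine (hC p.1 p.2 v (hb _ h1.1) (hb _ h2.1) (by linarith)).trans ?_
  refine mul_le_mul_of_nonneg_right ?_ (norm_nonneg _)
  have h3 := h1.2.le
  have h4 := h2.2.le
  rw [le_div_iff₀ (by positivity)] at h3 h4
  nlinarith

end Superposable

end Superposition

/-! ### Hyperbolicity and decay -/

/-- Geometric decay of a bounded sequence, if the recursion holds with a perturbation tending to
zero. -/
theorem geometric_decay_perturbed {a η : ℕ → ℝ} {θ τ D : ℝ} (h0 : 0 < θ) (h : θ < τ) (h1 : τ < 1)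
    (hD : 0 ≤ D) (hn : ∀ k, 0 ≤ a k) (hbdd : ∃ K, ∀ k, a k ≤ K) (hη : Tendsto η atTop (𝓝 0))
    (ha : ∀ k, (θ + θ⁻¹ - η k) * a (k + 1) ≤ a (k + 2) + a k + D * τ ^ (k + 1)) :
    ∃ C, 0 ≤ C ∧ ∀ k, a k ≤ C * τ ^ k := by
  have hτ : 0 < τ := h0.trans h
  obtain ⟨c, hc1, hc2⟩ := exists_between (add_inv_lt_add_inv h0 h h1)
  obtain ⟨k₀, hk₀⟩ := ((hη.eventually (gt_mem_nhds (sub_pos.mpr hc2))).exists_forall_of_atTop)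
  obtain ⟨K, hK⟩ := hbdd
  set E := a k₀ + D * τ ^ k₀ / (c - (τ + τ⁻¹)) with hE
  have key : ∀ k, a (k₀ + k) ≤ E * τ ^ k := by
    intro k
    refine geometric_decay_forced (a := fun k => a (k₀ + k)) (D := D * τ ^ k₀) hτ h1 hc1
      (by positivity) (fun k => hn _) ⟨K, fun k => hK _⟩ (fun k => ?_) k
    have h2 := ha (k₀ + k)
    have h3 := hk₀ (k₀ + k) (by omega)
    have h4 := hn (k₀ + k + 1)
    have h5 : D * τ ^ (k₀ + k + 1) = D * τ ^ k₀ * τ ^ (k + 1) := by ring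
    simp only [← add_assoc]
    nlinarith
  have hE0 : 0 ≤ E := add_nonneg (hn _) (div_nonneg (by positivity) (by linarith))
  have hK0 : 0 ≤ K := (hn 0).trans (hK 0)
  refine ⟨(E + K) / τ ^ k₀, by positivity, fun k => ?_⟩
  rw [div_mul_eq_mul_div, le_div_iff₀ (by positivity)]
  rcases le_total k₀ k with hk | hk
  · obtain ⟨j, rfl⟩ := Nat.exists_eq_add_of_le hk
    calc a (k₀ + j) * τ ^ k₀ ≤ E * τ ^ j * τ ^ k₀ := by gcongr; exact key j
      _ = E * τ ^ (k₀ + j) := by ring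
      _ ≤ _ := by gcongr; linarith
  · calc a k * τ ^ k₀ ≤ K * τ ^ k :=
          mul_le_mul (hK k) (pow_le_pow_of_le_one hτ.le h1.le hk) (by positivity) hK0
      _ ≤ _ := by gcongr; linarith

/-- A chain whose linearization at zero on `X_M` is hyperbolic, with decay rate at least as fast as
`θ ^ |n|`. -/
structure HypChain (M : ℕ) extends Chain where
  θ : ℝ
  θ_pos : 0 < θ
  θ_lt_one : θ < 1
  le_symbol : ∀ j ≤ M, θ + θ⁻¹ ≤ |toChain.symbol j|

namespace HypChain

variable {M : ℕ} (P : HypChain M) {𝕜 : Type} [RCLike 𝕜]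

theorem norm_B_zero_ge (w : X 𝕜 M) : (P.θ + P.θ⁻¹) * P.d * ‖w‖ ≤ ‖P.B 𝕜 (0 : X ℝ M) w‖ :=
  P.toChain.norm_B_zero_ge P.le_symbol (by have := P.θ_pos; positivity) w

theorem recursion_le {w p m : X 𝕜 M} {η e : ℝ}
    (h : ‖(P.d : 𝕜) • (p + m) - P.B 𝕜 (0 : X ℝ M) w‖ ≤ P.d * (η * ‖w‖ + e)) :
    (P.θ + P.θ⁻¹ - η) * ‖w‖ ≤ ‖p‖ + ‖m‖ + e := by
  have h1 := P.norm_B_zero_ge w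
  have h2 : ‖P.B 𝕜 (0 : X ℝ M) w‖ ≤ ‖(P.d : 𝕜) • (p + m)‖ + P.d * (η * ‖w‖ + e) := by
    refine (norm_le_norm_add_norm_sub _ _).trans (add_le_add le_rfl ?_)
    exact h
  rw [norm_smul, RCLike.norm_ofReal, abs_of_pos P.d_pos] at h2
  have h3 := norm_add_le p m
  have hd := P.d_pos
  refine le_of_mul_le_mul_left ?_ hd
  nlinarith

/-- Decay of bounded solutions of the linearization about a sequence converging to zero. -/
theorem forward_decay {x : ℕ → X ℝ M} {w : ℕ → X 𝕜 M} {τ D : ℝ} (hτ : P.θ < τ) (hτ1 : τ < 1)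
    (hD : 0 ≤ D) (hx : Tendsto x atTop (𝓝 0)) (hb : ∃ b, ∀ k, ‖w k‖ ≤ b)
    (hw : ∀ k, ‖(P.d : 𝕜) • (w (k + 2) + w k) - P.B 𝕜 (x k) (w (k + 1))‖ ≤ D * τ ^ k) :
    ∃ C, 0 ≤ C ∧ ∀ k, ‖w k‖ ≤ C * τ ^ k := by
  have hd := P.d_pos
  have hτ0 : 0 < τ := P.θ_pos.trans hτ
  obtain ⟨A, hA⟩ := hx.norm.bddAbove_range
  obtain ⟨C, hC0, hC⟩ := P.exists_B_lipschitz 𝕜 M A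
  have hxA : ∀ k, ‖x k‖ ≤ A := fun k => hA ⟨k, rfl⟩
  refine geometric_decay_perturbed (η := fun k => C * ‖x k‖ / P.d) (D := D / P.d / τ) P.θ_pos hτ hτ1
    (by positivity) (fun k => norm_nonneg _) hb ?_ fun k => ?_
  · simpa using (hx.norm.const_mul C).div_const P.d
  · refine P.recursion_le ?_
    have h1 : (P.d : 𝕜) • (w (k + 2) + w k) - P.B 𝕜 (0 : X ℝ M) (w (k + 1))
        = ((P.d : 𝕜) • (w (k + 2) + w k) - P.B 𝕜 (x k) (w (k + 1)))
          + (P.B 𝕜 (x k) - P.B 𝕜 0 : X 𝕜 M →L[𝕜] X 𝕜 M) (w (k + 1)) := by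
      rw [sub_apply]; abel
    rw [h1]
    refine (norm_add_le _ _).trans ?_
    have h2 := hC (x k) 0 (hxA k) (by simpa using (norm_nonneg _).trans (hxA k))
    rw [sub_zero] at h2
    have h3 := (P.B 𝕜 (x k) - P.B 𝕜 0).le_of_opNorm_le h2 (w (k + 1))
    have h4 : P.d * (C * ‖x k‖ / P.d * ‖w (k + 1)‖ + D / P.d / τ * τ ^ (k + 1))
        = C * ‖x k‖ * ‖w (k + 1)‖ + D * τ ^ k := by
      field_simp; ring
    rw [h4]
    linarith [hw k]

/-- Solutions of the stationary equation that converge to zero do so at the rate `θ` of the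
linearization: a slower rate follows from perturbing the linear recursion, and then the quadratic
remainder decays faster than `θ`. -/
theorem nonlinear_decay {u : ℕ → X ℝ M} (hu : Tendsto u atTop (𝓝 0))
    (h : ∀ k, P.d • (u (k + 2) + u k) = P.H (u (k + 1))) :
    ∃ C, 0 ≤ C ∧ ∀ k, ‖u k‖ ≤ C * P.θ ^ k := by
  have hd := P.d_pos
  have hθ := P.θ_pos
  obtain ⟨A, hA⟩ := hu.norm.bddAbove_range
  have huA : ∀ k, ‖u k‖ ≤ A := fun k => hA ⟨k, rfl⟩
  have hA0 : 0 ≤ A := (norm_nonneg _).trans (huA 0)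
  obtain ⟨C, hC0, hC⟩ := P.exists_H_taylor M A
  have hq : ∀ k, ‖P.d • (u (k + 2) + u k) - P.B ℝ 0 (u (k + 1))‖
      ≤ C * ‖u (k + 1)‖ * ‖u (k + 1)‖ := by
    intro k
    have := hC (u (k + 1)) 0 0 (huA _) (by simpa using hA0) (by simpa using hA0)
    rw [P.H_zero] at this
    rw [h]
    simpa using this
  obtain ⟨τ, hτ1, hτ2⟩ : ∃ τ, P.θ < τ ∧ τ < √P.θ := exists_between (by
    rw [Real.lt_sqrt hθ.le]; nlinarith [P.θ_lt_one])
  have hs1 : √P.θ < 1 := by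
    rw [Real.sqrt_lt' one_pos]; simpa using P.θ_lt_one
  have hτ0 : 0 < τ := hθ.trans hτ1
  have hτs : τ ^ 2 < P.θ := by
    have := Real.sq_sqrt hθ.le
    nlinarith [Real.sqrt_nonneg P.θ]
  obtain ⟨E, hE0, hE⟩ := geometric_decay_perturbed (a := fun k => ‖u k‖)
    (η := fun k => C * ‖u (k + 1)‖ / P.d) (D := 0) hθ hτ1 (hτ2.trans hs1) le_rfl
    (fun k => norm_nonneg _) ⟨A, huA⟩
    (by simpa using (((tendsto_add_atTop_iff_nat 1).mpr hu.norm).const_mul C).div_const P.d)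
    fun k => by
      rw [zero_mul]
      refine P.recursion_le ((hq k).trans (le_of_eq ?_))
      field_simp; ring
  refine geometric_decay_exact (κ := τ ^ 2) (D := C * E ^ 2 / P.d) (by positivity) hτs P.θ_lt_one
    (by positivity) (fun k => norm_nonneg _) ⟨A, huA⟩ fun k => ?_
  have := P.recursion_le (w := u (k + 1)) (p := u (k + 2)) (m := u k) (η := 0)
    (e := C * E ^ 2 / P.d * (τ ^ 2) ^ (k + 1)) ((hq k).trans ?_)
  · simpa using this
  · have h1 := hE (k + 1)
    calc C * ‖u (k + 1)‖ * ‖u (k + 1)‖ ≤ C * (E * τ ^ (k + 1)) * (E * τ ^ (k + 1)) := by gcongr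
      _ = _ := by field_simp; ring

/-- A neighbourhood of zero in which the recursion is uniformly hyperbolic. -/
theorem exists_small : ∃ τ ε : ℝ, P.θ < τ ∧ τ < 1 ∧ 0 < ε ∧
    (∀ u u' p p' m m' : X ℝ M, ‖u‖ ≤ ε → ‖u'‖ ≤ ε → P.d • (p + m) = P.H u →
      P.d • (p' + m') = P.H u' → (τ + τ⁻¹) * ‖u - u'‖ ≤ ‖p - p'‖ + ‖m - m'‖) ∧
    ∀ u : X ℝ M, ‖u‖ ≤ ε → ∀ w : X ℝ M, (τ + τ⁻¹) * P.d * ‖w‖ ≤ ‖P.B ℝ u w‖ := by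
  have hd := P.d_pos
  obtain ⟨τ, hτ1, hτ2⟩ := exists_between P.θ_lt_one
  have hgap := sub_pos.mpr (add_inv_lt_add_inv P.θ_pos hτ1 hτ2)
  obtain ⟨C, hC0, hC⟩ := P.exists_H_taylor M 1
  obtain ⟨C', hC0', hC'⟩ := P.exists_B_lipschitz ℝ M 1
  set δ := P.θ + P.θ⁻¹ - (τ + τ⁻¹)
  refine ⟨τ, min 1 (min (P.d * δ / (2 * C)) (P.d * δ / C')), hτ1, hτ2, by positivity, ?_, ?_⟩
  · intro u u' p p' m m' hu hu' h h'
    rw [le_min_iff, le_min_iff, le_div_iff₀ (by positivity)] at hu hu'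
    have h1 := hC u u' 0 hu.1 hu'.1 (by simp)
    have h2 := P.recursion_le (w := u - u') (p := p - p') (m := m - m') (η := δ) (e := 0) (by
      have h3 : (P.d : ℝ) • ((p - p') + (m - m')) = P.H u - P.H u' := by
        rw [← h, ← h', ← smul_sub]; congr 1; abel
      simp only [RCLike.ofReal_real_eq_id, id]
      rw [h3]
      refine h1.trans ?_
      rw [sub_zero, sub_zero, add_zero, ← mul_assoc]
      refine mul_le_mul_of_nonneg_right ?_ (norm_nonneg _)
      nlinarith [hu.2.1, hu'.2.1])
    simpa [δ] using h2
  · intro u hu w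
    rw [le_min_iff, le_min_iff, le_div_iff₀ hC0'] at hu
    have h1 := hC' u 0 hu.1 (by simp)
    rw [sub_zero] at h1
    have h2 := (P.B ℝ u - P.B ℝ 0).le_of_opNorm_le h1 w
    have h3 := P.norm_B_zero_ge w
    have h4 : ‖P.B ℝ 0 w‖ ≤ ‖P.B ℝ u w‖ + ‖(P.B ℝ u - P.B ℝ 0 : X ℝ M →L[ℝ] X ℝ M) w‖ := by
      rw [sub_apply]; exact norm_le_norm_add_norm_sub _ _
    have h5 : C' * ‖u‖ * ‖w‖ ≤ P.d * δ * ‖w‖ :=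
      mul_le_mul_of_nonneg_right (by linarith [hu.2.2]) (norm_nonneg _)
    simp only [δ] at h5
    linarith

end HypChain

/-! ### Bounded solutions and tangent spaces of the stable manifold -/

/-- The implicit function theorem for a one-parameter family of equations. -/
theorem exists_implicit_curve {E F : Type*} [NormedAddCommGroup E] [NormedSpace ℝ E]
    [CompleteSpace E] [NormedAddCommGroup F] [NormedSpace ℝ F] [CompleteSpace F]
    {Ψ : ℝ × E → F} {Ψ' : ℝ × E →L[ℝ] F} {s₀ : ℝ} {v₀ : E}
    (h : HasStrictFDerivAt Ψ Ψ' (s₀, v₀)) (hb : Function.Bijective fun v : E => Ψ' (0, v)) :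
    ∃ (ψ : ℝ → E) (ψ' : E), ψ s₀ = v₀ ∧ HasDerivAt ψ ψ' s₀ ∧ Ψ' (1, ψ') = 0 ∧
      (∀ᶠ s in 𝓝 s₀, Ψ (s, ψ s) = Ψ (s₀, v₀)) ∧
      ∀ᶠ z in 𝓝 (s₀, v₀), Ψ z = Ψ (s₀, v₀) ↔ ψ z.1 = z.2 := by
  have hinv : (Ψ' ∘L .inr ℝ ℝ E).IsInvertible :=
    ⟨ContinuousLinearEquiv.ofBijective (Ψ' ∘L .inr ℝ ℝ E) (LinearMap.ker_eq_bot.mpr hb.1)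
      (LinearMap.range_eq_top.mpr hb.2), ContinuousLinearEquiv.coe_ofBijective _ _ _⟩
  have hev := h.eventually_apply_eq_iff_implicitFunctionOfProdDomain hinv
  have hd := (h.hasStrictFDerivAt_implicitFunctionOfProdDomain hinv).hasFDerivAt.hasDerivAt
  refine ⟨_, _, hev.self_of_nhds.mp rfl, hd, ?_,
    h.eventually_apply_implicitFunctionOfProdDomain hinv, hev⟩
  set y := Ψ' (1, 0) with hy
  have h2 : ∀ v, Ψ' (1, v) = y + (Ψ' ∘L .inr ℝ ℝ E) v := fun v => by
    rw [hy, ContinuousLinearMap.comp_apply, ContinuousLinearMap.inr_apply, ← map_add]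
    simp
  rw [h2]
  change y + (Ψ' ∘L .inr ℝ ℝ E) (-((Ψ' ∘L .inr ℝ ℝ E).inverse y)) = 0
  rw [map_neg, hinv.self_apply_inverse, add_neg_cancel]

theorem stableTangent_mono {E : Type*} [NormedAddCommGroup E] [NormedSpace ℝ E] (G : E ≃ E)
    {S S' : Set E} (h : S ⊆ S') (p : E) : stableTangent G S p ⊆ stableTangent G S' p := by
  rintro v ⟨γ, h0, h1, η, hη, h2, h3⟩
  exact ⟨γ, h0, h1, η, hη, fun s hs => ⟨h (h2 s hs).1, (h2 s hs).2⟩, h3⟩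

theorem map_mem_stableTangent {E : Type*} [NormedAddCommGroup E] [NormedSpace ℝ E] {G G' : E ≃ E}
    (c : E →L[ℝ] E) (hc : ∀ x, G' (c x) = c (G x)) {p v : E}
    (hv : v ∈ stableTangent G Set.univ p) : c v ∈ stableTangent G' Set.univ (c p) := by
  obtain ⟨γ, h0, h1, η, hη, h2, h3⟩ := hv
  have hit : ∀ n x, G'^[n] (c x) = c (G^[n] x) := fun n x => by
    have : Function.Semiconj c G G' := fun x => (hc x).symm
    exact ((this.iterate_right n) x).symm
  refine ⟨fun s => c (γ s), congrArg c h0, c.hasFDerivAt.comp_hasDerivAt 0 h1, η, hη,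
    fun s hs => ⟨trivial, ?_⟩, ?_⟩
  · simp only [hit]
    have := (c.continuous.tendsto 0).comp (h2 s hs).2
    simpa [Function.comp_def] using this
  · simp only [hit]
    have := c.uniformContinuous.comp_tendstoUniformlyOn h3
    simpa [Function.comp_def] using this

/-- Exchange of the two components of a point of the phase space; it conjugates the spatial dynamics
map to its inverse. -/
def swapL (M : ℕ) : (X ℝ M × X ℝ M) →L[ℝ] (X ℝ M × X ℝ M) :=
  (ContinuousLinearMap.snd ℝ _ _).prod (ContinuousLinearMap.fst ℝ _ _)

@[simp] theorem swapL_apply {M : ℕ} (p : X ℝ M × X ℝ M) : swapL M p = (p.2, p.1) := rfl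

theorem F_symm_swap (V : ℝ → ℝ) (d T : ℝ) {M : ℕ} (p : X ℝ M × X ℝ M) :
    (F V d T).symm (swapL M p) = swapL M (F V d T p) := rfl

theorem F_swap (V : ℝ → ℝ) (d T : ℝ) {M : ℕ} (p : X ℝ M × X ℝ M) :
    F V d T (swapL M p) = swapL M ((F V d T).symm p) := rfl

namespace Chain

variable (P : Chain) {M : ℕ}

/-- The spatial dynamics map `F_M`. -/
noncomputable def map (M : ℕ) : (X ℝ M × X ℝ M) ≃ (X ℝ M × X ℝ M) := F P.V P.d P.T

theorem map_apply (p : X ℝ M × X ℝ M) : P.map M p = ((1 / P.d) • P.H p.1 - p.2, p.1) := by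
  have hd := P.d_pos.ne'
  have := (P.F_pair_iff p.2 p.1 ((1 / P.d) • P.H p.1 - p.2)).mpr (by
    rw [sub_add_cancel, smul_smul, mul_one_div_cancel hd, one_smul])
  exact this.symm

/-- The solution `(y_k)` of the stationary equation with `(y_1, y_0) = p`. -/
noncomputable def orb (p : X ℝ M × X ℝ M) (k : ℕ) : X ℝ M := ((P.map M)^[k] p).2

theorem iterate_map (p : X ℝ M × X ℝ M) (k : ℕ) :
    (P.map M)^[k] p = (P.orb p (k + 1), P.orb p k) := by
  rw [orb, orb, Function.iterate_succ_apply', map_apply]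

theorem orb_eq (p : X ℝ M × X ℝ M) (k : ℕ) :
    P.d • (P.orb p (k + 2) + P.orb p k) = P.H (P.orb p (k + 1)) := by
  rw [← F_pair_iff]
  have := P.iterate_map p (k + 1)
  rw [Function.iterate_succ_apply', iterate_map] at this
  exact this.symm

theorem iterate_eq_of_recursion {y : ℕ → X ℝ M}
    (h : ∀ k, P.d • (y (k + 2) + y k) = P.H (y (k + 1))) (k : ℕ) :
    (P.map M)^[k] (y 1, y 0) = (y (k + 1), y k) := by
  induction k with
  | zero => rfl
  | succ k ih =>
    rw [Function.iterate_succ_apply', ih]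
    exact ((P.F_pair_iff _ _ _).mpr (h k)).symm

/-- The derivative of the spatial dynamics map. -/
noncomputable def dmap (u : X ℝ M) : (X ℝ M × X ℝ M) →L[ℝ] (X ℝ M × X ℝ M) :=
  ((1 / P.d) • (P.B ℝ u).comp (ContinuousLinearMap.fst ℝ _ _)
    - ContinuousLinearMap.snd ℝ _ _).prod (ContinuousLinearMap.fst ℝ _ _)

theorem dmap_apply (u : X ℝ M) (v : X ℝ M × X ℝ M) :
    P.dmap u v = ((1 / P.d) • P.B ℝ u v.1 - v.2, v.1) := rfl

theorem hasFDerivAt_map (p : X ℝ M × X ℝ M) : HasFDerivAt (P.map M) (P.dmap p.1) p := by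
  have h1 : HasFDerivAt (fun p : X ℝ M × X ℝ M => ((1 / P.d) • P.H p.1 - p.2, p.1))
      (P.dmap p.1) p := by
    have hf : HasFDerivAt (fun p : X ℝ M × X ℝ M => p.1) (ContinuousLinearMap.fst ℝ _ _) p :=
      hasFDerivAt_fst
    exact ((((P.hasFDerivAt_H p.1).comp p hf).const_smul (1 / P.d)).sub hasFDerivAt_snd).prodMk hf
  exact h1.congr_of_eventuallyEq (Eventually.of_forall fun p => P.map_apply p)

theorem hasFDerivAt_map_symm (p : X ℝ M × X ℝ M) :
    HasFDerivAt (P.map M).symm ((swapL M).comp ((P.dmap p.2).comp (swapL M))) p := by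
  have h := (swapL M).hasFDerivAt.comp p ((P.hasFDerivAt_map (swapL M p)).comp p
    (swapL M).hasFDerivAt)
  exact h

/-- If the derivative of the spatial dynamics map takes a vector to a stable tangent vector, then
the vector is tangent to the stable manifold. -/
theorem mem_stableTangent_of_dmap {p v : X ℝ M × X ℝ M}
    (h : P.dmap p.1 v ∈ stableTangent (P.map M) Set.univ (P.map M p)) :
    v ∈ stableTangent (P.map M) Set.univ p := by
  obtain ⟨γ, h0, h1, η, hη, h2, h3⟩ := h
  have hit : ∀ n x, (P.map M)^[n + 1] ((P.map M).symm x) = (P.map M)^[n] x := fun n x => by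
    rw [Function.iterate_succ_apply, Equiv.apply_symm_apply]
  refine ⟨fun s => (P.map M).symm (γ s), by simp [h0], ?_, η, hη, fun s hs => ⟨trivial, ?_⟩, ?_⟩
  · have h4 := P.hasFDerivAt_map_symm (γ 0)
    have h5 : HasDerivAt (fun s => (P.map M).symm (γ s)) _ 0 := h4.comp_hasDerivAt 0 h1
    have h6 : ((swapL M).comp ((P.dmap (γ 0).2).comp (swapL M))) (P.dmap p.1 v) = v := by
      rw [h0, map_apply]
      simp only [ContinuousLinearMap.comp_apply, dmap_apply, swapL_apply]
      ext1 <;> simp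
    rwa [h6] at h5
  · rw [← tendsto_add_atTop_iff_nat 1]
    simpa only [hit] using (h2 s hs).2
  · rw [Metric.tendstoUniformlyOn_iff] at h3 ⊢
    intro ε hε
    obtain ⟨N, hN⟩ := eventually_atTop.mp (h3 ε hε)
    refine eventually_atTop.mpr ⟨N + 1, fun n hn s hs => ?_⟩
    obtain ⟨m, rfl⟩ := Nat.exists_eq_add_of_le' (show 1 ≤ n by omega)
    rw [hit]
    exact hN m (by omega) s hs

end Chain

/-- A bounded forward solution `w` of the linearization about `(x_k)`, the position of `x_k` being
that of `w_{k+1}`. -/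
structure Chain.IsForward (P : Chain) {M : ℕ} (x w : ℕ → X ℝ M) : Prop where
  eq : ∀ k, P.d • (w (k + 2) + w k) = P.B ℝ (x k) (w (k + 1))
  bdd : ∃ b, ∀ k, ‖w k‖ ≤ b

namespace HypChain

variable {M : ℕ} (P : HypChain M)

/-- The vectors tangent to the stable manifold give rise to bounded solutions of the linearization:
far out the difference quotients of the orbits on the manifold are nonincreasing. -/
theorem exists_forward_of_mem_stableTangent {p v : X ℝ M × X ℝ M}
    (hv : v ∈ stableTangent (P.map M) Set.univ p) :
    ∃ w : ℕ → X ℝ M, w 0 = v.2 ∧ w 1 = v.1 ∧ P.IsForward (fun k => P.orb p (k + 1)) w := by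
  obtain ⟨γ, h0, h1, η, hη, -, h3⟩ := hv
  obtain ⟨τ, ε, hτ1, hτ2, hε, hsm, -⟩ := P.exists_small
  have hτ0 := P.θ_pos.trans hτ1
  set W : ℕ → X ℝ M × X ℝ M := fun k => Nat.rec v (fun k z => P.dmap (P.orb p (k + 1)) z) k with hW
  have hWs : ∀ k, W (k + 1) = P.dmap (P.orb p (k + 1)) (W k) := fun k => rfl
  have hder : ∀ k, HasDerivAt (fun s => (P.map M)^[k] (γ s)) (W k) 0 := by
    intro k
    induction k with
    | zero => exact h1
    | succ k ih =>
      have h4 := (P.hasFDerivAt_map ((P.map M)^[k] (γ 0))).comp_hasDerivAt 0 ih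
      rw [h0, P.iterate_map] at h4
      refine h4.congr_of_eventuallyEq (Eventually.of_forall fun s => ?_)
      exact Function.iterate_succ_apply' _ _ _
  have hder2 : ∀ k, HasDerivAt (fun s => P.orb (γ s) k) (W k).2 0 := fun k =>
    (ContinuousLinearMap.snd ℝ (X ℝ M) (X ℝ M)).hasFDerivAt.comp_hasDerivAt 0 (hder k)
  obtain ⟨n₀, hn₀⟩ := eventually_atTop.mp ((Metric.tendstoUniformlyOn_iff.mp h3) ε hε)
  have hsmall : ∀ k ≥ n₀, ∀ s ∈ Set.Ioo (-η) η, ‖P.orb (γ s) k‖ ≤ ε := by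
    intro k hk s hs
    have := hn₀ k hk s hs
    rw [dist_comm, dist_zero_right] at this
    exact (norm_snd_le _).trans this.le
  have hmem0 : (0 : ℝ) ∈ Set.Ioo (-η) η := ⟨by linarith, hη⟩
  have hmono : ∀ s ∈ Set.Ioo (-η) η, ∀ k,
      ‖P.orb (γ s) (n₀ + k) - P.orb (γ 0) (n₀ + k)‖ ≤ ‖P.orb (γ s) n₀ - P.orb (γ 0) n₀‖ := by
    intro s hs k
    have := geometric_decay (a := fun k => ‖P.orb (γ s) (n₀ + k) - P.orb (γ 0) (n₀ + k)‖) hτ0 hτ2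
      (fun k => norm_nonneg _) ⟨ε + ε, fun k => (norm_sub_le _ _).trans
        (add_le_add (hsmall _ (by omega) s hs) (hsmall _ (by omega) 0 hmem0))⟩ (fun k =>
        hsm _ _ _ _ _ _ (hsmall _ (by omega) s hs) (hsmall _ (by omega) 0 hmem0)
          (P.orb_eq (γ s) (n₀ + k)) (P.orb_eq (γ 0) (n₀ + k))) k
    refine this.trans ?_
    exact mul_le_of_le_one_right (norm_nonneg _) (pow_le_one₀ hτ0.le hτ2.le)
  have hWmono : ∀ k, ‖(W (n₀ + k)).2‖ ≤ ‖(W n₀).2‖ := by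
    intro k
    have ha := ((hder2 (n₀ + k)).tendsto_slope_zero).norm
    have hb := ((hder2 n₀).tendsto_slope_zero).norm
    refine le_of_tendsto_of_tendsto ha hb ?_
    have : Set.Ioo (-η) η ∈ 𝓝 (0 : ℝ) := Ioo_mem_nhds (by linarith) hη
    filter_upwards [nhdsWithin_le_nhds this] with s hs
    rw [norm_smul, norm_smul, zero_add]
    exact mul_le_mul_of_nonneg_left (hmono s hs k) (norm_nonneg _)
  refine ⟨fun k => (W k).2, rfl, by simp [W, Chain.dmap_apply], fun k => ?_, ?_⟩
  · have h5 : (W (k + 2)).2 = (1 / P.d) • P.B ℝ (P.orb p (k + 1)) (W (k + 1)).2 - (W k).2 := by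
      rw [hWs (k + 1), Chain.dmap_apply, hWs k, Chain.dmap_apply]
    rw [h5, sub_add_cancel, smul_smul, mul_one_div_cancel P.d_pos.ne', one_smul]
  · refine ⟨∑ j ∈ Finset.range (n₀ + 1), ‖(W j).2‖, fun k => ?_⟩
    have hle : ∀ j ≤ n₀, ‖(W j).2‖ ≤ ∑ j ∈ Finset.range (n₀ + 1), ‖(W j).2‖ := fun j hj =>
      Finset.single_le_sum (f := fun j => ‖(W j).2‖) (fun _ _ => norm_nonneg _)
        (Finset.mem_range.mpr (by omega))
    rcases le_total k n₀ with hk | hk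
    · exact hle k hk
    · obtain ⟨j, rfl⟩ := Nat.exists_eq_add_of_le hk
      exact (hWmono j).trans (hle n₀ le_rfl)

theorem smul_add_three {E : Type*} [AddCommGroup E] [Module ℝ E] (d s : ℝ)
    (x₂ x₀ w₂ w₀ v₂ v₀ : E) : d • (x₂ + (s • w₂ + v₂) + (x₀ + (s • w₀ + v₀)))
      = d • (x₂ + x₀) + s • (d • (w₂ + w₀)) + d • (v₂ + v₀) := by
  module

set_option maxHeartbeats 1000000 in
/-- Conversely, a bounded solution of the linearization is tangent to the stable manifold, here near
the equilibrium: the implicit function theorem in the space of bounded sequences solves for the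
correction that makes `x + s w` an orbit. -/
theorem mem_stableTangent_of_forward_of_small {τ ε : ℝ} (hτ1 : P.θ < τ) (hτ2 : τ < 1) (hε : 0 < ε)
    (hsm : ∀ u p m : X ℝ M, ‖u‖ ≤ ε → P.d • (p + m) = P.H u → (τ + τ⁻¹) * ‖u‖ ≤ ‖p‖ + ‖m‖)
    (hB : ∀ u : X ℝ M, ‖u‖ ≤ ε → ∀ w : X ℝ M, (τ + τ⁻¹) * P.d * ‖w‖ ≤ ‖P.B ℝ u w‖)
    {p : X ℝ M × X ℝ M} (hp : ∀ k, ‖P.orb p k‖ ≤ ε / 2) {w : ℕ → X ℝ M}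
    (hw : P.IsForward (fun k => P.orb p (k + 1)) w) :
    (w 1, w 0) ∈ stableTangent (P.map M) Set.univ p := by
  have hd := P.d_pos
  have hτ0 := P.θ_pos.trans hτ1
  obtain ⟨b, hb⟩ := hw.bdd
  -- The equation on the half-line is posed for sequences on `ℤ`: the nonlinear part is switched off at
  -- the sites `n ≤ 0`, where the linear operator at zero is invertible by itself.
  set Xs : ℤ → X ℝ M := fun n => if 0 ≤ n then P.orb p n.toNat else 0 with hXs
  have hXsb : ∀ n, ‖Xs n‖ ≤ ε / 2 := by
    intro n; simp only [hXs]; split_ifs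
    · exact hp _
    · rw [norm_zero]; positivity
  set Ws : Seq (X ℝ M) := mkSeq (fun n => if 0 ≤ n then w n.toNat else 0) ⟨b, fun n => by
    split_ifs
    · exact hb _
    · simpa using (norm_nonneg _).trans (hb 0)⟩ with hWs
  set φ : ℤ → X ℝ M → X ℝ M := fun n y => if 1 ≤ n then
    (P.H (Xs n + y) - P.B ℝ 0 (Xs n + y)) - (P.H (Xs n) - P.B ℝ 0 (Xs n)) else 0 with hφ
  set φ' : ℤ → X ℝ M → X ℝ M →L[ℝ] X ℝ M := fun n y => if 1 ≤ n then
    P.B ℝ (Xs n + y) - P.B ℝ 0 else 0 with hφ'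
  have hS : Superposable φ φ' := by
    refine ⟨fun R => ?_, ⟨0, fun n => ?_⟩, fun R => ?_⟩
    · obtain ⟨C, hC0, hC⟩ := P.exists_H_taylor M (ε / 2 + R)
      refine ⟨C, hC0, fun n u u' v hu hu' hv => ?_⟩
      simp only [hφ, hφ']
      split_ifs
      · have hle : ∀ y : X ℝ M, ‖y‖ ≤ R → ‖Xs n + y‖ ≤ ε / 2 + R := fun y hy =>
          (norm_add_le _ _).trans (add_le_add (hXsb n) hy)
        have := hC (Xs n + u) (Xs n + u') (Xs n + v) (hle u hu) (hle u' hu') (hle v hv)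
        simp only [add_sub_add_left_eq_sub] at this
        refine le_trans (le_of_eq (congrArg _ ?_)) this
        simp only [sub_apply, map_add, map_sub]
        abel
      · simp; positivity
    · simp only [hφ]; split_ifs <;> simp
    · obtain ⟨C, hC0, hC⟩ := P.exists_B_lipschitz ℝ M (ε / 2 + |R|)
      refine ⟨C * (ε / 2 + |R|), fun n v hv => ?_⟩
      simp only [hφ']
      split_ifs
      · have hle : ‖Xs n + v‖ ≤ ε / 2 + |R| :=
          (norm_add_le _ _).trans (add_le_add (hXsb n) (hv.trans (le_abs_self R)))
        refine (hC _ 0 hle (by simp; positivity)).trans ?_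
        rw [sub_zero]
        exact mul_le_mul_of_nonneg_left hle hC0.le
      · simp; positivity
  set B0 : Seq (X ℝ M →L[ℝ] X ℝ M) := mkSeq (fun _ => P.B ℝ 0) ⟨_, fun _ => le_rfl⟩ with hB0
  set D := mulSeq (hS.deriv 0) with hD
  set Ψ : ℝ × Seq (X ℝ M) → Seq (X ℝ M) := fun z =>
    lapL P.d B0 z.2 - hS.map (z.1 • Ws + z.2) + z.1 • D Ws with hΨ
  set A : ℝ × Seq (X ℝ M) →L[ℝ] Seq (X ℝ M) :=
    (ContinuousLinearMap.fst ℝ ℝ (Seq (X ℝ M))).smulRight Ws + ContinuousLinearMap.snd ℝ _ _ with hA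
  have hAz : ∀ z : ℝ × Seq (X ℝ M), A z = z.1 • Ws + z.2 := fun z => rfl
  set Ψ' : ℝ × Seq (X ℝ M) →L[ℝ] Seq (X ℝ M) :=
    (lapL P.d B0).comp (ContinuousLinearMap.snd ℝ _ _) - D.comp A +
      (ContinuousLinearMap.fst ℝ ℝ (Seq (X ℝ M))).smulRight (D Ws) with hΨ'
  have hstrict : HasStrictFDerivAt Ψ Ψ' (0, 0) := by
    have h1 : HasStrictFDerivAt hS.map D (A (0, 0)) := by
      rw [hAz, zero_smul, zero_add]; exact hS.hasStrictFDerivAt 0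
    have h2 := h1.comp (0, 0) A.hasStrictFDerivAt
    exact (((lapL P.d B0).comp (ContinuousLinearMap.snd ℝ ℝ _)).hasStrictFDerivAt.sub h2).add
      ((ContinuousLinearMap.fst ℝ ℝ (Seq (X ℝ M))).smulRight (D Ws)).hasStrictFDerivAt
  set Bs : Seq (X ℝ M →L[ℝ] X ℝ M) := B0 + hS.deriv 0 with hBs
  have hinr : Ψ' ∘L .inr ℝ ℝ (Seq (X ℝ M)) = lapL P.d Bs := by
    ext1 v
    ext1 n
    simp [hΨ', hA, hBs, hD]
    abel
  have hbij : Function.Bijective fun v : Seq (X ℝ M) => Ψ' (0, v) := by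
    have h1 : (fun v : Seq (X ℝ M) => Ψ' (0, v)) = lapL P.d Bs :=
      funext fun v => congrArg (fun A : Seq (X ℝ M) →L[ℝ] Seq (X ℝ M) => A v) hinr
    rw [h1]
    refine lapL_bijective (γ := (τ + τ⁻¹) * P.d) hd
      (by have := mul_lt_mul_of_pos_right (two_lt_add_inv hτ0 hτ2) hd; linarith) fun n y => ?_
    have : Bs n = if 1 ≤ n then P.B ℝ (Xs n) else P.B ℝ 0 := by
      simp only [hBs, hB0, BoundedContinuousFunction.coe_add, Pi.add_apply, mkSeq_apply,
        Superposable.deriv_apply, hφ', BoundedContinuousFunction.coe_zero, Pi.zero_apply, add_zero]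
      split_ifs <;> simp
    rw [this]
    split_ifs
    · exact hB _ ((hXsb n).trans (by linarith)) y
    · exact hB 0 (by simp [hε.le]) y
  have hΨ0 : Ψ (0, 0) = 0 := by
    ext1 n
    simp only [hΨ, zero_smul, add_zero, map_zero, zero_sub]
    simp [hφ]
  obtain ⟨ψ, ψ', hψ0, hψd, hψ', hev, -⟩ := exists_implicit_curve hstrict hbij
  have hψ'0 : ψ' = 0 := by
    refine hbij.1 ?_
    have h1 : Ψ' (1, 0) = 0 := by simp [hΨ', hA]
    have h2 : Ψ' (1, ψ') = Ψ' (1, 0) + Ψ' (0, ψ') := by rw [← map_add]; simp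
    change Ψ' (0, ψ') = Ψ' (0, 0)
    rw [Prod.mk_zero_zero, map_zero]
    rw [hψ', h1, zero_add] at h2
    exact h2.symm
  rw [hψ'0] at hψd
  have hcont : Tendsto (fun s => s • Ws + ψ s) (𝓝 0) (𝓝 0) := by
    have h1 : Tendsto (fun s : ℝ => s • Ws) (𝓝 0) (𝓝 0) := by
      have : Continuous fun s : ℝ => s • Ws := by fun_prop
      simpa using this.tendsto 0
    have h2 := hψd.continuousAt.tendsto
    rw [hψ0] at h2
    simpa using h1.add h2
  have hsmall : ∀ᶠ s in 𝓝 (0 : ℝ), ‖s • Ws + ψ s‖ < ε / 2 := by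
    have := hcont.norm
    rw [norm_zero] at this
    exact this.eventually (gt_mem_nhds (by positivity))
  obtain ⟨η, hη, hηs⟩ := Metric.eventually_nhds_iff.mp (hsmall.and hev)
  -- At the sites `n ≥ 1`, the curve `ψ` solves the equation for a correction of `x + s w`; small orbits
  -- decay, so that these lie on the stable manifold.
  set y : ℝ → ℕ → X ℝ M := fun s k => P.orb p k + (s • Ws + ψ s) k with hy
  have hmem : ∀ s ∈ Set.Ioo (-η) η, dist s 0 < η := fun s hs => by
    rw [Real.dist_eq, sub_zero, abs_lt]; exact hs
  have hyε : ∀ s ∈ Set.Ioo (-η) η, ∀ k, ‖y s k‖ ≤ ε := fun s hs k => by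
    have h1 := (hηs (hmem s hs)).1.le
    have h2 := (s • Ws + ψ s).norm_apply_le k
    refine (norm_add_le _ _).trans ?_
    linarith [hp k]
  have hyeq : ∀ s ∈ Set.Ioo (-η) η, ∀ k, P.d • (y s (k + 2) + y s k) = P.H (y s (k + 1)) := by
    intro s hs k
    have h1 := (hηs (hmem s hs)).2
    rw [hΨ0] at h1
    have h2 := congrArg (fun v : Seq (X ℝ M) => v ((k : ℤ) + 1)) h1
    have hk0 : (0 : ℤ) ≤ (k : ℤ) + 1 := by omega
    have hk1 : (1 : ℤ) ≤ (k : ℤ) + 1 := by omega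
    have hk2 : ((k : ℤ) + 1).toNat = k + 1 := by omega
    have hXk : Xs ((k : ℤ) + 1) = P.orb p (k + 1) := by simp only [hXs, hk0, if_true, hk2]
    have hWk : ∀ j : ℕ, Ws (j : ℤ) = w j := fun j => by simp [hWs]
    have hWk1 : Ws ((k : ℤ) + 1) = w (k + 1) := by exact_mod_cast hWk (k + 1)
    simp only [hΨ, hD, BoundedContinuousFunction.coe_add, BoundedContinuousFunction.coe_sub,
      BoundedContinuousFunction.coe_smul, Pi.add_apply, Pi.sub_apply, Superposable.map_apply,
      lapL_apply, mulSeq_apply, Superposable.deriv_apply, hφ, hφ', hk1, if_true, hXk, hB0,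
      mkSeq_apply, BoundedContinuousFunction.coe_zero, Pi.zero_apply, add_zero, hWk1,
      RCLike.ofReal_real_eq_id, id, sub_apply] at h2
    have h3 := P.orb_eq p k
    have h4 := hw.eq k
    have e2 : (k : ℤ) + 1 + 1 = ((k + 2 : ℕ) : ℤ) := by push_cast; ring
    have e0 : (k : ℤ) + 1 - 1 = (k : ℤ) := by ring
    rw [e2, e0] at h2
    simp only [hy, BoundedContinuousFunction.coe_add, BoundedContinuousFunction.coe_smul,
      Pi.add_apply, hWk, Nat.cast_add, Nat.cast_one] at h2 ⊢
    rw [smul_add_three, h3, h4, ← sub_eq_zero, ← h2]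
    simp only [map_add, map_smul]
    generalize P.B ℝ (P.orb p (k + 1)) (w (k + 1)) = z₁
    generalize P.B ℝ 0 (P.orb p (k + 1)) = z₂
    generalize P.B ℝ 0 (w (k + 1)) = z₃
    generalize P.B ℝ 0 (ψ s ((k : ℤ) + 1)) = z₄
    generalize ψ s ((k : ℤ) + (2 : ℕ)) = z₅
    generalize ψ s (k : ℤ) = z₆
    generalize P.H (P.orb p (k + 1)) = z₇
    generalize P.H (P.orb p (k + 1) + (s • w (k + 1) + ψ s ((k : ℤ) + 1))) = z₈
    module
  have h0mem : (0 : ℝ) ∈ Set.Ioo (-η) η := ⟨by linarith, hη⟩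
  have hdec : ∀ s ∈ Set.Ioo (-η) η, ∀ k, ‖y s k‖ ≤ ε * τ ^ k := fun s hs k => by
    have := geometric_decay (a := fun k => ‖y s k‖) hτ0 hτ2 (fun k => norm_nonneg _)
      ⟨ε, hyε s hs⟩ (fun k => hsm _ _ _ (hyε s hs _) (hyeq s hs k)) k
    exact this.trans (mul_le_mul_of_nonneg_right (hyε s hs 0) (by positivity))
  have hτlim : Tendsto (fun k : ℕ => ε * τ ^ k) atTop (𝓝 0) := by
    simpa using (tendsto_pow_atTop_nhds_zero_of_lt_one hτ0.le hτ2).const_mul ε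
  have hit : ∀ s ∈ Set.Ioo (-η) η, ∀ k, ‖(P.map M)^[k] (y s 1, y s 0)‖ ≤ ε * τ ^ k := by
    intro s hs k
    rw [P.iterate_eq_of_recursion (hyeq s hs), Prod.norm_def]
    refine max_le ((hdec s hs (k + 1)).trans ?_) (hdec s hs k)
    exact mul_le_mul_of_nonneg_left (pow_le_pow_of_le_one hτ0.le hτ2.le (by omega)) hε.le
  refine ⟨fun s => (y s 1, y s 0), ?_, ?_, η, hη, fun s hs => ⟨trivial, ?_⟩, ?_⟩
  · have h8 : ∀ k, y 0 k = P.orb p k := fun k => by simp [hy, hψ0]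
    simp only [h8]
    exact (P.iterate_map p 0).symm
  · have h9 : ∀ k : ℕ, HasDerivAt (fun s => y s k) (w k) 0 := by
      intro k
      have h10 : HasDerivAt (fun s => s • Ws + ψ s) (Ws + 0) 0 := by
        refine HasDerivAt.add ?_ hψd
        simpa using (hasDerivAt_id (0 : ℝ)).smul_const Ws
      have h11 := (BoundedContinuousFunction.evalCLM ℝ (k : ℤ)).hasFDerivAt.comp_hasDerivAt 0 h10
      have h12 : (BoundedContinuousFunction.evalCLM ℝ (k : ℤ)) (Ws + 0) = w k := by
        simp [hWs]
      rw [h12] at h11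
      exact h11.const_add (P.orb p k)
    exact (h9 1).prodMk (h9 0)
  · exact squeeze_zero_norm (hit s hs) hτlim
  · rw [Metric.tendstoUniformlyOn_iff]
    intro δ hδ
    filter_upwards [hτlim.eventually (gt_mem_nhds hδ)] with k hk s hs
    rw [dist_comm, dist_zero_right]
    exact (hit s hs k).trans_lt hk

/-- The tangent vectors of the stable manifold are the initial data of bounded solutions of the
linearization. -/
theorem mem_stableTangent_of_forward {p : X ℝ M × X ℝ M}
    (hp : Tendsto (fun n => (P.map M)^[n] p) atTop (𝓝 0)) {w : ℕ → X ℝ M}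
    (hw : P.IsForward (fun k => P.orb p (k + 1)) w) :
    (w 1, w 0) ∈ stableTangent (P.map M) Set.univ p := by
  obtain ⟨τ, ε, hτ1, hτ2, hε, hsm, hB⟩ := P.exists_small
  have horb : Tendsto (P.orb p) atTop (𝓝 0) := (continuous_snd.tendsto _).comp hp
  have hn : ∀ᶠ k in atTop, ‖P.orb p k‖ < ε / 2 := by
    have := horb.norm
    rw [norm_zero] at this
    exact this.eventually (gt_mem_nhds (by positivity))
  obtain ⟨n₀, hn₀⟩ := eventually_atTop.mp hn
  clear hn hp horb
  induction n₀ generalizing p w with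
  | zero =>
    refine P.mem_stableTangent_of_forward_of_small hτ1 hτ2 hε (fun u p m hu h => ?_) hB
      (fun k => (hn₀ k (by omega)).le) hw
    have := hsm u 0 p 0 m 0 hu (by simp [hε.le]) h (by simp [P.H_zero])
    simpa using this
  | succ n₀ ih =>
    have h1 : P.IsForward (fun k => P.orb (P.map M p) (k + 1)) fun k => w (k + 1) :=
      ⟨fun k => hw.eq (k + 1), hw.bdd.imp fun b hb k => hb _⟩
    have h2 := ih h1 fun k hk => hn₀ (k + 1) (by omega)
    refine P.mem_stableTangent_of_dmap ?_
    convert h2 using 1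
    have h3 := hw.eq 0
    have h4 : P.orb p 1 = p.1 := by
      have := P.iterate_map p 0
      exact (congrArg Prod.fst this).symm
    simp only [zero_add] at h3 ⊢
    rw [Chain.dmap_apply]
    simp only
    rw [← h4, ← h3, smul_smul, one_div_mul_cancel P.d_pos.ne', one_smul, add_sub_cancel_right]

end HypChain

/-! ### The kernel of the linearization about the breather -/

theorem eq_zero_of_odd_of_dt_eq_zero {M : ℕ} {T : ℝ} (hT : 0 < T) {u : X ℝ M}
    (h1 : refl ℝ u = -u) (h2 : dt T u = 0) : u = 0 := by
  ext k
  rcases k with k | k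
  · have := congrArg (fun v : X ℝ M => v (Sum.inl k)) h1
    simp at this ⊢
    linarith
  · have := congrArg (fun v : X ℝ M => v (Sum.inl k.succ)) h2
    simp [dt] at this ⊢
    rcases this with h | h
    · have h3 : (0 : ℝ) < (k : ℕ) + 1 := by positivity
      rcases h with h | h
      · linarith
      · linarith
    · exact h

/-- Both half-lines together give a bound on the whole line. -/
theorem exists_natAbs_bound {E : Type*} [NormedAddCommGroup E] {w : ℤ → E} {τ : ℝ} (h0 : 0 < τ)
    (h1 : ∃ C, 0 ≤ C ∧ ∀ k : ℕ, ‖w (k - 1)‖ ≤ C * τ ^ k)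
    (h2 : ∃ C, 0 ≤ C ∧ ∀ k : ℕ, ‖w (-k)‖ ≤ C * τ ^ k) :
    ∃ C, 0 ≤ C ∧ ∀ n : ℤ, ‖w n‖ ≤ C * τ ^ n.natAbs := by
  obtain ⟨C, hC0, hC⟩ := h1
  obtain ⟨D, hD0, hD⟩ := h2
  refine ⟨C * τ + D, by positivity, fun n => ?_⟩
  rcases Int.eq_nat_or_neg n with ⟨k, rfl | rfl⟩
  · have := hC (k + 1)
    simp only [Nat.cast_add, Nat.cast_one, add_sub_cancel_right] at this
    refine this.trans ?_
    rw [Int.natAbs_natCast, add_mul, pow_succ']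
    have : 0 ≤ D * τ ^ k := by positivity
    linarith
  · refine (hD k).trans ?_
    rw [Int.natAbs_neg, Int.natAbs_natCast, add_mul]
    have : 0 ≤ C * τ * τ ^ k := by positivity
    linarith

namespace Chain

variable (P : Chain) {M : ℕ}

theorem IsForward.add {P : Chain} {x w w' : ℕ → X ℝ M} (h : P.IsForward x w)
    (h' : P.IsForward x w') : P.IsForward x fun k => w k + w' k := by
  obtain ⟨b, hb⟩ := h.bdd
  obtain ⟨b', hb'⟩ := h'.bdd
  refine ⟨fun k => ?_, b + b', fun k => (norm_add_le _ _).trans (add_le_add (hb k) (hb' k))⟩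
  rw [map_add, ← h.eq, ← h'.eq]
  module

theorem IsForward.refl {P : Chain} {x w : ℕ → X ℝ M} (h : P.IsForward x w)
    (hx : ∀ k, refl ℝ (x k) = x k) : P.IsForward x fun k => refl ℝ (w k) := by
  obtain ⟨b, hb⟩ := h.bdd
  refine ⟨fun k => ?_, b, fun k => by rw [norm_refl]; exact hb k⟩
  rw [← map_add, ← map_smul, h.eq, ← P.B_refl, hx]

theorem IsForward.dt {P : Chain} {x w : ℕ → X ℝ M} (h : P.IsForward x w)
    (hx : ∀ k, dt P.T (x k) = 0) : P.IsForward x fun k => dt P.T (w k) := by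
  obtain ⟨b, hb⟩ := h.bdd
  refine ⟨fun k => ?_, ‖dtL ℝ (M := M) P.T‖ * b, fun k => ?_⟩
  · rw [P.B_dt_of_dt_eq_zero (hx k), ← h.eq]
    simp only [← dtL_apply, map_add, map_smul]
  · rw [← dtL_apply]
    exact (dtL ℝ P.T).le_of_opNorm_le_of_le le_rfl (hb k)

/-- The symplectic form is invariant under the linearization, hence vanishes on pairs of decaying
solutions. -/
theorem IsForward.symplectic {P : Chain} {x w w' : ℕ → X ℝ M} (h : P.IsForward x w)
    (h' : P.IsForward x w') (h0 : Tendsto w atTop (𝓝 0)) :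
    dotp (w 1) (w' 0) - dotp (w 0) (w' 1) = 0 := by
  have hinv : ∀ k, P.d * (dotp (w (k + 1)) (w' k) - dotp (w k) (w' (k + 1)))
      = P.d * (dotp (w 1) (w' 0) - dotp (w 0) (w' 1)) := by
    intro k
    induction k with
    | zero => rfl
    | succ k ih =>
      rw [← ih]
      have h1 := congrArg (fun v => dotp v (w' (k + 1))) (h.eq k)
      have h2 := congrArg (fun v => dotp (w (k + 1)) v) (h'.eq k)
      have h3 : dotp (P.B ℝ (x k) (w (k + 1))) (w' (k + 1))
          = dotp (w (k + 1)) (P.B ℝ (x k) (w' (k + 1))) := P.dotp_B _ _ _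
      simp only [dotp_smul_left, dotp_smul_right, dotp_add_left, dotp_add_right,
        RCLike.ofReal_real_eq_id, id] at h1 h2
      rw [h3, ← h2] at h1
      linarith
  obtain ⟨b, hb⟩ := h'.bdd
  have hlim : Tendsto (fun k => P.d * (dotp (w (k + 1)) (w' k) - dotp (w k) (w' (k + 1)))) atTop
      (𝓝 0) := by
    have h1 : Tendsto (fun k => P.d * (‖w (k + 1)‖ * b + ‖w k‖ * b)) atTop (𝓝 0) := by
      have h2 := h0.norm
      have h3 := (tendsto_add_atTop_iff_nat 1).mpr h2
      simpa using ((h3.mul_const b).add (h2.mul_const b)).const_mul P.d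
    refine squeeze_zero_norm (fun k => ?_) h1
    rw [norm_mul, Real.norm_of_nonneg P.d_pos.le]
    refine mul_le_mul_of_nonneg_left ((norm_sub_le _ _).trans (add_le_add ?_ ?_)) P.d_pos.le
    · exact (norm_dotp_le _ _).trans (mul_le_mul_of_nonneg_left (hb _) (norm_nonneg _))
    · exact (norm_dotp_le _ _).trans (mul_le_mul_of_nonneg_left (hb _) (norm_nonneg _))
  simp only [hinv] at hlim
  have := tendsto_nhds_unique hlim tendsto_const_nhds
  exact (mul_eq_zero.mp this.symm).resolve_left P.d_pos.ne'

/-- A solution of the linearization on `ℤ` is determined by two consecutive values. -/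
theorem eq_zero_of_recursion {x w : ℤ → X ℝ M}
    (h : ∀ n, P.d • (w (n + 1) + w (n - 1)) = P.B ℝ (x n) (w n)) (h0 : w 0 = 0)
    (h1 : w (-1) = 0) (n : ℤ) : w n = 0 := by
  have hd := P.d_pos.ne'
  have hf : ∀ k : ℕ, w k = 0 ∧ w (k - 1) = 0 := by
    intro k
    induction k with
    | zero => exact ⟨by simpa using h0, by simpa using h1⟩
    | succ k ih =>
      have := h k
      rw [ih.1, ih.2, map_zero, add_zero, smul_eq_zero] at this
      exact ⟨by simpa using this.resolve_left hd, by simpa using ih.1⟩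
  have hb : ∀ k : ℕ, w (-k) = 0 ∧ w (-k - 1) = 0 := by
    intro k
    induction k with
    | zero => exact ⟨by simpa using h0, by simpa using h1⟩
    | succ k ih =>
      have := h (-k - 1)
      rw [sub_add_cancel, ih.1, ih.2, map_zero, zero_add, smul_eq_zero] at this
      have e : -((k + 1 : ℕ) : ℤ) = -k - 1 := by push_cast; ring
      rw [e]
      exact ⟨ih.2, this.resolve_left hd⟩
  rcases Int.eq_nat_or_neg n with ⟨k, rfl | rfl⟩
  · exact (hf k).1
  · exact (hb k).1

theorem iterate_pair {q : ℤ → X ℝ M}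
    (hq : ∀ n, pair q (n + 1) = F P.V P.d P.T (pair q n)) (k : ℕ) :
    (P.map M)^[k] (pair q 0) = pair q k := by
  induction k with
  | zero => rfl
  | succ k ih => rw [Function.iterate_succ_apply', ih]; exact (hq k).symm

theorem iterate_symm_pair {q : ℤ → X ℝ M}
    (hq : ∀ n, pair q (n + 1) = F P.V P.d P.T (pair q n)) (k : ℕ) :
    (P.map M).symm^[k] (pair q 0) = pair q (-k) := by
  induction k with
  | zero => rfl
  | succ k ih =>
    rw [Function.iterate_succ_apply', ih, Equiv.symm_apply_eq]
    have := hq (-((k + 1 : ℕ) : ℤ))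
    rw [show -((k + 1 : ℕ) : ℤ) + 1 = -(k : ℤ) by push_cast; ring] at this
    exact this

end Chain

namespace HypChain

variable {M : ℕ} (P : HypChain M)

/-- A nondegenerate primary breather, with the consequences of the hypotheses on the stable and
unstable manifolds that the perturbation arguments use: the stationary equation, time reversibility,
decay at the rate `θ`, and the fact that the bounded solutions of the linearization are the multiples
of the time derivative. -/
structure IsPulse (q : ℤ → X ℝ M) : Prop where
  eq : ∀ n, P.d • (q (n + 1) + q (n - 1)) = P.H (q n)
  even : ∀ n, refl ℝ (q n) = q n
  decay : ∃ C, 0 ≤ C ∧ ∀ n : ℤ, ‖q n‖ ≤ C * P.θ ^ n.natAbs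
  dt_ne : ∃ n, dt P.T (q n) ≠ 0
  ker : ∀ w : ℤ → X ℝ M, (∃ b, ∀ n, ‖w n‖ ≤ b) →
    (∀ n, P.d • (w (n + 1) + w (n - 1)) = P.B ℝ (q n) (w n)) → ∃ c : ℝ, ∀ n, w n = c • dt P.T (q n)

theorem mem_stableTangent_iff {q : ℤ → X ℝ M}
    (hq : ∀ n, pair q (n + 1) = F P.V P.d P.T (pair q n))
    (hlim : Tendsto (fun n => (P.map M)^[n] (pair q 0)) atTop (𝓝 0)) (z : X ℝ M × X ℝ M) :
    z ∈ stableTangent (P.map M) Set.univ (pair q 0) ↔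
      ∃ w : ℕ → X ℝ M, w 0 = z.2 ∧ w 1 = z.1 ∧ P.IsForward (fun k => q k) w := by
  have horb : (fun k => P.orb (pair q 0) (k + 1)) = fun k : ℕ => q k := by
    funext k
    have := P.iterate_pair hq (k + 1)
    rw [Chain.orb, this]
    simp [pair]
  constructor
  · intro hz
    have := P.exists_forward_of_mem_stableTangent hz
    rwa [horb] at this
  · rintro ⟨w, h0, h1, hw⟩
    rw [← horb] at hw
    have := P.mem_stableTangent_of_forward hlim hw
    rwa [h0, h1] at this

theorem mem_unstableTangent_iff {q : ℤ → X ℝ M}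
    (hq : ∀ n, pair q (n + 1) = F P.V P.d P.T (pair q n))
    (hlim : Tendsto (fun n => (P.map M).symm^[n] (pair q 0)) atTop (𝓝 0)) (z : X ℝ M × X ℝ M) :
    z ∈ stableTangent (P.map M).symm Set.univ (pair q 0) ↔
      ∃ w : ℕ → X ℝ M, w 0 = z.1 ∧ w 1 = z.2 ∧ P.IsForward (fun k => q (-1 - k)) w := by
  have hit : ∀ k : ℕ, (P.map M)^[k] (swapL M (pair q 0)) = swapL M (pair q (-k)) := by
    intro k
    have h : Function.Semiconj (swapL M) (P.map M).symm (P.map M) :=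
      fun x => (F_swap P.V P.d P.T x).symm
    rw [← P.iterate_symm_pair hq]
    exact ((h.iterate_right k) (pair q 0)).symm
  have horb : (fun k => P.orb (swapL M (pair q 0)) (k + 1)) = fun k : ℕ => q (-1 - k) := by
    funext k
    rw [Chain.orb, hit]
    simp only [pair, swapL_apply]
    congr 1; push_cast; ring
  have hlim' : Tendsto (fun n => (P.map M)^[n] (swapL M (pair q 0))) atTop (𝓝 0) := by
    simp only [hit, ← P.iterate_symm_pair hq]
    have := ((swapL M).continuous.tendsto 0).comp hlim
    rw [map_zero] at this
    exact this
  constructor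
  · intro hz
    have h1 := map_mem_stableTangent (G' := P.map M) (swapL M)
      (fun x => F_swap P.V P.d P.T x) hz
    have := P.exists_forward_of_mem_stableTangent h1
    rwa [horb] at this
  · rintro ⟨w, h0, h1, hw⟩
    rw [← horb] at hw
    have h2 := P.mem_stableTangent_of_forward hlim' hw
    have h3 := map_mem_stableTangent (G' := (P.map M).symm) (swapL M)
      (fun x => F_symm_swap P.V P.d P.T x) h2
    rw [h0, h1] at h3
    exact h3

/-- Transversality in the even subspace and nondegeneracy in the full space amount to the statement
that the kernel of the linearization is spanned by the time derivative. Transversality excludes even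
kernel elements because the symplectic form vanishes on the stable and on the unstable directions; the
time derivative does not vanish, since otherwise time differentiation would map the odd kernel to an
even one. -/
theorem isPulse {q : ℤ → X ℝ M} (hq : IsPrimaryBreather P.V P.d P.T q)
    (hnd : IsNondegenerate P.V P.d P.T q) : P.IsPulse q := by
  have horbit := hq.orbit
  have heq := (P.isOrbit_iff q).mp horbit
  have hlimF : Tendsto (fun n => (P.map M)^[n] (pair q 0)) atTop (𝓝 0) := (hq.homoclinic 0).1.2
  have hlimB : Tendsto (fun n => (P.map M).symm^[n] (pair q 0)) atTop (𝓝 0) :=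
    (hq.homoclinic 0).2.2
  have heven : ∀ n, refl ℝ (q n) = q n := fun n =>
    (even_iff P.T_pos _).mp (hq.homoclinic n).1.1.1
  have hqF : Tendsto (fun k : ℕ => q k) atTop (𝓝 0) := by
    have := (continuous_fst.tendsto _).comp hlimF
    simp only [Function.comp_def, P.iterate_pair horbit] at this
    exact this
  have hqF' : Tendsto (fun k : ℕ => q (k - 1)) atTop (𝓝 0) := by
    have := (continuous_snd.tendsto _).comp hlimF
    simp only [Function.comp_def, P.iterate_pair horbit] at this
    exact this
  have hqB : Tendsto (fun k : ℕ => q (-k)) atTop (𝓝 0) := by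
    have := (continuous_fst.tendsto _).comp hlimB
    simp only [Function.comp_def, P.iterate_symm_pair horbit] at this
    exact this
  have hqB' : Tendsto (fun k : ℕ => q (-1 - k)) atTop (𝓝 0) := by
    have := (continuous_snd.tendsto _).comp hlimB
    have e : ∀ k : ℕ, -(k : ℤ) - 1 = -1 - k := fun k => by ring
    simp only [Function.comp_def, P.iterate_symm_pair horbit] at this
    simp only [pair, e] at this
    exact this
  have hdecay : ∃ C, 0 ≤ C ∧ ∀ n : ℤ, ‖q n‖ ≤ C * P.θ ^ n.natAbs := by
    refine exists_natAbs_bound P.θ_pos (P.nonlinear_decay hqF' fun k => ?_)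
      (P.nonlinear_decay hqB fun k => ?_)
    · have := heq k
      push_cast
      rw [show (k : ℤ) + 2 - 1 = k + 1 by ring, show (k : ℤ) + 1 - 1 = k by ring]
      exact this
    · have := heq (-k - 1)
      push_cast
      rw [show -((k : ℤ) + 2) = -k - 1 - 1 by ring, show -((k : ℤ) + 1) = -k - 1 by ring, add_comm]
      rwa [sub_add_cancel] at this
  obtain ⟨τ, hτ1, hτ2⟩ := exists_between P.θ_lt_one
  have hdec0 : ∀ {x w : ℕ → X ℝ M}, Tendsto x atTop (𝓝 0) → P.IsForward x w →
      Tendsto w atTop (𝓝 0) := by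
    intro x w hx hw
    obtain ⟨C, -, hC⟩ := P.forward_decay (D := 0) hτ1 hτ2 le_rfl hx hw.bdd fun k => by
      rw [zero_mul, norm_le_zero_iff, sub_eq_zero]; exact hw.eq k
    refine squeeze_zero_norm hC ?_
    simpa using (tendsto_pow_atTop_nhds_zero_of_lt_one (P.θ_pos.trans hτ1).le hτ2).const_mul C
  set Ts := stableTangent (P.map M) Set.univ (pair q 0) with hTs
  set Tu := stableTangent (P.map M).symm Set.univ (pair q 0) with hTu
  have hmemF := P.mem_stableTangent_iff horbit hlimF
  have hmemB := P.mem_unstableTangent_iff horbit hlimB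
  have hsymF : ∀ z ∈ Ts, ∀ a ∈ Ts, dotp z.1 a.2 - dotp z.2 a.1 = 0 := by
    intro z hz a ha
    obtain ⟨w, h0, h1, hw⟩ := (hmemF z).mp hz
    obtain ⟨w', h0', h1', hw'⟩ := (hmemF a).mp ha
    have := hw.symplectic hw' (hdec0 hqF hw)
    rwa [h0, h1, h0', h1'] at this
  have hsymB : ∀ z ∈ Tu, ∀ a ∈ Tu, dotp z.1 a.2 - dotp z.2 a.1 = 0 := by
    intro z hz a ha
    obtain ⟨w, h0, h1, hw⟩ := (hmemB z).mp hz
    obtain ⟨w', h0', h1', hw'⟩ := (hmemB a).mp ha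
    have := hw.symplectic hw' (hdec0 hqB' hw)
    rw [h0, h1, h0', h1'] at this
    linarith
  have hevenker : ∀ z ∈ Ts, z ∈ Tu → refl ℝ z.1 = z.1 → refl ℝ z.2 = z.2 → z = 0 := by
    intro z hzs hzu h1 h2
    obtain ⟨a, ha, b, hb, hab⟩ := hq.transverse 0 (-z.2, z.1) ⟨by
      rw [even_iff P.T_pos, map_neg, h2], by rw [even_iff P.T_pos, h1]⟩
    have ha' := hsymF z hzs a (stableTangent_mono _ (Set.subset_univ _) _ ha)
    have hb' := hsymB z hzu b (stableTangent_mono _ (Set.subset_univ _) _ hb)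
    have hab1 : a.1 + b.1 = -z.2 := congrArg Prod.fst hab
    have hab2 : a.2 + b.2 = z.1 := congrArg Prod.snd hab
    have h3 : dotp z.1 (a.2 + b.2) - dotp z.2 (a.1 + b.1) = 0 := by
      rw [dotp_add_right, dotp_add_right]; linarith
    rw [hab1, hab2, dotp_neg_right, dotp_self, dotp_self] at h3
    have h4 : ‖z.1‖ = 0 := by nlinarith [sq_nonneg ‖z.1‖, sq_nonneg ‖z.2‖]
    have h5 : ‖z.2‖ = 0 := by nlinarith [sq_nonneg ‖z.1‖, sq_nonneg ‖z.2‖]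
    exact Prod.ext (norm_eq_zero.mp h4) (norm_eq_zero.mp h5)
  obtain ⟨v, hv0, hv⟩ := hnd 0
  have hv' : Ts ∩ Tu = {p | ∃ c : ℝ, p = c • v} := hv
  have hvmem : v ∈ Ts ∩ Tu := by rw [hv']; exact ⟨1, by simp⟩
  have hbdd : ∃ b, ∀ n, ‖q n‖ ≤ b := by
    obtain ⟨C, hC0, hC⟩ := hdecay
    exact ⟨C, fun n => (hC n).trans
      (mul_le_of_le_one_right hC0 (pow_le_one₀ P.θ_pos.le P.θ_lt_one.le))⟩
  -- A bounded solution on the line has initial data in both tangent spaces, whose intersection is the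
  -- line spanned by `v`.
  have hline : ∀ w : ℤ → X ℝ M, (∃ b, ∀ n, ‖w n‖ ≤ b) →
      (∀ n, P.d • (w (n + 1) + w (n - 1)) = P.B ℝ (q n) (w n)) → ∃ c : ℝ, (w 0, w (-1)) = c • v := by
    intro w ⟨b, hb⟩ hw
    have hmem : (w 0, w (-1)) ∈ Ts ∩ Tu := by
      refine ⟨(hmemF _).mpr ⟨fun k => w (k - 1), by simp, by simp, fun k => ?_, b, fun k => hb _⟩,
        (hmemB _).mpr ⟨fun k => w (-k), by simp, by simp, fun k => ?_, b, fun k => hb _⟩⟩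
      · have := hw k
        push_cast
        rw [show (k : ℤ) + 2 - 1 = k + 1 by ring, show (k : ℤ) + 1 - 1 = k by ring]
        exact this
      · have := hw (-1 - k)
        push_cast
        rw [show -((k : ℤ) + 2) = -1 - k - 1 by ring, show -((k : ℤ) + 1) = -1 - k by ring, add_comm]
        rwa [show -1 - (k : ℤ) + 1 = -k by ring] at this
    rw [hv'] at hmem
    exact hmem
  have hdtker : ∀ n, P.d • (dt P.T (q (n + 1)) + dt P.T (q (n - 1)))
      = P.B ℝ (q n) (dt P.T (q n)) := by
    intro n
    rw [P.B_dt, ← heq]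
    simp only [← dtL_apply, map_add, map_smul]
  have hdtne : ∃ n, dt P.T (q n) ≠ 0 := by
    by_contra! hall
    obtain ⟨w, hw0, hw1, hw⟩ := (hmemF v).mp hvmem.1
    obtain ⟨w', hw0', hw1', hw'⟩ := (hmemB v).mp hvmem.2
    have hodd : (v.1 + refl ℝ v.1, v.2 + refl ℝ v.2) = (0 : X ℝ M × X ℝ M) := by
      refine hevenker _ ((hmemF _).mpr ⟨_, ?_, ?_, hw.add (hw.refl fun k => heven _)⟩)
        ((hmemB _).mpr ⟨_, ?_, ?_, hw'.add (hw'.refl fun k => heven _)⟩) ?_ ?_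
      · simp [hw0]
      · simp [hw1]
      · simp [hw0']
      · simp [hw1']
      · simp [add_comm]
      · simp [add_comm]
    have hodd1 : refl ℝ v.1 = -v.1 :=
      (eq_neg_of_add_eq_zero_right (congrArg Prod.fst hodd))
    have hodd2 : refl ℝ v.2 = -v.2 :=
      (eq_neg_of_add_eq_zero_right (congrArg Prod.snd hodd))
    have heven' : ∀ u : X ℝ M, refl ℝ u = -u → refl ℝ (dt P.T u) = dt P.T u := by
      intro u hu
      have := dt_refl P.T u
      rw [hu, ← dtL_apply, map_neg, neg_inj, dtL_apply] at this
      exact this.symm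
    have hdt : (dt P.T v.1, dt P.T v.2) = (0 : X ℝ M × X ℝ M) :=
      hevenker _ ((hmemF _).mpr ⟨_, by simp [hw0], by simp [hw1], hw.dt fun k => hall _⟩)
        ((hmemB _).mpr ⟨_, by simp [hw0'], by simp [hw1'], hw'.dt fun k => hall _⟩)
        (heven' _ hodd1) (heven' _ hodd2)
    exact hv0 (Prod.ext (eq_zero_of_odd_of_dt_eq_zero P.T_pos hodd1 (congrArg Prod.fst hdt))
      (eq_zero_of_odd_of_dt_eq_zero P.T_pos hodd2 (congrArg Prod.snd hdt)))
  refine ⟨heq, heven, hdecay, hdtne, fun w hwb hw => ?_⟩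
  obtain ⟨b, hb⟩ := hbdd
  obtain ⟨c₀, hc₀⟩ := hline (fun n => dt P.T (q n)) ⟨‖dtL ℝ (M := M) P.T‖ * b, fun n => by
    rw [← dtL_apply]; exact (dtL ℝ P.T).le_of_opNorm_le_of_le le_rfl (hb n)⟩ hdtker
  obtain ⟨c, hc⟩ := hline w hwb hw
  have hc₀' : c₀ ≠ 0 := by
    rintro rfl
    rw [zero_smul] at hc₀
    obtain ⟨n, hn⟩ := hdtne
    exact hn (P.eq_zero_of_recursion (x := q) (w := fun n => dt P.T (q n)) hdtker (congrArg Prod.fst hc₀) (congrArg Prod.snd hc₀) n)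
  refine ⟨c / c₀, fun n => ?_⟩
  rw [← sub_eq_zero]
  have hdiff : ∀ z z₀ : X ℝ M, ∀ y : X ℝ M, z = c • y → z₀ = c₀ • y → z - (c / c₀) • z₀ = 0 := by
    rintro z z₀ y rfl rfl
    rw [smul_smul, div_mul_cancel₀ _ hc₀', sub_self]
  refine P.eq_zero_of_recursion (x := q) (w := fun n => w n - (c / c₀) • dt P.T (q n))
    (fun n => ?_) ?_ ?_ n
  · rw [map_sub, map_smul, ← hw, ← hdtker]
    module
  · exact hdiff _ _ v.1 (congrArg Prod.fst hc) (congrArg Prod.fst hc₀)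
  · exact hdiff _ _ v.2 (congrArg Prod.snd hc) (congrArg Prod.snd hc₀)

end HypChain

/-! ### Separated points and geometric sums -/

section GeometricSums

/-- A common bound for the geometric sums with ratio `x` over the integers. -/
noncomputable def geomC (x : ℝ) : ℝ := 2 / (x * (1 - x))

theorem geomC_pos {x : ℝ} (h0 : 0 < x) (h1 : x < 1) : 0 < geomC x := by
  have : 0 < 1 - x := by linarith
  unfold geomC; positivity

theorem summable_pow_natAbs {x : ℝ} (h0 : 0 < x) (h1 : x < 1) (s : ℤ) :
    Summable fun n : ℤ => x ^ (n - s).natAbs := by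
  have h : Summable fun n : ℤ => x ^ n.natAbs := by
    refine Summable.of_nat_of_neg_add_one ?_ ?_
    · simpa using summable_geometric_of_lt_one h0.le h1
    · have : ∀ n : ℕ, x ^ (-((n : ℤ) + 1)).natAbs = x * x ^ n := fun n => by
        rw [← pow_succ']; congr 1
      simp only [this]
      exact (summable_geometric_of_lt_one h0.le h1).mul_left x
  exact h.comp_injective (i := fun n => n - s) fun a b h => by simpa using h

theorem tsum_pow_natAbs_le {x : ℝ} (h0 : 0 < x) (h1 : x < 1) (s : ℤ) :
    ∑' n : ℤ, x ^ (n - s).natAbs ≤ 2 / (1 - x) := by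
  have e : ∑' n : ℤ, x ^ (n - s).natAbs = ∑' n : ℤ, x ^ n.natAbs :=
    (Equiv.subRight s).tsum_eq fun n : ℤ => x ^ n.natAbs
  rw [e]
  have hg := hasSum_geometric_of_lt_one h0.le h1
  have h : HasSum (fun n : ℤ => x ^ n.natAbs) ((1 - x)⁻¹ + x * (1 - x)⁻¹) := by
    refine HasSum.of_nat_of_neg_add_one ?_ ?_
    · simpa using hg
    · have : ∀ n : ℕ, x ^ (-((n : ℤ) + 1)).natAbs = x * x ^ n := fun n => by
        rw [← pow_succ']; congr 1
      simp only [this]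
      exact hg.mul_left x
  rw [h.tsum_eq, div_eq_mul_inv, ← one_add_mul]
  have : 0 < (1 - x)⁻¹ := inv_pos.mpr (by linarith)
  nlinarith

/-- The points `s i` are separated by multiples of `L`, according to the distance of their
indices. -/
def Separated {m : ℕ} (L : ℕ) (s : Fin m → ℤ) : Prop :=
  ∀ i j : Fin m, L * ((i : ℤ) - (j : ℤ)).natAbs ≤ (s i - s j).natAbs

variable {m L : ℕ} {s : Fin m → ℤ}

theorem Separated.sum_erase_le_of_le (i : Fin m) {x C : ℝ} (h0 : 0 < x) (h1 : x < 1) (hL : 1 ≤ L)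
    (hC : 0 ≤ C) {f : Fin m → ℝ} (hf : ∀ j, f j ≤ C * x ^ (L * ((i : ℤ) - (j : ℤ)).natAbs)) :
    ∑ j ∈ Finset.univ.erase i, f j ≤ C * geomC x * x ^ L := by
  have hx := pow_pos h0
  have h2 : ∀ j ∈ Finset.univ.erase i, f j
      ≤ C * (x ^ L / x) * x ^ ((j : ℤ) - (i : ℤ)).natAbs := by
    intro j hj
    have hji : ((j : ℤ) - (i : ℤ)).natAbs ≠ 0 := by
      have : (j : ℕ) ≠ i := fun h => (Finset.mem_erase.mp hj).1 (Fin.ext h)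
      omega
    obtain ⟨k, hk⟩ := Nat.exists_eq_succ_of_ne_zero hji
    refine (hf j).trans ?_
    rw [show ((i : ℤ) - (j : ℤ)).natAbs = ((j : ℤ) - (i : ℤ)).natAbs by omega, hk, mul_assoc]
    refine mul_le_mul_of_nonneg_left ?_ hC
    rw [Nat.succ_eq_add_one, pow_succ' x k, ← mul_assoc, div_mul_cancel₀ _ h0.ne', ← pow_add]
    exact pow_le_pow_of_le_one h0.le h1.le (by nlinarith)
  refine (Finset.sum_le_sum h2).trans ?_
  rw [← Finset.mul_sum]
  have h3 : ∑ j ∈ Finset.univ.erase i, x ^ ((j : ℤ) - (i : ℤ)).natAbs ≤ 2 / (1 - x) := by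
    have h4 : ∑ j ∈ Finset.univ.erase i, x ^ ((j : ℤ) - (i : ℤ)).natAbs
        = ∑ n ∈ (Finset.univ.erase i).image (fun j : Fin m => (j : ℤ)), x ^ (n - (i : ℤ)).natAbs :=
      (Finset.sum_image (g := fun j : Fin m => (j : ℤ)) (f := fun n : ℤ => x ^ (n - (i : ℤ)).natAbs)
        fun a _ b _ h => Fin.ext (by simpa using h)).symm
    rw [h4]
    exact ((summable_pow_natAbs h0 h1 _).sum_le_tsum _ fun n _ => (hx _).le).trans
      (tsum_pow_natAbs_le h0 h1 _)
  calc _ ≤ C * (x ^ L / x) * (2 / (1 - x)) := by gcongr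
    _ = _ := by
        have : (1 - x) ≠ 0 := by linarith
        unfold geomC; field_simp

theorem Separated.sum_erase_le (hs : Separated L s) (i : Fin m) {x : ℝ} (h0 : 0 < x) (h1 : x < 1)
    (hL : 1 ≤ L) :
    ∑ j ∈ Finset.univ.erase i, x ^ (s i - s j).natAbs ≤ geomC x * x ^ L := by
  have := Separated.sum_erase_le_of_le (L := L) (C := 1) i h0 h1 hL zero_le_one
    (f := fun j => x ^ (s i - s j).natAbs) fun j => by
      rw [one_mul]; exact pow_le_pow_of_le_one h0.le h1.le (hs i j)
  simpa using this

/-- The contributions of all but the nearest point are small. -/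
theorem Separated.sum_erase_near_le (hs : Separated L s) (i : Fin m) {x : ℝ} (h0 : 0 < x)
    (h1 : x < 1) (hL : 1 ≤ L) {n : ℤ} (hn : ∀ j, (s i - s j).natAbs ≤ 2 * (n - s j).natAbs) :
    ∑ j ∈ Finset.univ.erase i, (x ^ 2) ^ (n - s j).natAbs ≤ geomC x * x ^ L := by
  refine (Finset.sum_le_sum fun j _ => ?_).trans (hs.sum_erase_le i h0 h1 hL)
  rw [← pow_mul]
  exact pow_le_pow_of_le_one h0.le h1.le (hn j)

theorem exists_nearest [NeZero m] (s : Fin m → ℤ) (n : ℤ) :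
    ∃ i, ∀ j, (s i - s j).natAbs ≤ 2 * (n - s j).natAbs := by
  obtain ⟨i, -, hi⟩ := Finset.exists_min_image Finset.univ (fun j => (n - s j).natAbs)
    ⟨0, Finset.mem_univ _⟩
  refine ⟨i, fun j => ?_⟩
  have := hi j (Finset.mem_univ _)
  omega

theorem Separated.sum_le (hs : Separated L s) {x : ℝ} (h0 : 0 < x)
    (h1 : x < 1) (hL : 1 ≤ L) (n : ℤ) :
    ∑ j, (x ^ 2) ^ (n - s j).natAbs ≤ 1 + geomC x := by
  have hg := geomC_pos h0 h1
  rcases Nat.eq_zero_or_pos m with rfl | hm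
  · simp only [Finset.univ_eq_empty, Finset.sum_empty]; positivity
  have : NeZero m := ⟨hm.ne'⟩
  obtain ⟨i, hi⟩ := exists_nearest s n
  rw [← Finset.add_sum_erase _ _ (Finset.mem_univ i)]
  refine add_le_add (pow_le_one₀ (by positivity) (by nlinarith)) ?_
  exact (hs.sum_erase_near_le i h0 h1 hL hi).trans
    (mul_le_of_le_one_right hg.le (pow_le_one₀ h0.le h1.le))

end GeometricSums

/-! ### The pairing of sequences and the symmetry of the linearization -/

section Pairing

variable {𝕜 : Type} [RCLike 𝕜] {M : ℕ}

/-- The `ℓ²` pairing of a real with a real or complex sequence, used for a summable and a bounded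
sequence. -/
noncomputable def pairing (a : ℤ → X ℝ M) (w : ℤ → X 𝕜 M) : 𝕜 := ∑' n, dotp (a n) (w n)

variable {a b : ℤ → X ℝ M}

theorem norm_dotp_seq_le (a : ℤ → X ℝ M) (w : Seq (X 𝕜 M)) (n : ℤ) :
    ‖dotp (a n) (w n)‖ ≤ ‖a n‖ * ‖w‖ :=
  (norm_dotp_le _ _).trans (mul_le_mul_of_nonneg_left (w.norm_apply_le n) (norm_nonneg _))

theorem summable_dotp (ha : Summable fun n => ‖a n‖) (w : Seq (X 𝕜 M)) :
    Summable fun n => dotp (a n) (w n) :=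
  .of_norm_bounded (ha.mul_right _) (norm_dotp_seq_le a w)

theorem norm_pairing_le_of_le {w : ℤ → X 𝕜 M} {f : ℤ → ℝ} (hf : Summable f)
    (h : ∀ n, ‖a n‖ * ‖w n‖ ≤ f n) : ‖pairing a w‖ ≤ ∑' n, f n :=
  tsum_of_norm_bounded hf.hasSum fun n => (norm_dotp_le _ _).trans (h n)

theorem norm_pairing_le (ha : Summable fun n => ‖a n‖) (w : Seq (X 𝕜 M)) :
    ‖pairing a w‖ ≤ (∑' n, ‖a n‖) * ‖w‖ := by
  rw [← tsum_mul_right]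
  exact norm_pairing_le_of_le (ha.mul_right _) fun n =>
    mul_le_mul_of_nonneg_left (w.norm_apply_le n) (norm_nonneg _)

theorem pairing_add (ha : Summable fun n => ‖a n‖) (v w : Seq (X 𝕜 M)) :
    pairing a (v + w : Seq (X 𝕜 M)) = pairing a v + pairing a w := by
  rw [pairing, pairing, pairing, ← (summable_dotp ha v).tsum_add (summable_dotp ha w)]
  exact tsum_congr fun n => dotp_add_right _ _ _

theorem pairing_smul (c : 𝕜) (w : ℤ → X 𝕜 M) :
    pairing a (fun n => c • w n) = c * pairing a w := by
  rw [pairing, pairing, ← tsum_mul_left]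
  exact tsum_congr fun n => dotp_smul_right _ _ _

/-- The pairing with a summable sequence, as a functional on bounded sequences. -/
noncomputable def pairL (𝕜 : Type) [RCLike 𝕜] (a : ℤ → X ℝ M) (ha : Summable fun n => ‖a n‖) :
    Seq (X 𝕜 M) →L[𝕜] 𝕜 :=
  LinearMap.mkContinuous
    { toFun := fun w => pairing a w
      map_add' := pairing_add ha
      map_smul' := fun c w => pairing_smul c w } (∑' n, ‖a n‖) (norm_pairing_le ha)

@[simp] theorem pairL_apply (ha : Summable fun n => ‖a n‖) (w : Seq (X 𝕜 M)) :
    pairL 𝕜 a ha w = pairing a w := rfl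

theorem pairing_eq_zero_of_parity {w : ℤ → X 𝕜 M} (ha : ∀ n, refl ℝ (a n) = -a n)
    (hw : ∀ n, refl 𝕜 (w n) = w n) : pairing a w = 0 := by
  rw [pairing, ← tsum_zero (L := .unconditional ℤ)]
  exact tsum_congr fun n => dotp_eq_zero_of_parity (ha n) (hw n)

theorem pairing_comp_sub (a : ℤ → X ℝ M) (w : ℤ → X 𝕜 M) (s : ℤ) :
    pairing (fun n => a (n - s)) (fun n => w (n - s)) = pairing a w :=
  (Equiv.subRight s).tsum_eq fun n => dotp (a n) (w n)

namespace Chain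

variable (P : Chain)

/-- The linearization `w ↦ d (w_{n+1} + w_{n-1}) - B(u_n) w_n` of the stationary equation. -/
noncomputable def lin (u : ℤ → X ℝ M) (w : ℤ → X 𝕜 M) (n : ℤ) : X 𝕜 M :=
  (P.d : 𝕜) • (w (n + 1) + w (n - 1)) - P.B 𝕜 (u n) (w n)

/-- The linearization is symmetric. -/
theorem pairing_lin {u : ℤ → X ℝ M} (ha : Summable fun n => ‖a n‖)
    (hu : ∃ C, ∀ n, ‖P.B ℝ (u n)‖ ≤ C) (w : Seq (X 𝕜 M)) :
    pairing a (P.lin u w) = pairing (P.lin u a) w := by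
  obtain ⟨C, hC⟩ := hu
  have hBa : Summable fun n => ‖P.B ℝ (u n) (a n)‖ :=
    .of_nonneg_of_le (fun n => norm_nonneg _) (fun n => (P.B ℝ (u n)).le_of_opNorm_le (hC n) _)
      (ha.mul_left C)
  have hsh : ∀ k : ℤ, Summable fun n => ‖a (n + k)‖ := fun k =>
    ha.comp_injective (i := fun n => n + k) (add_left_injective k)
  have h1 : ∀ k : ℤ, ∑' n, dotp (a (n + k)) (w n) = ∑' n, dotp (a n) (w (n - k)) := fun k => by
    rw [← (Equiv.subRight k).tsum_eq fun n => dotp (a (n + k)) (w n)]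
    simp
  have s1 : Summable fun n => dotp (a n) (w (n + 1)) := summable_dotp ha (shiftSeq 𝕜 1 w)
  have s2 : Summable fun n => dotp (a n) (w (n - 1)) := summable_dotp ha (shiftSeq 𝕜 (-1) w)
  have s3 := summable_dotp (hsh 1) w
  have s4 := summable_dotp (hsh (-1)) w
  have s5 := summable_dotp hBa w
  have e1 : ∀ n, dotp (a n) (P.lin u w n)
      = (P.d : 𝕜) * (dotp (a n) (w (n + 1)) + dotp (a n) (w (n - 1)))
        - dotp (P.B ℝ (u n) (a n)) (w n) := fun n => by
    rw [lin, dotp_sub_right, dotp_smul_right, dotp_add_right, P.dotp_B]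
  have e2 : ∀ n, dotp (P.lin u a n) (w n)
      = (P.d : 𝕜) * (dotp (a (n + -1)) (w n) + dotp (a (n + 1)) (w n))
        - dotp (P.B ℝ (u n) (a n)) (w n) := fun n => by
    rw [lin, dotp_sub_left]
    have : (((P.d : ℝ) : ℝ) • (a (n + 1) + a (n - 1)) : X ℝ M) = P.d • (a (n + 1) + a (n - 1)) := rfl
    simp only [RCLike.ofReal_real_eq_id, id]
    rw [dotp_smul_left, dotp_add_left, add_comm (dotp (a (n + 1)) _)]
    rfl
  rw [pairing, pairing]
  simp only [e1, e2]
  rw [((s1.add s2).mul_left _).tsum_sub s5, ((s4.add s3).mul_left _).tsum_sub s5, tsum_mul_left,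
    tsum_mul_left, s1.tsum_add s2, s4.tsum_add s3, h1, h1]
  simp

end Chain

end Pairing

/-! ### The bordered linearization about a single pulse -/

/-- A finite-rank perturbation of a bijection is bijective as soon as it is injective. -/
theorem bijective_of_finite_rank {𝕜 X Y W : Type*} [Field 𝕜] [AddCommGroup X] [Module 𝕜 X]
    [AddCommGroup Y] [Module 𝕜 Y] [AddCommGroup W] [Module 𝕜 W] [FiniteDimensional 𝕜 W]
    {A T : X →ₗ[𝕜] Y} (π : X →ₗ[𝕜] W) (ι : W →ₗ[𝕜] Y) (hA : Function.Bijective A)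
    (hT : ∀ x, T x = A x - ι (π x)) (hinj : Function.Injective T) : Function.Bijective T := by
  refine ⟨hinj, fun y => ?_⟩
  set e := LinearEquiv.ofBijective A hA with he
  have hAe : ∀ z, A (e.symm z) = z := fun z => e.apply_symm_apply z
  set f : W →ₗ[𝕜] W := LinearMap.id - π ∘ₗ e.symm.toLinearMap ∘ₗ ι with hf
  have hfv : ∀ v, f v = v - π (e.symm (ι v)) := fun v => rfl
  have hfi : Function.Injective f := (injective_iff_map_eq_zero f).mpr fun v hv => by
    rw [hfv, sub_eq_zero] at hv
    have h0 : T (e.symm (ι v)) = 0 := by rw [hT, hAe, ← hv, sub_self]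
    have h1 := (injective_iff_map_eq_zero T).mp hinj _ h0
    rw [hv, h1, map_zero]
  obtain ⟨v, hv⟩ := LinearMap.injective_iff_surjective.mp hfi (π (e.symm y))
  rw [hfv] at hv
  refine ⟨e.symm y + e.symm (ι v), ?_⟩
  have h2 : π (e.symm y + e.symm (ι v)) = v := by rw [map_add, ← hv]; abel
  rw [hT, h2, map_add, hAe, hAe, add_sub_cancel_right]

section Bordered

variable {𝕜 : Type} [RCLike 𝕜] {E : Type*} [NormedAddCommGroup E] [NormedSpace 𝕜 E] {m : ℕ}

/-- The second difference operator, bordered by finitely many sequences `e i` and functionals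
`φ i`. -/
noncomputable def bordered (d : ℝ) (D : Seq (E →L[𝕜] E)) (e : Fin m → Seq E)
    (φ : Fin m → Seq E →L[𝕜] 𝕜) : Seq E × (Fin m → 𝕜) →L[𝕜] Seq E × (Fin m → 𝕜) :=
  ((lapL d D).comp (.fst 𝕜 _ _) -
    ∑ i, ((ContinuousLinearMap.proj i).comp (.snd 𝕜 (Seq E) (Fin m → 𝕜))).smulRight (e i)).prod
  (ContinuousLinearMap.pi fun i => (φ i).comp (.fst 𝕜 _ _))

variable (d : ℝ) (D : Seq (E →L[𝕜] E)) (e : Fin m → Seq E) (φ : Fin m → Seq E →L[𝕜] 𝕜)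

theorem bordered_apply (w : Seq E) (b : Fin m → 𝕜) :
    bordered d D e φ (w, b) = (lapL d D w - ∑ i, b i • e i, fun i => φ i w) := by
  simp [bordered]

/-- If the diagonal part dominates near infinity, the bordered operator is bijective as soon as it is
injective. -/
theorem bordered_bijective [FiniteDimensional 𝕜 E] {d γ : ℝ} (hd : 0 < d) (hγ : 2 * d < γ)
    {D : Seq (E →L[𝕜] E)} (hD : ∀ᶠ n in cofinite, ∀ w, γ * ‖w‖ ≤ ‖D n w‖)
    (hinj : Function.Injective (bordered d D e φ)) : Function.Bijective (bordered d D e φ) := by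
  classical
  set S : Set ℤ := {n | ¬ ∀ w, γ * ‖w‖ ≤ ‖D n w‖} with hS
  have hSf : S.Finite := hD
  have : Finite S := hSf
  have := Fintype.ofFinite S
  set D' : Seq (E →L[𝕜] E) := mkSeq
    (fun n => if n ∈ S then (γ : 𝕜) • ContinuousLinearMap.id 𝕜 E else D n)
    ⟨‖(γ : 𝕜) • ContinuousLinearMap.id 𝕜 E‖ + ‖D‖, fun n => by
      have := norm_nonneg ((γ : 𝕜) • ContinuousLinearMap.id 𝕜 E)
      have := norm_nonneg D
      have := D.norm_apply_le n
      split_ifs <;> linarith⟩ with hD'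
  have hD'0 : ∀ n w, γ * ‖w‖ ≤ ‖D' n w‖ := by
    intro n w
    rw [hD', mkSeq_apply]
    split_ifs with h
    · rw [smul_apply, norm_smul, RCLike.norm_ofReal]
      exact mul_le_mul_of_nonneg_right (le_abs_self γ) (norm_nonneg _)
    · exact not_not.mp h w
  set A : Seq E × (Fin m → 𝕜) →ₗ[𝕜] Seq E × (Fin m → 𝕜) :=
    LinearMap.prodMap (lapL d D') LinearMap.id with hA
  have hAb : Function.Bijective A := by
    have := lapL_bijective hd hγ hD'0
    exact Function.Bijective.prodMap this Function.bijective_id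
  set ext : (S → E) →ₗ[𝕜] Seq E :=
    { toFun := fun v => mkSeq (fun n => if h : n ∈ S then v ⟨n, h⟩ else 0) ⟨‖v‖, fun n => by
        split_ifs with h
        · exact norm_le_pi_norm v _
        · simp⟩
      map_add' := fun v w => by
        ext n
        by_cases h : n ∈ S <;> simp [h]
      map_smul' := fun c v => by
        ext n
        by_cases h : n ∈ S <;> simp [h] } with hext
  set π : Seq E × (Fin m → 𝕜) →ₗ[𝕜] (S → E) × (Fin m → 𝕜) × (Fin m → 𝕜) :=
    { toFun := fun x => (fun n => (D n - D' n) (x.1 n), x.2, fun i => x.2 i - φ i x.1)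
      map_add' := fun x y => by
        refine Prod.ext (funext fun n => ?_) (Prod.ext rfl (funext fun i => ?_))
        · simp only [Prod.fst_add, BoundedContinuousFunction.coe_add, Pi.add_apply, map_add]
        · simp; ring
      map_smul' := fun c x => by
        refine Prod.ext (funext fun n => ?_) (Prod.ext rfl (funext fun i => ?_))
        · simp [smul_sub]
        · simp; ring } with hπ
  set ι : (S → E) × (Fin m → 𝕜) × (Fin m → 𝕜) →ₗ[𝕜] Seq E × (Fin m → 𝕜) :=
    { toFun := fun v => (ext v.1 + ∑ i, v.2.1 i • e i, v.2.2)
      map_add' := fun v w => by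
        simp only [Prod.fst_add, Prod.snd_add, map_add, Pi.add_apply, add_smul,
          Finset.sum_add_distrib, Prod.mk_add_mk]
        congr 1; abel
      map_smul' := fun c v => by
        simp [Finset.smul_sum, smul_smul] } with hι
  refine bijective_of_finite_rank (T := (bordered d D e φ : _ →ₗ[𝕜] _)) π ι hAb (fun x => ?_) hinj
  obtain ⟨w, b⟩ := x
  refine (bordered_apply d D e φ w b).trans (Prod.ext ?_ (funext fun i => ?_))
  · change lapL d D w - ∑ i, b i • e i
      = lapL d D' w - (ext (fun n => (D n - D' n) (w n)) + ∑ i, b i • e i)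
    rw [sub_add_eq_sub_sub, sub_left_inj]
    ext1 n
    rw [BoundedContinuousFunction.coe_sub, Pi.sub_apply, lapL_apply, lapL_apply, hext]
    change _ = _ - (if h : n ∈ S then (D n - D' n) (w n) else 0)
    by_cases h : n ∈ S
    · simp only [h, dif_pos, sub_apply]; abel
    · simp [h, hD']
  · change φ i w = b i - (b i - φ i w)
    ring

end Bordered

section RealParts

variable {𝕜 : Type} [RCLike 𝕜] {M : ℕ}

/-- The application of a real functional, such as the real or the imaginary part, to the values of a
trigonometric polynomial. -/
noncomputable def part (ψ : 𝕜 →L[ℝ] ℝ) (w : X 𝕜 M) : X ℝ M := WithLp.toLp 2 fun k => ψ (w k)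

theorem dotp_part (ψ : 𝕜 →L[ℝ] ℝ) (a : X ℝ M) (w : X 𝕜 M) : dotp a (part ψ w) = ψ (dotp a w) := by
  simp only [dotp_eq_sum, map_sum, part, RCLike.ofReal_real_eq_id, id]
  refine Finset.sum_congr rfl fun k _ => ?_
  rw [← RCLike.real_smul_eq_coe_mul, map_smul, smul_eq_mul]

theorem Chain.B_part (P : Chain) (ψ : 𝕜 →L[ℝ] ℝ) (u : X ℝ M) (w : X 𝕜 M) :
    P.B ℝ u (part ψ w) = part ψ (P.B 𝕜 u w) :=
  eq_of_forall_dotp_eq fun a => by rw [← P.dotp_B, dotp_part, dotp_part, P.dotp_B]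

theorem norm_part_le (ψ : 𝕜 →L[ℝ] ℝ) (w : X 𝕜 M) : ‖part ψ w‖ ≤ ‖ψ‖ * ‖w‖ := by
  rw [EuclideanSpace.norm_eq, EuclideanSpace.norm_eq, ← Real.sqrt_sq (norm_nonneg ψ),
    ← Real.sqrt_mul (sq_nonneg _), Finset.mul_sum]
  refine Real.sqrt_le_sqrt (Finset.sum_le_sum fun k _ => ?_)
  rw [← mul_pow]
  exact pow_le_pow_left₀ (norm_nonneg _) (ψ.le_opNorm _) 2

theorem eq_zero_of_part_eq_zero {w : X 𝕜 M} (h : ∀ ψ : 𝕜 →L[ℝ] ℝ, part ψ w = 0) : w = 0 := by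
  ext k
  refine RCLike.ext ?_ ?_
  · simpa [part] using congrArg (fun v : X ℝ M => v k) (h RCLike.reCLM)
  · simpa [part] using congrArg (fun v : X ℝ M => v k) (h RCLike.imCLM)

end RealParts

namespace HypChain

variable {M : ℕ} (P : HypChain M) {𝕜 : Type} [RCLike 𝕜]

theorem exists_dominant (𝕜 : Type) [RCLike 𝕜] : ∃ ε γ : ℝ, 0 < ε ∧ 2 * P.d < γ ∧
    ∀ (u : X ℝ M) (K : X 𝕜 M →L[𝕜] X 𝕜 M), ‖u‖ ≤ ε → ‖K‖ ≤ ε → ∀ w : X 𝕜 M,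
      γ * ‖w‖ ≤ ‖(P.B 𝕜 u + K) w‖ := by
  have hd := P.d_pos
  have hgap := sub_pos.mpr (two_lt_add_inv P.θ_pos P.θ_lt_one)
  obtain ⟨C, hC0, hC⟩ := P.exists_B_lipschitz 𝕜 M 1
  set κ := (P.θ + P.θ⁻¹ - 2) * P.d with hκ
  have hκ0 : 0 < κ := by positivity
  refine ⟨min 1 (κ / (2 * (C + 1))), 2 * P.d + κ / 2, by positivity, by linarith,
    fun u K hu hK w => ?_⟩
  rw [le_min_iff] at hu hK
  have h0 := P.norm_B_zero_ge w
  have h1 := hC u 0 hu.1 (by simp)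
  rw [sub_zero] at h1
  set K' := K - (P.B 𝕜 (0 : X ℝ M) - P.B 𝕜 u) with hK'
  have h2 : ‖K'‖ ≤ κ / 2 := by
    have h3 := norm_sub_le K (P.B 𝕜 (0 : X ℝ M) - P.B 𝕜 u)
    rw [norm_sub_rev (P.B 𝕜 (0 : X ℝ M))] at h3
    have h4 : (C + 1) * (κ / (2 * (C + 1))) = κ / 2 := by field_simp
    nlinarith [hu.2, hK.2]
  have h5 := ContinuousLinearMap.le_of_opNorm_le _ h2 w
  have h6 : P.B 𝕜 (0 : X ℝ M) w = (P.B 𝕜 u + K) w - K' w := by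
    simp only [hK', sub_apply, add_apply]; abel
  have h7 := norm_sub_le ((P.B 𝕜 u + K) w) (K' w)
  rw [← h6] at h7
  nlinarith [norm_nonneg w]

/-- The sequence of the linearized on-site operators. -/
noncomputable def BSeq (𝕜 : Type) [RCLike 𝕜] (u : Seq (X ℝ M)) : Seq (X 𝕜 M →L[𝕜] X 𝕜 M) :=
  mkSeq (fun n => P.B 𝕜 (u n)) (by
    obtain ⟨C, hC0, hC⟩ := P.exists_B_lipschitz 𝕜 M ‖u‖
    refine ⟨C * ‖u‖ + ‖P.B 𝕜 (0 : X ℝ M)‖, fun n => ?_⟩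
    have h1 := hC (u n) 0 (u.norm_apply_le n) (by simp)
    rw [sub_zero] at h1
    have h2 := norm_le_norm_add_norm_sub' (P.B 𝕜 (u n)) (P.B 𝕜 (0 : X ℝ M))
    have := u.norm_apply_le n
    nlinarith)

@[simp] theorem BSeq_apply (u : Seq (X ℝ M)) (n : ℤ) : P.BSeq 𝕜 u n = P.B 𝕜 (u n) := rfl

namespace IsPulse

variable {P} {q : ℤ → X ℝ M} (hq : P.IsPulse q)
include hq

theorem exists_dt_decay : ∃ C, 0 ≤ C ∧ ∀ n : ℤ, ‖dt P.T (q n)‖ ≤ C * P.θ ^ n.natAbs := by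
  obtain ⟨C, hC0, hC⟩ := hq.decay
  refine ⟨‖dtL ℝ (M := M) P.T‖ * C, by positivity, fun n => ?_⟩
  rw [← dtL_apply, mul_assoc]
  exact (dtL ℝ P.T).le_of_opNorm_le_of_le le_rfl (hC n)

theorem summable_dt : Summable fun n => ‖dt P.T (q n)‖ := by
  obtain ⟨C, hC0, hC⟩ := hq.exists_dt_decay
  have := (summable_pow_natAbs P.θ_pos P.θ_lt_one 0).mul_left C
  simp only [sub_zero] at this
  exact .of_nonneg_of_le (fun n => norm_nonneg _) hC this

theorem bdd : ∃ C, ∀ n, ‖q n‖ ≤ C := by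
  obtain ⟨C, hC0, hC⟩ := hq.decay
  exact ⟨C, fun n => (hC n).trans
    (mul_le_of_le_one_right hC0 (pow_le_one₀ P.θ_pos.le P.θ_lt_one.le))⟩

theorem dt_bdd : ∃ C, ∀ n, ‖dt P.T (q n)‖ ≤ C := by
  obtain ⟨C, hC0, hC⟩ := hq.exists_dt_decay
  exact ⟨C, fun n => (hC n).trans
    (mul_le_of_le_one_right hC0 (pow_le_one₀ P.θ_pos.le P.θ_lt_one.le))⟩

theorem tendsto_cofinite : Tendsto q cofinite (𝓝 0) := by
  obtain ⟨C, hC0, hC⟩ := hq.decay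
  refine squeeze_zero_norm hC ?_
  have := (summable_pow_natAbs P.θ_pos P.θ_lt_one 0).tendsto_cofinite_zero.const_mul C
  simpa using this

theorem lin_dt (n : ℤ) : P.lin q (fun n => dt P.T (q n)) n = 0 := by
  rw [Chain.lin, P.B_dt, ← hq.eq, sub_eq_zero]
  simp only [← dtL_apply, map_add, map_smul, RCLike.ofReal_real_eq_id, id]

theorem pairing_dt_self_pos : 0 < pairing (fun n => dt P.T (q n)) fun n => dt P.T (q n) := by
  obtain ⟨n, hn⟩ := hq.dt_ne
  have hs := summable_dotp hq.summable_dt (mkSeq (fun n => dt P.T (q n)) hq.dt_bdd)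
  refine hs.tsum_pos (fun n => ?_) n ?_
  · rw [mkSeq_apply, dotp_self]; positivity
  · rw [mkSeq_apply, dotp_self]
    exact pow_pos (norm_pos_iff.mpr hn) 2

/-- A bounded solution of the bordered homogeneous equation vanishes. -/
theorem eq_zero_of_bordered {w : Seq (X 𝕜 M)} {b : 𝕜}
    (h : ∀ n, P.lin q w n = b • lift 𝕜 (dt P.T (q n)))
    (h0 : pairing (fun n => dt P.T (q n)) w = 0) : w = 0 ∧ b = 0 := by
  obtain ⟨Cq, hCq⟩ := hq.bdd
  have hBb : ∃ C, ∀ n, ‖P.B ℝ (q n)‖ ≤ C :=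
    ⟨_, fun n => (P.BSeq ℝ (mkSeq q hq.bdd)).norm_apply_le n⟩
  have hpos := hq.pairing_dt_self_pos
  have hb : b = 0 := by
    have h1 := P.pairing_lin hq.summable_dt hBb w
    have h2 : pairing (P.lin q fun n => dt P.T (q n)) w = 0 := by
      have : P.lin q (fun n => dt P.T (q n)) = 0 := funext hq.lin_dt
      rw [this, pairing]
      simp [dotp_zero_left]
    have h3 : P.lin q w = fun n => b • lift 𝕜 (dt P.T (q n)) := funext h
    rw [h2, h3, pairing_smul, mul_eq_zero] at h1
    refine h1.resolve_right fun h4 => hpos.ne' ?_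
    simp only [pairing, dotp_lift, ← RCLike.ofReal_tsum, RCLike.ofReal_eq_zero] at h4
    exact h4
  refine ⟨?_, hb⟩
  subst hb
  ext1 n
  refine eq_zero_of_part_eq_zero fun ψ => ?_
  obtain ⟨c, hc⟩ := hq.ker (fun n => part ψ (w n))
    ⟨‖ψ‖ * ‖w‖, fun n => (norm_part_le ψ _).trans (by gcongr; exact w.norm_apply_le n)⟩ fun n => by
    have h1 := h n
    rw [zero_smul, Chain.lin, sub_eq_zero] at h1
    rw [P.B_part, ← h1]
    ext k
    simp only [part, PiLp.smul_apply, PiLp.add_apply, smul_eq_mul]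
    rw [← RCLike.real_smul_eq_coe_mul, map_smul, ψ.map_add, smul_eq_mul]
  have h1 : pairing (fun n => dt P.T (q n)) (fun n => part ψ (w n)) = 0 := by
    simp only [pairing, dotp_part]
    rw [← ψ.map_tsum (summable_dotp hq.summable_dt w)]
    exact (congrArg ψ h0).trans (map_zero ψ)
  simp only [hc] at h1
  rw [pairing_smul, mul_eq_zero] at h1
  rw [hc, h1.resolve_right hpos.ne', zero_smul]

/-- The bordered linearization about a single pulse is invertible. -/
theorem exists_single_inverse (𝕜 : Type) [RCLike 𝕜] : ∃ C, 0 < C ∧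
    (∀ (w : Seq (X 𝕜 M)) (b : 𝕜) (A : ℝ), (∀ n, ‖P.lin q w n - b • lift 𝕜 (dt P.T (q n))‖ ≤ A) →
      ‖pairing (fun n => dt P.T (q n)) w‖ ≤ A → ‖w‖ ≤ C * A ∧ ‖b‖ ≤ C * A) ∧
    ∀ (f : Seq (X 𝕜 M)) (c : 𝕜), ∃ (w : Seq (X 𝕜 M)) (b : 𝕜),
      (∀ n, P.lin q w n - b • lift 𝕜 (dt P.T (q n)) = f n) ∧
        pairing (fun n => dt P.T (q n)) w = c := by
  obtain ⟨ε, γ, hε, hγ, hdom⟩ := P.exists_dominant 𝕜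
  set e : Fin 1 → Seq (X 𝕜 M) := fun _ => mkSeq (fun n => lift 𝕜 (dt P.T (q n)))
    (by simpa using hq.dt_bdd) with he
  set φ : Fin 1 → Seq (X 𝕜 M) →L[𝕜] 𝕜 := fun _ => pairL 𝕜 _ hq.summable_dt
  set S := bordered P.d (P.BSeq 𝕜 (mkSeq q hq.bdd)) e φ with hS
  have hS1 : ∀ (w : Seq (X 𝕜 M)) (b : Fin 1 → 𝕜) n,
      (S (w, b)).1 n = P.lin q w n - b 0 • lift 𝕜 (dt P.T (q n)) := fun w b n => by
    rw [hS, bordered_apply]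
    simp only [Finset.univ_unique, Finset.sum_singleton]
    rfl
  have hS2 : ∀ (w : Seq (X 𝕜 M)) (b : Fin 1 → 𝕜) i,
      (S (w, b)).2 i = pairing (fun n => dt P.T (q n)) w := fun w b i => by
    rw [hS, bordered_apply]; rfl
  have hinj : Function.Injective S := (injective_iff_map_eq_zero S).mpr fun ⟨w, b⟩ h => by
    obtain ⟨h1, h2⟩ := hq.eq_zero_of_bordered (w := w) (b := b 0)
      (fun n => sub_eq_zero.mp (by rw [← hS1, h]; rfl)) (by rw [← hS2 w b 0, h]; rfl)
    exact Prod.ext h1 (funext fun i => by rw [Subsingleton.elim i 0]; exact h2)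
  have hbij : Function.Bijective S := by
    refine bordered_bijective e φ P.d_pos hγ ?_ hinj
    filter_upwards [hq.tendsto_cofinite.eventually (Metric.closedBall_mem_nhds 0 hε)] with n hn w
    simpa using hdom (q n) 0 (by simpa using hn) (by simpa using hε.le) w
  have : CompleteSpace (X 𝕜 M) := FiniteDimensional.complete 𝕜 _
  set T := ContinuousLinearEquiv.ofBijective S (LinearMap.ker_eq_bot.mpr hbij.1)
    (LinearMap.range_eq_top.mpr hbij.2) with hT
  set S' : Seq (X 𝕜 M) × (Fin 1 → 𝕜) →L[𝕜] Seq (X 𝕜 M) × (Fin 1 → 𝕜) :=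
    T.symm.toContinuousLinearMap with hS'
  have hTS : ∀ x, S' (S x) = x := fun x => T.symm_apply_apply x
  refine ⟨‖S'‖ + 1, by positivity, fun w b A h1 h2 => ?_, fun f c => ?_⟩
  · have hA : 0 ≤ A := (norm_nonneg _).trans h2
    have h3 : ‖S (w, fun _ => b)‖ ≤ A := by
      refine (Prod.norm_def _).trans_le (max_le ?_ ?_)
      · exact Seq.norm_le hA fun n => by rw [hS1]; exact h1 n
      · exact (pi_norm_le_iff_of_nonneg hA).mpr fun i => by rw [hS2]; exact h2
    have h4 : ‖(w, fun _ : Fin 1 => b)‖ ≤ (‖S'‖ + 1) * A := by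
      rw [← hTS (w, fun _ => b)]
      refine (S'.le_of_opNorm_le_of_le (le_add_of_nonneg_right zero_le_one) h3)
    have h5 := (norm_snd_le (w, fun _ : Fin 1 => b)).trans h4
    exact ⟨(norm_fst_le (w, fun _ : Fin 1 => b)).trans h4, (norm_le_pi_norm _ 0).trans h5⟩
  · obtain ⟨⟨w, b⟩, hwb⟩ := hbij.2 (f, fun _ => c)
    refine ⟨w, b 0, fun n => ?_, ?_⟩
    · rw [← hS1, hwb]
    · rw [← hS2 w b 0, hwb]

end IsPulse

end HypChain

/-! ### Localization by cutoff functions -/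

section Sums

variable {m L : ℕ} {s : Fin m → ℤ} {E : Type*} [NormedAddCommGroup E]

/-- A sum of localized contributions is close to that of the nearest point. -/
theorem Separated.norm_sum_sub_le (hs : Separated L s) (i : Fin m) {x : ℝ} (h0 : 0 < x)
    (h1 : x < 1) (hL : 1 ≤ L) {n : ℤ} (hn : ∀ j, (s i - s j).natAbs ≤ 2 * (n - s j).natAbs)
    {f : Fin m → E} {K : ℝ} (hK : 0 ≤ K) (hf : ∀ j, ‖f j‖ ≤ K * (x ^ 2) ^ (n - s j).natAbs) :
    ‖∑ j, f j - f i‖ ≤ K * (geomC x * x ^ L) := by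
  rw [← Finset.add_sum_erase _ _ (Finset.mem_univ i), add_sub_cancel_left]
  refine (norm_sum_le_of_le _ fun j _ => hf j).trans ?_
  rw [← Finset.mul_sum]
  exact mul_le_mul_of_nonneg_left (hs.sum_erase_near_le i h0 h1 hL hn) hK

theorem Separated.norm_sum_le (hs : Separated L s) {x : ℝ} (h0 : 0 < x)
    (h1 : x < 1) (hL : 1 ≤ L) {n : ℤ} {f : Fin m → E} {K : ℝ} (hK : 0 ≤ K)
    (hf : ∀ j, ‖f j‖ ≤ K * (x ^ 2) ^ (n - s j).natAbs) :
    ‖∑ j, f j‖ ≤ K * (1 + geomC x) := by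
  refine (norm_sum_le_of_le _ fun j _ => hf j).trans ?_
  rw [← Finset.mul_sum]
  exact mul_le_mul_of_nonneg_left (hs.sum_le h0 h1 hL n) hK

theorem natCast_mul_pow_le {x : ℝ} (h0 : 0 < x) (h1 : x < 1) (k : ℕ) : k * x ^ k ≤ (1 - x)⁻¹ := by
  have h2 : ∑ i ∈ Finset.range k, x ^ k ≤ ∑ i ∈ Finset.range k, x ^ i :=
    Finset.sum_le_sum fun i hi => pow_le_pow_of_le_one h0.le h1.le (Finset.mem_range.mp hi).le
  rw [Finset.sum_const, Finset.card_range, nsmul_eq_mul] at h2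
  refine h2.trans ?_
  rw [← tsum_geometric_of_lt_one h0.le h1]
  exact (summable_geometric_of_lt_one h0.le h1).sum_le_tsum _ fun i _ => by positivity

/-- The piecewise linear cutoff function that is `1` at zero and vanishes at distance `ℓ`. -/
noncomputable def tent (ℓ : ℕ) (n : ℤ) : ℝ := max 0 (1 - (n.natAbs : ℝ) / ℓ)

variable {ℓ : ℕ}

theorem tent_nonneg (n : ℤ) : 0 ≤ tent ℓ n := le_max_left _ _

theorem tent_le_one (n : ℤ) : tent ℓ n ≤ 1 :=
  max_le zero_le_one (sub_le_self _ (by positivity))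

theorem one_sub_tent_le (n : ℤ) : 1 - tent ℓ n ≤ n.natAbs / ℓ := by
  have := le_max_right 0 (1 - (n.natAbs : ℝ) / ℓ)
  unfold tent; linarith

theorem tent_eq_zero (hℓ : 0 < ℓ) {n : ℤ} (h : ℓ ≤ n.natAbs) : tent ℓ n = 0 := by
  refine max_eq_left (sub_nonpos.mpr ?_)
  rw [one_le_div (by exact_mod_cast hℓ)]
  exact_mod_cast h

theorem abs_tent_sub_le (hℓ : 0 < ℓ) {n n' : ℤ} (h : (n - n').natAbs ≤ 1) :
    |tent ℓ n - tent ℓ n'| ≤ 1 / ℓ := by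
  refine (abs_max_sub_max_le_max _ _ _ _).trans ?_
  have hℓ' : (0 : ℝ) < ℓ := by exact_mod_cast hℓ
  rw [sub_self, abs_zero, sub_sub_sub_cancel_left, ← sub_div, abs_div, abs_of_pos hℓ']
  refine max_le (by positivity) (div_le_div_of_nonneg_right ?_ hℓ'.le)
  have h1 : n'.natAbs ≤ n.natAbs + 1 := by omega
  have h2 : n.natAbs ≤ n'.natAbs + 1 := by omega
  rw [abs_le]
  have h1' : (n'.natAbs : ℝ) ≤ n.natAbs + 1 := by exact_mod_cast h1
  have h2' : (n.natAbs : ℝ) ≤ n'.natAbs + 1 := by exact_mod_cast h2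
  constructor <;> linarith

end Sums

namespace HypChain

variable {M : ℕ} (P : HypChain M) {𝕜 : Type} [RCLike 𝕜]

/-- The fourth root of the decay rate `θ`. -/
noncomputable def β : ℝ := √(√P.θ)

theorem β_pos : 0 < P.β := Real.sqrt_pos.mpr (Real.sqrt_pos.mpr P.θ_pos)

theorem β_lt_one : P.β < 1 := by
  have h := P.θ_lt_one
  rw [β, Real.sqrt_lt' one_pos, one_pow, Real.sqrt_lt' one_pos, one_pow]
  exact h

theorem sq_sq_β : (P.β ^ 2) ^ 2 = P.θ := by
  rw [β, Real.sq_sqrt (Real.sqrt_nonneg _), Real.sq_sqrt P.θ_pos.le]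

theorem ρ_pos : 0 < P.β ^ 2 := pow_pos P.β_pos 2

theorem ρ_lt_one : P.β ^ 2 < 1 := pow_lt_one₀ P.β_pos.le P.β_lt_one two_ne_zero

namespace IsPulse

variable {P} {q : ℤ → X ℝ M} (hq : P.IsPulse q)
include hq

/-- A common constant for the decay of a pulse and of its time derivative. -/
theorem exists_decay : ∃ Q, 0 < Q ∧ (∀ n : ℤ, ‖q n‖ ≤ Q * ((P.β ^ 2) ^ 2) ^ n.natAbs) ∧
    ∀ n : ℤ, ‖dt P.T (q n)‖ ≤ Q * ((P.β ^ 2) ^ 2) ^ n.natAbs := by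
  obtain ⟨C, hC0, hC⟩ := hq.decay
  obtain ⟨D, hD0, hD⟩ := hq.exists_dt_decay
  have hθ := P.θ_pos
  rw [P.sq_sq_β]
  refine ⟨C + D + 1, by positivity, fun n => (hC n).trans ?_, fun n => (hD n).trans ?_⟩ <;>
  · gcongr; linarith

omit hq in
/-- Localization near the `i`-th center: multiplication of a sequence by a tent turns the bordered
equation about a superposition of pulses into that about a single pulse, up to small errors. -/
theorem localized_bound {C₁ : ℝ} (hC₁ : ∀ (w : Seq (X 𝕜 M)) (b : 𝕜) (A : ℝ),
      (∀ n, ‖P.lin q w n - b • lift 𝕜 (dt P.T (q n))‖ ≤ A) →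
      ‖pairing (fun n => dt P.T (q n)) w‖ ≤ A → ‖w‖ ≤ C₁ * A ∧ ‖b‖ ≤ C₁ * A)
    {Q : ℝ} (hQ : ∀ n : ℤ, ‖dt P.T (q n)‖ ≤ Q * ((P.β ^ 2) ^ 2) ^ n.natAbs) (hQ0 : 0 < Q)
    {m ℓ : ℕ} (hℓ : 0 < ℓ) {s : Fin m → ℤ} {σ : Fin m → ℝ} (hσ : ∀ i, σ i = 1 ∨ σ i = -1)
    {u : ℤ → X ℝ M} {w : Seq (X 𝕜 M)} {b : Fin m → 𝕜} {A ε₁ ε₂ : ℝ} (hε₁ : 0 ≤ ε₁) (hε₂ : 0 ≤ ε₂)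
    (i : Fin m)
    (h₁ : ∀ n : ℤ, n.natAbs < ℓ → ‖P.B 𝕜 (u (n + s i)) - P.B 𝕜 (q n)‖ ≤ ε₁)
    (h₂ : ∀ n : ℤ, n.natAbs < ℓ →
      ‖∑ j, b j • lift 𝕜 (σ j • dt P.T (q (n + s i - s j)))
        - b i • lift 𝕜 (σ i • dt P.T (q n))‖ ≤ ε₂ * ‖b‖)
    (hA : ∀ n, ‖P.lin u w n - ∑ j, b j • lift 𝕜 (σ j • dt P.T (q (n - s j)))‖ ≤ A)
    (hA' : ‖pairing (fun n => σ i • dt P.T (q (n - s i))) w‖ ≤ A) :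
    (∀ n : ℤ, tent ℓ n * ‖w (n + s i)‖ ≤ C₁ * (A + ((2 * P.d + Q * (1 - P.β ^ 2)⁻¹ +
        Q * (1 - P.β ^ 2)⁻¹ * (2 / (1 - P.β ^ 2))) / ℓ + ε₁ + ε₂) * (‖w‖ + ‖b‖))) ∧
      ‖b i‖ ≤ C₁ * (A + ((2 * P.d + Q * (1 - P.β ^ 2)⁻¹ +
        Q * (1 - P.β ^ 2)⁻¹ * (2 / (1 - P.β ^ 2))) / ℓ + ε₁ + ε₂) * (‖w‖ + ‖b‖)) := by
  have hd := P.d_pos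
  have hρ0 := P.ρ_pos
  have hρ1 := P.ρ_lt_one
  have hℓ' : (0 : ℝ) < ℓ := by exact_mod_cast hℓ
  set ρ := P.β ^ 2 with hρ
  set K := (1 - ρ)⁻¹ with hK
  have hK0 : 0 < K := inv_pos.mpr (by linarith)
  have hK2 : 0 < 2 / (1 - ρ) := div_pos two_pos (by linarith)
  have hσ1 : ‖(σ i : 𝕜)‖ = 1 := by
    rcases hσ i with h | h <;> simp [h]
  have hA0 : 0 ≤ A := (norm_nonneg _).trans hA'
  set wi : Seq (X 𝕜 M) := mkSeq (fun n => (tent ℓ n : 𝕜) • w (n + s i)) ⟨‖w‖, fun n => by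
    rw [norm_smul, RCLike.norm_ofReal, abs_of_nonneg (tent_nonneg n)]
    exact (mul_le_of_le_one_left (norm_nonneg _) (tent_le_one n)).trans (w.norm_apply_le _)⟩ with hwi
  have hwin : ∀ n, wi n = (tent ℓ n : 𝕜) • w (n + s i) := fun n => rfl
  have hkρ : ∀ n : ℤ, (n.natAbs : ℝ) * (ρ ^ 2) ^ n.natAbs ≤ K * ρ ^ n.natAbs := fun n => by
    rw [← pow_mul, mul_comm 2, pow_mul, sq, ← mul_assoc]
    exact mul_le_mul_of_nonneg_right (natCast_mul_pow_le hρ0 hρ1 _) (by positivity)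
  have hte : ∀ n : ℤ, (1 - tent ℓ n) * ‖dt P.T (q n)‖ ≤ Q * K / ℓ * ρ ^ n.natAbs := fun n =>
    calc (1 - tent ℓ n) * ‖dt P.T (q n)‖ ≤ n.natAbs / ℓ * (Q * (ρ ^ 2) ^ n.natAbs) := by
          refine mul_le_mul (one_sub_tent_le n) (hQ n) (norm_nonneg _) (by positivity)
      _ = Q / ℓ * (n.natAbs * (ρ ^ 2) ^ n.natAbs) := by ring
      _ ≤ Q / ℓ * (K * ρ ^ n.natAbs) := mul_le_mul_of_nonneg_left (hkρ n) (by positivity)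
      _ = _ := by ring
  have key := hC₁ wi (σ i * b i) (A + ((2 * P.d + Q * K + Q * K * (2 / (1 - ρ))) / ℓ + ε₁ + ε₂)
      * (‖w‖ + ‖b‖)) (fun n => ?_) ?_
  · refine ⟨fun n => ?_, ?_⟩
    · have := (wi.norm_apply_le n).trans key.1
      rwa [hwin, norm_smul, RCLike.norm_ofReal, abs_of_nonneg (tent_nonneg n)] at this
    · have := key.2
      rwa [norm_mul, hσ1, one_mul] at this
  · set f := P.lin u w (n + s i) - ∑ j, b j • lift 𝕜 (σ j • dt P.T (q (n + s i - s j))) with hf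
    set g := ∑ j, b j • lift 𝕜 (σ j • dt P.T (q (n + s i - s j)))
        - b i • lift 𝕜 (σ i • dt P.T (q n)) with hg
    have hfA : ‖f‖ ≤ A := hA (n + s i)
    have hsmul : (σ i * b i) • lift 𝕜 (dt P.T (q n)) = b i • lift 𝕜 (σ i • dt P.T (q n)) := by
      rw [map_smul, mul_comm, mul_smul, RCLike.real_smul_eq_coe_smul (K := 𝕜)]
    have hdec : P.lin q wi n - (σ i * b i) • lift 𝕜 (dt P.T (q n))
        = (tent ℓ n : 𝕜) • f + (P.d : 𝕜) • ((((tent ℓ (n + 1) - tent ℓ n : ℝ) : 𝕜) • w (n + s i + 1))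
          + ((tent ℓ (n - 1) - tent ℓ n : ℝ) : 𝕜) • w (n + s i - 1))
          + (tent ℓ n : 𝕜) • (P.B 𝕜 (u (n + s i)) - P.B 𝕜 (q n)) (w (n + s i))
          + (tent ℓ n : 𝕜) • g - ((1 - tent ℓ n : ℝ) : 𝕜) • (b i • lift 𝕜 (σ i • dt P.T (q n))) := by
      rw [hsmul, hf, hg, Chain.lin, Chain.lin, hwin, hwin, hwin, map_smul, sub_apply,
        show n + 1 + s i = n + s i + 1 by ring, show n - 1 + s i = n + s i - 1 by ring]
      push_cast
      module
    rw [hdec]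
    have htn : ‖(tent ℓ n : 𝕜)‖ ≤ 1 := by
      rw [RCLike.norm_ofReal, abs_of_nonneg (tent_nonneg n)]; exact tent_le_one n
    have t1 : ‖(tent ℓ n : 𝕜) • f‖ ≤ A := by
      rw [norm_smul]
      exact (mul_le_of_le_one_left (norm_nonneg _) htn).trans hfA
    have t2 : ‖(P.d : 𝕜) • ((((tent ℓ (n + 1) - tent ℓ n : ℝ) : 𝕜) • w (n + s i + 1))
          + ((tent ℓ (n - 1) - tent ℓ n : ℝ) : 𝕜) • w (n + s i - 1))‖ ≤ 2 * P.d / ℓ * ‖w‖ := by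
      rw [norm_smul, RCLike.norm_ofReal, abs_of_pos hd]
      have e1 := abs_tent_sub_le hℓ (n := n + 1) (n' := n) (by omega)
      have e2 := abs_tent_sub_le hℓ (n := n - 1) (n' := n) (by omega)
      have : ‖(((tent ℓ (n + 1) - tent ℓ n : ℝ) : 𝕜) • w (n + s i + 1))
          + ((tent ℓ (n - 1) - tent ℓ n : ℝ) : 𝕜) • w (n + s i - 1)‖ ≤ 1 / ℓ * ‖w‖ + 1 / ℓ * ‖w‖ := by
        refine norm_add_le_of_le ?_ ?_ <;> rw [norm_smul, RCLike.norm_ofReal]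
        · exact mul_le_mul e1 (w.norm_apply_le _) (norm_nonneg _) (by positivity)
        · exact mul_le_mul e2 (w.norm_apply_le _) (norm_nonneg _) (by positivity)
      calc _ ≤ P.d * (1 / ℓ * ‖w‖ + 1 / ℓ * ‖w‖) := mul_le_mul_of_nonneg_left this hd.le
        _ = _ := by ring
    have t3 : ‖(tent ℓ n : 𝕜) • (P.B 𝕜 (u (n + s i)) - P.B 𝕜 (q n)) (w (n + s i))‖ ≤ ε₁ * ‖w‖ := by
      by_cases hn : n.natAbs < ℓ
      · rw [norm_smul]
        refine (mul_le_of_le_one_left (norm_nonneg _) htn).trans ?_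
        exact ContinuousLinearMap.le_of_opNorm_le_of_le _ (h₁ n hn) (w.norm_apply_le _)
      · rw [tent_eq_zero hℓ (not_lt.mp hn), RCLike.ofReal_zero, zero_smul, norm_zero]
        positivity
    have t4 : ‖(tent ℓ n : 𝕜) • g‖ ≤ ε₂ * ‖b‖ := by
      by_cases hn : n.natAbs < ℓ
      · rw [norm_smul]
        exact (mul_le_of_le_one_left (norm_nonneg _) htn).trans (h₂ n hn)
      · rw [tent_eq_zero hℓ (not_lt.mp hn), RCLike.ofReal_zero, zero_smul, norm_zero]
        positivity
    have t5 : ‖((1 - tent ℓ n : ℝ) : 𝕜) • (b i • lift 𝕜 (σ i • dt P.T (q n)))‖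
        ≤ Q * K / ℓ * ‖b‖ := by
      rw [← hsmul, norm_smul, norm_smul, RCLike.norm_ofReal,
        abs_of_nonneg (sub_nonneg.mpr (tent_le_one n)), norm_lift, norm_mul, hσ1, one_mul,
        mul_left_comm, mul_comm]
      refine mul_le_mul ((hte n).trans ?_) (norm_le_pi_norm b i) (norm_nonneg _) (by positivity)
      exact mul_le_of_le_one_right (by positivity) (pow_le_one₀ hρ0.le hρ1.le)
    refine (norm_sub_le_of_le (norm_add_le_of_le (norm_add_le_of_le (norm_add_le_of_le t1 t2) t3)
      t4) t5).trans ?_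
    have hw := norm_nonneg w
    have hb := norm_nonneg b
    have e1 : 0 ≤ 2 * P.d / ℓ * ‖b‖ := by positivity
    have e2 : 0 ≤ Q * K / ℓ * ‖w‖ := by positivity
    have e3 : 0 ≤ Q * K * (2 / (1 - ρ)) / ℓ * (‖w‖ + ‖b‖) := by positivity
    have e4 := mul_nonneg hε₁ hb
    have e5 := mul_nonneg hε₂ hw
    simp only [add_div]
    linarith
  · have hdt : Summable fun n => ‖dt P.T (q n)‖ := by
      have := (summable_pow_natAbs (x := ρ ^ 2) (by positivity) (by nlinarith) 0).mul_left Q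
      simp only [sub_zero] at this
      exact .of_nonneg_of_le (fun n => norm_nonneg _) hQ this
    have e1 : pairing (fun n => σ i • dt P.T (q (n - s i))) w
        = σ i * pairing (fun n => dt P.T (q n)) fun n => w (n + s i) := by
      rw [← pairing_comp_sub (fun n => dt P.T (q n)) (fun n => w (n + s i)) (s i), ← pairing_smul]
      refine tsum_congr fun n => ?_
      rw [dotp_smul_left, dotp_smul_right, sub_add_cancel]
    set v : Seq (X 𝕜 M) := shiftSeq 𝕜 (s i) w with hv
    have e2 : wi = v + (wi - v) := by abel
    have e3 : ‖pairing (fun n => dt P.T (q n)) v‖ ≤ A := by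
      rw [e1, norm_mul, hσ1, one_mul] at hA'
      exact hA'
    have e4 : ‖pairing (fun n => dt P.T (q n)) (wi - v)‖ ≤ Q * K * (2 / (1 - ρ)) / ℓ * ‖w‖ := by
      have hsum := (summable_pow_natAbs hρ0 hρ1 0).mul_left (Q * K / ℓ * ‖w‖)
      simp only [sub_zero] at hsum
      refine (norm_pairing_le_of_le hsum fun n => ?_).trans ?_
      · have : (wi - v) n = -(((1 - tent ℓ n : ℝ) : 𝕜) • w (n + s i)) := by
          rw [BoundedContinuousFunction.coe_sub, Pi.sub_apply, hwin, hv, shiftSeq_apply]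
          push_cast
          module
        rw [this, norm_neg, norm_smul, RCLike.norm_ofReal,
          abs_of_nonneg (sub_nonneg.mpr (tent_le_one n))]
        calc _ = (1 - tent ℓ n) * ‖dt P.T (q n)‖ * ‖w (n + s i)‖ := by ring
          _ ≤ Q * K / ℓ * ρ ^ n.natAbs * ‖w‖ :=
            mul_le_mul (hte n) (w.norm_apply_le _) (norm_nonneg _) (by positivity)
          _ = _ := by ring
      · rw [tsum_mul_left]
        have h3 := tsum_pow_natAbs_le hρ0 hρ1 0
        simp only [sub_zero] at h3
        refine (mul_le_mul_of_nonneg_left h3 (by positivity)).trans (le_of_eq (by ring))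
    rw [e2, pairing_add hdt]
    refine (norm_add_le_of_le e3 e4).trans ?_
    have hw := norm_nonneg w
    have hb := norm_nonneg b
    have e5 : 0 ≤ 2 * P.d / ℓ * (‖w‖ + ‖b‖) := by positivity
    have e6 : 0 ≤ Q * K / ℓ * (‖w‖ + ‖b‖) := by positivity
    have e7 : 0 ≤ Q * K * (2 / (1 - ρ)) / ℓ * ‖b‖ := by positivity
    have e8 := mul_nonneg (add_nonneg hε₁ hε₂) (add_nonneg hw hb)
    simp only [add_div]
    linarith

end IsPulse

end HypChain

/-! ### A uniform bound for the bordered linearization about a superposition -/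

namespace HypChain
namespace IsPulse

variable {M : ℕ} {P : HypChain M} {q : ℤ → X ℝ M} (hq : P.IsPulse q)
include hq

set_option maxHeartbeats 600000 in
/-- The bordered linearization about a superposition of separated pulses is bounded from below,
uniformly in the number of pulses. Near each center this follows from the estimate for a single
pulse, away from the centers from the domination of the diagonal part. -/
theorem exists_bordered_bound (𝕜 : Type) [RCLike 𝕜] : ∃ (C η : ℝ) (L₀ : ℕ), 0 < C ∧ 0 < η ∧ 1 ≤ L₀ ∧
    ∀ {m : ℕ} [NeZero m] (L : ℕ) (s : Fin m → ℤ) (σ : Fin m → ℝ) (u : ℤ → X ℝ M), L₀ ≤ L →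
      Separated L s → (∀ i, σ i = 1 ∨ σ i = -1) →
      (∀ n, ‖u n - ∑ i, σ i • q (n - s i)‖ ≤ η) →
      ∀ (w : Seq (X 𝕜 M)) (b : Fin m → 𝕜) (A : ℝ),
        (∀ n, ‖P.lin u w n - ∑ j, b j • lift 𝕜 (σ j • dt P.T (q (n - s j)))‖ ≤ A) →
        (∀ i, ‖pairing (fun n => σ i • dt P.T (q (n - s i))) w‖ ≤ A) →
        ‖w‖ ≤ C * A ∧ ‖b‖ ≤ C * A := by
  have hd := P.d_pos
  have hρ0 := P.ρ_pos
  have hρ1 := P.ρ_lt_one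
  obtain ⟨C₁, hC₁0, hC₁, -⟩ := hq.exists_single_inverse 𝕜
  obtain ⟨Q, hQ0, hQ, hQ'⟩ := hq.exists_decay
  obtain ⟨ε, γ, hε, hγ, hdom⟩ := P.exists_dominant 𝕜
  set ρ := P.β ^ 2 with hρ
  have hG := geomC_pos hρ0 hρ1
  set G := geomC ρ with hGdef
  obtain ⟨Λ, hΛ0, hΛ⟩ := P.exists_B_lipschitz 𝕜 M (1 + Q * (1 + G))
  have hγ0 : 0 < γ := by linarith
  have hκ : 0 < 1 - 2 * P.d / γ := by rw [sub_pos, div_lt_one hγ0]; exact hγ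
  set D := (2 * C₁ + 1 / γ) / (1 - 2 * P.d / γ) + C₁ with hD
  have hD0 : 0 < D := by positivity
  set t := min ε (1 / (2 * D)) with ht
  have ht0 : 0 < t := by positivity
  have ht2 : t * (2 * D) ≤ 1 := by
    rw [← le_div_iff₀ (by positivity)]; exact min_le_right _ _
  set c₀ := 2 * P.d + Q * (1 - ρ)⁻¹ + Q * (1 - ρ)⁻¹ * (2 / (1 - ρ)) with hc₀
  have hlim : ∀ c : ℝ, Tendsto (fun k : ℕ => c * ρ ^ k) atTop (𝓝 0) := fun c => by
    simpa using (tendsto_pow_atTop_nhds_zero_of_lt_one hρ0.le hρ1).const_mul c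
  have hlim' : Tendsto (fun k : ℕ => c₀ / ((2 * k : ℕ) : ℝ)) atTop (𝓝 0) := by
    refine tendsto_const_nhds.div_atTop ?_
    exact tendsto_natCast_atTop_atTop.comp (tendsto_id.const_mul_atTop' two_pos)
  have hev : ∀ {f : ℕ → ℝ}, Tendsto f atTop (𝓝 0) → ∀ᶠ k in atTop, f k ≤ t / 4 := fun h =>
    (h.eventually (gt_mem_nhds (by positivity : (0 : ℝ) < t / 4))).mono fun _ => le_of_lt
  obtain ⟨k, hk1, hk2, hk3, hk4, hk5⟩ := ((hev hlim').and ((hev (hlim (Λ * (Q * G)))).and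
    ((hev (hlim (Q * G))).and ((hev (hlim Q)).and (eventually_ge_atTop 1))))).exists
  refine ⟨2 * D, min 1 (min (t / 4) (t / (4 * Λ))), 4 * k, by positivity, by positivity, by omega,
    fun {m} _ L s σ u hL hs hσ hu w b A hA hA' => ?_⟩
  have hL1 : 1 ≤ L := by omega
  have hA0 : 0 ≤ A := (norm_nonneg _).trans (hA 0)
  have hnear : ∀ (i : Fin m) (n : ℤ), n.natAbs < 2 * k →
      ∀ j, (s i - s j).natAbs ≤ 2 * (n + s i - s j).natAbs := by
    intro i n hn j
    by_cases hij : i = j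
    · subst hij; omega
    · have h1 := hs i j
      have h2 : 1 ≤ ((i : ℤ) - (j : ℤ)).natAbs := by
        have : (i : ℕ) ≠ j := fun h => hij (Fin.ext h)
        omega
      have h3 : L ≤ (s i - s j).natAbs := by nlinarith
      omega
  have hρL : ρ ^ L ≤ ρ ^ k := pow_le_pow_of_le_one hρ0.le hρ1.le (by omega)
  have hσn : ∀ i (v : X ℝ M), ‖σ i • v‖ = ‖v‖ := fun i v => by
    rw [norm_smul]; rcases hσ i with h | h <;> simp [h]
  have hqf : ∀ n j, ‖σ j • q (n - s j)‖ ≤ Q * (ρ ^ 2) ^ (n - s j).natAbs := fun n j => by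
    rw [hσn]; exact hQ _
  have hef : ∀ n j, ‖b j • lift 𝕜 (σ j • dt P.T (q (n - s j)))‖
      ≤ ‖b‖ * Q * (ρ ^ 2) ^ (n - s j).natAbs := fun n j => by
    rw [norm_smul, norm_lift, hσn, mul_assoc]
    exact mul_le_mul (norm_le_pi_norm b j) (hQ' _) (norm_nonneg _) (norm_nonneg _)
  have hηΛ : Λ * min 1 (min (t / 4) (t / (4 * Λ))) ≤ t / 4 := by
    have : min 1 (min (t / 4) (t / (4 * Λ))) ≤ t / (4 * Λ) :=
      (min_le_right _ _).trans (min_le_right _ _)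
    calc _ ≤ Λ * (t / (4 * Λ)) := mul_le_mul_of_nonneg_left this hΛ0.le
      _ = _ := by field_simp
  have hη1 : min 1 (min (t / 4) (t / (4 * Λ))) ≤ 1 := min_le_left _ _
  have hη2 : min 1 (min (t / 4) (t / (4 * Λ))) ≤ t / 4 := (min_le_right _ _).trans (min_le_left _ _)
  have hη0 : 0 < min 1 (min (t / 4) (t / (4 * Λ))) := by positivity
  generalize min 1 (min (t / 4) (t / (4 * Λ))) = η at hu hηΛ hη1 hη2 hη0
  have huR : ∀ n, ‖u n‖ ≤ 1 + Q * (1 + G) := fun n => by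
    have h1 := hs.norm_sum_le hρ0 hρ1 hL1 hQ0.le (hqf n)
    have h2 := norm_le_norm_add_norm_sub' (u n) (∑ i, σ i • q (n - s i))
    linarith [hu n]
  have hsmall : Q * (G * ρ ^ L) ≤ Q * G * ρ ^ k := by
    rw [mul_assoc]; gcongr
  -- Within distance `2 k` of the center `i`, the superposition is close to a single pulse. The slope of
  -- the cutoff contributes the error `c₀ / (2 k)`.
  have hloc := fun i => localized_bound hC₁ hQ' hQ0 (ℓ := 2 * k) (by omega) hσ (u := u) (w := w)
    (b := b) (A := A) (ε₁ := t / 2) (ε₂ := t / 4) (by positivity) (by positivity) i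
    (fun n hn => by
      have h1 := hs.norm_sum_sub_le i hρ0 hρ1 hL1 (hnear i n hn) hQ0.le (hqf (n + s i))
      rw [add_sub_cancel_right] at h1
      have h2 : P.B 𝕜 (q n) = P.B 𝕜 (σ i • q n) := by
        rcases hσ i with h | h
        · rw [h, one_smul]
        · rw [h, neg_smul, one_smul, P.B_neg]
      have hqR : ‖σ i • q n‖ ≤ 1 + Q * (1 + G) := by
        rw [hσn]
        refine (hQ n).trans ?_
        have : Q * (ρ ^ 2) ^ n.natAbs ≤ Q :=
          mul_le_of_le_one_right hQ0.le (pow_le_one₀ (by positivity) (by nlinarith))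
        nlinarith
      rw [h2]
      refine (hΛ _ _ (huR _) hqR).trans ?_
      have h3 := norm_sub_le_norm_sub_add_norm_sub (u (n + s i)) (∑ j, σ j • q (n + s i - s j))
        (σ i • q n)
      have h4 := hu (n + s i)
      calc Λ * ‖u (n + s i) - σ i • q n‖ ≤ Λ * (η + Q * G * ρ ^ k) := by gcongr; linarith
        _ = Λ * η + Λ * (Q * G) * ρ ^ k := by ring
        _ ≤ t / 2 := by linarith)
    (fun n hn => by
      have h1 := hs.norm_sum_sub_le i hρ0 hρ1 hL1 (hnear i n hn) (by positivity) (hef (n + s i))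
      rw [add_sub_cancel_right] at h1
      refine h1.trans ?_
      calc ‖b‖ * Q * (G * ρ ^ L) = ‖b‖ * (Q * (G * ρ ^ L)) := by ring
        _ ≤ ‖b‖ * (t / 4) := by gcongr; linarith
        _ = _ := by ring)
    hA (hA' i)
  have hcoef : c₀ / ((2 * k : ℕ) : ℝ) + t / 2 + t / 4 ≤ t := by linarith
  set Y := A + t * (‖w‖ + ‖b‖) with hY
  have hwb : 0 ≤ ‖w‖ + ‖b‖ := by positivity
  have hY0 : 0 ≤ Y := by positivity
  have hYle : A + (c₀ / ((2 * k : ℕ) : ℝ) + t / 2 + t / 4) * (‖w‖ + ‖b‖) ≤ Y := by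
    rw [hY]; gcongr
  have hb : ‖b‖ ≤ C₁ * Y := (pi_norm_le_iff_of_nonneg (by positivity)).mpr fun i =>
    (hloc i).2.trans (mul_le_mul_of_nonneg_left hYle hC₁0.le)
  have hk0 : (0 : ℝ) < k := by exact_mod_cast hk5
  have hpt : ∀ n, ‖w n‖ ≤ 2 * P.d / γ * ‖w‖ + (2 * C₁ + 1 / γ) * Y := by
    intro n
    obtain ⟨i, hi⟩ := exists_nearest s n
    have hκ' : 0 ≤ 2 * P.d / γ * ‖w‖ := by positivity
    rcases le_or_gt (n - s i).natAbs k with hn | hn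
    -- Within distance `k` of the nearest center, the cutoff is at least one half.
    · have h1 := (hloc i).1 (n - s i)
      rw [sub_add_cancel] at h1
      have h2 : 1 / 2 ≤ tent (2 * k) (n - s i) := by
        have h3 := one_sub_tent_le (ℓ := 2 * k) (n - s i)
        have h4 : ((n - s i).natAbs : ℝ) / ((2 * k : ℕ) : ℝ) ≤ 1 / 2 := by
          push_cast
          rw [div_le_div_iff₀ (by positivity) two_pos]
          have : ((n - s i).natAbs : ℝ) ≤ k := by exact_mod_cast hn
          linarith
        linarith
      have h5 := h1.trans (mul_le_mul_of_nonneg_left hYle hC₁0.le)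
      have h6 : 0 ≤ 1 / γ * Y := by positivity
      have h7 := mul_le_mul_of_nonneg_right h2 (norm_nonneg (w n))
      linarith
    -- Far from all centers, `u n` is small, so that the equation bounds `w n` by `2 d / γ < 1` times
    -- the norm of `w`, which can be absorbed.
    · have hqθ : Q * (ρ ^ 2) ^ (n - s i).natAbs ≤ Q * ρ ^ k := by
        refine mul_le_mul_of_nonneg_left ?_ hQ0.le
        rw [← pow_mul]
        exact pow_le_pow_of_le_one hρ0.le hρ1.le (by omega)
      have h1 := hs.norm_sum_sub_le i hρ0 hρ1 hL1 hi hQ0.le (hqf n)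
      have h2 := hs.norm_sum_sub_le i hρ0 hρ1 hL1 hi (by positivity) (hef n)
      have h3 : ‖u n‖ ≤ ε := by
        have h4 := norm_le_norm_add_norm_sub' (u n) (∑ i, σ i • q (n - s i))
        have h5 := norm_le_norm_add_norm_sub' (∑ i, σ i • q (n - s i)) (σ i • q (n - s i))
        have h6 := hqf n i
        have h7 : t ≤ ε := min_le_left _ _
        linarith [hu n]
      have h4 : ‖∑ j, b j • lift 𝕜 (σ j • dt P.T (q (n - s j)))‖ ≤ ‖b‖ * t := by
        have h5 := norm_le_norm_add_norm_sub' (∑ j, b j • lift 𝕜 (σ j • dt P.T (q (n - s j))))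
          (b i • lift 𝕜 (σ i • dt P.T (q (n - s i))))
        have h6 := hef n i
        have h7 : ‖b‖ * Q * (G * ρ ^ L) ≤ ‖b‖ * (t / 4) := by
          rw [mul_assoc]; gcongr; linarith
        have h8 : ‖b‖ * Q * (ρ ^ 2) ^ (n - s i).natAbs ≤ ‖b‖ * (t / 4) := by
          rw [mul_assoc]; gcongr; linarith
        have h9 : 0 ≤ ‖b‖ * t := by positivity
        linarith
      have h5 := hdom (u n) 0 h3 (by simpa using hε.le) (w n)
      rw [add_zero] at h5
      have h6 : P.B 𝕜 (u n) (w n) = (P.d : 𝕜) • (w (n + 1) + w (n - 1))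
          - (P.lin u w n - ∑ j, b j • lift 𝕜 (σ j • dt P.T (q (n - s j))))
          - ∑ j, b j • lift 𝕜 (σ j • dt P.T (q (n - s j))) := by rw [Chain.lin]; abel
      have h7 : ‖(P.d : 𝕜) • (w (n + 1) + w (n - 1))‖ ≤ P.d * (‖w‖ + ‖w‖) := by
        rw [norm_smul, RCLike.norm_ofReal, abs_of_pos hd]
        exact mul_le_mul_of_nonneg_left (norm_add_le_of_le (w.norm_apply_le _)
          (w.norm_apply_le _)) hd.le
      have h8 : γ * ‖w n‖ ≤ P.d * (‖w‖ + ‖w‖) + A + ‖b‖ * t := by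
        rw [h6] at h5
        exact h5.trans (norm_sub_le_of_le (norm_sub_le_of_le h7 (hA n)) h4)
      have h9 : ‖w n‖ ≤ 2 * P.d / γ * ‖w‖ + 1 / γ * (A + ‖b‖ * t) := by
        rw [← mul_le_mul_iff_right₀ hγ0]
        refine h8.trans (le_of_eq ?_)
        field_simp
        ring
      have h10 : A + ‖b‖ * t ≤ Y := by
        have := mul_nonneg ht0.le (norm_nonneg w)
        rw [hY]; linarith
      have h11 : 1 / γ * (A + ‖b‖ * t) ≤ 1 / γ * Y := by gcongr
      have h12 : 0 ≤ 2 * C₁ * Y := by positivity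
      linarith
  have hw := Seq.norm_le (by positivity) hpt
  have hw' : ‖w‖ ≤ (2 * C₁ + 1 / γ) / (1 - 2 * P.d / γ) * Y := by
    rw [div_mul_eq_mul_div, le_div_iff₀ hκ]; linarith
  have hsum : ‖w‖ + ‖b‖ ≤ D * Y := by rw [hD, add_mul]; linarith
  -- The choice of `t` makes the error terms at most half of the left-hand side.
  have hfin : ‖w‖ + ‖b‖ ≤ 2 * D * A := by
    have : D * Y = D * A + (t * (2 * D)) * (‖w‖ + ‖b‖) / 2 := by rw [hY]; ring
    have h1 := mul_le_mul_of_nonneg_right ht2 hwb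
    linarith
  exact ⟨by linarith [norm_nonneg b], by linarith [norm_nonneg w]⟩

end IsPulse
end HypChain

/-! ### The derivative with respect to the frequency -/

namespace HypChain

section Weighted

variable {M : ℕ} {ρ : ℝ}

/-- The weighted sequence `ρ ^ |n| x_n` of a bounded sequence, as a square summable sequence. -/
noncomputable def weightL (M : ℕ) (h0 : 0 < ρ) (h1 : ρ < 1) :
    Seq (X ℝ M) →L[ℝ] lp (fun _ : ℤ => X ℝ M) 2 :=
  have key : ∀ (x : Seq (X ℝ M)) (S : Finset ℤ),
      ∑ n ∈ S, ‖ρ ^ n.natAbs • x n‖ ^ (2 : ENNReal).toReal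
        ≤ (√(2 / (1 - ρ ^ 2)) * ‖x‖) ^ (2 : ENNReal).toReal := fun x S => by
    have h2 : ρ ^ 2 < 1 := by nlinarith
    have h3 : 0 < 1 - ρ ^ 2 := by linarith
    simp only [ENNReal.toReal_ofNat, Real.rpow_ofNat]
    rw [mul_pow, Real.sq_sqrt (by positivity)]
    have hs := summable_pow_natAbs (x := ρ ^ 2) (by positivity) h2 0
    have ht := tsum_pow_natAbs_le (x := ρ ^ 2) (by positivity) h2 0
    simp only [sub_zero] at hs ht
    refine le_trans ?_ (mul_le_mul_of_nonneg_right ((hs.sum_le_tsum S fun n _ => by positivity).trans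
      ht) (sq_nonneg _))
    rw [Finset.sum_mul]
    refine Finset.sum_le_sum fun n _ => ?_
    rw [norm_smul, mul_pow, Real.norm_of_nonneg (by positivity), ← pow_mul, ← pow_mul, mul_comm 2]
    gcongr
    exact x.norm_apply_le n
  LinearMap.mkContinuous
    { toFun := fun x => ⟨fun n => ρ ^ n.natAbs • x n, memℓp_gen' (key x)⟩
      map_add' := fun x y => by ext1; funext n; exact smul_add _ _ _
      map_smul' := fun c x => by ext1; funext n; exact smul_comm _ c _ } (√(2 / (1 - ρ ^ 2))) fun x =>
    lp.norm_le_of_forall_sum_le (by simp) (by positivity) (key x)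

@[simp] theorem weightL_apply (h0 : 0 < ρ) (h1 : ρ < 1) (x : Seq (X ℝ M)) (n : ℤ) :
    weightL M h0 h1 x n = ρ ^ n.natAbs • x n := rfl

theorem superposable_weighted (P : Chain) (h0 : 0 < ρ) (h1 : ρ < 1) : Superposable
    (fun n (x : X ℝ M) => (ρ ^ n.natAbs)⁻¹ • P.H (ρ ^ n.natAbs • x))
    fun n x => P.B ℝ (ρ ^ n.natAbs • x) := by
  have hr0 : ∀ n : ℤ, 0 < ρ ^ n.natAbs := fun n => pow_pos h0 _
  have hr1 : ∀ n : ℤ, ρ ^ n.natAbs ≤ 1 := fun n => pow_le_one₀ h0.le h1.le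
  have hn : ∀ (n : ℤ) (x : X ℝ M), ‖ρ ^ n.natAbs • x‖ = ρ ^ n.natAbs * ‖x‖ := fun n x => by
    rw [norm_smul, Real.norm_of_nonneg (hr0 n).le]
  have hle : ∀ (n : ℤ) (x : X ℝ M) (R : ℝ), ‖x‖ ≤ R → ‖ρ ^ n.natAbs • x‖ ≤ R := fun n x R h => by
    rw [hn]; exact (mul_le_of_le_one_left (norm_nonneg _) (hr1 n)).trans h
  refine ⟨fun R => ?_, ⟨0, fun n => by simp [P.H_zero]⟩, fun R => ?_⟩
  · obtain ⟨C, hC0, hC⟩ := P.exists_H_taylor M R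
    refine ⟨C, hC0, fun n u u' v hu hu' hv => ?_⟩
    have h2 := hC _ _ _ (hle n u R hu) (hle n u' R hu') (hle n v R hv)
    simp only [← smul_sub, hn, map_smul] at h2
    set r := ρ ^ n.natAbs with hr
    have hr0' : 0 < r := hr0 n
    have h3 : r⁻¹ • P.H (r • u) - r⁻¹ • P.H (r • u') - P.B ℝ (r • v) (u - u')
        = r⁻¹ • (P.H (r • u) - P.H (r • u') - r • P.B ℝ (r • v) (u - u')) := by
      rw [smul_sub, smul_sub, inv_smul_smul₀ hr0'.ne']
    rw [h3, norm_smul, Real.norm_of_nonneg (inv_pos.mpr hr0').le]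
    calc _ ≤ r⁻¹ * (C * (r * ‖u - v‖ + r * ‖u' - v‖) * (r * ‖u - u'‖)) := by gcongr
      _ = r * (C * (‖u - v‖ + ‖u' - v‖) * ‖u - u'‖) := by field_simp
      _ ≤ _ := mul_le_of_le_one_left (by positivity) (hr1 n)
  · obtain ⟨C, hC0, hC⟩ := P.exists_B_lipschitz ℝ M |R|
    refine ⟨C * |R| + ‖P.B ℝ (0 : X ℝ M)‖, fun n v hv => ?_⟩
    have h2 := hle n v |R| (hv.trans (le_abs_self R))
    have h3 := hC _ 0 h2 (by simp)
    rw [sub_zero] at h3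
    have h4 := norm_le_norm_add_norm_sub' (P.B ℝ (ρ ^ n.natAbs • v)) (P.B ℝ (0 : X ℝ M))
    nlinarith

end Weighted

namespace IsPulse

variable {M : ℕ} {P : HypChain M} {q : ℤ → X ℝ M} (hq : P.IsPulse q)
include hq

theorem tendsto_comp {g : ℕ → ℤ} (hg : Function.Injective g) :
    Tendsto (fun k => q (g k)) atTop (𝓝 0) := by
  have := hq.tendsto_cofinite.comp hg.tendsto_cofinite
  rwa [Nat.cofinite_eq_atTop] at this

/-- Bounded solutions of the linearized equation decay as fast as the forcing. -/
theorem exists_decay_of_lin {τ D : ℝ} (h0 : P.θ < τ) (h1 : τ < 1) (hD : 0 ≤ D) {w : ℤ → X ℝ M}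
    (hb : ∃ b, ∀ n, ‖w n‖ ≤ b) (hw : ∀ n, ‖P.lin q w n‖ ≤ D * τ ^ n.natAbs) :
    ∃ C, 0 ≤ C ∧ ∀ n : ℤ, ‖w n‖ ≤ C * τ ^ n.natAbs := by
  have hτ0 : 0 < τ := P.θ_pos.trans h0
  obtain ⟨b, hb⟩ := hb
  refine exists_natAbs_bound hτ0 ?_ ?_
  · refine P.forward_decay (x := fun k => q k) h0 h1 hD (hq.tendsto_comp Nat.cast_injective)
      ⟨b, fun k => hb _⟩ fun k => ?_
    have := hw k
    rw [Int.natAbs_natCast] at this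
    push_cast
    rw [show (k : ℤ) + 2 - 1 = k + 1 by ring, show (k : ℤ) + 1 - 1 = k by ring]
    exact this
  · refine P.forward_decay (x := fun k => q (-k - 1)) h0 h1 hD
      (hq.tendsto_comp fun a b h => by simpa using h) ⟨b, fun k => hb _⟩ fun k => ?_
    have h2 := hw (-k - 1)
    have h3 : τ ^ (-(k : ℤ) - 1).natAbs ≤ τ ^ k := pow_le_pow_of_le_one hτ0.le h1.le (by omega)
    push_cast
    rw [show -((k : ℤ) + 2) = -k - 1 - 1 by ring, show -((k : ℤ) + 1) = -k - 1 by ring]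
    rw [Chain.lin, sub_add_cancel, add_comm (w (-k))] at h2
    exact h2.trans (mul_le_mul_of_nonneg_left h3 hD)

set_option maxHeartbeats 1000000 in
/-- The continuation of the breather in the frequency: the implicit function theorem is applied in a
space of exponentially weighted sequences to the equation bordered by the time derivative. By
uniqueness, the solution is invariant under time reversal, which forces the multiplier of the time
derivative to vanish. -/
theorem exists_frequencyDerivative : ∃ y : ℤ → X ℝ M, IsFrequencyDerivative P.V P.d P.T q y ∧
    (∀ n, refl ℝ (y n) = y n) ∧ (∃ C, 0 < C ∧ ∀ n : ℤ, ‖y n‖ ≤ C * (P.β ^ 2) ^ n.natAbs) ∧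
    ∀ n, P.lin q y n = (2 : ℝ) • dt P.T (dt P.T (q n)) := by
  have h0 := P.ρ_pos
  have h1 := P.ρ_lt_one
  have hθρ : P.θ < P.β ^ 2 := by rw [← P.sq_sq_β]; nlinarith
  obtain ⟨Q, hQ0, hQ, hQ'⟩ := hq.exists_decay
  obtain ⟨-, -, -, hsurj⟩ := hq.exists_single_inverse ℝ
  set ρ := P.β ^ 2 with hρ
  set r : ℤ → ℝ := fun n => ρ ^ n.natAbs with hr
  have hr0 : ∀ n, 0 < r n := fun n => pow_pos h0 _
  have hr1 : ∀ n, r n ≤ 1 := fun n => pow_le_one₀ h0.le h1.le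
  have hrs : ∀ n k : ℤ, k.natAbs = 1 → (r n)⁻¹ * r (n + k) ≤ ρ⁻¹ := fun n k hk => by
    rw [inv_mul_le_iff₀ (hr0 n), ← div_eq_mul_inv, le_div_iff₀ h0, hr]
    simp only
    rw [← pow_succ]
    exact pow_le_pow_of_le_one h0.le h1.le (by omega)
  set e : ℤ → X ℝ M := fun n => dt P.T (q n) with he
  have hwd : ∀ {v : ℤ → X ℝ M}, (∀ n : ℤ, ‖v n‖ ≤ Q * (ρ ^ 2) ^ n.natAbs) →
      ∀ n, ‖(r n)⁻¹ • v n‖ ≤ Q := fun {v} hv n => by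
    rw [norm_smul, Real.norm_of_nonneg (inv_pos.mpr (hr0 n)).le, inv_mul_le_iff₀ (hr0 n), mul_comm]
    refine (hv n).trans (mul_le_mul_of_nonneg_left ?_ hQ0.le)
    exact pow_le_pow_left₀ (by positivity) (by nlinarith) _
  set x₀ : Seq (X ℝ M) := mkSeq (fun n => (r n)⁻¹ • q n) ⟨Q, hwd hQ⟩ with hx₀
  set ê : Seq (X ℝ M) := mkSeq (fun n => (r n)⁻¹ • e n) ⟨Q, hwd hQ'⟩ with hê
  have hx₀n : ∀ n, r n • x₀ n = q n := fun n => smul_inv_smul₀ (hr0 n).ne' _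
  have hên : ∀ n, r n • ê n = e n := fun n => smul_inv_smul₀ (hr0 n).ne' _
  have hsup := superposable_weighted (M := M) P.toChain h0 h1
  have hsum : Summable fun n => ‖r n • e n‖ := by
    refine .of_nonneg_of_le (fun n => norm_nonneg _) (fun n => ?_) hq.summable_dt
    rw [norm_smul, Real.norm_of_nonneg (hr0 n).le]
    exact mul_le_of_le_one_left (norm_nonneg _) (hr1 n)
  -- The shifts conjugated by the weight `ρ ^ |n|` are bounded, with coefficients at most `ρ⁻¹`.
  set c : ℤ → Seq (X ℝ M →L[ℝ] X ℝ M) := fun k => mkSeq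
    (fun n => if k.natAbs = 1 then (P.d * ((r n)⁻¹ * r (n + k))) • ContinuousLinearMap.id ℝ _ else 0)
    ⟨P.d * ρ⁻¹, fun n => by
      have hd := P.d_pos
      split_ifs with h
      · rw [norm_smul, Real.norm_of_nonneg
          (mul_nonneg hd.le (mul_nonneg (inv_pos.mpr (hr0 n)).le (hr0 _).le))]
        refine (mul_le_of_le_one_right ?_ ContinuousLinearMap.norm_id_le).trans ?_
        · exact mul_nonneg hd.le (mul_nonneg (inv_pos.mpr (hr0 n)).le (hr0 _).le)
        · exact mul_le_mul_of_nonneg_left (hrs n k h) hd.le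
      · rw [norm_zero]; positivity⟩ with hc
  set A : Seq (X ℝ M) →L[ℝ] Seq (X ℝ M) :=
    (mulSeq (c 1)).comp (shiftSeq ℝ 1) + (mulSeq (c (-1))).comp (shiftSeq ℝ (-1)) with hA
  have hAn : ∀ x n, r n • A x n = P.d • (r (n + 1) • x (n + 1) + r (n - 1) • x (n - 1)) := by
    intro x n
    have hn := (hr0 n).ne'
    have : A x n = (P.d * ((r n)⁻¹ * r (n + 1))) • x (n + 1)
        + (P.d * ((r n)⁻¹ * r (n + -1))) • x (n + -1) := by
      simp [hA, hc]
    rw [this, smul_add, smul_smul, smul_smul, smul_add, smul_smul, smul_smul, ← sub_eq_add_neg]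
    congr 2 <;> field_simp
  set D2 : Seq (X ℝ M) →L[ℝ] Seq (X ℝ M) :=
    mulSeq (mkSeq (fun _ => (dtL ℝ P.T).comp (dtL ℝ P.T)) ⟨_, fun _ => le_rfl⟩) with hD2
  have hD2n : ∀ x n, D2 x n = dt P.T (dt P.T (x n)) := fun x n => rfl
  set p2 := pairL ℝ (fun n => r n • e n) hsum with hp2
  have hp2n : ∀ x : Seq (X ℝ M), p2 x = pairing e fun n => r n • x n := fun x => by
    rw [hp2, pairL_apply, pairing, pairing]
    exact tsum_congr fun n => by
      rw [dotp_smul_left, dotp_smul_right]; rfl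
  -- In time rescaled to period `T`, a change of the frequency multiplies `∂_t²` by the square `s` of the
  -- ratio of the frequencies.
  set Ψ : ℝ × (Seq (X ℝ M) × ℝ) → Seq (X ℝ M) × ℝ := fun z =>
    (A z.2.1 - hsup.map z.2.1 - (z.1 - 1) • D2 z.2.1 - z.2.2 • ê, p2 z.2.1) with hΨ
  have hΨn : ∀ s x b n, r n • (Ψ (s, x, b)).1 n
      = P.d • (r (n + 1) • x (n + 1) + r (n - 1) • x (n - 1)) - P.H (r n • x n)
        - (s - 1) • dt P.T (dt P.T (r n • x n)) - b • e n := by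
    intro s x b n
    change r n • (A x n - (r n)⁻¹ • P.H (r n • x n) - (s - 1) • D2 x n - b • ê n) = _
    rw [smul_sub, smul_sub, smul_sub, hAn, smul_inv_smul₀ (hr0 n).ne', smul_comm (r n) b, hên,
      smul_comm (r n) (s - 1), hD2n]
    simp only [← dtL_apply, map_smul]
  have hΨ0 : Ψ (1, x₀, 0) = 0 := by
    refine Prod.ext ?_ ?_
    · ext1 n
      refine (smul_right_injective _ (hr0 n).ne') ?_
      change r n • _ = r n • (0 : X ℝ M)
      rw [hΨn, smul_zero, hx₀n, hx₀n, hx₀n, hq.eq]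
      simp
    · change p2 x₀ = 0
      rw [hp2n]
      simp only [hx₀n]
      refine pairing_eq_zero_of_parity (fun n => ?_) hq.even
      have := dt_refl P.T (q n)
      rw [hq.even] at this
      rw [he]; simp only; rw [this, neg_neg, ← this]
  set Ψ' : ℝ × (Seq (X ℝ M) × ℝ) →L[ℝ] Seq (X ℝ M) × ℝ :=
    ((A - mulSeq (hsup.deriv x₀)).comp
        ((ContinuousLinearMap.fst ℝ _ ℝ).comp (ContinuousLinearMap.snd ℝ ℝ _))
      - (ContinuousLinearMap.fst ℝ ℝ _).smulRight (D2 x₀)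
      - ((ContinuousLinearMap.snd ℝ _ ℝ).comp (ContinuousLinearMap.snd ℝ ℝ _)).smulRight ê).prod
    (p2.comp ((ContinuousLinearMap.fst ℝ _ ℝ).comp (ContinuousLinearMap.snd ℝ ℝ _))) with hΨ'
  have hΨ'n : ∀ s x b n, r n • (Ψ' (s, x, b)).1 n
      = P.lin q (fun n => r n • x n) n - s • dt P.T (dt P.T (q n)) - b • e n := by
    intro s x b n
    change r n • (A x n - P.B ℝ (r n • x₀ n) (x n) - s • D2 x₀ n - b • ê n) = _
    rw [smul_sub, smul_sub, smul_sub, hAn, hx₀n, smul_comm (r n) b, hên, smul_comm (r n) s, hD2n,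
      Chain.lin, map_smul, ← hx₀n n]
    simp only [← dtL_apply, map_smul, RCLike.ofReal_real_eq_id, id]
  have hstrict : HasStrictFDerivAt Ψ Ψ' (1, x₀, 0) := by
    have hx : HasStrictFDerivAt (fun z : ℝ × (Seq (X ℝ M) × ℝ) => z.2.1)
        ((ContinuousLinearMap.fst ℝ _ ℝ).comp (ContinuousLinearMap.snd ℝ ℝ _)) (1, x₀, 0) :=
      ((ContinuousLinearMap.fst ℝ (Seq (X ℝ M)) ℝ).comp
        (ContinuousLinearMap.snd ℝ ℝ _)).hasStrictFDerivAt
    have hb : HasStrictFDerivAt (fun z : ℝ × (Seq (X ℝ M) × ℝ) => z.2.2)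
        ((ContinuousLinearMap.snd ℝ _ ℝ).comp (ContinuousLinearMap.snd ℝ ℝ _)) (1, x₀, 0) :=
      ((ContinuousLinearMap.snd ℝ (Seq (X ℝ M)) ℝ).comp
        (ContinuousLinearMap.snd ℝ ℝ _)).hasStrictFDerivAt
    have hs : HasStrictFDerivAt (fun z : ℝ × (Seq (X ℝ M) × ℝ) => z.1 - 1)
        (ContinuousLinearMap.fst ℝ ℝ _) (1, x₀, 0) :=
      (ContinuousLinearMap.fst ℝ ℝ (Seq (X ℝ M) × ℝ)).hasStrictFDerivAt.sub_const 1
    have hH : HasStrictFDerivAt (fun z : ℝ × (Seq (X ℝ M) × ℝ) => hsup.map z.2.1) _ (1, x₀, 0) :=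
      (hsup.hasStrictFDerivAt x₀).comp (1, x₀, 0) hx
    have h := (((A.hasStrictFDerivAt.comp (1, x₀, 0) hx).sub hH).sub
      (hs.smul (D2.hasStrictFDerivAt.comp (1, x₀, 0) hx))).sub (hb.smul_const ê) |>.prodMk
      (p2.hasStrictFDerivAt.comp (1, x₀, 0) hx)
    refine h.congr_fderiv (ContinuousLinearMap.ext fun z => Prod.ext ?_ rfl)
    simp [hΨ']
  have hker : ∀ z : Seq (X ℝ M) × ℝ, Ψ' (0, z) = 0 → z = 0 := by
    rintro ⟨x, b⟩ hz
    have h2 := hq.eq_zero_of_bordered (𝕜 := ℝ) (b := b)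
      (w := mkSeq (fun n => r n • x n) ⟨‖x‖, fun n => by
        rw [norm_smul, Real.norm_of_nonneg (hr0 n).le]
        exact (mul_le_of_le_one_left (norm_nonneg _) (hr1 n)).trans (x.norm_apply_le n)⟩)
      (fun n => by
        have h3 := hΨ'n 0 x b n
        rw [hz, zero_smul, sub_zero] at h3
        have h4 : r n • (0 : Seq (X ℝ M) × ℝ).1 n = 0 := smul_zero _
        rw [h4] at h3
        rw [lift_real]
        exact (sub_eq_zero.mp h3.symm))
      (by
        have h3 : p2 x = 0 := congrArg Prod.snd hz
        rw [hp2n] at h3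
        exact h3)
    refine Prod.ext ?_ h2.2
    ext1 n
    have h3 : r n • x n = 0 := congrArg (fun v : Seq (X ℝ M) => v n) h2.1
    exact (smul_eq_zero.mp h3).resolve_left (hr0 n).ne'
  have hbij : Function.Bijective fun v : Seq (X ℝ M) × ℝ => Ψ' (0, v) := by
    constructor
    · intro v v' h
      have h2 : Ψ' (0, v) = Ψ' (0, v') := h
      have : Ψ' (0, v - v') = 0 := by
        have e : ((0 : ℝ), v - v') = (0, v) - (0, v') := by simp
        rw [e, map_sub, h2, sub_self]
      exact sub_eq_zero.mp (hker _ this)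
    · rintro ⟨f, c'⟩
      obtain ⟨w, b, hw, hw2⟩ := hsurj (mkSeq (fun n => r n • f n) ⟨‖f‖, fun n => by
        rw [norm_smul, Real.norm_of_nonneg (hr0 n).le]
        exact (mul_le_of_le_one_left (norm_nonneg _) (hr1 n)).trans (f.norm_apply_le n)⟩) c'
      simp only [lift_real, mkSeq_apply] at hw
      obtain ⟨C, hC0, hC⟩ := hq.exists_decay_of_lin (w := w) (D := ‖f‖ + |b| * Q) hθρ h1
        (by positivity) ⟨‖w‖, w.norm_apply_le⟩ fun n => by
          rw [← sub_add_cancel (P.lin q w n) (b • dt P.T (q n)), hw, add_mul]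
          refine norm_add_le_of_le ?_ ?_
          · rw [norm_smul, Real.norm_of_nonneg (hr0 n).le, mul_comm]
            exact mul_le_mul_of_nonneg_right (f.norm_apply_le n) (hr0 n).le
          · rw [norm_smul, Real.norm_eq_abs, mul_assoc]
            refine mul_le_mul_of_nonneg_left ((hQ' n).trans ?_) (abs_nonneg b)
            exact mul_le_mul_of_nonneg_left (pow_le_pow_left₀ (by positivity) (by nlinarith) _)
              hQ0.le
      set x : Seq (X ℝ M) := mkSeq (fun n => (r n)⁻¹ • w n) ⟨C, fun n => by
        rw [norm_smul, Real.norm_of_nonneg (inv_pos.mpr (hr0 n)).le, inv_mul_le_iff₀ (hr0 n),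
          mul_comm]
        exact hC n⟩ with hx
      have hxn : ∀ n, r n • x n = w n := fun n => smul_inv_smul₀ (hr0 n).ne' _
      refine ⟨(x, b), Prod.ext ?_ ?_⟩
      · ext1 n
        refine smul_right_injective _ (hr0 n).ne' ?_
        change r n • (Ψ' (0, x, b)).1 n = r n • f n
        rw [hΨ'n, zero_smul, sub_zero]
        simp only [hxn]
        exact hw n
      · change p2 x = c'
        rw [hp2n]
        simp only [hxn]
        exact hw2
  obtain ⟨ψ, ψ', hψ0, hψd, hψ', hψe, hψu⟩ := exists_implicit_curve hstrict hbij
  rw [hΨ0] at hψe hψu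
  -- Time reversal maps zeros of `Ψ` to zeros, with the opposite multiplier; by local uniqueness the
  -- curve consists of even sequences with multiplier zero.
  set J : Seq (X ℝ M) × ℝ →L[ℝ] Seq (X ℝ M) × ℝ :=
    (mulSeq (mkSeq (fun _ => refl ℝ) ⟨_, fun _ => le_rfl⟩)).prodMap (-ContinuousLinearMap.id ℝ ℝ)
    with hJ
  have hJ1 : ∀ z n, (J z).1 n = refl ℝ (z.1 n) := fun z n => rfl
  have hJ2 : ∀ z, (J z).2 = -z.2 := fun z => rfl
  have hrefle : ∀ n, refl ℝ (e n) = -e n := fun n => by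
    have := dt_refl P.T (q n)
    rw [hq.even] at this
    rw [he]; simp only; rw [this, neg_neg, ← this]
  have hJΨ : ∀ s z, Ψ (s, z) = 0 → Ψ (s, J z) = 0 := by
    rintro s ⟨x, b⟩ hz
    refine Prod.ext ?_ ?_
    · ext1 n
      refine smul_right_injective _ (hr0 n).ne' ?_
      change r n • (Ψ (s, (J (x, b)).1, (J (x, b)).2)).1 n = r n • (0 : X ℝ M)
      rw [hΨn, smul_zero, hJ1, hJ1, hJ1, hJ2]
      have h3 := hΨn s x b n
      rw [hz] at h3
      have h4 : r n • (0 : Seq (X ℝ M) × ℝ).1 n = 0 := smul_zero _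
      rw [h4] at h3
      have h5 := congrArg (refl ℝ) h3.symm
      simp only [map_zero, map_sub, map_smul, map_add, ← P.H_refl, hrefle] at h5
      have h6 : refl ℝ (dt P.T (dt P.T (x n))) = dt P.T (dt P.T (refl ℝ (x n))) := by
        rw [dt_refl, show dt P.T (-(refl ℝ (dt P.T (x n)))) = -dt P.T (refl ℝ (dt P.T (x n))) from
          map_neg (dtL ℝ P.T) _, dt_refl, neg_neg]
      simp only [← dtL_apply, map_smul] at h5 ⊢
      simp only [dtL_apply, h6] at h5 ⊢
      rw [neg_smul, ← smul_neg]
      exact h5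
    · have h3 : p2 x = 0 := congrArg Prod.snd hz
      change p2 (J (x, b)).1 = 0
      rw [hp2n] at h3 ⊢
      simp only [hJ1, ← map_smul]
      have : ∀ n, dotp (e n) (refl ℝ (r n • x n)) = -dotp (e n) (r n • x n) := fun n => by
        rw [← dotp_refl_left, hrefle, dotp_neg_left]
      simp only [pairing, this, tsum_neg] at h3 ⊢
      rw [h3, neg_zero]
  have hJ0 : J (x₀, 0) = (x₀, 0) := by
    refine Prod.ext ?_ neg_zero
    ext1 n
    rw [hJ1]
    change refl ℝ ((r n)⁻¹ • q n) = (r n)⁻¹ • q n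
    rw [map_smul, hq.even]
  have hψJ : ∀ᶠ s in 𝓝 (1 : ℝ), J (ψ s) = ψ s := by
    have h2 : Tendsto (fun s => (s, J (ψ s))) (𝓝 1) (𝓝 (1, x₀, 0)) := by
      refine Filter.Tendsto.prodMk_nhds tendsto_id ?_
      have h3 := (J.continuous.tendsto _).comp hψd.continuousAt.tendsto
      rwa [hψ0, hJ0] at h3
    filter_upwards [hψe, h2.eventually hψu] with s h3 h4
    exact (h4.mp (hJΨ s _ h3)).symm
  have hψ'J : J ψ' = ψ' := by
    have h2 : HasDerivAt (fun s => J (ψ s)) (J ψ') 1 := J.hasFDerivAt.comp_hasDerivAt 1 hψd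
    exact (h2.congr_of_eventuallyEq (hψJ.mono fun s h => h.symm)).unique hψd
  have hodd : ∀ z, J z = z → z.2 = 0 ∧ ∀ n, refl ℝ (z.1 n) = z.1 n := fun z hz => by
    have h2 : -z.2 = z.2 := by rw [← hJ2, hz]
    exact ⟨by linarith, fun n => by rw [← hJ1, hz]⟩
  have hΩ : (0 : ℝ) < 2 * Real.pi / P.T := by have := P.T_pos; positivity
  set Ω := 2 * Real.pi / P.T with hΩdef
  have hscale : HasDerivAt (fun Ω' : ℝ => (Ω' / Ω) ^ 2) (2 / Ω) Ω := by
    have h2 := ((hasDerivAt_id Ω).div_const Ω).pow 2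
    refine h2.congr_deriv ?_
    simp [hΩ.ne']
    ring
  have hone : (Ω / Ω) ^ 2 = 1 := by rw [div_self hΩ.ne', one_pow]
  set Wt : Seq (X ℝ M) × ℝ →L[ℝ] lp (fun _ : ℤ => X ℝ M) 2 :=
    (weightL M h0 h1).comp (ContinuousLinearMap.fst ℝ _ ℝ) with hWt
  have hWtn : ∀ z n, Wt z n = r n • z.1 n := fun z n => rfl
  refine ⟨fun n => Ω • ((2 / Ω) • Wt ψ') n, ⟨fun Ω' => Wt (ψ ((Ω' / Ω) ^ 2)), (2 / Ω) • Wt ψ',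
    ?_, fun n => ?_, ?_, fun n => rfl⟩, fun n => ?_, ⟨2 * ‖ψ'.1‖ + 1, by positivity, fun n => ?_⟩,
    fun n => ?_⟩
  · have hcont : Tendsto (fun Ω' : ℝ => (Ω' / Ω) ^ 2) (𝓝 Ω) (𝓝 1) := by
      have := hscale.continuousAt.tendsto
      rwa [hone] at this
    filter_upwards [hcont.eventually hψe, hcont.eventually hψJ] with Ω' h2 h3 n
    obtain ⟨hb, hev⟩ := hodd _ h3
    refine ⟨(even_iff P.T_pos _).mpr ?_, ?_⟩
    · rw [hWtn, map_smul, hev]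
    · have h4 := hΨn ((Ω' / Ω) ^ 2) (ψ ((Ω' / Ω) ^ 2)).1 (ψ ((Ω' / Ω) ^ 2)).2 n
      have h5 : (Ψ ((Ω' / Ω) ^ 2, (ψ ((Ω' / Ω) ^ 2)).1, (ψ ((Ω' / Ω) ^ 2)).2)) = 0 := h2
      have h6 : r n • (0 : Seq (X ℝ M) × ℝ).1 n = 0 := smul_zero _
      rw [h5, h6, hb, zero_smul, sub_zero, Chain.H] at h4
      simp only [hWtn]
      rw [← sub_eq_zero, ← neg_eq_zero, h4]
      module
  · change Wt (ψ ((Ω / Ω) ^ 2)) n = q n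
    rw [hone, hψ0, hWtn, hx₀n]
  · have h2 := hψd
    rw [← hone] at h2
    have h3 := HasDerivAt.scomp Ω h2 hscale
    have h4 := Wt.hasFDerivAt.comp_hasDerivAt Ω h3
    rwa [map_smul] at h4
  all_goals
    have hy : ∀ n, Ω • ((2 / Ω) • Wt ψ') n = (2 : ℝ) • r n • ψ'.1 n := fun n => by
      change Ω • (2 / Ω) • r n • ψ'.1 n = _
      rw [smul_smul, mul_div_cancel₀ _ hΩ.ne']
    simp only [hy]
  · rw [map_smul, map_smul, (hodd _ hψ'J).2]
  · rw [norm_smul, norm_smul, Real.norm_of_nonneg (hr0 n).le, Real.norm_of_nonneg zero_le_two]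
    have h2 := ψ'.1.norm_apply_le n
    have h3 := hr0 n
    change 2 * (r n * ‖ψ'.1 n‖) ≤ (2 * ‖ψ'.1‖ + 1) * r n
    nlinarith
  · have h2 := hΨ'n 1 ψ'.1 ψ'.2 n
    have h5 : Ψ' (1, ψ'.1, ψ'.2) = 0 := hψ'
    have h6 : r n • (0 : Seq (X ℝ M) × ℝ).1 n = 0 := smul_zero _
    rw [h5, h6, (hodd _ hψ'J).1, zero_smul, sub_zero, one_smul] at h2
    have h7 := sub_eq_zero.mp h2.symm
    rw [← h7, Chain.lin, Chain.lin]
    simp only [map_smul, smul_sub, ← smul_add]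
    rw [smul_comm]

end IsPulse
end HypChain

/-! ### Newton's method and uniform inverses near a superposition -/

/-- A quantitative Newton argument: a map close to an invertible linear map has exactly one zero in a
ball whose radius does not depend on the size of the residual, and the zero is as small as the
residual. -/
theorem exists_zero_of_taylor {E F : Type*} [NormedAddCommGroup E] [NormedSpace ℝ E]
    [CompleteSpace E] [NormedAddCommGroup F] [NormedSpace ℝ F] {Φ : E → F} {S : E →L[ℝ] F} {C K : ℝ}
    (hC : 0 < C) (hK : 0 < K) (hS : Function.Surjective S) (hSC : ∀ x, ‖x‖ ≤ C * ‖S x‖)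
    (hΦ : ∀ x x', ‖x‖ ≤ 1 → ‖x'‖ ≤ 1 → ‖Φ x - Φ x' - S (x - x')‖ ≤ K * (‖x‖ + ‖x'‖) * ‖x - x'‖)
    (h0 : 2 * C * ‖Φ 0‖ ≤ min 1 (1 / (4 * C * K))) :
    (∃ x, ‖x‖ ≤ 2 * C * ‖Φ 0‖ ∧ Φ x = 0) ∧
      ∀ x x', ‖x‖ ≤ min 1 (1 / (4 * C * K)) → ‖x'‖ ≤ min 1 (1 / (4 * C * K)) → Φ x = 0 → Φ x' = 0 →
        x = x' := by
  have hr := min_le_left 1 (1 / (4 * C * K))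
  have hr2 : C * (K * (min 1 (1 / (4 * C * K)) + min 1 (1 / (4 * C * K)))) ≤ 1 / 2 := by
    have := min_le_right 1 (1 / (4 * C * K))
    calc _ = 2 * (C * K) * min 1 (1 / (4 * C * K)) := by ring
      _ ≤ 2 * (C * K) * (1 / (4 * C * K)) := by gcongr
      _ = 1 / 2 := by field_simp; norm_num
  set r := min 1 (1 / (4 * C * K))
  have hap : ∀ x x', ‖x‖ ≤ r → ‖x'‖ ≤ r → ‖Φ x - Φ x' - S (x - x')‖ ≤ (2 * C)⁻¹ * ‖x - x'‖ := by
    intro x x' hx hx'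
    refine (hΦ x x' (hx.trans hr) (hx'.trans hr)).trans ?_
    refine mul_le_mul_of_nonneg_right ?_ (norm_nonneg _)
    rw [mul_inv, mul_comm, ← div_eq_mul_inv, le_div_iff₀ hC]
    have h1 : K * (‖x‖ + ‖x'‖) * C ≤ K * (r + r) * C := by gcongr
    linarith
  refine ⟨?_, fun x x' hx hx' h h' => ?_⟩
  · have hal : ApproximatesLinearOn Φ S (Metric.closedBall 0 (2 * C * ‖Φ 0‖))
        ⟨(2 * C)⁻¹, by positivity⟩ := by
      intro x hx x' hx'
      rw [mem_closedBall_zero_iff] at hx hx'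
      exact hap x x' (hx.trans h0) (hx'.trans h0)
    choose J hJ using hS
    have := hal.surjOn_closedBall_of_nonlinearRightInverse
      { toFun := J
        nnnorm := ⟨C, hC.le⟩
        bound' := fun y => by have := hSC (J y); rw [hJ] at this; exact this
        right_inv' := hJ } (ε := 2 * C * ‖Φ 0‖) (b := 0) (by positivity) subset_rfl
    obtain ⟨x, hx, hx0⟩ := this (show (0 : F) ∈ _ by
      rw [mem_closedBall_iff_norm, zero_sub, norm_neg]
      refine le_of_eq ?_
      change _ = (C⁻¹ - (2 * C)⁻¹) * (2 * C * ‖Φ 0‖)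
      field_simp
      ring)
    exact ⟨x, mem_closedBall_zero_iff.mp hx, hx0⟩
  · have h1 := hap x x' hx hx'
    rw [h, h', sub_zero, zero_sub, norm_neg] at h1
    have h2 := (hSC (x - x')).trans (mul_le_mul_of_nonneg_left h1 hC.le)
    have h3 : C * ((2 * C)⁻¹ * ‖x - x'‖) = ‖x - x'‖ / 2 := by field_simp
    have h4 : ‖x - x'‖ ≤ 0 := by linarith
    exact sub_eq_zero.mp (norm_le_zero_iff.mp h4)

/-- The superposition of the translates of a sequence to the points `s i`, with signs `σ i`. -/
noncomputable def superpose {M m : ℕ} (σ : Fin m → ℝ) (s : Fin m → ℤ) (x : ℤ → X ℝ M) (n : ℤ) :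
    X ℝ M := ∑ i, σ i • x (n - s i)

namespace HypChain
namespace IsPulse

variable {M : ℕ} {P : HypChain M} {q : ℤ → X ℝ M} (hq : P.IsPulse q)
include hq

theorem superpose_bdd {m : ℕ} (σ : Fin m → ℝ) (s : Fin m → ℤ) :
    ∃ C, ∀ n, ‖superpose σ s q n‖ ≤ C := by
  obtain ⟨C, hC⟩ := hq.bdd
  refine ⟨∑ i, |σ i| * C, fun n => norm_sum_le_of_le _ fun i _ => ?_⟩
  rw [norm_smul, Real.norm_eq_abs]
  exact mul_le_mul_of_nonneg_left (hC _) (abs_nonneg _)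

theorem superpose_tendsto {m : ℕ} (σ : Fin m → ℝ) (s : Fin m → ℤ) :
    Tendsto (superpose σ s q) cofinite (𝓝 0) := by
  have h : ∀ i, Tendsto (fun n => σ i • q (n - s i)) cofinite (𝓝 0) := fun i => by
    have := (hq.tendsto_cofinite.comp
      (sub_left_injective (b := s i)).tendsto_cofinite).const_smul (σ i)
    simpa using this
  have := tendsto_finsetSum Finset.univ fun i _ => h i
  rw [Finset.sum_const_zero] at this
  exact this

/-- The translates of the time derivative of the pulse, which are the approximate kernel of the
linearization about a superposition. -/
noncomputable def goldstone (𝕜 : Type) [RCLike 𝕜] {m : ℕ} (σ : Fin m → ℝ) (s : Fin m → ℤ)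
    (i : Fin m) : Seq (X 𝕜 M) :=
  mkSeq (fun n => lift 𝕜 (σ i • dt P.T (q (n - s i)))) (by
    obtain ⟨C, hC⟩ := hq.dt_bdd
    refine ⟨|σ i| * C, fun n => ?_⟩
    rw [norm_lift, norm_smul, Real.norm_eq_abs]
    exact mul_le_mul_of_nonneg_left (hC _) (abs_nonneg _))

theorem summable_goldstone {m : ℕ} (σ : Fin m → ℝ) (s : Fin m → ℤ) (i : Fin m) :
    Summable fun n => ‖σ i • dt P.T (q (n - s i))‖ := by
  simp only [norm_smul]
  exact (hq.summable_dt.comp_injective (sub_left_injective (b := s i))).mul_left _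

/-- The linearization about `u`, perturbed by `K`, and bordered by the approximate kernel. -/
noncomputable def bord {𝕜 : Type} [RCLike 𝕜] {m : ℕ} (σ : Fin m → ℝ) (s : Fin m → ℤ)
    (u : Seq (X ℝ M)) (K : X 𝕜 M →L[𝕜] X 𝕜 M) :
    Seq (X 𝕜 M) × (Fin m → 𝕜) →L[𝕜] Seq (X 𝕜 M) × (Fin m → 𝕜) :=
  bordered P.d (P.BSeq 𝕜 u + mkSeq (fun _ => K) ⟨_, fun _ => le_rfl⟩) (hq.goldstone 𝕜 σ s)
    fun i => pairL 𝕜 _ (hq.summable_goldstone σ s i)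

variable {𝕜 : Type} [RCLike 𝕜] {m : ℕ} (σ : Fin m → ℝ) (s : Fin m → ℤ)

theorem bord_fst (u : Seq (X ℝ M)) (K : X 𝕜 M →L[𝕜] X 𝕜 M) (w : Seq (X 𝕜 M)) (b : Fin m → 𝕜)
    (n : ℤ) : (hq.bord σ s u K (w, b)).1 n
      = P.lin u w n - K (w n) - ∑ j, b j • lift 𝕜 (σ j • dt P.T (q (n - s j))) := by
  rw [bord, bordered_apply]
  simp only [BoundedContinuousFunction.coe_sub, Pi.sub_apply, BoundedContinuousFunction.coe_sum,
    Finset.sum_apply, lapL_apply, BoundedContinuousFunction.coe_add, Pi.add_apply, Chain.lin,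
    BSeq_apply, mkSeq_apply, add_apply, goldstone, BoundedContinuousFunction.coe_smul]
  abel

theorem bord_snd (u : Seq (X ℝ M)) (K : X 𝕜 M →L[𝕜] X 𝕜 M) (w : Seq (X 𝕜 M)) (b : Fin m → 𝕜)
    (i : Fin m) : (hq.bord σ s u K (w, b)).2 i
      = pairing (fun n => σ i • dt P.T (q (n - s i))) w := by
  rw [bord, bordered_apply]; rfl

/-- The bordered linearization near a superposition of separated pulses is invertible, uniformly in
the number of pulses. -/
theorem exists_bord_inverse (𝕜 : Type) [RCLike 𝕜] : ∃ (C η : ℝ) (L₀ : ℕ), 0 < C ∧ 0 < η ∧ 1 ≤ L₀ ∧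
    ∀ {m : ℕ} [NeZero m] (L : ℕ) (s : Fin m → ℤ) (σ : Fin m → ℝ) (u : Seq (X ℝ M))
      (K : X 𝕜 M →L[𝕜] X 𝕜 M), L₀ ≤ L → Separated L s → (∀ i, σ i = 1 ∨ σ i = -1) →
      (∀ n, ‖u n - superpose σ s q n‖ ≤ η) → ‖K‖ ≤ η →
      Function.Bijective (hq.bord σ s u K) ∧ ∀ x, ‖x‖ ≤ C * ‖hq.bord σ s u K x‖ := by
  obtain ⟨C, η, L₀, hC, hη, hL₀, hb⟩ := hq.exists_bordered_bound 𝕜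
  obtain ⟨ε, γ, hε, hγ, hdom⟩ := P.exists_dominant 𝕜
  refine ⟨2 * C, min η (min (ε / 2) (1 / (2 * C))), L₀, by positivity, by positivity, hL₀,
    fun {m} _ L s σ u K hL hs hσ hu hK => ?_⟩
  have hbound : ∀ x, ‖x‖ ≤ 2 * C * ‖hq.bord σ s u K x‖ := by
    rintro ⟨w, b⟩
    have h1 := hb L s σ u hL hs hσ (fun n => (hu n).trans (min_le_left _ _)) w b
      (‖hq.bord σ s u K (w, b)‖ + 1 / (2 * C) * ‖w‖) (fun n => ?_) (fun i => ?_)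
    · have h2 : ‖(w, b)‖ ≤ C * (‖hq.bord σ s u K (w, b)‖ + 1 / (2 * C) * ‖w‖) :=
        (Prod.norm_def _).trans_le (max_le h1.1 h1.2)
      have h3 : C * (1 / (2 * C) * ‖w‖) = ‖w‖ / 2 := by field_simp
      have h4 := norm_fst_le (w, b)
      simp only at h4
      rw [mul_add, h3] at h2
      linarith
    · have h2 := hq.bord_fst σ s u K w b n
      have h3 : P.lin u w n - ∑ j, b j • lift 𝕜 (σ j • dt P.T (q (n - s j)))
          = (hq.bord σ s u K (w, b)).1 n + K (w n) := by rw [h2]; abel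
      rw [h3]
      refine norm_add_le_of_le ?_ ?_
      · exact ((hq.bord σ s u K (w, b)).1.norm_apply_le n).trans (norm_fst_le _)
      · exact K.le_of_opNorm_le_of_le (hK.trans ((min_le_right _ _).trans (min_le_right _ _)))
          (w.norm_apply_le n)
    · rw [← hq.bord_snd σ s u K w b i]
      have h2 := (norm_le_pi_norm _ i).trans (norm_snd_le (hq.bord σ s u K (w, b)))
      have h3 : 0 ≤ 1 / (2 * C) * ‖w‖ := by positivity
      linarith
  refine ⟨bordered_bijective _ _ P.d_pos hγ ?_ ?_, hbound⟩
  · have h1 := (hq.superpose_tendsto σ s).eventually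
      (Metric.closedBall_mem_nhds 0 (by positivity : 0 < ε / 2))
    have hη2 : min η (min (ε / 2) (1 / (2 * C))) ≤ ε / 2 := (min_le_right _ _).trans (min_le_left _ _)
    filter_upwards [h1] with n hn w
    refine hdom (u n) K ?_ (hK.trans (hη2.trans (by linarith))) w
    have h2 := norm_le_norm_add_norm_sub' (u n) (superpose σ s q n)
    rw [dist_zero_right] at hn
    linarith [(hu n).trans hη2]
  · refine (injective_iff_map_eq_zero (hq.bord σ s u K)).mpr fun x hx => ?_
    have := hbound x
    rw [hx, norm_zero, mul_zero] at this
    exact norm_le_zero_iff.mp this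

end IsPulse
end HypChain

/-! ### Multi-breathers -/

namespace HypChain
namespace IsPulse

variable {M : ℕ} {P : HypChain M} {q : ℤ → X ℝ M} (hq : P.IsPulse q)
include hq

/-- The residual of a superposition of pulses in the stationary equation is quadratic in the overlap of
neighbouring pulses. -/
theorem exists_residual_bound : ∃ C, 0 < C ∧ ∀ {m : ℕ} [NeZero m] (L : ℕ) (s : Fin m → ℤ)
    (σ : Fin m → ℝ), 1 ≤ L → Separated L s → (∀ i, σ i = 1 ∨ σ i = -1) → ∀ n,
      ‖P.d • (superpose σ s q (n + 1) + superpose σ s q (n - 1)) - P.H (superpose σ s q n)‖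
        ≤ C * P.θ ^ L := by
  obtain ⟨Q, hQ0, hQ, -⟩ := hq.exists_decay
  have hρ0 := P.ρ_pos
  have hρ1 := P.ρ_lt_one
  have hθ0 := P.θ_pos
  have hθ1 := P.θ_lt_one
  have hG := geomC_pos hρ0 hρ1
  have hG' := geomC_pos hθ0 hθ1
  have hθρ : (P.β ^ 2) ^ 2 = P.θ := P.sq_sq_β
  set ρ := P.β ^ 2 with hρ
  set G := geomC ρ with hGdef
  set G' := geomC P.θ with hGdef'
  obtain ⟨K, hK0, hK⟩ := P.exists_H_taylor M (Q * (1 + G) + Q)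
  refine ⟨K * (2 * (Q ^ 2 * G') + (Q * G) ^ 2) + K * (Q ^ 2 * G'), by positivity,
    fun {m} _ L s σ hL hs hσ n => ?_⟩
  obtain ⟨i, hi⟩ := exists_nearest s n
  have hσn : ∀ i (v : X ℝ M), ‖σ i • v‖ = ‖v‖ := fun i v => by
    rw [norm_smul]; rcases hσ i with h | h <;> simp [h]
  set f : Fin m → X ℝ M := fun j => σ j • q (n - s j) with hf
  have hfj : ∀ j, ‖f j‖ ≤ Q * (ρ ^ 2) ^ (n - s j).natAbs := fun j => by rw [hf, hσn]; exact hQ _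
  have hfj1 : ∀ j, ‖f j‖ ≤ Q := fun j => (hfj j).trans
    (mul_le_of_le_one_right hQ0.le (pow_le_one₀ (by positivity) (by nlinarith)))
  have hsup : superpose σ s q n = ∑ j, f j := rfl
  have hH : ∀ j, P.H (f j) = σ j • P.H (q (n - s j)) := fun j => by
    rcases hσ j with h | h
    · simp [hf, h]
    · simp [hf, h, P.H_neg]
  have hlin : P.d • (superpose σ s q (n + 1) + superpose σ s q (n - 1)) = ∑ j, P.H (f j) := by
    simp only [hH, ← hq.eq, superpose, ← Finset.sum_add_distrib, Finset.smul_sum]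
    refine Finset.sum_congr rfl fun j _ => ?_
    rw [show n + 1 - s j = n - s j + 1 by ring, show n - 1 - s j = n - s j - 1 by ring, ← smul_add,
      smul_comm]
  set b := ∑ j ∈ Finset.univ.erase i, f j with hb
  have hsum : ∑ j, f j = f i + b := (Finset.add_sum_erase _ _ (Finset.mem_univ i)).symm
  have hbn : ‖b‖ ≤ Q * (G * ρ ^ L) := by
    have := hs.norm_sum_sub_le i hρ0 hρ1 hL hi hQ0.le hfj
    rwa [hsum, add_sub_cancel_left] at this
  have hbR : ‖f i + b‖ ≤ Q * (1 + G) + Q := by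
    rw [← hsum]
    have := hs.norm_sum_le hρ0 hρ1 hL hQ0.le hfj
    linarith
  have hQR : Q ≤ Q * (1 + G) + Q := by nlinarith
  have h0R : ‖(0 : X ℝ M)‖ ≤ Q * (1 + G) + Q := by rw [norm_zero]; positivity
  -- A product with the nearest pulse decays in the distance of the two centers, since the distances of
  -- `n` from them add up to at least that distance.
  have hprod : ‖f i‖ * ‖b‖ ≤ Q ^ 2 * G' * P.θ ^ L := by
    have h1 : ‖f i‖ * ‖b‖ ≤ ∑ j ∈ Finset.univ.erase i, ‖f i‖ * ‖f j‖ := by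
      rw [← Finset.mul_sum]
      exact mul_le_mul_of_nonneg_left (norm_sum_le _ _) (norm_nonneg _)
    have h2 : ∀ j ∈ Finset.univ.erase i, ‖f i‖ * ‖f j‖ ≤ Q ^ 2 * P.θ ^ (s i - s j).natAbs := by
      intro j _
      have h3 := mul_le_mul (hfj i) (hfj j) (norm_nonneg _) (by positivity)
      refine h3.trans ?_
      rw [hθρ]
      calc _ = Q ^ 2 * P.θ ^ ((n - s i).natAbs + (n - s j).natAbs) := by ring
        _ ≤ _ := mul_le_mul_of_nonneg_left
          (pow_le_pow_of_le_one hθ0.le hθ1.le (by omega)) (sq_nonneg Q)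
    refine h1.trans ((Finset.sum_le_sum h2).trans ?_)
    rw [← Finset.mul_sum, mul_assoc]
    exact mul_le_mul_of_nonneg_left (hs.sum_erase_le i hθ0 hθ1 hL) (sq_nonneg Q)
  have hsq : ‖b‖ ^ 2 ≤ (Q * G) ^ 2 * P.θ ^ L := by
    refine (pow_le_pow_left₀ (norm_nonneg _) hbn 2).trans (le_of_eq ?_)
    rw [← hθρ]; ring
  have hsqs : ∑ j ∈ Finset.univ.erase i, ‖P.H (f j) - P.B ℝ 0 (f j)‖
      ≤ K * (Q ^ 2 * G') * P.θ ^ L := by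
    have h2 : ∀ j ∈ Finset.univ.erase i, ‖P.H (f j) - P.B ℝ 0 (f j)‖
        ≤ K * Q ^ 2 * (P.θ ^ 2) ^ (n - s j).natAbs := by
      intro j _
      have h3 := hK (f j) 0 0 ((hfj1 j).trans hQR) h0R h0R
      rw [P.H_zero, sub_zero, sub_zero, sub_zero, norm_zero, add_zero] at h3
      refine h3.trans ?_
      have h4 := mul_le_mul (hfj j) (hfj j) (norm_nonneg _) (by positivity)
      rw [hθρ] at h4
      calc _ = K * (‖f j‖ * ‖f j‖) := by ring
        _ ≤ K * (Q * P.θ ^ (n - s j).natAbs * (Q * P.θ ^ (n - s j).natAbs)) := by gcongr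
        _ = K * Q ^ 2 * (P.θ ^ (n - s j).natAbs * P.θ ^ (n - s j).natAbs) := by ring
        _ = _ := by rw [← mul_pow, ← sq]
    refine (Finset.sum_le_sum h2).trans ?_
    rw [← Finset.mul_sum]
    calc _ ≤ K * Q ^ 2 * (G' * P.θ ^ L) :=
          mul_le_mul_of_nonneg_left (hs.sum_erase_near_le i hθ0 hθ1 hL hi) (by positivity)
      _ = _ := by ring
  have hT := hK (f i + b) (f i) 0 hbR ((hfj1 i).trans hQR) h0R
  rw [add_sub_cancel_left, sub_zero, sub_zero] at hT
  have hfin : ‖∑ j, P.H (f j) - P.H (f i + b)‖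
      ≤ K * (2 * (‖f i‖ * ‖b‖) + ‖b‖ ^ 2)
        + ∑ j ∈ Finset.univ.erase i, ‖P.H (f j) - P.B ℝ 0 (f j)‖ := by
    have h1 : ∑ j, P.H (f j) - P.H (f i + b)
        = -(P.H (f i + b) - P.H (f i) - P.B ℝ 0 b)
          + ∑ j ∈ Finset.univ.erase i, (P.H (f j) - P.B ℝ 0 (f j)) := by
      rw [Finset.sum_sub_distrib, ← map_sum, ← Finset.add_sum_erase _ _ (Finset.mem_univ i)]
      abel
    rw [h1]
    refine norm_add_le_of_le ?_ (norm_sum_le _ _)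
    rw [norm_neg]
    refine hT.trans ?_
    have h2 := norm_add_le (f i) b
    calc _ ≤ K * (‖f i‖ + ‖b‖ + ‖f i‖) * ‖b‖ := by gcongr
      _ = _ := by ring
  rw [hlin, hsup, hsum]
  refine hfin.trans ?_
  calc _ ≤ K * (2 * (Q ^ 2 * G' * P.θ ^ L) + (Q * G) ^ 2 * P.θ ^ L)
        + K * (Q ^ 2 * G') * P.θ ^ L := by gcongr
    _ = _ := by ring

omit hq in
theorem refl_dt_of_even {u : X ℝ M} (hu : refl ℝ u = u) (T : ℝ) :
    refl ℝ (dt T u) = -dt T u := by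
  have := dt_refl T u
  rw [hu] at this
  rw [this, neg_neg, ← this]

theorem superpose_even {m : ℕ} (σ : Fin m → ℝ) (s : Fin m → ℤ) (n : ℤ) :
    refl ℝ (superpose σ s q n) = superpose σ s q n := by
  simp only [superpose, map_sum, map_smul, hq.even]

theorem refl_goldstone {m : ℕ} (σ : Fin m → ℝ) (s : Fin m → ℤ) (i : Fin m) (n : ℤ) :
    refl ℝ (σ i • dt P.T (q (n - s i))) = -(σ i • dt P.T (q (n - s i))) := by
  rw [map_smul, refl_dt_of_even (hq.even _), smul_neg]

set_option maxHeartbeats 1000000 in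
/-- Existence and uniqueness of the multi-breather near a superposition of separated pulses. The
multipliers of the bordered equation vanish, and the solution is even, by uniqueness and time
reversibility. -/
theorem exists_multiBreather : ∃ (C ε : ℝ) (L₀ : ℕ), 0 < C ∧ 0 < ε ∧ 1 ≤ L₀ ∧
    ∀ {m : ℕ} [NeZero m] (L : ℕ) (s : Fin m → ℤ) (σ : Fin m → ℝ), L₀ ≤ L →
      Separated L s → (∀ i, σ i = 1 ∨ σ i = -1) →
      ∃ u : ℤ → X ℝ M, (∀ n, P.d • (u (n + 1) + u (n - 1)) = P.H (u n)) ∧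
        (∀ n, refl ℝ (u n) = u n) ∧ (∀ n, ‖u n - superpose σ s q n‖ ≤ C * P.θ ^ L) ∧
        ∀ u' : ℤ → X ℝ M, (∀ n, P.d • (u' (n + 1) + u' (n - 1)) = P.H (u' n)) →
          (∀ n, refl ℝ (u' n) = u' n) → (∀ n, ‖u' n - superpose σ s q n‖ ≤ ε) → u' = u := by
  obtain ⟨C, η, L₁, hC, hη, hL₁, hinv⟩ := hq.exists_bord_inverse ℝ
  obtain ⟨D, hD, hres⟩ := hq.exists_residual_bound
  obtain ⟨Q, hQ0, hQ, -⟩ := hq.exists_decay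
  have hρ0 := P.ρ_pos
  have hρ1 := P.ρ_lt_one
  have hG := geomC_pos hρ0 hρ1
  set ρ := P.β ^ 2 with hρ
  obtain ⟨K, hK0, hK⟩ := P.exists_H_taylor M (1 + Q * (1 + geomC ρ))
  set r := min 1 (1 / (4 * C * K)) with hr
  have hr0 : 0 < r := by positivity
  have hlim : Tendsto (fun k : ℕ => 2 * C * (D * P.θ ^ k)) atTop (𝓝 0) := by
    simpa using ((tendsto_pow_atTop_nhds_zero_of_lt_one P.θ_pos.le P.θ_lt_one).const_mul D).const_mul
      (2 * C)
  obtain ⟨L₂, hL₂⟩ := (hlim.eventually (gt_mem_nhds hr0)).exists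
  have hθ0 := P.θ_pos
  refine ⟨2 * C * D, r, max L₁ L₂, by positivity, hr0, by omega, fun {m} _ L s σ hL hs hσ => ?_⟩
  have hL1 : L₁ ≤ L := le_trans (le_max_left _ _) hL
  have hL2 : L₂ ≤ L := le_trans (le_max_right _ _) hL
  have hL3 : 1 ≤ L := hL₁.trans hL1
  set U : Seq (X ℝ M) := mkSeq (superpose σ s q) (hq.superpose_bdd σ s) with hU
  have hUn : ∀ n, U n = superpose σ s q n := fun n => rfl
  have hσn : ∀ i (v : X ℝ M), ‖σ i • v‖ = ‖v‖ := fun i v => by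
    rw [norm_smul]; rcases hσ i with h | h <;> simp [h]
  have hUR : ∀ n, ‖U n‖ ≤ Q * (1 + geomC ρ) := fun n =>
    hs.norm_sum_le hρ0 hρ1 hL3 hQ0.le fun j => by rw [hσn]; exact hQ _
  obtain ⟨hbij, hbound⟩ := hinv L s σ U 0 hL1 hs hσ (fun n => by simpa [hUn] using hη.le)
    (by simpa using hη.le)
  set S := hq.bord (𝕜 := ℝ) σ s U 0 with hS
  have hS1 : ∀ v b n, (S (v, b)).1 n = P.d • (v (n + 1) + v (n - 1)) - P.B ℝ (U n) (v n)
      - ∑ j, b j • σ j • dt P.T (q (n - s j)) := fun v b n => by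
    rw [hS, bord_fst, Chain.lin]
    simp [lift_real]
  have hS2 : ∀ v b i, (S (v, b)).2 i = pairing (fun n => σ i • dt P.T (q (n - s i))) v :=
    fun v b i => hq.bord_snd σ s U 0 v b i
  have hHb : ∀ u : Seq (X ℝ M), ∃ c, ∀ n, ‖P.H (u n)‖ ≤ c := fun u => by
    obtain ⟨c, hc0, hc⟩ := P.exists_H_taylor M ‖u‖
    refine ⟨c * ‖u‖ * ‖u‖ + ‖P.B ℝ (0 : X ℝ M)‖ * ‖u‖, fun n => ?_⟩
    have h1 := hc (u n) 0 0 (u.norm_apply_le n) (by simp) (by simp)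
    rw [P.H_zero, sub_zero, sub_zero, sub_zero, norm_zero, add_zero] at h1
    rw [← sub_add_cancel (P.H (u n)) (P.B ℝ (0 : X ℝ M) (u n))]
    have h2 := u.norm_apply_le n
    refine norm_add_le_of_le (h1.trans (by gcongr)) ?_
    exact (P.B ℝ (0 : X ℝ M)).le_of_opNorm_le_of_le le_rfl h2
  set Φ : Seq (X ℝ M) × (Fin m → ℝ) → Seq (X ℝ M) × (Fin m → ℝ) := fun x =>
    (P.d • (shiftSeq ℝ 1 (U + x.1) + shiftSeq ℝ (-1) (U + x.1)) - mkSeq _ (hHb (U + x.1))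
      - ∑ j, x.2 j • hq.goldstone ℝ σ s j, (S x).2) with hΦ
  have hΦ1 : ∀ v b n, (Φ (v, b)).1 n = P.d • ((U + v) (n + 1) + (U + v) (n - 1)) - P.H ((U + v) n)
      - ∑ j, b j • σ j • dt P.T (q (n - s j)) := fun v b n => by
    simp only [hΦ, BoundedContinuousFunction.coe_sub, Pi.sub_apply, mkSeq_apply,
      BoundedContinuousFunction.coe_sum, Finset.sum_apply, BoundedContinuousFunction.coe_smul,
      goldstone, lift_real]
    rfl
  have htaylor : ∀ x x', ‖x‖ ≤ 1 → ‖x'‖ ≤ 1 →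
      ‖Φ x - Φ x' - S (x - x')‖ ≤ K * (‖x‖ + ‖x'‖) * ‖x - x'‖ := by
    rintro ⟨v, b⟩ ⟨v', b'⟩ hx hx'
    have hv := norm_fst_le (v, b)
    have hv' := norm_fst_le (v', b')
    have hvv := norm_fst_le ((v, b) - (v', b'))
    simp only [Prod.fst_sub] at hv hv' hvv
    refine (Prod.norm_def _).trans_le (max_le (Seq.norm_le (by positivity) fun n => ?_) ?_)
    · have h1 : (Φ (v, b) - Φ (v', b') - S ((v, b) - (v', b'))).1 n
          = -(P.H (U n + v n) - P.H (U n + v' n) - P.B ℝ (U n) (v n - v' n)) := by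
        rw [Prod.mk_sub_mk]
        change (Φ (v, b)).1 n - (Φ (v', b')).1 n - (S (v - v', b - b')).1 n = _
        rw [hΦ1, hΦ1, hS1]
        simp only [BoundedContinuousFunction.coe_add, BoundedContinuousFunction.coe_sub,
          Pi.add_apply, Pi.sub_apply, sub_smul, Finset.sum_sub_distrib]
        module
      rw [h1, norm_neg]
      have hR : ∀ z : Seq (X ℝ M), ‖z‖ ≤ 1 → ‖U n + z n‖ ≤ 1 + Q * (1 + geomC ρ) := fun z hz => by
        have h2 := norm_add_le (U n) (z n)
        have h3 := (z.norm_apply_le n).trans hz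
        linarith [hUR n]
      have h2 := hK (U n + v n) (U n + v' n) (U n) (hR v (hv.trans hx)) (hR v' (hv'.trans hx'))
        (by linarith [hUR n])
      rw [add_sub_add_left_eq_sub, add_sub_cancel_left, add_sub_cancel_left] at h2
      refine h2.trans ?_
      have h3 := (v.norm_apply_le n).trans hv
      have h4 := (v'.norm_apply_le n).trans hv'
      have h5 := ((v - v').norm_apply_le n).trans hvv
      rw [BoundedContinuousFunction.coe_sub, Pi.sub_apply] at h5
      gcongr
    · have h1 : (Φ (v, b) - Φ (v', b') - S ((v, b) - (v', b'))).2 = 0 := by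
        change (S (v, b)).2 - (S (v', b')).2 - (S ((v, b) - (v', b'))).2 = 0
        rw [map_sub, Prod.snd_sub, sub_self]
      rw [h1, norm_zero]
      positivity
  have hΦ0 : ‖Φ 0‖ ≤ D * P.θ ^ L := by
    refine (Prod.norm_def _).trans_le (max_le (Seq.norm_le (by positivity) fun n => ?_) ?_)
    · have h1 := hΦ1 0 0 n
      simp only [add_zero, hUn, Pi.zero_apply, zero_smul, Finset.sum_const_zero, sub_zero] at h1
      change ‖(Φ (0, 0)).1 n‖ ≤ _
      rw [h1]
      exact hres L s σ hL3 hs hσ n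
    · change ‖(S 0).2‖ ≤ _
      rw [map_zero, Prod.snd_zero, norm_zero]
      positivity
  have hsmall : 2 * C * ‖Φ 0‖ ≤ 2 * C * (D * P.θ ^ L) := by gcongr
  have hsmall' : 2 * C * (D * P.θ ^ L) ≤ r := by
    refine le_trans ?_ hL₂.le
    gcongr ?_ * (?_ * ?_)
    exact pow_le_pow_of_le_one P.θ_pos.le P.θ_lt_one.le hL2
  obtain ⟨⟨x, hx, hx0⟩, huniq⟩ := exists_zero_of_taylor hC hK0 hbij.2 hbound htaylor
    (hsmall.trans hsmall')
  -- Time reversal changes the sign of the bordering vectors, hence maps zeros to zeros with the opposite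
  -- multipliers; by uniqueness the zero is even and its multipliers vanish.
  set J : Seq (X ℝ M) × (Fin m → ℝ) → Seq (X ℝ M) × (Fin m → ℝ) := fun x =>
    (mulSeq (mkSeq (fun _ => refl ℝ) ⟨_, fun _ => le_rfl⟩) x.1, -x.2) with hJ
  have hJ1 : ∀ z n, (J z).1 n = refl ℝ (z.1 n) := fun z n => rfl
  have hJ2 : ∀ z, (J z).2 = -z.2 := fun z => rfl
  have hJn : ∀ z, ‖J z‖ ≤ ‖z‖ := fun z => by
    refine (Prod.norm_def _).trans_le (max_le (Seq.norm_le (norm_nonneg _) fun n => ?_) ?_)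
    · rw [hJ1, norm_refl]
      exact (z.1.norm_apply_le n).trans (norm_fst_le z)
    · rw [hJ2, norm_neg]; exact norm_snd_le z
  have hJΦ : Φ (J x) = 0 := by
    obtain ⟨v, b⟩ := x
    refine Prod.ext ?_ (funext fun i => ?_)
    · ext1 n
      have h1 := hΦ1 v b n
      rw [hx0] at h1
      have h2 := congrArg (refl ℝ) h1.symm
      change (Φ ((J (v, b)).1, (J (v, b)).2)).1 n = (0 : X ℝ M)
      rw [hΦ1]
      have h3 : ∀ k, (U + (J (v, b)).1) k = refl ℝ ((U + v) k) := fun k => by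
        rw [BoundedContinuousFunction.coe_add, Pi.add_apply, BoundedContinuousFunction.coe_add,
          Pi.add_apply, map_add, hJ1, hUn, hq.superpose_even]
      simp only [h3, hJ2, Pi.neg_apply, neg_smul]
      simp only [map_sub, map_smul, map_add, map_sum, ← P.H_refl] at h2
      have h4 : ∀ j, refl ℝ (dt P.T (q (n - s j))) = -dt P.T (q (n - s j)) := fun j =>
        refl_dt_of_even (hq.even _) _
      simp only [h4, smul_neg] at h2
      exact h2.trans (map_zero _)
    · have h1 : (S (v, b)).2 i = 0 := congrFun (congrArg Prod.snd hx0) i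
      change (S ((J (v, b)).1, (J (v, b)).2)).2 i = 0
      rw [hS2] at h1 ⊢
      have h2 : ∀ n, dotp (σ i • dt P.T (q (n - s i))) ((J (v, b)).1 n)
          = -dotp (σ i • dt P.T (q (n - s i))) (v n) := fun n => by
        rw [hJ1, ← dotp_refl_left, hq.refl_goldstone, dotp_neg_left]
      simp only [pairing, h2, tsum_neg] at h1 ⊢
      rw [h1, neg_zero]
  have hxr : ‖x‖ ≤ r := hx.trans (hsmall.trans hsmall')
  have hJx : J x = x := huniq _ _ ((hJn x).trans hxr) hxr hJΦ hx0
  obtain ⟨v, b⟩ := x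
  have hb : b = 0 := by
    have h1 : -b = b := by rw [← hJ2 (v, b), hJx]
    funext i
    have := congrFun h1 i
    simp only [Pi.neg_apply] at this
    simp only [Pi.zero_apply]
    linarith
  have hve : ∀ n, refl ℝ (v n) = v n := fun n => by rw [← hJ1 (v, b), hJx]
  refine ⟨fun n => U n + v n, fun n => ?_, fun n => ?_, fun n => ?_, fun u' hu'1 hu'2 hu'3 => ?_⟩
  · have h1 := hΦ1 v b n
    rw [hx0, hb] at h1
    simp only [Pi.zero_apply, zero_smul, Finset.sum_const_zero, sub_zero] at h1
    exact sub_eq_zero.mp h1.symm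
  · simp only [map_add, hve, hUn, hq.superpose_even]
  · simp only [hUn]
    rw [add_sub_cancel_left, mul_assoc]
    exact (v.norm_apply_le n).trans ((norm_fst_le (v, b)).trans (hx.trans hsmall))
  · set v' : Seq (X ℝ M) := mkSeq (fun n => u' n - superpose σ s q n) ⟨r, hu'3⟩ with hv'
    have hUv : ∀ n, (U + v') n = u' n := fun n => by
      rw [BoundedContinuousFunction.coe_add, Pi.add_apply, hUn, hv', mkSeq_apply, add_sub_cancel]
    have h1 : Φ (v', 0) = 0 := by
      refine Prod.ext ?_ (funext fun i => ?_)
      · ext1 n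
        rw [hΦ1]
        simp only [hUv, hu'1, Pi.zero_apply, zero_smul, Finset.sum_const_zero, sub_self]
        rfl
      · change (S (v', 0)).2 i = 0
        rw [hS2]
        refine pairing_eq_zero_of_parity (fun n => hq.refl_goldstone σ s i n) fun n => ?_
        rw [hv', mkSeq_apply, map_sub, hu'2, hq.superpose_even]
    have h2 : ‖(v', (0 : Fin m → ℝ))‖ ≤ r := by
      refine (Prod.norm_def _).trans_le (max_le (Seq.norm_le hr0.le hu'3) ?_)
      simpa using hr0.le
    have h3 : v' = v := congrArg Prod.fst (huniq _ _ h2 hxr h1 hx0)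
    funext n
    rw [← hUv, BoundedContinuousFunction.coe_add, Pi.add_apply, h3]

end IsPulse
end HypChain

/-! ### The linearization near the copies of the pulse -/

section OverlapSums

variable {m L : ℕ} {s : Fin m → ℤ}

theorem pow_mul_pow_le_of_natAbs {x : ℝ} (h0 : 0 < x) (h1 : x < 1) (a b c : ℤ) :
    x ^ (a - c).natAbs * x ^ (a - b).natAbs ≤ x ^ (b - c).natAbs := by
  rw [← pow_add]
  exact pow_le_pow_of_le_one h0.le h1.le (by omega)

/-- The products of two different localized contributions add up to what the overlap of two
neighbouring ones contributes. -/
theorem Separated.sum_sum_erase_le [NeZero m] (hs : Separated L s) {x : ℝ} (h0 : 0 < x) (h1 : x < 1)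
    (hL : 1 ≤ L) (n : ℤ) :
    ∑ j, (∑ k ∈ Finset.univ.erase j, (x ^ 2) ^ (n - s k).natAbs) * (x ^ 2) ^ (n - s j).natAbs
      ≤ (2 * geomC (x ^ 2) + geomC x ^ 2) * (x ^ 2) ^ L := by
  obtain ⟨i, hi⟩ := exists_nearest s n
  have hx0 : 0 < x ^ 2 := by positivity
  have hx1 : x ^ 2 < 1 := by nlinarith
  set f : Fin m → ℝ := fun j => (x ^ 2) ^ (n - s j).natAbs with hf
  have hf0 : ∀ j, 0 ≤ f j := fun j => by positivity
  set b := ∑ k ∈ Finset.univ.erase i, f k with hb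
  have hb0 : 0 ≤ b := Finset.sum_nonneg fun j _ => hf0 j
  have hsum : ∀ j, ∑ k ∈ Finset.univ.erase j, f k = ∑ k, f k - f j := fun j => by
    rw [← Finset.add_sum_erase _ _ (Finset.mem_univ j), add_sub_cancel_left]
  have h2 : ∑ j, (∑ k ∈ Finset.univ.erase j, f k) * f j ≤ 2 * (b * f i) + b ^ 2 := by
    have h3 : f i ^ 2 ≤ ∑ j, f j ^ 2 :=
      Finset.single_le_sum (f := fun j => f j ^ 2) (fun j _ => sq_nonneg _) (Finset.mem_univ i)
    have h4 : ∑ k, f k = f i + b := (Finset.add_sum_erase _ _ (Finset.mem_univ i)).symm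
    simp only [hsum, sub_mul, Finset.sum_sub_distrib, ← Finset.mul_sum, ← sq, h4]
    nlinarith
  have h5 : b * f i ≤ geomC (x ^ 2) * (x ^ 2) ^ L := by
    rw [hb, Finset.sum_mul]
    exact (Finset.sum_le_sum fun j _ => pow_mul_pow_le_of_natAbs hx0 hx1 _ _ _).trans
      (hs.sum_erase_le i hx0 hx1 hL)
  have h6 : b ^ 2 ≤ geomC x ^ 2 * (x ^ 2) ^ L := by
    have := pow_le_pow_left₀ hb0 (hs.sum_erase_near_le i h0 h1 hL hi) 2
    rwa [mul_pow, ← pow_mul, mul_comm L, pow_mul] at this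
  linarith

theorem Separated.sum_sum_erase_slow_le (hs : Separated L s) {x : ℝ} (h0 : 0 < x) (h1 : x < 1)
    (hL : 1 ≤ L) (n : ℤ) :
    ∑ j, (∑ k ∈ Finset.univ.erase j, ((x ^ 2) ^ 2) ^ (n - s k).natAbs) * (x ^ 2) ^ (n - s j).natAbs
      ≤ geomC (x ^ 2) * (1 + geomC x) * (x ^ 2) ^ L := by
  have hx0 : 0 < x ^ 2 := by positivity
  have hx1 : x ^ 2 < 1 := by nlinarith
  have hG := geomC_pos hx0 hx1
  simp only [Finset.sum_mul]
  rw [Finset.sum_comm' (t' := Finset.univ) (s' := fun k => Finset.univ.erase k)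
    (fun j k => by simp [eq_comm])]
  have h2 : ∀ k, ∑ j ∈ Finset.univ.erase k,
      ((x ^ 2) ^ 2) ^ (n - s k).natAbs * (x ^ 2) ^ (n - s j).natAbs
        ≤ geomC (x ^ 2) * (x ^ 2) ^ L * (x ^ 2) ^ (n - s k).natAbs := fun k => by
    have h3 : ∀ j ∈ Finset.univ.erase k,
        ((x ^ 2) ^ 2) ^ (n - s k).natAbs * (x ^ 2) ^ (n - s j).natAbs
          ≤ (x ^ 2) ^ (s k - s j).natAbs * (x ^ 2) ^ (n - s k).natAbs := fun j _ => by
      rw [← pow_mul _ 2, mul_comm 2, pow_mul, sq, mul_right_comm]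
      gcongr
      rw [mul_comm]
      exact pow_mul_pow_le_of_natAbs hx0 hx1 _ _ _
    refine (Finset.sum_le_sum h3).trans ?_
    rw [← Finset.sum_mul]
    gcongr
    exact hs.sum_erase_le k hx0 hx1 hL
  refine (Finset.sum_le_sum fun k _ => h2 k).trans ?_
  rw [← Finset.mul_sum]
  calc _ ≤ geomC (x ^ 2) * (x ^ 2) ^ L * (1 + geomC x) := by
        gcongr
        exact hs.sum_le h0 h1 hL n
    _ = _ := by ring

theorem Separated.sum_erase_mul_le (hs : Separated L s) {x : ℝ} (h0 : 0 < x) (h1 : x < 1)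
    (hL : 1 ≤ L) (n : ℤ) (j : Fin m) :
    (∑ k ∈ Finset.univ.erase j, (x ^ 2) ^ (n - s k).natAbs) * (x ^ 2) ^ (n - s j).natAbs
      ≤ geomC x * x ^ L * x ^ (n - s j).natAbs := by
  rw [Finset.sum_mul]
  have h3 : ∀ k ∈ Finset.univ.erase j, (x ^ 2) ^ (n - s k).natAbs * (x ^ 2) ^ (n - s j).natAbs
      ≤ x ^ (s j - s k).natAbs * x ^ (n - s j).natAbs := fun k _ => by
    rw [← pow_mul, ← pow_mul, ← pow_add, ← pow_add]
    exact pow_le_pow_of_le_one h0.le h1.le (by omega)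
  refine (Finset.sum_le_sum h3).trans ?_
  rw [← Finset.sum_mul]
  gcongr
  exact hs.sum_erase_le j h0 h1 hL

/-- The overlap of two localized sequences decays in their distance, at almost the rate of the faster
of them. -/
theorem tsum_pow_mul_pow_le {x : ℝ} (h0 : 0 < x) (h1 : x < 1) (k : ℕ) (i j : ℤ) :
    (Summable fun n : ℤ => (x ^ (k + 1)) ^ (n - i).natAbs * (x ^ k) ^ (n - j).natAbs) ∧
    ∑' n : ℤ, (x ^ (k + 1)) ^ (n - i).natAbs * (x ^ k) ^ (n - j).natAbs
      ≤ 2 / (1 - x) * (x ^ k) ^ (i - j).natAbs := by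
  have h : ∀ n : ℤ, (x ^ (k + 1)) ^ (n - i).natAbs * (x ^ k) ^ (n - j).natAbs
      ≤ x ^ (n - i).natAbs * (x ^ k) ^ (i - j).natAbs := fun n => by
    simp only [← pow_mul, ← pow_add]
    refine pow_le_pow_of_le_one h0.le h1.le ?_
    have h2 : (i - j).natAbs ≤ (n - i).natAbs + (n - j).natAbs := by omega
    nlinarith [Nat.mul_le_mul_left k h2]
  have hs := (summable_pow_natAbs h0 h1 i).mul_right ((x ^ k) ^ (i - j).natAbs)
  have hsum := Summable.of_nonneg_of_le (fun n => by positivity) h hs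
  refine ⟨hsum, (hsum.tsum_le_tsum h hs).trans ?_⟩
  rw [tsum_mul_right]
  exact mul_le_mul_of_nonneg_right (tsum_pow_natAbs_le h0 h1 i) (by positivity)

end OverlapSums

/-- The translate of a sequence to the point `s i`, with sign `σ i`. -/
def copy {M m : ℕ} (σ : Fin m → ℝ) (s : Fin m → ℤ) (x : ℤ → X ℝ M) (i : Fin m) (n : ℤ) : X ℝ M :=
  σ i • x (n - s i)

/-- `u` is an even solution of the stationary equation within `Λ θ ^ L` of a superposition of copies of
`q` that are separated by multiples of `L`. -/
structure NearSuperposition {M : ℕ} (P : HypChain M) (q : ℤ → X ℝ M) (Λ : ℝ) {m : ℕ} (L : ℕ)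
    (s : Fin m → ℤ) (σ : Fin m → ℝ) (u : ℤ → X ℝ M) : Prop where
  one_le : 1 ≤ L
  separated : Separated L s
  sign : ∀ i, σ i = 1 ∨ σ i = -1
  eq : ∀ n, P.d • (u (n + 1) + u (n - 1)) = P.H (u n)
  even : ∀ n, refl ℝ (u n) = u n
  close : ∀ n, ‖u n - superpose σ s q n‖ ≤ Λ * P.θ ^ L

theorem norm_copy {M m : ℕ} {σ : Fin m → ℝ} (hσ : ∀ i, σ i = 1 ∨ σ i = -1) (s : Fin m → ℤ)
    (x : ℤ → X ℝ M) (i : Fin m) (n : ℤ) : ‖copy σ s x i n‖ = ‖x (n - s i)‖ := by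
  rw [copy, norm_smul]; rcases hσ i with h | h <;> simp [h]

namespace HypChain
namespace IsPulse

variable {M : ℕ} {P : HypChain M} {q : ℤ → X ℝ M} (hq : P.IsPulse q)
include hq

/-- Near the copy `j`, the linearization about a multi-breather differs from that about the copy by
the tails of the other copies. -/
theorem exists_B_sub_bound (Λ : ℝ) : ∃ C, 0 < C ∧ ∀ {m : ℕ} {L : ℕ} {s : Fin m → ℤ} {σ : Fin m → ℝ}
    {u : ℤ → X ℝ M}, NearSuperposition P q Λ L s σ u →
    (∀ n, ‖P.B ℝ (u n)‖ ≤ C) ∧ (∀ n, ‖u n‖ ≤ C) ∧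
    ∀ n j, ‖P.B ℝ (u n) - P.B ℝ (q (n - s j))‖
      ≤ C * (∑ k ∈ Finset.univ.erase j, P.θ ^ (n - s k).natAbs + P.θ ^ L) := by
  obtain ⟨Q, hQ0, hQ, -⟩ := hq.exists_decay
  have hρ0 := P.ρ_pos
  have hρ1 := P.ρ_lt_one
  have hθ0 := P.θ_pos
  have hθ1 := P.θ_lt_one
  have hG := geomC_pos hρ0 hρ1
  set R := Q * (1 + geomC (P.β ^ 2)) + |Λ| with hR
  have hR0 : 0 < R := by positivity
  obtain ⟨K, hK0, hK⟩ := P.exists_B_lipschitz ℝ M R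
  refine ⟨K * R + ‖P.B ℝ (0 : X ℝ M)‖ + R + K * (Q + |Λ|), by positivity,
    fun {m L s σ u} h => ?_⟩
  have hσn : ∀ i (v : X ℝ M), ‖σ i • v‖ = ‖v‖ := fun i v => by
    rw [norm_smul]; rcases h.sign i with h | h <;> simp [h]
  have hΛ : ∀ n, ‖u n - superpose σ s q n‖ ≤ |Λ| * P.θ ^ L := fun n =>
    (h.close n).trans (mul_le_mul_of_nonneg_right (le_abs_self _) (by positivity))
  have hun : ∀ n, ‖u n‖ ≤ R := fun n => by
    have h1 : ‖superpose σ s q n‖ ≤ Q * (1 + geomC (P.β ^ 2)) :=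
      h.separated.norm_sum_le hρ0 hρ1 h.one_le hQ0.le fun j => by rw [hσn]; exact hQ _
    have h2 : |Λ| * P.θ ^ L ≤ |Λ| := mul_le_of_le_one_right (abs_nonneg _)
      (pow_le_one₀ hθ0.le hθ1.le)
    have h3 := norm_le_norm_add_norm_sub' (u n) (superpose σ s q n)
    linarith [hΛ n]
  have hx : 0 ≤ K * R + ‖P.B ℝ (0 : X ℝ M)‖ := by positivity
  have hy : 0 ≤ K * (Q + |Λ|) := by positivity
  refine ⟨fun n => ?_, fun n => (hun n).trans (by linarith), fun n j => ?_⟩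
  · have h1 := hK (u n) 0 (hun n) (by simpa using hR0.le)
    rw [sub_zero] at h1
    have h2 := norm_le_norm_add_norm_sub' (P.B ℝ (u n)) (P.B ℝ (0 : X ℝ M))
    have h3 : K * ‖u n‖ ≤ K * R := by gcongr; exact hun n
    linarith
  · have hB : P.B ℝ (σ j • q (n - s j)) = P.B ℝ (q (n - s j)) := by
      rcases h.sign j with h | h
      · rw [h, one_smul]
      · rw [h, neg_one_smul, P.B_neg]
    have hqR : ‖σ j • q (n - s j)‖ ≤ R := by
      rw [hσn]
      have h1 : Q * ((P.β ^ 2) ^ 2) ^ (n - s j).natAbs ≤ Q * 1 := by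
        gcongr
        exact pow_le_one₀ (by positivity) (by nlinarith)
      have := hQ (n - s j)
      have := abs_nonneg Λ
      have := mul_pos hQ0 hG
      linarith
    rw [← hB]
    have h1 := hK (u n) _ (hun n) hqR
    have h2 : u n - σ j • q (n - s j) = (u n - superpose σ s q n)
        + ∑ k ∈ Finset.univ.erase j, σ k • q (n - s k) := by
      rw [superpose, ← Finset.add_sum_erase _ _ (Finset.mem_univ j)]
      abel
    have h3 : ‖∑ k ∈ Finset.univ.erase j, σ k • q (n - s k)‖
        ≤ Q * ∑ k ∈ Finset.univ.erase j, P.θ ^ (n - s k).natAbs := by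
      rw [Finset.mul_sum]
      refine norm_sum_le_of_le _ fun k _ => ?_
      rw [hσn, ← P.sq_sq_β]
      exact hQ _
    have h4 : 0 ≤ ∑ k ∈ Finset.univ.erase j, P.θ ^ (n - s k).natAbs :=
      Finset.sum_nonneg fun k _ => by positivity
    have h5 : 0 < P.θ ^ L := by positivity
    set S := ∑ k ∈ Finset.univ.erase j, P.θ ^ (n - s k).natAbs with hS
    refine h1.trans ?_
    rw [h2]
    have h6 := norm_add_le_of_le (hΛ n) h3
    calc _ ≤ K * (|Λ| * P.θ ^ L + Q * S) := by gcongr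
      _ ≤ K * (Q + |Λ|) * (S + P.θ ^ L) := by
        have := mul_nonneg hK0.le (mul_nonneg hQ0.le h5.le)
        have := mul_nonneg hK0.le (mul_nonneg (abs_nonneg Λ) h4)
        nlinarith
      _ ≤ _ := by
        refine mul_le_mul_of_nonneg_right ?_ (by linarith)
        linarith

omit hq in
theorem lin_copy_sub {m : ℕ} {s : Fin m → ℤ} {σ : Fin m → ℝ} (u x : ℤ → X ℝ M) (j : Fin m) (n : ℤ) :
    P.lin u (copy σ s x j) n - σ j • P.lin q x (n - s j)
      = -(P.B ℝ (u n) - P.B ℝ (q (n - s j))) (copy σ s x j n) := by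
  simp only [Chain.lin, copy, RCLike.ofReal_real_eq_id, id, smul_sub, ← map_smul,
    sub_apply]
  rw [show n + 1 - s j = n - s j + 1 by ring, show n - 1 - s j = n - s j - 1 by ring, ← smul_add,
    smul_comm]
  abel

end IsPulse
end HypChain

/-! ### Summation by parts and tridiagonal matrices -/

section Truncation

variable {M : ℕ} (P : Chain) {u a : ℤ → X ℝ M}

/-- Summation by parts: truncating one argument of the linearization leaves a boundary term, the
symplectic form. -/
theorem Chain.pairing_truncated_lin (ha : Summable fun n => ‖a n‖)
    (hu : ∃ C, ∀ n, ‖P.B ℝ (u n)‖ ≤ C) (b : Seq (X ℝ M)) (c : ℤ) :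
    pairing (fun n => if n < c then a n else 0) (P.lin u b)
      = pairing (fun n => if n < c then P.lin u a n else 0) b
        + P.d * (dotp (a (c - 1)) (b c) - dotp (a c) (b (c - 1))) := by
  have hle : ∀ n, ‖if n < c then a n else 0‖ ≤ ‖a n‖ := fun n => by split_ifs <;> simp
  have h1 : Summable fun n => ‖if n < c then a n else 0‖ :=
    .of_nonneg_of_le (fun n => norm_nonneg _) hle ha
  rw [P.pairing_lin h1 hu b]
  have h2 : ∀ n, dotp (P.lin u (fun n => if n < c then a n else 0) n) (b n)
      = dotp (if n < c then P.lin u a n else 0) (b n)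
        + ((if n = c then P.d * dotp (a (c - 1)) (b c) else 0)
          + if n = c - 1 then -(P.d * dotp (a c) (b (c - 1))) else 0) := by
    intro n
    simp only [Chain.lin, RCLike.ofReal_real_eq_id, id]
    rcases lt_trichotomy n (c - 1) with h | rfl | h
    · rw [if_pos (by omega), if_pos (by omega), if_pos (by omega), if_pos (by omega),
        if_neg (by omega), if_neg (by omega)]
      simp
    · rw [if_neg (by omega), if_pos (by omega), if_pos (by omega), if_pos (by omega),
        if_neg (by omega), if_pos rfl, sub_add_cancel, smul_add, smul_add]
      simp only [dotp_sub_left, dotp_add_left, dotp_smul_left, dotp_zero_left, smul_zero,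
        RCLike.ofReal_real_eq_id, id]
      ring
    · rcases eq_or_lt_of_le (show c ≤ n by omega) with rfl | h'
      · rw [if_neg (by omega), if_pos (by omega), if_neg (by omega), if_neg (by omega),
          if_pos rfl, if_neg (by omega)]
        simp only [zero_add, map_zero, sub_zero, dotp_smul_left, dotp_zero_left, add_zero,
          RCLike.ofReal_real_eq_id, id]
      · rw [if_neg (by omega), if_neg (by omega), if_neg (by omega), if_neg (by omega),
          if_neg (by omega), if_neg (by omega)]
        simp [dotp_zero_left]
  have h3 : Summable fun n => ‖P.lin u a n‖ := by
    obtain ⟨C, hC⟩ := hu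
    have hsh : ∀ k : ℤ, Summable fun n => ‖a (n + k)‖ := fun k =>
      ha.comp_injective (i := fun n => n + k) (add_left_injective k)
    refine .of_nonneg_of_le (fun n => norm_nonneg _) (fun n => ?_)
      ((((hsh 1).add (hsh (-1))).mul_left P.d).add (ha.mul_left C))
    refine (norm_sub_le _ _).trans (add_le_add ?_ ((P.B ℝ (u n)).le_of_opNorm_le (hC n) _))
    rw [norm_smul, RCLike.norm_ofReal, abs_of_pos P.d_pos]
    exact mul_le_mul_of_nonneg_left (norm_add_le _ _) P.d_pos.le
  have h4 : Summable fun n => ‖if n < c then P.lin u a n else 0‖ :=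
    .of_nonneg_of_le (fun n => norm_nonneg _) (fun n => by split_ifs <;> simp) h3
  rw [pairing, pairing]
  simp only [h2]
  have h5 := (hasSum_ite_eq c (P.d * dotp (a (c - 1)) (b c))).add
    (hasSum_ite_eq (c - 1) (-(P.d * dotp (a c) (b (c - 1)))))
  rw [(summable_dotp h4 b).tsum_add h5.summable, h5.tsum_eq]
  ring

end Truncation

section Tridiagonal

variable {k : ℕ} (α : Fin k → ℝ)

theorem tridiag_castSucc_succ (l : Fin k) :
    tridiag α (fun i => -α i) l.castSucc l.succ = α l := by
  simp only [tridiag, Matrix.of_apply, neg_neg]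
  rw [Finset.sum_eq_single l, Finset.sum_eq_zero]
  · simp
  · intro j _
    split_ifs with h1 h2 h3 <;> simp only [Fin.ext_iff, Fin.val_castSucc, Fin.val_succ] at * <;> omega
  · intro j _ hj
    rw [if_neg fun h => hj (Fin.castSucc_injective _ h).symm]
  · simp

theorem tridiag_symm (i j : Fin (k + 1)) :
    tridiag α (fun i => -α i) i j = tridiag α (fun i => -α i) j i := by
  simp only [tridiag, Matrix.of_apply, neg_neg, ← Finset.sum_add_distrib]
  refine Finset.sum_congr rfl fun l _ => ?_
  split_ifs <;> simp_all

theorem sum_tridiag (i : Fin (k + 1)) : ∑ j, tridiag α (fun i => -α i) i j = 0 := by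
  simp only [tridiag, Matrix.of_apply, neg_neg, Finset.sum_add_distrib]
  rw [Finset.sum_comm, Finset.sum_comm (γ := Fin (k + 1)), ← Finset.sum_add_distrib]
  refine Finset.sum_eq_zero fun l _ => ?_
  have h : l.castSucc ≠ l.succ := (Fin.castSucc_lt_succ).ne
  have e : ∀ x y : Fin (k + 1), x ≠ y → ∀ r : ℝ,
      ∑ j, (if j = x then r else if j = y then -r else 0) = 0 := fun x y hxy r => by
    have : ∀ j, (if j = x then r else if j = y then -r else 0)
        = (if j = x then r else 0) + if j = y then -r else 0 := fun j => by
      split_ifs <;> simp_all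
    simp [this, Finset.sum_add_distrib]
  have h1 : ∑ j, (if i = l.castSucc then
      (if j = l.succ then α l else if j = l.castSucc then -α l else 0) else 0) = 0 := by
    split_ifs
    · exact e _ _ h.symm _
    · simp
  have h2 : ∑ j, (if i = l.succ then
      (if j = l.castSucc then α l else if j = l.succ then -α l else 0) else 0) = 0 := by
    split_ifs
    · exact e _ _ h _
    · simp
  rw [h1, h2, add_zero]

theorem tridiag_eq_zero {i j : Fin (k + 1)} (h : 2 ≤ ((i : ℤ) - (j : ℤ)).natAbs) :
    tridiag α (fun i => -α i) i j = 0 := by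
  simp only [tridiag, Matrix.of_apply]
  rw [Finset.sum_eq_zero, Finset.sum_eq_zero, add_zero] <;> intro l _ <;> split_ifs with h1 h2 h3 <;>
    simp only [Fin.ext_iff, Fin.val_castSucc, Fin.val_succ] at * <;> omega

end Tridiagonal

/-! ### The approximate kernel -/

namespace HypChain
namespace IsPulse

variable {M : ℕ} {P : HypChain M} {q : ℤ → X ℝ M} (hq : P.IsPulse q)
include hq

/-- The translates of the time derivative of the pulse are approximate solutions of the linearization
about a multi-breather. -/
theorem exists_lin_copy_bound (Λ : ℝ) : ∃ C, 0 < C ∧ ∀ {m : ℕ} [NeZero m] {L : ℕ} {s : Fin m → ℤ}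
    {σ : Fin m → ℝ} {u : ℤ → X ℝ M}, NearSuperposition P q Λ L s σ u → ∀ n,
    ∑ j, ‖P.lin u (copy σ s (fun n => dt P.T (q n)) j) n‖ ≤ C * P.θ ^ L ∧
    ∀ j, ‖P.lin u (copy σ s (fun n => dt P.T (q n)) j) n‖
        ≤ C * ((P.β ^ 2) ^ L * (P.β ^ 2) ^ (n - s j).natAbs) ∧
      ‖P.lin u (copy σ s (fun n => dt P.T (q n)) j) n‖ ≤ C * P.θ ^ (n - s j).natAbs := by
  obtain ⟨Q, hQ0, -, hQ⟩ := hq.exists_decay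
  obtain ⟨K, hK0, hK⟩ := hq.exists_B_sub_bound Λ
  have hρ0 := P.ρ_pos
  have hρ1 := P.ρ_lt_one
  have hG := geomC_pos hρ0 hρ1
  have hG2 := geomC_pos P.θ_pos P.θ_lt_one
  have hθ := P.sq_sq_β
  set ρ := P.β ^ 2
  rw [← hθ] at hK hG2 ⊢
  set A := 2 * geomC (ρ ^ 2) + geomC ρ ^ 2 + (1 + geomC ρ) with hA
  set A' := geomC ρ + 1 with hA'
  refine ⟨K * Q * (A + A' + (1 + geomC ρ + 1)), by positivity, fun {m} _ {L s σ u} h n => ?_⟩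
  have hKn := fun j => (hK h).2.2 n j
  set S : Fin m → ℝ := fun j => ∑ k ∈ Finset.univ.erase j, (ρ ^ 2) ^ (n - s k).natAbs with hS
  have hρ2 : ρ ^ 2 ≤ 1 := by nlinarith
  have hs := h.separated
  have hL := h.one_le
  have hx : ∀ k, 0 ≤ (ρ ^ 2) ^ (n - s k).natAbs := fun k => by positivity
  have hS0 : ∀ j, 0 ≤ S j := fun j => Finset.sum_nonneg fun k _ => hx k
  have h1 : ∀ j, ‖P.lin u (copy σ s (fun n => dt P.T (q n)) j) n‖
      ≤ K * Q * ((S j + (ρ ^ 2) ^ L) * (ρ ^ 2) ^ (n - s j).natAbs) := fun j => by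
    have h2 := lin_copy_sub (P := P) (q := q) (s := s) (σ := σ) u (fun n => dt P.T (q n)) j n
    rw [hq.lin_dt, smul_zero, sub_zero] at h2
    rw [h2, norm_neg]
    have h3 := ContinuousLinearMap.le_of_opNorm_le_of_le _ (hKn j)
      ((norm_copy h.sign s (fun n => dt P.T (q n)) j n).le.trans (hQ _))
    refine h3.trans (le_of_eq ?_)
    ring
  have hKQ : 0 < K * Q := by positivity
  refine ⟨?_, fun j => ⟨?_, ?_⟩⟩
  · refine (Finset.sum_le_sum fun j _ => h1 j).trans ?_
    rw [← Finset.mul_sum]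
    have h3 : ∑ j, (S j + (ρ ^ 2) ^ L) * (ρ ^ 2) ^ (n - s j).natAbs ≤ A * (ρ ^ 2) ^ L := by
      simp only [add_mul, Finset.sum_add_distrib, ← Finset.mul_sum]
      have h4 := hs.sum_sum_erase_le hρ0 hρ1 hL n
      have h5 := mul_le_mul_of_nonneg_left (hs.sum_le hρ0 hρ1 hL n)
        (by positivity : 0 ≤ (ρ ^ 2) ^ L)
      rw [hA]
      linarith
    calc _ ≤ K * Q * (A * (ρ ^ 2) ^ L) := by gcongr
      _ = K * Q * A * (ρ ^ 2) ^ L := by ring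
      _ ≤ _ := by
        gcongr
        linarith [(by positivity : 0 ≤ A' + (1 + geomC ρ + 1))]
  · refine (h1 j).trans ?_
    have h3 : (S j + (ρ ^ 2) ^ L) * (ρ ^ 2) ^ (n - s j).natAbs
        ≤ A' * (ρ ^ L * ρ ^ (n - s j).natAbs) := by
      rw [add_mul]
      have h4 := hs.sum_erase_mul_le hρ0 hρ1 hL n j
      have h5 : (ρ ^ 2) ^ L * (ρ ^ 2) ^ (n - s j).natAbs ≤ ρ ^ L * ρ ^ (n - s j).natAbs := by
        have : ρ ^ 2 ≤ ρ := by nlinarith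
        gcongr
      calc _ ≤ geomC ρ * ρ ^ L * ρ ^ (n - s j).natAbs + ρ ^ L * ρ ^ (n - s j).natAbs :=
            add_le_add h4 h5
        _ = _ := by rw [hA']; ring
    calc _ ≤ K * Q * (A' * (ρ ^ L * ρ ^ (n - s j).natAbs)) := by gcongr
      _ = K * Q * A' * (ρ ^ L * ρ ^ (n - s j).natAbs) := by ring
      _ ≤ _ := by
        gcongr
        linarith [(by positivity : 0 ≤ A + (1 + geomC ρ + 1))]
  · refine (h1 j).trans ?_
    have h3 : S j ≤ 1 + geomC ρ :=
      (Finset.sum_le_sum_of_subset_of_nonneg (Finset.erase_subset _ _) fun k _ _ => hx k).trans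
        (hs.sum_le hρ0 hρ1 hL n)
    have h4 : (ρ ^ 2) ^ L ≤ 1 := pow_le_one₀ (by positivity) hρ2
    calc _ ≤ K * Q * ((1 + geomC ρ + 1) * (ρ ^ 2) ^ (n - s j).natAbs) := by gcongr
      _ = K * Q * (1 + geomC ρ + 1) * (ρ ^ 2) ^ (n - s j).natAbs := by ring
      _ ≤ _ := by
        refine mul_le_mul_of_nonneg_right (mul_le_mul_of_nonneg_left ?_ hKQ.le) (hx j)
        linarith [(by positivity : 0 ≤ A + A')]

/-- The translates of the frequency derivative approximately solve the inhomogeneous equation that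
it satisfies about the pulse. -/
theorem exists_lin_copy_frequency_bound (Λ : ℝ) {y : ℤ → X ℝ M} {Y : ℝ}
    (hY : ∀ n : ℤ, ‖y n‖ ≤ Y * (P.β ^ 2) ^ n.natAbs)
    (hy : ∀ n, P.lin q y n = (2 : ℝ) • dt P.T (dt P.T (q n))) :
    ∃ C, 0 < C ∧ ∀ {m : ℕ} {L : ℕ} {s : Fin m → ℤ} {σ : Fin m → ℝ} {u : ℤ → X ℝ M},
    NearSuperposition P q Λ L s σ u → ∀ n,
    ∑ j, ‖P.lin u (copy σ s y j) n
        - (2 : ℝ) • dt P.T (copy σ s (fun n => dt P.T (q n)) j n)‖ ≤ C * (P.β ^ 2) ^ L := by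
  obtain ⟨K, hK0, hK⟩ := hq.exists_B_sub_bound Λ
  have hβ0 := P.β_pos
  have hβ1 := P.β_lt_one
  have hρ0 := P.ρ_pos
  have hρ1 := P.ρ_lt_one
  have hG := geomC_pos hρ0 hρ1
  have hG2 := geomC_pos hβ0 hβ1
  have hθ := P.sq_sq_β
  have hY0 : 0 ≤ Y := by
    have h := (norm_nonneg _).trans (hY 0)
    simpa using h
  rw [← hθ] at hK
  set A := geomC (P.β ^ 2) * (1 + geomC P.β) + (1 + geomC P.β) with hA
  refine ⟨K * Y * A + 1, by positivity, fun {m L s σ u} h n => ?_⟩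
  have hKn := fun j => (hK h).2.2 n j
  have hs := h.separated
  have hL := h.one_le
  set S : Fin m → ℝ := fun j => ∑ k ∈ Finset.univ.erase j, ((P.β ^ 2) ^ 2) ^ (n - s k).natAbs
    with hS
  have h1 : ∀ j, ‖P.lin u (copy σ s y j) n
        - (2 : ℝ) • dt P.T (copy σ s (fun n => dt P.T (q n)) j n)‖
      ≤ K * Y * ((S j + ((P.β ^ 2) ^ 2) ^ L) * (P.β ^ 2) ^ (n - s j).natAbs) := fun j => by
    have h2 := lin_copy_sub (P := P) (q := q) (s := s) (σ := σ) u y j n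
    have h3 : σ j • P.lin q y (n - s j)
        = (2 : ℝ) • dt P.T (copy σ s (fun n => dt P.T (q n)) j n) := by
      rw [hy, copy, ← dtL_apply (𝕜 := ℝ) P.T (σ j • _), map_smul, dtL_apply, smul_comm]
    rw [h3] at h2
    rw [h2, norm_neg]
    have h4 := ContinuousLinearMap.le_of_opNorm_le_of_le _ (hKn j)
      ((norm_copy h.sign s y j n).le.trans (hY _))
    refine h4.trans (le_of_eq ?_)
    ring
  refine (Finset.sum_le_sum fun j _ => h1 j).trans ?_
  rw [← Finset.mul_sum]
  have h3 : ∑ j, (S j + ((P.β ^ 2) ^ 2) ^ L) * (P.β ^ 2) ^ (n - s j).natAbs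
      ≤ A * (P.β ^ 2) ^ L := by
    simp only [add_mul, Finset.sum_add_distrib, ← Finset.mul_sum]
    have h4 := hs.sum_sum_erase_slow_le hβ0 hβ1 hL n
    have h5 := hs.sum_le hβ0 hβ1 hL n
    have h6 : ((P.β ^ 2) ^ 2) ^ L ≤ (P.β ^ 2) ^ L :=
      pow_le_pow_left₀ (by positivity) (by nlinarith) L
    have h7 : ((P.β ^ 2) ^ 2) ^ L * ∑ j, (P.β ^ 2) ^ (n - s j).natAbs
        ≤ (P.β ^ 2) ^ L * (1 + geomC P.β) := by gcongr
    rw [hA]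
    linarith
  calc _ ≤ K * Y * (A * (P.β ^ 2) ^ L) := by gcongr
    _ = K * Y * A * (P.β ^ 2) ^ L := by ring
    _ ≤ _ := by gcongr; linarith

end IsPulse
end HypChain

section Tails

theorem half_add_coHalf (N : ℕ) : half N + coHalf N = N := by unfold coHalf; ring

theorem norm_pairing_le_tail {𝕜 : Type} [RCLike 𝕜] {M : ℕ} {a : ℤ → X ℝ M} {b : ℤ → X 𝕜 M}
    {x K : ℝ} (h0 : 0 < x) (h1 : x < 1)
    (hK : 0 ≤ K) (c : ℤ) (h : ∀ n, ‖a n‖ * ‖b n‖ ≤ K * x ^ (n - c).natAbs) :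
    ‖pairing a b‖ ≤ K * (2 / (1 - x)) := by
  refine (norm_pairing_le_of_le ((summable_pow_natAbs h0 h1 c).mul_left K) h).trans ?_
  rw [tsum_mul_left]
  exact mul_le_mul_of_nonneg_left (tsum_pow_natAbs_le h0 h1 c) hK

end Tails

/-! ### The interaction matrix -/

theorem aTilde_eq_neg {M : ℕ} (T : ℝ) (q : ℤ → X ℝ M) {k : ℕ} (N : Fin k → ℕ)
    (σ : Fin (k + 1) → ℝ) : aTilde T q N σ = fun i => -a T q N σ i := by
  funext i
  rw [aTilde, a, ← mul_neg, ← intervalIntegral.integral_neg]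
  congr 2
  funext t
  ring

theorem a_eq_dotp {M : ℕ} {T : ℝ} (hT : 0 < T) (q : ℤ → X ℝ M) {k : ℕ} (N : Fin k → ℕ)
    (σ : Fin (k + 1) → ℝ) (i : Fin k) : a T q N σ i = σ i.castSucc * σ i.succ *
      (dotp (dt T (q (half (N i)))) (dt T (q (-coHalf (N i) - 1)))
        - dotp (dt T (q (half (N i) - 1))) (dt T (q (-coHalf (N i))))) := by
  have hc : ∀ u v : X ℝ M, IntervalIntegrable (fun t => ev T u t * ev T v t) MeasureTheory.volume 0 T :=
    fun u v => ((continuous_ev T u).mul (continuous_ev T v)).intervalIntegrable _ _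
  rw [a, intervalIntegral.integral_sub (hc _ _) (hc _ _), integral_ev_mul_ev hT,
    integral_ev_mul_ev hT]

namespace HypChain
namespace IsPulse

variable {M : ℕ} {P : HypChain M} {q : ℤ → X ℝ M} (hq : P.IsPulse q)
include hq

omit hq in
theorem pairing_lin_symm {u a b : ℤ → X ℝ M} (ha : Summable fun n => ‖a n‖)
    (hb : ∃ C, ∀ n, ‖b n‖ ≤ C) (hu : ∃ C, ∀ n, ‖P.B ℝ (u n)‖ ≤ C) :
    pairing a (P.lin u b) = pairing b (P.lin u a) := by
  refine (P.pairing_lin ha hu (mkSeq b hb)).trans ?_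
  exact tsum_congr fun n => dotp_comm _ _

theorem copy_dt_bdd {m : ℕ} (σ : Fin m → ℝ) (s : Fin m → ℤ) (j : Fin m) :
    ∃ C, ∀ n, ‖copy σ s (fun n => dt P.T (q n)) j n‖ ≤ C := by
  obtain ⟨C, hC⟩ := hq.dt_bdd
  refine ⟨|σ j| * C, fun n => ?_⟩
  rw [copy, norm_smul, Real.norm_eq_abs]
  exact mul_le_mul_of_nonneg_left (hC _) (abs_nonneg _)

/-- The interaction of two neighbouring copies is given by the symplectic form between them at the
midpoint. -/
theorem exists_adjacent_bound (Λ : ℝ) : ∃ C, 0 < C ∧ ∀ {k L : ℕ} {N : Fin k → ℕ}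
    {s : Fin (k + 1) → ℤ} {σ : Fin (k + 1) → ℝ} {u : ℤ → X ℝ M},
    NearSuperposition P q Λ L s σ u → (∀ i, s i.succ = s i.castSucc + N i) → (∀ i, L ≤ N i) → ∀ i,
    |pairing (copy σ s (fun n => dt P.T (q n)) i.castSucc)
        (P.lin u (copy σ s (fun n => dt P.T (q n)) i.succ)) + P.d * a P.T q N σ i|
      ≤ C * ((P.β ^ 2) ^ L) ^ 3 := by
  obtain ⟨Q, hQ0, -, hQ⟩ := hq.exists_decay
  obtain ⟨K, hK0, hK⟩ := hq.exists_B_sub_bound Λ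
  obtain ⟨D, hD0, hD⟩ := hq.exists_lin_copy_bound Λ
  have hρ0 := P.ρ_pos
  have hρ1 := P.ρ_lt_one
  have hθ0 := P.θ_pos
  have hθ1 := P.θ_lt_one
  have hθ := P.sq_sq_β
  set ρ := P.β ^ 2
  rw [hθ] at hQ
  have hθ' : 0 < 1 - P.θ := by linarith
  refine ⟨D * Q / ρ * (2 / (1 - P.θ)) + D * Q * (2 / (1 - P.θ)), by positivity,
    fun {k L N s σ u} h hs hN i => ?_⟩
  set c := s i.castSucc + half (N i) with hc
  have hc' : c = s i.succ - coHalf (N i) := by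
    rw [hs]
    have := half_add_coHalf (N i)
    omega
  set x := copy σ s (fun n => dt P.T (q n)) i.castSucc with hx
  set y := copy σ s (fun n => dt P.T (q n)) i.succ with hy
  have hu : ∃ C, ∀ n, ‖P.B ℝ (u n)‖ ≤ C := ⟨K, (hK h).1⟩
  have hxs : Summable fun n => ‖x n‖ := hq.summable_goldstone σ s i.castSucc
  have hxn : ∀ n, ‖x n‖ ≤ Q * P.θ ^ (n - s i.castSucc).natAbs := fun n =>
    (norm_copy h.sign s _ _ n).le.trans (hQ _)
  have hyn : ∀ n, ‖y n‖ ≤ Q * P.θ ^ (n - s i.succ).natAbs := fun n =>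
    (norm_copy h.sign s _ _ n).le.trans (hQ _)
  have hlin : ∀ j n, ‖P.lin u (copy σ s (fun n => dt P.T (q n)) j) n‖ ≤ D * P.θ ^ L := fun j n =>
    (Finset.single_le_sum (f := fun j => ‖P.lin u (copy σ s (fun n => dt P.T (q n)) j) n‖)
      (fun j _ => norm_nonneg _) (Finset.mem_univ j)).trans (hD h n).1
  have hhalf : ((half (N i)).natAbs : ℤ) = half (N i) ∧ N i ≤ 2 * (half (N i)).natAbs + 1 ∧
      ((coHalf (N i)).natAbs : ℤ) = coHalf (N i) ∧ N i ≤ 2 * (coHalf (N i)).natAbs := by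
    unfold coHalf half; omega
  obtain ⟨hh1, hh2, hh3, hh4⟩ := hhalf
  have hLN := hN i
  have hρL0 : 0 < ρ ^ L := by positivity
  have hhρ : P.θ ^ (half (N i)).natAbs ≤ ρ ^ L / ρ := by
    rw [le_div_iff₀ hρ0, ← hθ, ← pow_mul, ← pow_succ]
    exact pow_le_pow_of_le_one hρ0.le hρ1.le (by omega)
  have hcρ : P.θ ^ (coHalf (N i)).natAbs ≤ ρ ^ L := by
    rw [← hθ, ← pow_mul]
    exact pow_le_pow_of_le_one hρ0.le hρ1.le (by omega)
  have hθL : P.θ ^ L = ρ ^ L * ρ ^ L := by rw [← hθ]; ring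
  -- To the right of the midpoint `c`, the copy at the left center has size `ρ ^ L`, and the residual of
  -- the other copy has size `θ ^ L = ρ ^ (2 L)`.
  have h1 : ‖pairing (fun n => if n < c then 0 else x n) (P.lin u y)‖
      ≤ D * Q / ρ * (ρ ^ L) ^ 3 * (2 / (1 - P.θ)) := by
    refine norm_pairing_le_tail hθ0 hθ1 (by positivity) c fun n => ?_
    by_cases hn : n < c
    · rw [if_pos hn, norm_zero, zero_mul]
      positivity
    · rw [if_neg hn]
      calc _ ≤ (Q * P.θ ^ (n - s i.castSucc).natAbs) * (D * P.θ ^ L) := by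
            gcongr
            · exact hxn n
            · exact hlin _ _
        _ = D * Q * P.θ ^ L * P.θ ^ ((half (N i)).natAbs) * P.θ ^ (n - c).natAbs := by
            rw [show (n - s i.castSucc).natAbs = (half (N i)).natAbs + (n - c).natAbs by omega,
              pow_add]
            ring
        _ ≤ D * Q * P.θ ^ L * (ρ ^ L / ρ) * P.θ ^ (n - c).natAbs := by gcongr
        _ = _ := by rw [hθL]; ring
  -- To the left of it, summation by parts exchanges the roles of the copies, at the expense of the
  -- symplectic form at the midpoint.
  have h2 : ‖pairing (fun n => if n < c then P.lin u x n else 0) y‖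
      ≤ D * Q * (ρ ^ L) ^ 3 * (2 / (1 - P.θ)) := by
    refine norm_pairing_le_tail hθ0 hθ1 (by positivity) c fun n => ?_
    by_cases hn : n < c
    · rw [if_pos hn]
      calc _ ≤ (D * P.θ ^ L) * (Q * P.θ ^ (n - s i.succ).natAbs) := by
            gcongr
            · exact hlin _ _
            · exact hyn n
        _ = D * Q * P.θ ^ L * P.θ ^ ((coHalf (N i)).natAbs) * P.θ ^ (n - c).natAbs := by
            rw [show (n - s i.succ).natAbs = (coHalf (N i)).natAbs + (n - c).natAbs by omega,
              pow_add]
            ring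
        _ ≤ D * Q * P.θ ^ L * ρ ^ L * P.θ ^ (n - c).natAbs := by gcongr
        _ = _ := by rw [hθL]; ring
    · rw [if_neg hn, norm_zero, zero_mul]
      positivity
  have h3 := P.pairing_truncated_lin hxs hu (mkSeq y (hq.copy_dt_bdd σ s i.succ)) c
  have h4 : dotp (x (c - 1)) (y c) - dotp (x c) (y (c - 1)) = -a P.T q N σ i := by
    rw [a_eq_dotp P.T_pos, hx, hy]
    simp only [copy, dotp_smul_left, dotp_smul_right, RCLike.ofReal_real_eq_id, id]
    rw [show c - s i.castSucc = half (N i) by omega,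
      show c - 1 - s i.castSucc = half (N i) - 1 by omega,
      show c - s i.succ = -coHalf (N i) by omega,
      show c - 1 - s i.succ = -coHalf (N i) - 1 by omega]
    ring
  have h5 : pairing x (P.lin u y) = pairing (fun n => if n < c then x n else 0) (P.lin u y)
      + pairing (fun n => if n < c then 0 else x n) (P.lin u y) := by
    have hs1 := summable_dotp (a := fun n => if n < c then x n else 0)
      (.of_nonneg_of_le (fun n => norm_nonneg _) (fun n => by split_ifs <;> simp) hxs)
      (mkSeq (P.lin u y) ⟨_, hlin i.succ⟩)
    have hs2 := summable_dotp (a := fun n => if n < c then 0 else x n)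
      (.of_nonneg_of_le (fun n => norm_nonneg _) (fun n => by split_ifs <;> simp) hxs)
      (mkSeq (P.lin u y) ⟨_, hlin i.succ⟩)
    refine Eq.trans (tsum_congr fun n => ?_) (hs1.tsum_add hs2)
    simp only [mkSeq_apply]
    split_ifs <;> simp [dotp_zero_left]
  have h6 : pairing x (P.lin u y) + P.d * a P.T q N σ i
      = pairing (fun n => if n < c then P.lin u x n else 0) y
        + pairing (fun n => if n < c then 0 else x n) (P.lin u y) := by
    rw [h5]
    have h7 : pairing (fun n => if n < c then x n else 0) (P.lin u y)
      = pairing (fun n => if n < c then P.lin u x n else 0) y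
        + P.d * (dotp (x (c - 1)) (y c) - dotp (x c) (y (c - 1))) := h3
    rw [h7, h4]
    ring
  rw [h6]
  refine (abs_add_le _ _).trans ((add_le_add h2 h1).trans (le_of_eq ?_))
  ring

/-- Translations in time of the whole multi-breather do not contribute to the interaction. -/
theorem exists_rowSum_bound (Λ : ℝ) : ∃ C, 0 < C ∧ ∀ {m : ℕ} [NeZero m] {L : ℕ}
    {s : Fin m → ℤ} {σ : Fin m → ℝ} {u : ℤ → X ℝ M}, NearSuperposition P q Λ L s σ u → ∀ i,
    |∑ j, pairing (copy σ s (fun n => dt P.T (q n)) i)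
        (P.lin u (copy σ s (fun n => dt P.T (q n)) j))| ≤ C * ((P.β ^ 2) ^ L) ^ 3 := by
  obtain ⟨K, hK0, hK⟩ := hq.exists_B_sub_bound Λ
  obtain ⟨D, hD0, hD⟩ := hq.exists_lin_copy_bound Λ
  have hρ0 := P.ρ_pos
  have hρ1 := P.ρ_lt_one
  have hθ0 := P.θ_pos
  have hθ := P.sq_sq_β
  set ρ := P.β ^ 2
  have hρ' : 0 < 1 - ρ := by linarith
  set c := ‖(dtL ℝ P.T : X ℝ M →L[ℝ] X ℝ M)‖ with hc
  refine ⟨D * (c * |Λ| + 1) * (2 / (1 - ρ)), by positivity, fun {m} _ {L s σ u} h i => ?_⟩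
  set e := copy σ s fun n => dt P.T (q n) with he
  have hu : ∃ C, ∀ n, ‖P.B ℝ (u n)‖ ≤ C := ⟨K, (hK h).1⟩
  have hes : ∀ j, Summable fun n => ‖e j n‖ := hq.summable_goldstone σ s
  have hl : ∀ n, ‖P.lin u (e i) n‖ ≤ D * (ρ ^ L * ρ ^ (n - s i).natAbs) :=
    fun n => ((hD h n).2 i).1
  have hls : Summable fun n => ‖P.lin u (e i) n‖ :=
    .of_nonneg_of_le (fun n => norm_nonneg _) hl
      (((summable_pow_natAbs hρ0 hρ1 _).mul_left _).mul_left _)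
  set E : Fin m → Seq (X ℝ M) := fun j => mkSeq (e j) (hq.copy_dt_bdd σ s j) with hE
  set U : Seq (X ℝ M) := mkSeq (fun n => dt P.T (u n)) ⟨c * K, fun n =>
    (dtL ℝ P.T : X ℝ M →L[ℝ] X ℝ M).le_of_opNorm_le_of_le le_rfl ((hK h).2.1 n)⟩ with hU
  have h1 : ∀ j, pairing (e i) (P.lin u (e j)) = pairL ℝ _ hls (E j) := fun j =>
    P.pairing_lin (hes i) hu (E j)
  -- The time derivative of the multi-breather is in the kernel of the linearization, and differs from the
  -- sum of the copies of the time derivative of the pulse by `O(θ ^ L)`.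
  have h2 : pairL ℝ _ hls U = 0 := by
    refine (P.pairing_lin (hes i) hu U).symm.trans ?_
    have h3 : ∀ n, P.lin u U n = 0 := fun n => by
      simp only [Chain.lin, hU, mkSeq_apply]
      rw [P.B_dt, ← h.eq, sub_eq_zero]
      simp only [← dtL_apply, map_add, map_smul, RCLike.ofReal_real_eq_id, id]
    simp only [pairing, h3, dotp_zero_right, tsum_zero]
  simp only [h1]
  rw [← map_sum, ← sub_zero (pairL ℝ _ hls _), ← h2, ← map_sub, pairL_apply]
  have h3 : ∀ n, ‖(∑ j, E j - U) n‖ ≤ c * (|Λ| * P.θ ^ L) := fun n => by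
    have h4 : (∑ j, E j - U) n = -dtL ℝ P.T (u n - superpose σ s q n) := by
      rw [map_sub, superpose, map_sum]
      simp only [hE, hU, he, BoundedContinuousFunction.coe_sub, Pi.sub_apply,
        BoundedContinuousFunction.coe_sum, Finset.sum_apply, mkSeq_apply, copy, map_smul, dtL_apply]
      abel
    rw [h4, norm_neg]
    exact ContinuousLinearMap.le_of_opNorm_le_of_le _ le_rfl ((h.close n).trans
      (mul_le_mul_of_nonneg_right (le_abs_self _) (by positivity)))
  have hk : 0 < D * (c * |Λ| + 1) * (ρ ^ L) ^ 3 := by positivity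
  have h5 := norm_pairing_le_tail (a := P.lin u (e i)) (b := (∑ j, E j - U : Seq (X ℝ M))) hρ0 hρ1
    hk.le (s i) fun n => by
      have hρL0 : 0 < ρ ^ L := by positivity
      calc _ ≤ D * (ρ ^ L * ρ ^ (n - s i).natAbs) * (c * (|Λ| * P.θ ^ L)) := by
            gcongr
            · exact hl n
            · exact h3 n
        _ = D * (c * |Λ|) * (ρ ^ L) ^ 3 * ρ ^ (n - s i).natAbs := by rw [← hθ]; ring
        _ ≤ _ := by gcongr; linarith
  refine h5.trans (le_of_eq ?_)
  ring

/-- The matrix of the linearization in the approximate kernel is tridiagonal to leading order. -/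
theorem exists_interaction_bound (Λ : ℝ) : ∃ C, 0 < C ∧ ∀ {k L : ℕ} {N : Fin k → ℕ}
    {s : Fin (k + 1) → ℤ} {σ : Fin (k + 1) → ℝ} {u : ℤ → X ℝ M},
    NearSuperposition P q Λ L s σ u → (∀ i, s i.succ = s i.castSucc + N i) → (∀ i, L ≤ N i) → ∀ i,
    ∑ j, |pairing (copy σ s (fun n => dt P.T (q n)) i)
        (P.lin u (copy σ s (fun n => dt P.T (q n)) j))
          + P.d * tridiag (a P.T q N σ) (aTilde P.T q N σ) i j| ≤ C * ((P.β ^ 2) ^ L) ^ 3 := by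
  obtain ⟨Q, hQ0, -, hQ⟩ := hq.exists_decay
  obtain ⟨K, hK0, hK⟩ := hq.exists_B_sub_bound Λ
  obtain ⟨D, hD0, hD⟩ := hq.exists_lin_copy_bound Λ
  obtain ⟨C₁, hC₁, hadj⟩ := hq.exists_adjacent_bound Λ
  obtain ⟨C₂, hC₂, hrow⟩ := hq.exists_rowSum_bound Λ
  -- A further root of the rate: overlaps at distance `2 L` are of the order `x ^ (14 L)`, which leaves
  -- room over the required `ρ ^ (3 L) = x ^ (12 L)`, while the sum over `j` uses `x ^ 2`.
  obtain ⟨x, hx0, hx1, hxβ⟩ : ∃ x, 0 < x ∧ x < 1 ∧ x ^ 2 = P.β :=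
    ⟨√P.β, Real.sqrt_pos.mpr P.β_pos, by
      rw [Real.sqrt_lt' one_pos, one_pow]; exact P.β_lt_one, Real.sq_sqrt P.β_pos.le⟩
  have hθ : P.θ = x ^ 8 := by rw [← P.sq_sq_β, ← hxβ]; ring
  have hρ : ∀ L : ℕ, ((P.β ^ 2) ^ L) ^ 3 = x ^ (10 * L) * (x ^ 2) ^ L := fun L => by
    rw [← hxβ]; ring
  have hx20 : 0 < x ^ 2 := by positivity
  have hx21 : x ^ 2 < 1 := by nlinarith
  have hG := geomC_pos hx20 hx21
  have hx' : 0 < 1 - x := by linarith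
  rw [P.sq_sq_β, hθ] at hQ
  set C₃ := D * Q * (2 / (1 - x)) with hC₃
  refine ⟨C₂ + 2 * ((C₁ + C₃) * geomC (x ^ 2)), by positivity, fun {k L N s σ u} h hs hN i => ?_⟩
  rw [aTilde_eq_neg]
  set e := copy σ s fun n => dt P.T (q n) with he
  have hu : ∃ C, ∀ n, ‖P.B ℝ (u n)‖ ≤ C := ⟨K, (hK h).1⟩
  have hes : ∀ j, Summable fun n => ‖e j n‖ := hq.summable_goldstone σ s
  have hsymm : ∀ i j, pairing (e i) (P.lin u (e j)) = pairing (e j) (P.lin u (e i)) := fun i j =>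
    pairing_lin_symm (hes i) (hq.copy_dt_bdd σ s j) hu
  set f : Fin (k + 1) → ℝ := fun j => pairing (e i) (P.lin u (e j))
    + P.d * tridiag (a P.T q N σ) (fun i => -a P.T q N σ i) i j with hf
  have hfar : ∀ j, |pairing (e i) (P.lin u (e j))| ≤ C₃ * (x ^ 7) ^ (s i - s j).natAbs := by
    intro j
    obtain ⟨h1, h2⟩ := tsum_pow_mul_pow_le hx0 hx1 7 (s i) (s j)
    have h3 : ∀ n, ‖e i n‖ * ‖P.lin u (e j) n‖
        ≤ D * Q * ((x ^ (7 + 1)) ^ (n - s i).natAbs * (x ^ 7) ^ (n - s j).natAbs) := fun n => by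
      have h4 : x ^ 8 ≤ x ^ 7 := pow_le_pow_of_le_one hx0.le hx1.le (by norm_num)
      have h5 : ‖e i n‖ ≤ Q * (x ^ 8) ^ (n - s i).natAbs :=
        (norm_copy h.sign s _ _ n).le.trans (hQ _)
      have h6 := ((hD h n).2 j).2
      rw [hθ] at h6
      calc _ ≤ Q * (x ^ 8) ^ (n - s i).natAbs * (D * (x ^ 8) ^ (n - s j).natAbs) := by gcongr
        _ ≤ Q * (x ^ 8) ^ (n - s i).natAbs * (D * (x ^ 7) ^ (n - s j).natAbs) := by gcongr
        _ = _ := by ring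
    refine (norm_pairing_le_of_le (h1.mul_left _) h3).trans ?_
    rw [tsum_mul_left, hC₃, mul_assoc _ (2 / (1 - x))]
    gcongr
  have hbound : ∀ j, j ≠ i →
      |f j| ≤ (C₁ + C₃) * x ^ (10 * L) * (x ^ 2) ^ (L * ((i : ℤ) - (j : ℤ)).natAbs) := by
    intro j hj
    have hij : ((i : ℤ) - (j : ℤ)).natAbs ≠ 0 := fun h0 => hj (Fin.ext (by omega))
    rcases (show ((i : ℤ) - (j : ℤ)).natAbs = 1 ∨ 2 ≤ ((i : ℤ) - (j : ℤ)).natAbs by omega) with h1 | h1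
    · have h2 : |f j| ≤ C₁ * ((P.β ^ 2) ^ L) ^ 3 := by
        rcases (show (j : ℕ) = i + 1 ∨ (i : ℕ) = j + 1 by omega) with h3 | h3
        · have hik : (i : ℕ) < k := by omega
          obtain ⟨l, hl, hl'⟩ : ∃ l : Fin k, i = l.castSucc ∧ j = l.succ :=
            ⟨⟨i, hik⟩, Fin.ext rfl, Fin.ext h3⟩
          simp only [hf]
          rw [hl, hl', tridiag_castSucc_succ]
          exact hadj h hs hN l
        · have hjk : (j : ℕ) < k := by omega
          obtain ⟨l, hl, hl'⟩ : ∃ l : Fin k, j = l.castSucc ∧ i = l.succ :=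
            ⟨⟨j, hjk⟩, Fin.ext rfl, Fin.ext h3⟩
          simp only [hf]
          rw [tridiag_symm, hsymm, hl, hl', tridiag_castSucc_succ]
          exact hadj h hs hN l
      rw [h1, mul_one, mul_assoc, ← hρ]
      refine h2.trans ?_
      have := P.ρ_pos
      gcongr
      linarith [(by positivity : 0 < C₃)]
    · have h2 : |f j| ≤ C₃ * (x ^ 7) ^ (s i - s j).natAbs := by
        simp only [hf, tridiag_eq_zero _ h1, mul_zero, add_zero]
        exact hfar j
      refine h2.trans ?_
      rw [mul_assoc (C₁ + C₃)]
      have h3 : (x ^ 7) ^ (s i - s j).natAbs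
          ≤ x ^ (10 * L) * (x ^ 2) ^ (L * ((i : ℤ) - (j : ℤ)).natAbs) := by
        rw [← pow_mul, ← pow_mul, ← pow_add]
        refine pow_le_pow_of_le_one hx0.le hx1.le ?_
        have h4 := h.separated i j
        have h5 := Nat.mul_le_mul_left L h1
        omega
      exact mul_le_mul (le_add_of_nonneg_left hC₁.le) h3 (by positivity) (by positivity)
  have hoff : ∑ j ∈ Finset.univ.erase i, |f j| ≤ (C₁ + C₃) * geomC (x ^ 2) * ((P.β ^ 2) ^ L) ^ 3 := by
    have h1 := Separated.sum_erase_le_of_le (L := L) i hx20 hx21 h.one_le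
      (C := (C₁ + C₃) * x ^ (10 * L)) (by positivity) (f := fun j => if j = i then 0 else |f j|)
      fun j => by
        split_ifs with hj
        · positivity
        · exact hbound j hj
    rw [hρ]
    have h2 : ∑ j ∈ Finset.univ.erase i, |f j|
        = ∑ j ∈ Finset.univ.erase i, if j = i then 0 else |f j| :=
      Finset.sum_congr rfl fun j hj => by rw [if_neg (Finset.ne_of_mem_erase hj)]
    rw [h2]
    refine h1.trans (le_of_eq ?_)
    ring
  -- The diagonal entry is controlled by the off-diagonal ones, as both row sums are small.
  have hdiag : |f i| ≤ C₂ * ((P.β ^ 2) ^ L) ^ 3 + ∑ j ∈ Finset.univ.erase i, |f j| := by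
    have h1 : ∑ j, f j = ∑ j, pairing (e i) (P.lin u (e j)) := by
      rw [hf, Finset.sum_add_distrib, ← Finset.mul_sum, sum_tridiag, mul_zero, add_zero]
    have h2 : f i = ∑ j, pairing (e i) (P.lin u (e j)) - ∑ j ∈ Finset.univ.erase i, f j := by
      rw [← h1, ← Finset.add_sum_erase _ _ (Finset.mem_univ i)]
      ring
    rw [h2]
    exact (abs_sub _ _).trans (add_le_add (hrow h i) (Finset.abs_sum_le_sum_abs _ _))
  rw [← Finset.add_sum_erase _ _ (Finset.mem_univ i)]
  change |f i| + ∑ j ∈ Finset.univ.erase i, |f j| ≤ _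
  linarith

end IsPulse
end HypChain

/-! ### The Floquet problem -/

section Combinations

variable {M m : ℕ}

/-- A complex linear combination of real sequences. -/
noncomputable def comb (c : Fin m → ℂ) (x : Fin m → ℤ → X ℝ M) (n : ℤ) : X ℂ M :=
  ∑ j, c j • lift ℂ (x j n)

variable (c : Fin m → ℂ) (x : Fin m → ℤ → X ℝ M)

theorem norm_comb_le (n : ℤ) : ‖comb c x n‖ ≤ ‖c‖ * ∑ j, ‖x j n‖ := by
  rw [Finset.mul_sum]
  refine norm_sum_le_of_le _ fun j _ => ?_
  rw [norm_smul, norm_lift]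
  exact mul_le_mul_of_nonneg_right (norm_le_pi_norm c j) (norm_nonneg _)

theorem comb_bdd (hx : ∀ j, ∃ C, ∀ n, ‖x j n‖ ≤ C) : ∃ C, ∀ n, ‖comb c x n‖ ≤ C := by
  choose C hC using hx
  exact ⟨‖c‖ * ∑ j, C j, fun n => (norm_comb_le c x n).trans
    (mul_le_mul_of_nonneg_left (Finset.sum_le_sum fun j _ => hC j n) (norm_nonneg _))⟩

theorem dt_comb (T : ℝ) (n : ℤ) : dt T (comb c x n) = comb c (fun j n => dt T (x j n)) n := by
  rw [← dtL_apply, comb, map_sum]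
  simp only [map_smul, dtL_apply, dt_lift]
  rfl

theorem pairing_comb {a : ℤ → X ℝ M} (ha : Summable fun n => ‖a n‖)
    (hx : ∀ j, ∃ C, ∀ n, ‖x j n‖ ≤ C) :
    pairing a (comb c x) = ∑ j, ((pairing a (x j) : ℝ) : ℂ) * c j := by
  have h1 : ∀ n, dotp (a n) (comb c x n) = ∑ j, ((dotp (a n) (x j n) : ℝ) : ℂ) * c j := fun n => by
    rw [dotp_eq_sum, comb]
    simp only [WithLp.ofLp_sum, Finset.sum_apply, Finset.mul_sum]
    rw [Finset.sum_comm]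
    refine Finset.sum_congr rfl fun j _ => ?_
    have h2 := dotp_smul_right (a n) (c j) (lift ℂ (x j n))
    rw [dotp_lift, dotp_eq_sum] at h2
    rw [mul_comm (_ : ℂ) (c j)]
    exact h2
  have h2 : ∀ j, Summable fun n => ((dotp (a n) (x j n) : ℝ) : ℂ) * c j := fun j =>
    (Complex.ofRealCLM.summable (summable_dotp ha (mkSeq (x j) (hx j)))).mul_right _
  rw [pairing]
  simp only [h1]
  rw [Summable.tsum_finsetSum fun j _ => h2 j]
  refine Finset.sum_congr rfl fun j _ => ?_
  rw [tsum_mul_right, pairing, Complex.ofReal_tsum]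

theorem Chain.lin_comb (P : Chain) (u : ℤ → X ℝ M) (n : ℤ) :
    P.lin u (comb c x) n = comb c (fun j => P.lin u (x j)) n := by
  simp only [Chain.lin, comb, map_sum, map_smul, P.B_lift, ← Finset.sum_add_distrib,
    Finset.smul_sum, ← Finset.sum_sub_distrib]
  refine Finset.sum_congr rfl fun j _ => ?_
  have h : ∀ v : X ℝ M, lift ℂ (P.d • v) = (P.d : ℂ) • lift ℂ v := fun v => by
    ext k; simp
  simp only [map_sub, map_add, RCLike.ofReal_real_eq_id, id, h, smul_sub, smul_add]
  simp only [smul_comm (c j)]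
  rfl

end Combinations

/-- The spectral part `w ↦ 2 l ∂_t w + l² w` of the Floquet problem. -/
noncomputable def floquetTerm {M : ℕ} (T : ℝ) (l : ℂ) : X ℂ M →L[ℂ] X ℂ M :=
  (2 * l) • dtL ℂ T + l ^ 2 • ContinuousLinearMap.id ℂ (X ℂ M)

theorem floquetTerm_apply {M : ℕ} (T : ℝ) (l : ℂ) (w : X ℂ M) :
    floquetTerm T l w = (2 * l) • dt T w + l ^ 2 • w := rfl

theorem Chain.exists_floquetEigenfunction_iff (P : Chain) {M : ℕ} (u : ℤ → X ℝ M) (l : ℂ) :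
    (∃ W, IsFloquetEigenfunction P.V P.d P.T u l W) ↔
      ∃ w : Seq (X ℂ M), w ≠ 0 ∧ ∀ n, P.lin u w n = floquetTerm P.T l (w n) := by
  have hd : (P.d : ℂ) ≠ 0 := by exact_mod_cast P.d_pos.ne'
  have key : ∀ x y z : X ℂ M, ∀ n,
      (x = (2 : ℂ) • y + ((1 / P.d : ℝ) : ℂ) • dg P.V P.T (u n) y
        + ((1 / P.d : ℝ) : ℂ) • dt P.T (dt P.T y) - z
        + (1 / P.d : ℂ) • ((2 * l) • dt P.T y + l ^ 2 • y)) ↔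
      (P.d : ℂ) • (x + z) - P.B ℂ (u n) y = floquetTerm P.T l y := by
    intro x y z n
    rw [P.B_apply, floquetTerm_apply]
    have e2 : (RCLike.ofReal (2 * P.d) : ℂ) = 2 * (P.d : ℂ) := by simp
    have e3 : ((1 / P.d : ℝ) : ℂ) = (P.d : ℂ)⁻¹ := by simp
    rw [e2, e3, one_div]
    generalize (2 * l) • dt P.T y + l ^ 2 • y = r
    constructor
    · rintro rfl
      match_scalars <;> field_simp <;> ring
    · rintro rfl
      match_scalars <;> field_simp <;> ring
  constructor
  · rintro ⟨W, hW0, ⟨b, hb⟩, hW⟩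
    have h2 : ∀ n, (W n).2 = (W (n - 1)).1 := fun n => by
      have := hW (n - 1)
      rw [sub_add_cancel] at this
      rw [this]
      simp [DF]
    refine ⟨mkSeq (fun n => (W n).1) ⟨b, fun n => (norm_fst_le _).trans (hb n)⟩, fun h0 => hW0 ?_,
      fun n => ?_⟩
    · have h3 : ∀ n, (W n).1 = 0 := fun n => DFunLike.congr_fun h0 n
      funext n
      exact Prod.ext (h3 n) ((h2 n).trans (h3 _))
    · refine (key _ _ _ n).mp ?_
      have := congrArg Prod.fst (hW n)
      simp only [DF, Prod.fst_add] at this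
      rw [h2] at this
      exact this
  · rintro ⟨w, hw0, hw⟩
    refine ⟨fun n => (w n, w (n - 1)), fun h0 => hw0 ?_, ⟨‖w‖, fun n => ?_⟩, fun n => ?_⟩
    · ext1 n
      exact congrArg Prod.fst (congrFun h0 n)
    · exact (Prod.norm_def _).trans_le (max_le (w.norm_apply_le _) (w.norm_apply_le _))
    · refine Prod.ext ?_ ?_
      · simp only [DF, Prod.fst_add]
        exact (key _ _ _ n).mpr (hw n)
      · simp [DF]

/-! ### The multiplier block and the Gram matrix -/

section Multiplier

variable {Z : Type*} [NormedAddCommGroup Z] [NormedSpace ℂ Z] [CompleteSpace Z] {m : ℕ}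

/-- The lower right block of the inverse of a bordered operator: it maps the prescribed values of the
functionals to the multipliers of the bordering vectors. -/
noncomputable def multiplier (S : Z × (Fin m → ℂ) →L[ℂ] Z × (Fin m → ℂ)) :
    Matrix (Fin m) (Fin m) ℂ :=
  LinearMap.toMatrix' (LinearMap.snd ℂ Z (Fin m → ℂ) ∘ₗ
    ((Ring.inverse S : Z × (Fin m → ℂ) →L[ℂ] Z × (Fin m → ℂ)) : _ →ₗ[ℂ] _) ∘ₗ LinearMap.inr ℂ Z _)

variable {S : Z × (Fin m → ℂ) →L[ℂ] Z × (Fin m → ℂ)}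

theorem multiplier_mulVec (hS : Function.Bijective S) {w : Z} {b c : Fin m → ℂ}
    (h : S (w, b) = (0, c)) : multiplier S *ᵥ c = b := by
  rw [multiplier, LinearMap.toMatrix'_mulVec]
  have h1 : Ring.inverse S (S (w, b)) = (w, b) := by
    have := Ring.inverse_mul_cancel S (ContinuousLinearMap.isUnit_iff_bijective.mpr hS)
    exact DFunLike.congr_fun this (w, b)
  rw [h] at h1
  exact congrArg Prod.snd h1

theorem det_multiplier_eq_zero_iff (hS : Function.Bijective S) :
    (multiplier S).det = 0 ↔ ∃ w, w ≠ 0 ∧ ∃ c, S (w, 0) = (0, c) := by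
  rw [← Matrix.exists_mulVec_eq_zero_iff]
  constructor
  · rintro ⟨c, hc0, hc⟩
    obtain ⟨⟨w, b⟩, hx⟩ := hS.2 (0, c)
    rw [multiplier_mulVec hS hx] at hc
    subst hc
    refine ⟨w, ?_, c, hx⟩
    rintro rfl
    exact hc0 (congrArg Prod.snd (hx.symm.trans (map_zero S)))
  · rintro ⟨w, hw, c, h⟩
    refine ⟨c, ?_, multiplier_mulVec hS h⟩
    rintro rfl
    exact hw (congrArg Prod.fst (hS.1 (h.trans (map_zero S).symm)))

theorem differentiableAt_multiplier {S : ℂ → Z × (Fin m → ℂ) →L[ℂ] Z × (Fin m → ℂ)} {l : ℂ}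
    (hS : DifferentiableAt ℂ S l) (hb : Function.Bijective (S l)) (i j : Fin m) :
    DifferentiableAt ℂ (fun l => multiplier (S l) i j) l := by
  have h1 : DifferentiableAt ℂ (fun l => Ring.inverse (S l)) l :=
    (differentiableAt_inverse (𝕜 := ℂ) (ContinuousLinearMap.isUnit_iff_bijective.mpr hb)).comp l hS
  have h2 : (fun l => multiplier (S l) i j)
      = fun l => (Ring.inverse (S l) (0, Pi.single j 1)).2 i := by
    funext l
    rw [multiplier, LinearMap.toMatrix'_apply]
    simp only [LinearMap.comp_apply, LinearMap.inr_apply, LinearMap.snd_apply,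
      ContinuousLinearMap.coe_coe]
  rw [h2]
  have h3 := h1.clm_apply (differentiableAt_const (0, Pi.single j 1))
  exact (((ContinuousLinearMap.proj i).comp (.snd ℂ Z (Fin m → ℂ))).differentiableAt).comp l h3

end Multiplier

section CombLemmas

variable {M m : ℕ} (c : Fin m → ℂ)

theorem comb_add_smul (r : ℝ) (x y : Fin m → ℤ → X ℝ M) (n : ℤ) :
    comb c (fun j n => x j n + r • y j n) n = comb c x n + (r : ℂ) • comb c y n := by
  simp only [comb, Finset.smul_sum, ← Finset.sum_add_distrib]
  refine Finset.sum_congr rfl fun j _ => ?_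
  have h : lift ℂ (r • y j n) = (r : ℂ) • lift ℂ (y j n) := by ext k; simp
  rw [map_add, h, smul_add, smul_comm]

theorem refl_comb {x : Fin m → ℤ → X ℝ M} {n : ℤ} (h : ∀ j, refl ℝ (x j n) = x j n) :
    refl ℂ (comb c x n) = comb c x n := by
  simp only [comb, map_sum, map_smul, refl_lift, h]

end CombLemmas

namespace HypChain
namespace IsPulse

variable {M : ℕ} {P : HypChain M} {q : ℤ → X ℝ M} (hq : P.IsPulse q)
include hq

theorem differentiable_bord {m : ℕ} (σ : Fin m → ℝ) (s : Fin m → ℤ) (u : Seq (X ℝ M)) :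
    Differentiable ℂ fun l => hq.bord σ s u (floquetTerm P.T l) := by
  set J : (X ℂ M →L[ℂ] X ℂ M) → (Seq (X ℂ M) × (Fin m → ℂ) →L[ℂ] Seq (X ℂ M) × (Fin m → ℂ)) :=
    fun K => ((mulSeq (mkSeq (fun _ => K) ⟨_, fun _ => le_rfl⟩)).comp (.fst ℂ _ _)).prod 0 with hJ
  have h : (fun l => hq.bord σ s u (floquetTerm P.T l)) = fun l => hq.bord σ s u 0
      - ((2 * l) • J (dtL ℂ P.T) + l ^ 2 • J (ContinuousLinearMap.id ℂ (X ℂ M))) := by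
    funext l
    refine ContinuousLinearMap.ext fun x => ?_
    obtain ⟨w, b⟩ := x
    have h1 : ∀ K, J K (w, b) = (mulSeq (mkSeq (fun _ => K) ⟨_, fun _ => le_rfl⟩) w, 0) :=
      fun K => rfl
    rw [sub_apply, add_apply, smul_apply, smul_apply, h1, h1]
    refine Prod.ext ?_ (funext fun i => ?_)
    · ext1 n
      rw [Prod.fst_sub, BoundedContinuousFunction.coe_sub, Pi.sub_apply, hq.bord_fst, hq.bord_fst,
        floquetTerm_apply]
      simp only [zero_apply, sub_zero, Prod.fst_add, Prod.smul_fst,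
        BoundedContinuousFunction.coe_add, Pi.add_apply, BoundedContinuousFunction.coe_smul,
        mulSeq_apply, mkSeq_apply, dtL_apply, ContinuousLinearMap.id_apply]
      abel
    · rw [Prod.snd_sub, Pi.sub_apply, hq.bord_snd, hq.bord_snd]
      simp
  rw [h]
  fun_prop

/-- Copies of localized sequences are almost orthogonal to the translates of the time derivative of the
pulse. -/
theorem exists_overlap_bound {v : ℤ → X ℝ M} {D : ℝ}
    (hv : ∀ n : ℤ, ‖v n‖ ≤ D * (P.β ^ 2) ^ n.natAbs) :
    ∃ C : ℝ, 0 < C ∧ ∀ {m L : ℕ} {s : Fin m → ℤ} {σ : Fin m → ℝ}, 1 ≤ L → Separated L s →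
    (∀ i, σ i = 1 ∨ σ i = -1) → ∀ i,
    pairing (copy σ s (fun n => dt P.T (q n)) i) (copy σ s v i)
      = pairing (fun n => dt P.T (q n)) v ∧
    ∑ j ∈ Finset.univ.erase i, |pairing (copy σ s (fun n => dt P.T (q n)) i) (copy σ s v j)|
      ≤ C * (P.β ^ 2) ^ L := by
  obtain ⟨Q, hQ0, -, hQ⟩ := hq.exists_decay
  have hρ0 := P.ρ_pos
  have hρ1 := P.ρ_lt_one
  have hG := geomC_pos hρ0 hρ1
  have hρ' : 0 < 1 - P.β ^ 2 := by linarith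
  have hD0 : 0 ≤ D := by simpa using (norm_nonneg _).trans (hv 0)
  refine ⟨Q * D * (2 / (1 - P.β ^ 2)) * geomC (P.β ^ 2) + 1, by positivity,
    fun {m L s σ} hL hs hσ i => ⟨?_, ?_⟩⟩
  · refine Eq.trans (tsum_congr fun n => ?_)
      (pairing_comp_sub (𝕜 := ℝ) (fun n => dt P.T (q n)) v (s i))
    simp only [copy, dotp_smul_left, dotp_smul_right, RCLike.ofReal_real_eq_id, id]
    rcases hσ i with h | h <;> simp [h]
  · have h1 : ∀ j, |pairing (copy σ s (fun n => dt P.T (q n)) i) (copy σ s v j)|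
        ≤ Q * D * (2 / (1 - P.β ^ 2)) * (P.β ^ 2) ^ (s i - s j).natAbs := fun j => by
      obtain ⟨h2, h3⟩ := tsum_pow_mul_pow_le hρ0 hρ1 1 (s i) (s j)
      simp only [pow_one] at h2 h3
      refine (norm_pairing_le_of_le (𝕜 := ℝ) (h2.mul_left (Q * D)) fun n => ?_).trans ?_
      · rw [norm_copy hσ, norm_copy hσ]
        calc _ ≤ Q * ((P.β ^ 2) ^ 2) ^ (n - s i).natAbs * (D * (P.β ^ 2) ^ (n - s j).natAbs) := by
              gcongr
              · exact hQ _
              · exact hv _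
          _ = _ := by ring
      · rw [tsum_mul_left, mul_assoc _ (2 / (1 - P.β ^ 2))]
        gcongr
    refine (Finset.sum_le_sum fun j _ => h1 j).trans ?_
    rw [← Finset.mul_sum]
    have h4 := hs.sum_erase_le i hρ0 hρ1 hL
    calc _ ≤ Q * D * (2 / (1 - P.β ^ 2)) * (geomC (P.β ^ 2) * (P.β ^ 2) ^ L) := by gcongr
      _ = Q * D * (2 / (1 - P.β ^ 2)) * geomC (P.β ^ 2) * (P.β ^ 2) ^ L := by ring
      _ ≤ _ := by gcongr; linarith

/-- The Gram matrix of the translates of the time derivative of the pulse. -/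
noncomputable def gram (P : HypChain M) (q : ℤ → X ℝ M) {m : ℕ} (σ : Fin m → ℝ) (s : Fin m → ℤ) :
    Matrix (Fin m) (Fin m) ℝ :=
  Matrix.of fun i j => pairing (copy σ s (fun n => dt P.T (q n)) i)
    (copy σ s (fun n => dt P.T (q n)) j)

theorem exists_det_gram_ne_zero : ∃ L₀ : ℕ, 1 ≤ L₀ ∧ ∀ {m L : ℕ} {s : Fin m → ℤ} {σ : Fin m → ℝ},
    L₀ ≤ L → Separated L s → (∀ i, σ i = 1 ∨ σ i = -1) → (gram P q σ s).det ≠ 0 := by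
  obtain ⟨Q, hQ0, -, hQ⟩ := hq.exists_decay
  have hρ0 := P.ρ_pos
  have hρ1 := P.ρ_lt_one
  obtain ⟨C, hC0, hC⟩ := hq.exists_overlap_bound (v := fun n => dt P.T (q n)) (D := Q) fun n =>
    (hQ n).trans (by
      have : (P.β ^ 2) ^ 2 ≤ P.β ^ 2 := by nlinarith
      gcongr)
  have hlim : Tendsto (fun L : ℕ => C * (P.β ^ 2) ^ L) atTop (𝓝 0) := by
    simpa using (tendsto_pow_atTop_nhds_zero_of_lt_one hρ0.le hρ1).const_mul C
  obtain ⟨L₁, hL₁⟩ := (hlim.eventually (gt_mem_nhds hq.pairing_dt_self_pos)).exists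
  refine ⟨max 1 L₁, le_max_left _ _, fun {m L s σ} hL hs hσ => ?_⟩
  refine det_ne_zero_of_sum_row_lt_diag fun i => ?_
  obtain ⟨h1, h2⟩ := hC (le_trans (le_max_left _ _) hL) hs hσ i
  simp only [gram, Matrix.of_apply, Real.norm_eq_abs]
  rw [h1, abs_of_pos hq.pairing_dt_self_pos]
  refine h2.trans_lt (lt_of_le_of_lt ?_ hL₁)
  gcongr ?_ * ?_
  exact pow_le_pow_of_le_one hρ0.le hρ1.le (le_trans (le_max_right _ _) hL)

end IsPulse
end HypChain

/-! ### Expansion of the reduced matrix -/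

namespace HypChain
namespace IsPulse

variable {M : ℕ} {P : HypChain M} {q : ℤ → X ℝ M} (hq : P.IsPulse q)
include hq

omit hq in
theorem K_eq_pairing (q y : ℤ → X ℝ M) : K P.T q y
    = pairing (fun n => dt P.T (q n)) fun n => dt P.T (q n) + (2 : ℝ) • dt P.T (y n) := by
  refine tsum_congr fun n => ?_
  have hc : ∀ u v : X ℝ M,
      IntervalIntegrable (fun t => ev P.T u t * ev P.T v t) MeasureTheory.volume 0 P.T :=
    fun u v => ((continuous_ev P.T u).mul (continuous_ev P.T v)).intervalIntegrable _ _
  simp only [sq, mul_assoc]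
  rw [intervalIntegral.integral_add (hc _ _) ((hc _ _).const_mul 2),
    intervalIntegral.integral_const_mul, integral_ev_mul_ev P.T_pos, integral_ev_mul_ev P.T_pos,
    dotp_add_right, dotp_smul_right, dotp_comm (dt P.T (y n))]

omit hq in
/-- The Floquet operator applied to an approximate eigenfunction, expanded in the spectral
parameter. -/
theorem floquet_ansatz {m : ℕ} (σ : Fin m → ℝ) (s : Fin m → ℤ) (u : ℤ → X ℝ M) (x : ℤ → X ℂ M)
    (y : ℤ → X ℝ M) (l : ℂ) (c : Fin m → ℂ)
    (hx : ∀ n, x n = comb c (copy σ s fun n => dt P.T (q n)) n + l • comb c (copy σ s y) n) (n : ℤ) :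
    P.lin u x n - floquetTerm P.T l (x n)
      = comb c (fun j => P.lin u (copy σ s (fun n => dt P.T (q n)) j)) n
        + l • comb c (fun j n => P.lin u (copy σ s y j) n
          - (2 : ℝ) • dt P.T (copy σ s (fun n => dt P.T (q n)) j n)) n
        - l ^ 2 • comb c (copy σ s fun n => dt P.T (q n) + (2 : ℝ) • dt P.T (y n)) n
        - l ^ 3 • comb c (copy σ s y) n := by
  set e := copy σ s fun n => dt P.T (q n) with he
  set Y := copy σ s y with hYd
  have h1 : comb c (fun j n => P.lin u (Y j) n - (2 : ℝ) • dt P.T (e j n)) n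
      = P.lin u (comb c Y) n - (2 : ℂ) • dt P.T (comb c e n) := by
    simp only [sub_eq_add_neg, ← neg_smul]
    rw [comb_add_smul c (-2) (fun j => P.lin u (Y j)) (fun j n => dt P.T (e j n)), P.lin_comb,
      dt_comb]
    simp
  have h2 : comb c (copy σ s fun n => dt P.T (q n) + (2 : ℝ) • dt P.T (y n)) n
      = comb c e n + (2 : ℂ) • dt P.T (comb c Y n) := by
    have h3 : (copy σ s fun n => dt P.T (q n) + (2 : ℝ) • dt P.T (y n))
        = fun j n => e j n + (2 : ℝ) • dt P.T (Y j n) := by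
      funext j n
      rw [he, hYd]
      simp only [copy, ← dtL_apply, map_smul, smul_add]
      rw [smul_comm]
    rw [h3, comb_add_smul c 2 e (fun j n => dt P.T (Y j n)), dt_comb]
    simp
  have h3 : P.lin u x n = P.lin u (comb c e) n + l • P.lin u (comb c Y) n := by
    simp only [Chain.lin, hx, map_add, map_smul]
    module
  rw [h1, h2, ← P.lin_comb, h3, hx, floquetTerm_apply, ← dtL_apply, map_add, map_smul, dtL_apply,
    dtL_apply]
  module

/-- The approximate eigenfunctions solve the Floquet problem to second order. -/
theorem exists_ansatz_bound (Λ : ℝ) {y : ℤ → X ℝ M} {Y : ℝ}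
    (hY : ∀ n : ℤ, ‖y n‖ ≤ Y * (P.β ^ 2) ^ n.natAbs)
    (hy : ∀ n, P.lin q y n = (2 : ℝ) • dt P.T (dt P.T (q n))) :
    ∃ C : ℝ, 0 < C ∧ ∀ {m : ℕ} [NeZero m] {L : ℕ} {s : Fin m → ℤ} {σ : Fin m → ℝ} {u : ℤ → X ℝ M},
    NearSuperposition P q Λ L s σ u → ∀ (l : ℂ), ‖l‖ ≤ 1 → ∀ (c : Fin m → ℂ) (x : ℤ → X ℂ M),
    (∀ n, x n = comb c (copy σ s fun n => dt P.T (q n)) n + l • comb c (copy σ s y) n) →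
    ∀ n, ‖P.lin u x n - floquetTerm P.T l (x n)‖ ≤ C * (((P.β ^ 2) ^ L + ‖l‖) ^ 2 * ‖c‖) := by
  obtain ⟨D, hD0, hD⟩ := hq.exists_lin_copy_bound Λ
  obtain ⟨D', hD'0, hD'⟩ := hq.exists_lin_copy_frequency_bound Λ hY hy
  obtain ⟨Q, hQ0, -, hQ⟩ := hq.exists_decay
  have hβ0 := P.β_pos
  have hβ1 := P.β_lt_one
  have hρ0 := P.ρ_pos
  have hρ1 := P.ρ_lt_one
  have hG := geomC_pos hβ0 hβ1
  have hY0 : 0 ≤ Y := by simpa using (norm_nonneg _).trans (hY 0)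
  set κ := ‖(dtL ℝ P.T : X ℝ M →L[ℝ] X ℝ M)‖ with hκ
  have hv : ∀ n : ℤ, ‖dt P.T (q n) + (2 : ℝ) • dt P.T (y n)‖
      ≤ (Q + 2 * (κ * Y)) * (P.β ^ 2) ^ n.natAbs := fun n => by
    rw [add_mul]
    refine norm_add_le_of_le ((hQ n).trans ?_) ?_
    · have : (P.β ^ 2) ^ 2 ≤ P.β ^ 2 := by nlinarith
      gcongr
    · rw [norm_smul, Real.norm_two, mul_assoc, mul_assoc]
      gcongr
      exact (dtL ℝ P.T : X ℝ M →L[ℝ] X ℝ M).le_of_opNorm_le_of_le le_rfl (hY n)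
  refine ⟨D + D' + (Q + 2 * (κ * Y)) * (1 + geomC P.β) + Y * (1 + geomC P.β), by positivity,
    fun {m} _ {L s σ u} h l hl c x hx n => ?_⟩
  rw [floquet_ansatz σ s u x y l c hx n]
  have hsum : ∀ {v : ℤ → X ℝ M} {A : ℝ}, 0 ≤ A → (∀ n : ℤ, ‖v n‖ ≤ A * (P.β ^ 2) ^ n.natAbs) →
      ‖comb c (copy σ s v) n‖ ≤ ‖c‖ * (A * (1 + geomC P.β)) := fun {v A} hA hv => by
    refine (norm_comb_le c _ n).trans ?_
    gcongr
    refine (Finset.sum_le_sum fun j _ => (norm_copy h.sign s v j n).le.trans (hv _)).trans ?_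
    rw [← Finset.mul_sum]
    gcongr
    exact h.separated.sum_le hβ0 hβ1 h.one_le n
  set ρL := (P.β ^ 2) ^ L with hρL
  have hρL0 : 0 < ρL := by positivity
  have hθL : P.θ ^ L = ρL ^ 2 := by rw [← P.sq_sq_β, hρL]; ring
  have h1 : ‖comb c (fun j => P.lin u (copy σ s (fun n => dt P.T (q n)) j)) n‖
      ≤ ‖c‖ * (D * ρL ^ 2) := by
    refine (norm_comb_le c _ n).trans ?_
    rw [← hθL]
    gcongr
    exact (hD h n).1
  have h2 : ‖l • comb c (fun j n => P.lin u (copy σ s y j) n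
      - (2 : ℝ) • dt P.T (copy σ s (fun n => dt P.T (q n)) j n)) n‖ ≤ ‖l‖ * (‖c‖ * (D' * ρL)) := by
    rw [norm_smul]
    refine mul_le_mul_of_nonneg_left ((norm_comb_le c _ n).trans ?_) (norm_nonneg _)
    gcongr
    exact hD' h n
  have h3 : ‖l ^ 2 • comb c (copy σ s fun n => dt P.T (q n) + (2 : ℝ) • dt P.T (y n)) n‖
      ≤ ‖l‖ ^ 2 * (‖c‖ * ((Q + 2 * (κ * Y)) * (1 + geomC P.β))) := by
    rw [norm_smul, norm_pow]
    exact mul_le_mul_of_nonneg_left (hsum (by positivity) hv) (by positivity)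
  have h4 : ‖l ^ 3 • comb c (copy σ s y) n‖ ≤ ‖l‖ ^ 2 * (‖c‖ * (Y * (1 + geomC P.β))) := by
    rw [norm_smul, norm_pow]
    refine mul_le_mul ?_ (hsum hY0 hY) (norm_nonneg _) (by positivity)
    exact pow_le_pow_of_le_one (norm_nonneg _) hl (by norm_num)
  refine (norm_sub_le_of_le (norm_sub_le_of_le (norm_add_le_of_le h1 h2) h3) h4).trans ?_
  have e1 : ρL ^ 2 ≤ (ρL + ‖l‖) ^ 2 := by
    have := norm_nonneg l
    gcongr
    linarith
  have e2 : ‖l‖ * ρL ≤ (ρL + ‖l‖) ^ 2 := by nlinarith [norm_nonneg l]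
  have e3 : ‖l‖ ^ 2 ≤ (ρL + ‖l‖) ^ 2 := by
    have := norm_nonneg l
    gcongr
    linarith
  set A := (Q + 2 * (κ * Y)) * (1 + geomC P.β) with hA
  set B := Y * (1 + geomC P.β) with hB
  have hA0 : 0 ≤ A := by positivity
  have hB0 : 0 ≤ B := by positivity
  calc _ = ‖c‖ * (D * ρL ^ 2 + D' * (‖l‖ * ρL) + A * ‖l‖ ^ 2 + B * ‖l‖ ^ 2) := by ring
    _ ≤ ‖c‖ * (D * (ρL + ‖l‖) ^ 2 + D' * (ρL + ‖l‖) ^ 2 + A * (ρL + ‖l‖) ^ 2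
        + B * (ρL + ‖l‖) ^ 2) := by gcongr
    _ = _ := by ring

set_option maxHeartbeats 1000000 in
/-- The reduced matrix of the Floquet problem agrees with the interaction matrix up to an error of
third order. -/
theorem exists_floquet_bound (Λ : ℝ) {y : ℤ → X ℝ M} {Y : ℝ}
    (hY : ∀ n : ℤ, ‖y n‖ ≤ Y * (P.β ^ 2) ^ n.natAbs)
    (hy : ∀ n, P.lin q y n = (2 : ℝ) • dt P.T (dt P.T (q n)))
    (hye : ∀ n, refl ℝ (y n) = y n) {C₀ : ℝ} (hC₀ : 0 < C₀) :
    ∃ C : ℝ, 0 < C ∧ ∀ {k L : ℕ} {N : Fin k → ℕ} {s : Fin (k + 1) → ℤ} {σ : Fin (k + 1) → ℝ}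
    {u : Seq (X ℝ M)}, NearSuperposition P q Λ L s σ u → (∀ i, s i.succ = s i.castSucc + N i) →
    (∀ i, L ≤ N i) → ∀ (l : ℂ), ‖l‖ ≤ 1 →
    (∀ x, ‖x‖ ≤ C₀ * ‖hq.bord σ s u (floquetTerm P.T l) x‖) → ∀ (c : Fin (k + 1) → ℂ) w b,
    hq.bord σ s u (floquetTerm P.T l) (w, b)
      = (0, (gram P q σ s).map (fun x : ℝ => (x : ℂ)) *ᵥ c) →
    ∀ i, ‖((gram P q σ s).map (fun x : ℝ => (x : ℂ)) *ᵥ b) i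
        + P.d * ((tridiag (a P.T q N σ) (aTilde P.T q N σ)).map (fun x : ℝ => (x : ℂ)) *ᵥ c) i
        + K P.T q y * l ^ 2 * c i‖ ≤ C * (((P.β ^ 2) ^ L + ‖l‖) ^ 3 * ‖c‖) := by
  obtain ⟨D, hD0, hD⟩ := hq.exists_lin_copy_bound Λ
  obtain ⟨D', hD'0, hD'⟩ := hq.exists_lin_copy_frequency_bound Λ hY hy
  obtain ⟨Q, hQ0, -, hQ⟩ := hq.exists_decay
  obtain ⟨C₁, hC₁, hint⟩ := hq.exists_interaction_bound Λ
  obtain ⟨C₂, hC₂, hans⟩ := hq.exists_ansatz_bound Λ hY hy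
  obtain ⟨B, hB0, hB⟩ := hq.exists_B_sub_bound Λ
  have hρ0 := P.ρ_pos
  have hρ1 := P.ρ_lt_one
  have hρ' : 0 < 1 - P.β ^ 2 := by linarith
  have hY0 : 0 ≤ Y := by simpa using (norm_nonneg _).trans (hY 0)
  set κ := ‖(dtL ℝ P.T : X ℝ M →L[ℝ] X ℝ M)‖ with hκ
  set κ' := ‖(dtL ℂ P.T : X ℂ M →L[ℂ] X ℂ M)‖ with hκ'
  have hQ' : ∀ n : ℤ, ‖dt P.T (q n)‖ ≤ Q * (P.β ^ 2) ^ n.natAbs := fun n => (hQ n).trans (by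
    have : (P.β ^ 2) ^ 2 ≤ P.β ^ 2 := by nlinarith
    gcongr)
  set v : ℤ → X ℝ M := fun n => dt P.T (q n) + (2 : ℝ) • dt P.T (y n) with hvdef
  have hv : ∀ n : ℤ, ‖v n‖ ≤ (Q + 2 * (κ * Y)) * (P.β ^ 2) ^ n.natAbs := fun n => by
    rw [add_mul]
    refine norm_add_le_of_le (hQ' n) ?_
    rw [norm_smul, Real.norm_two, mul_assoc, mul_assoc]
    gcongr
    exact (dtL ℝ P.T : X ℝ M →L[ℝ] X ℝ M).le_of_opNorm_le_of_le le_rfl (hY n)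
  obtain ⟨C₃, hC₃, hov⟩ := hq.exists_overlap_bound hv
  refine ⟨C₁ + C₃ + (D + Q * (2 * κ' + 1)) * (C₀ * C₂) * (2 / (1 - P.β ^ 2)), by positivity,
    fun {k L N s σ u} h hs hN l hl hinv c w b hwb i => ?_⟩
  set ρL := (P.β ^ 2) ^ L with hρL
  have hρL0 : 0 < ρL := by positivity
  set e := copy σ s fun n => dt P.T (q n) with he
  set Yc := copy σ s y with hYc
  have hbdd : ∀ {v : ℤ → X ℝ M} {A : ℝ}, (∀ n : ℤ, ‖v n‖ ≤ A * (P.β ^ 2) ^ n.natAbs) →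
      ∀ j, ∃ C, ∀ n, ‖copy σ s v j n‖ ≤ C := fun {v A} hv j => ⟨A, fun n => by
    rw [norm_copy h.sign]
    have hA : 0 ≤ A := by simpa using (norm_nonneg _).trans (hv 0)
    exact (hv _).trans (mul_le_of_le_one_right hA (pow_le_one₀ hρ0.le hρ1.le))⟩
  have heb : ∀ j, ∃ C, ∀ n, ‖e j n‖ ≤ C := hbdd hQ'
  have hYb : ∀ j, ∃ C, ∀ n, ‖Yc j n‖ ≤ C := hbdd hY
  have hvb : ∀ j, ∃ C, ∀ n, ‖copy σ s v j n‖ ≤ C := hbdd hv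
  have hes : Summable fun n => ‖e i n‖ := hq.summable_goldstone σ s i
  have heodd : ∀ j n, refl ℝ (e j n) = -e j n := fun j n => hq.refl_goldstone σ s j n
  have hYeven : ∀ j n, refl ℝ (Yc j n) = Yc j n := fun j n => by
    rw [hYc, copy, map_smul, hye]
  set Le : Fin (k + 1) → ℤ → X ℝ M := fun j => P.lin u (e j) with hLe
  set Z : Fin (k + 1) → ℤ → X ℝ M := fun j n => P.lin u (Yc j) n - (2 : ℝ) • dt P.T (e j n) with hZ
  have hLeb : ∀ j, ∃ C, ∀ n, ‖Le j n‖ ≤ C := fun j => ⟨D * P.θ ^ L, fun n =>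
    (Finset.single_le_sum (f := fun j => ‖Le j n‖) (fun j _ => norm_nonneg _)
      (Finset.mem_univ j)).trans (hD h n).1⟩
  have hZb : ∀ j, ∃ C, ∀ n, ‖Z j n‖ ≤ C := fun j => ⟨D' * ρL, fun n =>
    (Finset.single_le_sum (f := fun j => ‖Z j n‖) (fun j _ => norm_nonneg _)
      (Finset.mem_univ j)).trans (hD' h n)⟩
  have hZeven : ∀ j n, refl ℝ (Z j n) = Z j n := fun j n => by
    have h1 : refl ℝ (dt P.T (e j n)) = dt P.T (e j n) := by
      have h2 := dt_refl P.T (e j n)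
      rw [heodd, ← dtL_apply, map_neg, dtL_apply, neg_inj] at h2
      exact h2.symm
    have h3 : refl ℝ (P.B ℝ (u n) (Yc j n)) = P.B ℝ (u n) (Yc j n) := by
      have h4 := P.B_refl (u n) (Yc j n)
      rw [h.even, hYeven] at h4
      exact h4.symm
    simp only [hZ, Chain.lin, map_sub, map_smul, map_add, hYeven, h1, h3]
  -- The approximate eigenfunction `E c + l Y c`.
  set xs : Seq (X ℂ M) := mkSeq (comb c e) (comb_bdd c e heb)
    + l • mkSeq (comb c Yc) (comb_bdd c Yc hYb) with hxs
  have hxs1 : ∀ n, xs n = comb c e n + l • comb c Yc n := fun n => rfl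
  set A : Seq (X ℂ M) →L[ℂ] Seq (X ℂ M) := lapL P.d
    (P.BSeq ℂ u + mkSeq (fun _ => floquetTerm P.T l) ⟨_, fun _ => le_rfl⟩) with hA
  have hA1 : ∀ (z : Seq (X ℂ M)) n, A z n = P.lin u z n - floquetTerm P.T l (z n) := fun z n => by
    rw [hA, lapL_apply, Chain.lin, BoundedContinuousFunction.coe_add, Pi.add_apply, add_apply,
      mkSeq_apply, BSeq_apply]
    abel
  have hbord1 : ∀ z b', (hq.bord σ s u (floquetTerm P.T l) (z, b')).1
      = A z - mkSeq (comb b' e) (comb_bdd b' e heb) := fun z b' => by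
    ext1 n
    rw [hq.bord_fst, BoundedContinuousFunction.coe_sub, Pi.sub_apply, hA1]
    rfl
  have hbord2 : ∀ z b' j, (hq.bord σ s u (floquetTerm P.T l) (z, b')).2 j = pairing (e j) z :=
    fun z b' j => hq.bord_snd σ s u _ z b' j
  have hgram : ∀ c' : Fin (k + 1) → ℂ, ∀ j, pairing (e j) (comb c' e)
      = ((gram P q σ s).map (fun x : ℝ => (x : ℂ)) *ᵥ c') j := fun c' j => by
    have hej : Summable fun n => ‖e j n‖ := hq.summable_goldstone σ s j
    rw [pairing_comb c' e hej heb]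
    rfl
  have hYzero : ∀ j, pairing (e j) (comb c Yc) = 0 := fun j =>
    pairing_eq_zero_of_parity (heodd j) fun n => refl_comb c fun j' => hYeven j' n
  -- The difference of the solution and the approximate eigenfunction solves the bordered problem with the
  -- residual as the only datum: the functionals agree, since the copies of `y` are even and those of the
  -- time derivative odd.
  have hcorr : hq.bord σ s u (floquetTerm P.T l) (w - xs, b) = (-A xs, 0) := by
    have h1 : (w - xs, b) = (w, b) - (xs, (0 : Fin (k + 1) → ℂ)) := by simp
    rw [h1, map_sub, hwb]
    refine Prod.ext ?_ (funext fun j => ?_)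
    · rw [Prod.fst_sub, hbord1, zero_sub]
      have h2 : mkSeq (comb (0 : Fin (k + 1) → ℂ) e) (comb_bdd 0 e heb) = 0 := by
        ext1 n
        simp [comb]
      rw [h2, sub_zero]
    · rw [Prod.snd_sub, Pi.sub_apply, hbord2]
      have h2 : pairing (e j) xs = pairing (e j) (comb c e) := by
        have hej : Summable fun n => ‖e j n‖ := hq.summable_goldstone σ s j
        rw [hxs, pairing_add hej]
        have h3 : pairing (e j) (l • mkSeq (comb c Yc) (comb_bdd c Yc hYb) : Seq (X ℂ M))
            = l * pairing (e j) (comb c Yc) := pairing_smul l _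
        rw [h3, hYzero, mul_zero, add_zero]
        rfl
      rw [h2, hgram]
      exact sub_self _
  have hAxs : ‖A xs‖ ≤ C₂ * ((ρL + ‖l‖) ^ 2 * ‖c‖) := Seq.norm_le (by positivity) fun n => by
    rw [hA1]
    exact hans h l hl c xs hxs1 n
  set z := w - xs with hz
  have hzn : ‖z‖ ≤ C₀ * (C₂ * ((ρL + ‖l‖) ^ 2 * ‖c‖)) := by
    have h1 := hinv (z, b)
    rw [hcorr] at h1
    refine (norm_fst_le (z, b)).trans (h1.trans ?_)
    gcongr
    refine (Prod.norm_def _).trans_le (max_le ?_ ?_)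
    · simpa using hAxs
    · simp only [norm_zero]; positivity
  -- Pairing the equation with the copies of the time derivative expresses `G b`.
  have hproj : ((gram P q σ s).map (fun x : ℝ => (x : ℂ)) *ᵥ b) i
      = pairing (e i) (A xs) + pairing (e i) (A z) := by
    have h1 := hbord1 w b
    rw [hwb] at h1
    have h2 : A w = mkSeq (comb b e) (comb_bdd b e heb) := (sub_eq_zero.mp h1.symm)
    have h3 : A w = A xs + A z := by rw [← map_add, hz, add_sub_cancel]
    rw [← hgram, ← pairing_add hes, ← h3, h2]
    rfl
  have hxsA : pairing (e i) (A xs) = ∑ j, ((pairing (e i) (Le j) : ℝ) : ℂ) * c j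
      - l ^ 2 * ∑ j, ((pairing (e i) (copy σ s v j) : ℝ) : ℂ) * c j := by
    have h1 : A xs = mkSeq (comb c Le) (comb_bdd c Le hLeb) + l • mkSeq (comb c Z) (comb_bdd c Z hZb)
        - l ^ 2 • mkSeq (comb c (copy σ s v)) (comb_bdd c _ hvb)
        - l ^ 3 • mkSeq (comb c Yc) (comb_bdd c Yc hYb) := by
      ext1 n
      rw [hA1, floquet_ansatz σ s u xs y l c hxs1 n]
      rfl
    have h2 : pairing (e i) (A xs) = pairL ℂ (e i) hes (A xs) := rfl
    have h3 : pairing (e i) (comb c Z) = 0 :=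
      pairing_eq_zero_of_parity (heodd i) fun n => refl_comb c fun j' => hZeven j' n
    have h4 : ∀ (x : Fin (k + 1) → ℤ → X ℝ M) (hx : ∀ j, ∃ C, ∀ n, ‖x j n‖ ≤ C),
        pairL ℂ (e i) hes (mkSeq (comb c x) (comb_bdd c x hx)) = pairing (e i) (comb c x) :=
      fun x hx => rfl
    rw [h2, h1, map_sub, map_sub, map_add, map_smul, map_smul, map_smul, h4 Le hLeb,
      h4 Z hZb, h4 _ hvb, h4 Yc hYb, h3, hYzero,
      pairing_comb c Le hes hLeb, pairing_comb c _ hes hvb]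
    simp only [smul_eq_mul, mul_zero, add_zero, sub_zero]
  -- By symmetry the operator can be moved to `e i`, where it is of first order; as `z` is of second order,
  -- the pairing is of third order.
  have hzA : ‖pairing (e i) (A z)‖
      ≤ (D * ρL + Q * (‖l‖ * (2 * κ' + 1))) * ‖z‖ * (2 / (1 - P.β ^ 2)) := by
    have hAz : A z = lapL P.d (P.BSeq ℂ u) z
        - mulSeq (mkSeq (fun _ => floquetTerm P.T l) ⟨_, fun _ => le_rfl⟩) z := by
      ext1 n
      rw [hA1]
      rfl
    have h1 : pairing (e i) (lapL P.d (P.BSeq ℂ u) z) = pairing (Le i) z :=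
      P.pairing_lin hes ⟨B, (hB h).1⟩ z
    have h2 : ‖pairing (Le i) z‖ ≤ D * ρL * ‖z‖ * (2 / (1 - P.β ^ 2)) :=
      norm_pairing_le_tail hρ0 hρ1 (by positivity) (s i) fun n => by
        have h3 := ((hD h n).2 i).1
        have h4 := z.norm_apply_le n
        calc _ ≤ D * (ρL * (P.β ^ 2) ^ (n - s i).natAbs) * ‖z‖ := by gcongr
          _ = _ := by ring
    have hF : ∀ n, ‖floquetTerm P.T l (z n)‖ ≤ ‖l‖ * (2 * κ' + 1) * ‖z‖ := fun n => by
      rw [floquetTerm_apply]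
      have h3 := z.norm_apply_le n
      have h4 : ‖dt P.T (z n)‖ ≤ κ' * ‖z‖ :=
        (dtL ℂ P.T : X ℂ M →L[ℂ] X ℂ M).le_of_opNorm_le_of_le le_rfl h3
      have h5 : ‖l‖ ^ 2 ≤ ‖l‖ := by nlinarith [norm_nonneg l]
      refine (norm_add_le _ _).trans ?_
      rw [norm_smul, norm_smul, norm_mul, norm_pow, Complex.norm_two]
      calc _ ≤ 2 * ‖l‖ * (κ' * ‖z‖) + ‖l‖ * ‖z‖ := by gcongr
        _ = _ := by ring
    have h3 : ‖pairing (e i) (mulSeq (mkSeq (fun _ => floquetTerm P.T l) ⟨_, fun _ => le_rfl⟩) z)‖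
        ≤ Q * (‖l‖ * (2 * κ' + 1) * ‖z‖) * (2 / (1 - P.β ^ 2)) :=
      norm_pairing_le_tail hρ0 hρ1 (by positivity) (s i) fun n => by
        have h4 : ‖e i n‖ ≤ Q * (P.β ^ 2) ^ (n - s i).natAbs :=
          (norm_copy h.sign s _ i n).le.trans (hQ' _)
        have h5 := hF n
        rw [mulSeq_apply, mkSeq_apply]
        calc _ ≤ Q * (P.β ^ 2) ^ (n - s i).natAbs * (‖l‖ * (2 * κ' + 1) * ‖z‖) := by gcongr
          _ = _ := by ring
    have h4 : pairing (e i) (A z) = pairL ℂ (e i) hes (A z) := rfl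
    rw [h4, hAz, map_sub, pairL_apply, pairL_apply, h1]
    refine (norm_sub_le_of_le h2 h3).trans (le_of_eq ?_)
    ring
  -- The terms of odd order in `l` have dropped out by parity; the remaining two are the interaction matrix
  -- and the coefficient `K` of `l ^ 2`, each up to third order.
  have hM : ‖∑ j, ((pairing (e i) (Le j) : ℝ) : ℂ) * c j
      + P.d * ((tridiag (a P.T q N σ) (aTilde P.T q N σ)).map (fun x : ℝ => (x : ℂ)) *ᵥ c) i‖
      ≤ C₁ * ρL ^ 3 * ‖c‖ := by
    have h1 := hint h hs hN i
    have h2 : ∑ j, ((pairing (e i) (Le j) : ℝ) : ℂ) * c j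
        + P.d * ((tridiag (a P.T q N σ) (aTilde P.T q N σ)).map (fun x : ℝ => (x : ℂ)) *ᵥ c) i
        = ∑ j, ((pairing (e i) (Le j)
          + P.d * tridiag (a P.T q N σ) (aTilde P.T q N σ) i j : ℝ) : ℂ) * c j := by
      rw [Matrix.mulVec, dotProduct, Finset.mul_sum, ← Finset.sum_add_distrib]
      refine Finset.sum_congr rfl fun j _ => ?_
      rw [Matrix.map_apply]
      push_cast
      ring
    rw [h2]
    refine (norm_sum_le_of_le _ fun j _ => ?_).trans
      (le_trans (le_of_eq (Finset.sum_mul _ _ _).symm) (mul_le_mul_of_nonneg_right h1 (norm_nonneg c)))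
    rw [norm_mul, Complex.norm_real]
    exact mul_le_mul_of_nonneg_left (norm_le_pi_norm c j) (abs_nonneg _)
  have hV : ‖∑ j, ((pairing (e i) (copy σ s v j) : ℝ) : ℂ) * c j - K P.T q y * c i‖
      ≤ C₃ * ρL * ‖c‖ := by
    obtain ⟨h1, h2⟩ := hov h.one_le h.separated h.sign i
    rw [← Finset.add_sum_erase _ _ (Finset.mem_univ i), h1, K_eq_pairing, add_sub_cancel_left]
    refine (norm_sum_le_of_le _ fun j _ => ?_).trans
      (le_trans (le_of_eq (Finset.sum_mul _ _ _).symm) (mul_le_mul_of_nonneg_right h2 (norm_nonneg c)))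
    rw [norm_mul, Complex.norm_real]
    exact mul_le_mul_of_nonneg_left (norm_le_pi_norm c j) (abs_nonneg _)
  rw [hproj, hxsA]
  set SM := ∑ j, ((pairing (e i) (Le j) : ℝ) : ℂ) * c j with hSM
  set SV := ∑ j, ((pairing (e i) (copy σ s v j) : ℝ) : ℂ) * c j with hSV
  set SA := ((tridiag (a P.T q N σ) (aTilde P.T q N σ)).map (fun x : ℝ => (x : ℂ)) *ᵥ c) i with hSA
  have hfin : SM - l ^ 2 * SV + pairing (e i) (A z) + P.d * SA + K P.T q y * l ^ 2 * c i
      = (SM + P.d * SA) - l ^ 2 * (SV - K P.T q y * c i) + pairing (e i) (A z) := by ring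
  rw [hfin]
  have hV2 : ‖l ^ 2 * (SV - K P.T q y * c i)‖ ≤ ‖l‖ ^ 2 * (C₃ * ρL * ‖c‖) := by
    rw [norm_mul, norm_pow]
    gcongr
  refine (norm_add_le_of_le (norm_sub_le_of_le hM hV2) hzA).trans ?_
  have hl0 := norm_nonneg l
  set r := ρL + ‖l‖ with hr
  have hr0 : 0 < r := by positivity
  have e1 : ρL ≤ r := by linarith
  have e2 : ‖l‖ ≤ r := by linarith
  set G := 2 / (1 - P.β ^ 2) with hG
  have hG0 : 0 < G := by positivity
  calc _ ≤ C₁ * r ^ 3 * ‖c‖ + r ^ 2 * (C₃ * r * ‖c‖)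
        + (D * r + Q * (r * (2 * κ' + 1))) * (C₀ * (C₂ * (r ^ 2 * ‖c‖))) * G := by gcongr
    _ = _ := by ring

end IsPulse
end HypChain

/-! ### Centers, windows and the reduced Floquet problem -/

section Centers

variable {k : ℕ} (N : Fin k → ℕ)

theorem center_succ (i : Fin k) : center N i.succ = center N i.castSucc + N i := by
  have h : ∀ j : Fin k, (if j.castSucc < i.succ then (N j : ℤ) else 0)
      = (if j.castSucc < i.castSucc then (N j : ℤ) else 0) + if j = i then (N j : ℤ) else 0 := by
    intro j
    simp only [Fin.lt_def, Fin.val_castSucc, Fin.val_succ, Fin.ext_iff]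
    split_ifs <;> omega
  simp only [center, h, Finset.sum_add_distrib, Finset.sum_ite_eq', Finset.mem_univ, if_true]

variable {N} {L : ℕ}

theorem mul_le_center_sub (hN : ∀ i, L ≤ N i) (n : ℕ) : ∀ i j : Fin (k + 1), (j : ℕ) = i + n →
    (L * n : ℤ) ≤ center N j - center N i := by
  induction n with
  | zero =>
    intro i j h
    obtain rfl : i = j := Fin.ext (by omega)
    simp
  | succ n ih =>
    intro i j h
    have hj : i.val + n < k := by omega
    obtain rfl : j = (⟨i.val + n, hj⟩ : Fin k).succ := Fin.ext (by simp; omega)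
    have h1 := ih i (⟨i.val + n, hj⟩ : Fin k).castSucc rfl
    have h2 := hN ⟨i.val + n, hj⟩
    rw [center_succ]
    push_cast
    have h3 : (L : ℤ) ≤ N ⟨i.val + n, hj⟩ := by exact_mod_cast h2
    linarith

theorem separated_center (hN : ∀ i, L ≤ N i) : Separated L (center N) := by
  intro i j
  rcases le_total (i : ℕ) j with h | h
  · have h1 := mul_le_center_sub hN (j - i : ℕ) i j (by omega)
    zify [h] at h1 ⊢
    rw [abs_sub_comm, abs_sub_comm (center N i), abs_of_nonneg (by omega)]
    exact h1.trans (le_abs_self _)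
  · have h1 := mul_le_center_sub hN (i - j : ℕ) j i (by omega)
    zify [h] at h1 ⊢
    rw [abs_of_nonneg (by omega)]
    exact h1.trans (le_abs_self _)

/-- On the window around the copy `i`, extended by one site, the other copies are at least half as far
away as from the copy `i`, up to a bounded loss. -/
theorem natAbs_center_sub_le {i : Fin (k + 1)} {n n' : ℤ}
    (h1 : ∀ j : Fin k, j.succ = i → -coHalf (N j) ≤ n)
    (h2 : ∀ j : Fin k, j.castSucc = i → n ≤ half (N j)) (hn' : n' = n ∨ n' = n - 1)
    (j : Fin (k + 1)) :
    (center N i - center N j).natAbs ≤ 2 * (center N i + n' - center N j).natAbs + 3 := by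
  have hmono : ∀ i j : Fin (k + 1), i ≤ j → center N i ≤ center N j := fun i j hij => by
    have := mul_le_center_sub (L := 0) (N := N) (fun i => Nat.zero_le _) (j - i : ℕ) i j (by omega)
    simp only [Nat.cast_zero, zero_mul] at this
    omega
  rcases lt_trichotomy i j with h | rfl | h
  · have hik : (i : ℕ) < k := by omega
    obtain ⟨l, rfl⟩ : ∃ l : Fin k, i = l.castSucc := ⟨⟨i, hik⟩, rfl⟩
    have h3 := h2 l rfl
    have h4 := hmono l.succ j (Fin.castSucc_lt_iff_succ_le.mp h)
    rw [center_succ] at h4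
    unfold half at h3
    omega
  · simp
  · obtain ⟨l, rfl⟩ : ∃ l : Fin k, i = l.succ := ⟨i.pred (Fin.ne_zero_of_lt h), by simp⟩
    have h3 := h1 l rfl
    have h4 := hmono j l.castSucc (Fin.le_castSucc_iff.mpr h)
    rw [center_succ] at *
    unfold coHalf half at h3
    omega

/-- The windows around the copies cover the lattice. -/
theorem exists_window (N : Fin k → ℕ) (n : ℤ) : ∃ i : Fin (k + 1),
    (∀ j : Fin k, j.succ = i → -coHalf (N j) ≤ n - center N i) ∧
    ∀ j : Fin k, j.castSucc = i → n - center N i ≤ half (N j) := by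
  classical
  set S : Finset (Fin (k + 1)) := Finset.univ.filter fun i =>
    ∀ j : Fin k, j.succ = i → -coHalf (N j) ≤ n - center N i with hS
  have h0 : (0 : Fin (k + 1)) ∈ S := by
    rw [hS, Finset.mem_filter]
    exact ⟨Finset.mem_univ _, fun j hj => absurd hj (Fin.succ_ne_zero j)⟩
  obtain ⟨i, hi, hmax⟩ := S.exists_max_image id ⟨0, h0⟩
  refine ⟨i, (Finset.mem_filter.mp hi).2, ?_⟩
  rintro j rfl
  by_contra hlt
  have h1 : j.succ ∈ S := by
    rw [hS, Finset.mem_filter]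
    refine ⟨Finset.mem_univ _, fun j' hj' => ?_⟩
    obtain rfl := Fin.succ_injective _ hj'
    rw [center_succ]
    unfold coHalf
    omega
  exact absurd (hmax _ h1) (not_le.mpr Fin.castSucc_lt_succ)

theorem exists_rpow_charDist (hk : 1 ≤ k) (N : Fin k → ℕ) {ρ θ : ℝ} (hρ : 0 < ρ)
    (hθ : ρ ^ 2 = θ) : ∃ i₀, (∀ i, N i₀ ≤ N i) ∧ θ⁻¹ ^ (-charDist N) = ρ ^ N i₀ := by
  have : Nonempty (Fin k) := ⟨⟨0, hk⟩⟩
  obtain ⟨i₀, hi₀⟩ := Finite.exists_min N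
  refine ⟨i₀, hi₀, ?_⟩
  have h1 : ⨅ i, (N i : ℝ) = N i₀ := le_antisymm
    (ciInf_le ⟨0, by rintro _ ⟨i, rfl⟩; positivity⟩ i₀)
    (le_ciInf fun i => by exact_mod_cast hi₀ i)
  have hθ0 : 0 < θ := by rw [← hθ]; positivity
  rw [charDist, h1, Real.inv_rpow hθ0.le, ← Real.rpow_neg hθ0.le, neg_neg, ← hθ,
    ← Real.rpow_natCast, ← Real.rpow_mul hρ.le, ← Real.rpow_natCast]
  congr 1
  push_cast
  ring

end Centers

namespace HypChain
namespace IsPulse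

variable {M : ℕ} {P : HypChain M} {q : ℤ → X ℝ M} (hq : P.IsPulse q)
include hq

/-- On the window around a copy, the superposition is close to that copy. -/
theorem exists_window_bound : ∃ C : ℝ, 0 < C ∧ ∀ {k L : ℕ} {N : Fin k → ℕ} {σ : Fin (k + 1) → ℝ},
    1 ≤ L → (∀ i, L ≤ N i) → (∀ i, σ i = 1 ∨ σ i = -1) → ∀ (i : Fin (k + 1)) (n n' : ℤ),
    (∀ j : Fin k, j.succ = i → -coHalf (N j) ≤ n) →
    (∀ j : Fin k, j.castSucc = i → n ≤ half (N j)) → (n' = n ∨ n' = n - 1) →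
    ‖superpose σ (center N) q (center N i + n') - σ i • q n'‖ ≤ C * (P.β ^ 2) ^ L := by
  obtain ⟨Q, hQ0, hQ, -⟩ := hq.exists_decay
  have hρ0 := P.ρ_pos
  have hρ1 := P.ρ_lt_one
  have hG := geomC_pos hρ0 hρ1
  set ρ := P.β ^ 2
  refine ⟨Q / ρ ^ 3 * geomC ρ, by positivity, fun {k L N σ} hL hN hσ i n n' h1 h2 hn' => ?_⟩
  have h3 : superpose σ (center N) q (center N i + n') - σ i • q n'
      = ∑ j ∈ Finset.univ.erase i, σ j • q (center N i + n' - center N j) := by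
    rw [superpose, ← Finset.add_sum_erase _ _ (Finset.mem_univ i), add_sub_cancel_left,
      add_sub_cancel_left]
  have h4 : ∀ j ∈ Finset.univ.erase i, ‖σ j • q (center N i + n' - center N j)‖
      ≤ Q / ρ ^ 3 * ρ ^ (center N i - center N j).natAbs := fun j _ => by
    have h5 : ‖σ j • q (center N i + n' - center N j)‖ = ‖q (center N i + n' - center N j)‖ := by
      rw [norm_smul]; rcases hσ j with h | h <;> simp [h]
    rw [h5]
    refine (hQ _).trans ?_
    rw [div_mul_eq_mul_div, le_div_iff₀ (by positivity), mul_assoc, ← pow_mul, ← pow_add]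
    exact mul_le_mul_of_nonneg_left (pow_le_pow_of_le_one hρ0.le hρ1.le
      (natAbs_center_sub_le h1 h2 hn' j)) hQ0.le
  rw [h3]
  refine (norm_sum_le_of_le _ h4).trans ?_
  rw [← Finset.mul_sum, mul_assoc]
  gcongr
  exact (separated_center hN).sum_erase_le i hρ0 hρ1 hL

/-- Reduction of the Floquet problem about a multi-breather to a matrix problem. -/
theorem exists_floquet_reduction (Λ : ℝ) {y : ℤ → X ℝ M} {Y : ℝ}
    (hY : ∀ n : ℤ, ‖y n‖ ≤ Y * (P.β ^ 2) ^ n.natAbs)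
    (hy : ∀ n, P.lin q y n = (2 : ℝ) • dt P.T (dt P.T (q n)))
    (hye : ∀ n, refl ℝ (y n) = y n) :
    ∃ (δ C : ℝ) (L₀ : ℕ), 0 < δ ∧ 0 < C ∧ ∀ {k L : ℕ} {N : Fin k → ℕ} {s : Fin (k + 1) → ℤ}
    {σ : Fin (k + 1) → ℝ} {u : Seq (X ℝ M)}, L₀ ≤ L → NearSuperposition P q Λ L s σ u →
    (∀ i, s i.succ = s i.castSucc + N i) → (∀ i, L ≤ N i) →
    ∃ R : ℂ → Matrix (Fin (k + 1)) (Fin (k + 1)) ℂ,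
      (∀ i j, DifferentiableOn ℂ (fun l => R l i j) (Metric.ball 0 δ)) ∧
      ∀ l : ℂ, ‖l‖ < δ →
        ((∃ w : Seq (X ℂ M), w ≠ 0 ∧ ∀ n, P.lin u w n = floquetTerm P.T l (w n)) ↔
          ((tridiag (a P.T q N σ) (aTilde P.T q N σ)).map (fun x : ℝ => (x : ℂ))
            + ((1 / P.d : ℂ) * (K P.T q y : ℂ) * l ^ 2) •
              (1 : Matrix (Fin (k + 1)) (Fin (k + 1)) ℂ) + R l).det = 0) ∧
        ∀ c : Fin (k + 1) → ℂ, ‖R l *ᵥ c‖ ≤ C * ((P.β ^ 2) ^ L + ‖l‖) ^ 3 * ‖c‖ := by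
  obtain ⟨C₀, η, L₁, hC₀, hη, hL₁, hinv⟩ := hq.exists_bord_inverse ℂ
  obtain ⟨L₂, hL₂, hgram⟩ := hq.exists_det_gram_ne_zero
  obtain ⟨C, hC, hfl⟩ := hq.exists_floquet_bound Λ hY hy hye hC₀
  have hd := P.d_pos
  have hd' : (P.d : ℂ) ≠ 0 := by exact_mod_cast hd.ne'
  have hlim : Tendsto (fun L : ℕ => Λ * P.θ ^ L) atTop (𝓝 0) := by
    simpa using (tendsto_pow_atTop_nhds_zero_of_lt_one P.θ_pos.le P.θ_lt_one).const_mul Λ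
  obtain ⟨L₃, hL₃⟩ := eventually_atTop.mp (hlim.eventually (gt_mem_nhds hη))
  set κ := ‖(dtL ℂ P.T : X ℂ M →L[ℂ] X ℂ M)‖ with hκ
  refine ⟨min 1 (η / (2 * κ + 1)), C / P.d, max L₁ (max L₂ L₃), by positivity, by positivity,
    fun {k L N s σ u} hL h hs hN => ?_⟩
  have hL1 : L₁ ≤ L := le_trans (le_max_left _ _) hL
  have hL2 : L₂ ≤ L := le_trans ((le_max_left _ _).trans (le_max_right _ _)) hL
  have hL3 : L₃ ≤ L := le_trans ((le_max_right _ _).trans (le_max_right _ _)) hL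
  set S : ℂ → Seq (X ℂ M) × (Fin (k + 1) → ℂ) →L[ℂ] Seq (X ℂ M) × (Fin (k + 1) → ℂ) :=
    fun l => hq.bord σ s u (floquetTerm P.T l) with hS
  have hl1 : ∀ l : ℂ, ‖l‖ < min 1 (η / (2 * κ + 1)) → ‖l‖ ≤ 1 := fun l hl =>
    hl.le.trans (min_le_left _ _)
  have hSl : ∀ l : ℂ, ‖l‖ < min 1 (η / (2 * κ + 1)) →
      Function.Bijective (S l) ∧ ∀ x, ‖x‖ ≤ C₀ * ‖S l x‖ := fun l hl => by
    refine hinv L s σ u _ hL1 h.separated h.sign (fun n => (h.close n).trans (hL₃ L hL3).le) ?_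
    have h1 : ‖l‖ * (2 * κ + 1) ≤ η := by
      rw [← le_div_iff₀ (by positivity)]
      exact hl.le.trans (min_le_right _ _)
    refine le_trans (ContinuousLinearMap.opNorm_le_bound _ (by positivity) fun w => ?_) h1
    rw [floquetTerm_apply]
    have h2 : ‖dt P.T w‖ ≤ κ * ‖w‖ := (dtL ℂ P.T : X ℂ M →L[ℂ] X ℂ M).le_opNorm w
    have h3 : ‖l‖ ^ 2 ≤ ‖l‖ := by nlinarith [norm_nonneg l, hl1 l hl]
    refine (norm_add_le _ _).trans ?_
    rw [norm_smul, norm_smul, norm_mul, norm_pow, Complex.norm_two]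
    calc _ ≤ 2 * ‖l‖ * (κ * ‖w‖) + ‖l‖ * ‖w‖ := by gcongr
      _ = _ := by ring
  set G := (gram P q σ s).map (fun x : ℝ => (x : ℂ)) with hG
  have hGdet : G.det ≠ 0 := by
    have h1 := hgram hL2 h.separated h.sign
    have h2 : G.det = (((gram P q σ s).det : ℝ) : ℂ) :=
      (RingHom.map_det Complex.ofRealHom (gram P q σ s)).symm
    rw [h2]
    exact_mod_cast h1
  set A := (tridiag (a P.T q N σ) (aTilde P.T q N σ)).map (fun x : ℝ => (x : ℂ)) with hA
  set R : ℂ → Matrix (Fin (k + 1)) (Fin (k + 1)) ℂ := fun l =>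
    -((1 / P.d : ℂ) • (G * multiplier (S l) * G)) - A
      - ((1 / P.d : ℂ) * (K P.T q y : ℂ) * l ^ 2) • (1 : Matrix (Fin (k + 1)) (Fin (k + 1)) ℂ) with hR
  refine ⟨R, fun i j l hl => ?_, fun l hl => ⟨?_, fun c => ?_⟩⟩
  · rw [mem_ball_zero_iff] at hl
    have h1 : ∀ i j, DifferentiableAt ℂ (fun l => multiplier (S l) i j) l := fun i j =>
      differentiableAt_multiplier (hq.differentiable_bord σ s u l) (hSl l hl).1 i j
    refine DifferentiableAt.differentiableWithinAt ?_
    simp only [hR, Matrix.sub_apply, Matrix.neg_apply, Matrix.smul_apply, Matrix.mul_apply,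
      smul_eq_mul]
    fun_prop
  · have h1 : A + ((1 / P.d : ℂ) * (K P.T q y : ℂ) * l ^ 2) •
        (1 : Matrix (Fin (k + 1)) (Fin (k + 1)) ℂ) + R l
        = (-(1 / P.d : ℂ)) • (G * multiplier (S l) * G) := by
      simp only [hR, neg_smul]
      abel
    have h2 : (-(1 / P.d : ℂ)) ^ Fintype.card (Fin (k + 1)) ≠ 0 :=
      pow_ne_zero _ (neg_ne_zero.mpr (one_div_ne_zero hd'))
    rw [h1, Matrix.det_smul, Matrix.det_mul, Matrix.det_mul, mul_eq_zero_iff_left h2,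
      mul_eq_zero_iff_right hGdet, mul_eq_zero_iff_left hGdet, det_multiplier_eq_zero_iff (hSl l hl).1]
    refine exists_congr fun w => and_congr_right fun _ => ?_
    have h3 : ∀ n, (S l (w, 0)).1 n = P.lin u w n - floquetTerm P.T l (w n) := fun n => by
      rw [hS]
      simp only
      rw [hq.bord_fst]
      simp
    constructor
    · intro hw
      refine ⟨(S l (w, 0)).2, Prod.ext ?_ rfl⟩
      ext1 n
      rw [h3, hw, sub_self]
      rfl
    · rintro ⟨c, hc⟩ n
      have h4 := h3 n
      rw [hc] at h4
      exact (sub_eq_zero.mp h4.symm)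
  · obtain ⟨⟨w, b⟩, hwb⟩ := (hSl l hl).1.2 (0, G *ᵥ c)
    have hb := multiplier_mulVec (hSl l hl).1 hwb
    have h1 := hfl h hs hN l (hl1 l hl) (hSl l hl).2 c w b hwb
    refine (pi_norm_le_iff_of_nonneg (by positivity)).mpr fun i => ?_
    have h2 : (R l *ᵥ c) i = -(1 / P.d : ℂ) * ((G *ᵥ b) i + P.d * (A *ᵥ c) i
        + K P.T q y * l ^ 2 * c i) := by
      simp only [hR, Matrix.sub_mulVec, Matrix.neg_mulVec, Matrix.smul_mulVec, Matrix.one_mulVec,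
        ← Matrix.mulVec_mulVec, hb, Pi.sub_apply, Pi.neg_apply, Pi.smul_apply, smul_eq_mul]
      field_simp
      ring
    rw [h2, norm_mul, norm_neg, norm_div, norm_one, Complex.norm_real, Real.norm_of_nonneg hd.le]
    calc _ ≤ 1 / P.d * (C * (((P.β ^ 2) ^ L + ‖l‖) ^ 3 * ‖c‖)) := by gcongr; exact h1 i
      _ = _ := by ring

end IsPulse
end HypChain

end DKG

theorem theorem2 (V : ℝ → ℝ) (hV : ContDiff ℝ ∞ V) (hVeven : ∀ x, V (-x) = V x) (hV0 : V 0 = 0)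
    (hV2 : 0 < deriv (deriv V) 0) (d T : ℝ) (hd : 0 < d) (hT : 0 < T)
    (hhyp : DKG.SpectrumAwayFromCircle V d T)
    (M : ℕ) (hM : 1 ≤ M) (q : ℤ → DKG.X ℝ M)
    (hq : DKG.IsPrimaryBreather V d T q) (hnd : DKG.IsNondegenerate V d T q) :
    ∃ y : ℤ → DKG.X ℝ M, DKG.IsFrequencyDerivative V d T q y ∧
    ∃ ε > 0, ∃ Nstar : ℕ, ∃ δ > 0, ∃ C > 0,
      ∀ (k : ℕ) (N : Fin k → ℕ) (σ : Fin (k + 1) → ℝ), 1 ≤ k →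
        (∀ i, Nstar ≤ N i) → (∀ i, σ i = 1 ∨ σ i = -1) →
        (∃! u : ℤ → DKG.X ℝ M, DKG.IsMultiBreather V d T q N σ ε u) ∧
        ∀ u : ℤ → DKG.X ℝ M, DKG.IsMultiBreather V d T q N σ ε u →
          ∃ R : ℂ → Matrix (Fin (k + 1)) (Fin (k + 1)) ℂ,
            (∀ i j, DifferentiableOn ℂ (fun l => R l i j) (Metric.ball 0 δ)) ∧
            ∀ l : ℂ, ‖l‖ < δ →
              ((∃ W : ℤ → DKG.X ℂ M × DKG.X ℂ M, DKG.IsFloquetEigenfunction V d T u l W) ↔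
                ((DKG.tridiag (DKG.a T q N σ) (DKG.aTilde T q N σ)).map (fun x : ℝ => (x : ℂ))
                  + ((1 / d : ℂ) * (DKG.K T q y : ℂ) * l ^ 2) •
                    (1 : Matrix (Fin (k + 1)) (Fin (k + 1)) ℂ)
                  + R l).det = 0) ∧
              ∀ c : Fin (k + 1) → ℂ,
                ‖R l *ᵥ c‖ ≤ C * (DKG.rM V d T M ^ (-DKG.charDist N) + ‖l‖) ^ 3 * ‖c‖ := by
  set Q₀ : DKG.Chain := ⟨V, d, T, hV, hVeven, hd, hT⟩ with hQ₀
  obtain ⟨θ, hθ0, hθ1, hr, hsym⟩ := Q₀.exists_rate hhyp M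
  set P : DKG.HypChain M := ⟨Q₀, θ, hθ0, hθ1, hsym⟩ with hP
  have hp : P.IsPulse q := P.isPulse hq hnd
  obtain ⟨y, hyf, hye, ⟨Y, -, hY⟩, hy⟩ := hp.exists_frequencyDerivative
  obtain ⟨Λ, ε, L₁, hΛ, hε, hL₁, hmb⟩ := hp.exists_multiBreather
  obtain ⟨D, hD, hwin⟩ := hp.exists_window_bound
  obtain ⟨δ, C, L₂, hδ, hC, hfl⟩ := hp.exists_floquet_reduction Λ hY hy hye
  have hρ0 := P.ρ_pos
  have hρ1 := P.ρ_lt_one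
  have hθρ : (P.β ^ 2) ^ 2 = θ := P.sq_sq_β
  have hlim : Tendsto (fun L : ℕ => Λ * θ ^ L + D * (P.β ^ 2) ^ L) atTop (𝓝 0) := by
    simpa using ((tendsto_pow_atTop_nhds_zero_of_lt_one hθ0.le hθ1).const_mul Λ).add
      ((tendsto_pow_atTop_nhds_zero_of_lt_one hρ0.le hρ1).const_mul D)
  obtain ⟨L₃, hL₃⟩ := eventually_atTop.mp (hlim.eventually (gt_mem_nhds (half_pos hε)))
  -- Closeness to a copy on each window and closeness to the superposition on the lattice differ by less
  -- than `ε / 2`, so that uniqueness in the `ε`-ball of the superposition gives uniqueness for `ε / 2`.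
  refine ⟨y, hyf, ε / 2, half_pos hε, max L₁ (max L₂ L₃), δ, hδ, C, hC,
    fun k N σ hk hNstar hσ => ?_⟩
  -- The estimates are in terms of the smallest distance `L`; as `charDist N = L / 2`, the power
  -- `rM ^ (-charDist N)` is `ρ ^ L` with `ρ = θ ^ (1 / 2) = P.β ^ 2`.
  obtain ⟨i₀, hi₀, hrN⟩ := DKG.exists_rpow_charDist hk N hρ0 hθρ
  have hL := hNstar i₀
  set L := N i₀ with hLdef
  have hL1 : L₁ ≤ L := le_trans (le_max_left _ _) hL
  have hL2 : L₂ ≤ L := le_trans ((le_max_left _ _).trans (le_max_right _ _)) hL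
  have hL3 : L₃ ≤ L := le_trans ((le_max_right _ _).trans (le_max_right _ _)) hL
  have hL0 : 1 ≤ L := hL₁.trans hL1
  have hsmall := hL₃ L hL3
  have hsep := DKG.separated_center hi₀
  obtain ⟨u, hu1, hu2, hu3, hu4⟩ := hmb L (DKG.center N) σ hL1 hsep hσ
  have hΛL : 0 ≤ Λ * θ ^ L := by positivity
  have hDL : 0 ≤ D * (P.β ^ 2) ^ L := by positivity
  have huniq : ∀ u', DKG.IsMultiBreather V d T q N σ (ε / 2) u' → u' = u := by
    intro u' hu'
    refine hu4 u' ((Q₀.isOrbit_iff u').mp hu'.orbit)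
      (fun n => (DKG.even_iff hT _).mp (hu'.even n).1) fun n => ?_
    obtain ⟨i, hi1, hi2⟩ := DKG.exists_window N n
    have h1 := hu'.close i (n - DKG.center N i) hi1 hi2
    have h2 := hwin hL0 hi₀ hσ i _ _ hi1 hi2 (Or.inl rfl)
    have h3 : ‖u' (DKG.center N i + (n - DKG.center N i))
        - σ i • q (n - DKG.center N i)‖ ≤ ε / 2 := (norm_fst_le _).trans h1
    rw [add_sub_cancel] at h2 h3
    have h4 := norm_sub_le_norm_sub_add_norm_sub (u' n) (σ i • q (n - DKG.center N i))
      (DKG.superpose σ (DKG.center N) q n)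
    rw [norm_sub_rev (σ i • q (n - DKG.center N i))] at h4
    linarith
  refine ⟨⟨u, ⟨(Q₀.isOrbit_iff u).mpr hu1, fun n => ⟨(DKG.even_iff hT _).mpr (hu2 n),
    (DKG.even_iff hT _).mpr (hu2 (n - 1))⟩, fun i n h1 h2 => ?_⟩, huniq⟩, fun u' hu' => ?_⟩
  · have h3 : ∀ n', n' = n ∨ n' = n - 1 →
        ‖u (DKG.center N i + n') - σ i • q n'‖ ≤ ε / 2 := fun n' hn' => by
      have h4 := hwin hL0 hi₀ hσ i n n' h1 h2 hn'
      have h5 : ‖u (DKG.center N i + n') - DKG.superpose σ (DKG.center N) q (DKG.center N i + n')‖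
          ≤ Λ * θ ^ L := hu3 _
      have h6 := norm_sub_le_norm_sub_add_norm_sub (u (DKG.center N i + n'))
        (DKG.superpose σ (DKG.center N) q (DKG.center N i + n')) (σ i • q n')
      linarith
    refine (Prod.norm_def _).trans_le (max_le (h3 n (Or.inl rfl)) ?_)
    have h4 := h3 (n - 1) (Or.inr rfl)
    rw [← add_sub_assoc] at h4
    exact h4
  · rw [huniq u' hu']
    obtain ⟨B, hB⟩ := hp.superpose_bdd σ (DKG.center N)
    have hub : ∃ B, ∀ n, ‖u n‖ ≤ B := ⟨B + Λ * θ ^ L, fun n => by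
      have h1 := norm_le_norm_add_norm_sub' (u n) (DKG.superpose σ (DKG.center N) q n)
      have h2 : ‖u n - DKG.superpose σ (DKG.center N) q n‖ ≤ Λ * θ ^ L := hu3 n
      linarith [hB n]⟩
    have hnear : DKG.NearSuperposition P q Λ L (DKG.center N) σ (DKG.mkSeq u hub) :=
      ⟨hL0, hsep, hσ, hu1, hu2, hu3⟩
    obtain ⟨R, hR1, hR2⟩ := hfl hL2 hnear (DKG.center_succ N) hi₀
    refine ⟨R, hR1, fun l hl => ⟨?_, fun c => ?_⟩⟩
    · exact (Q₀.exists_floquetEigenfunction_iff u l).trans (hR2 l hl).1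
    · have h1 := (hR2 l hl).2 c
      have h2 : DKG.rM V d T M ^ (-DKG.charDist N) = (P.β ^ 2) ^ L := by
        rw [← hrN, ← show DKG.rM V d T M = θ⁻¹ from hr]
      rw [h2]
      exact h1
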